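/- Let $S$ be a closed connected surface, orientable or not, let $V\subset S$ be a finite set and let $d$ be a spherical cone-metric on $(S,V)$, i.e. an intrinsic metric on $S$ such that each point of $S\setminus V$ has a neighbourhood isometric to a ball of the standard unit sphere $\mathbb S^2$ and each $v\in V$ has a neighbourhood isometric to a neighbourhood of the apex of a spherical cone of some total angle $\omega_v>0$. A *polygonal decomposition* of $(S,V)$ is a finite collection of simple arcs (edges; loops and multiple edges are allowed) with endpoints in $V$, whose relative interiors are pairwise disjoint and disjoint from $V$, that cut $S$ into topological polygons (faces) with at least three vertices each and without points of $V$ in the interior. A *convex spherical polygon* is one that is contained in an open hemisphere and all of whose angles are at most $\pi$; a spherical triangle is *convex* if all its angles lie in $(0,\pi)$. A *Delaunay decomposition* of $d$ is a polygonal decomposition such that each face, after being cut out, is isometric to a convex spherical polygon that has a circumscribed circle, and such that for each edge, when the two faces adjacent along it (possibly two copies of the same face) are developed to $\mathbb S^2$ along this edge, the closed circumscribed disk of each of the two polygons contains no vertex of the other one, except the endpoints of the common edge. Suppose that $(S,V)$ has a polygonal decomposition each of whose faces, after being cut out, is isometric to a convex spherical triangle. Then $d$ has a Delaunay decomposition,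 and it is unique (its edges are uniquely determined as subsets of $S$). -/

import Mathlib

noncomputable section

open scoped RealInnerProductSpace

namespace SphCone

/-- Euclidean 3-space. The standard sphere is the set of its unit vectors, and the spherical
distance between two unit vectors is the angle between them. -/
abbrev E3 : Type := EuclideanSpace ℝ (Fin 3)

/-! ### Spherical cone-metrics -/

/-- The distance on the spherical cone of total angle `ω` between the points with polar
coordinates `(r₁, θ₁)` and `(r₂, θ₂)`, for `r₁, r₂ ∈ [0, π/2)`; the angular coordinate is taken
modulo `ω`. If the angle between the two directions is at least `π`, the shortest path runs
through the apex and the distance is `r₁ + r₂`. -/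
def coneDist (ω r₁ : ℝ) (θ₁ : AddCircle ω) (r₂ : ℝ) (θ₂ : AddCircle ω) : ℝ :=
  Real.arccos (Real.cos r₁ * Real.cos r₂ +
    Real.sin r₁ * Real.sin r₂ * Real.cos (min ‖θ₁ - θ₂‖ Real.pi))

variable {S : Type*} [MetricSpace S]

/-- Some ball around `p` is isometric to a ball of the standard sphere. -/
def IsRegularPoint (p : S) : Prop :=
  ∃ ε > 0, ∃ f : S → E3,
    (∀ x ∈ Metric.ball p ε, ‖f x‖ = 1) ∧
    (∀ x ∈ Metric.ball p ε, ∀ y ∈ Metric.ball p ε,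
      dist x y = InnerProductGeometry.angle (f x) (f y)) ∧
    (∀ u : E3, ‖u‖ = 1 → InnerProductGeometry.angle (f p) u < ε →
      ∃ x ∈ Metric.ball p ε, f x = u)

/-- Some ball around `v` is isometric to the ball around the apex of the spherical cone of total
angle `ω`, by means of polar coordinates `f r θ`. -/
def IsConePoint (v : S) (ω : ℝ) : Prop :=
  ∃ ε > 0, ε ≤ Real.pi / 2 ∧ ∃ f : ℝ → AddCircle ω → S,
    (∀ θ, f 0 θ = v) ∧
    (∀ r₁ ∈ Set.Ico 0 ε, ∀ r₂ ∈ Set.Ico 0 ε, ∀ θ₁ θ₂,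
      dist (f r₁ θ₁) (f r₂ θ₂) = coneDist ω r₁ θ₁ r₂ θ₂) ∧
    (∀ x ∈ Metric.ball v ε, ∃ r ∈ Set.Ico 0 ε, ∃ θ, f r θ = x)

/-- The metric of `S` is a spherical cone-metric on `(S, V)`: it is intrinsic (any two points are
joined by a path whose length is their distance), every point outside `V` has a neighbourhood
isometric to a ball of the standard sphere, and every point of `V` has a neighbourhood isometric
to a neighbourhood of the apex of a spherical cone. -/
structure IsSphericalConeMetric (V : Finset S) : Prop where
  geodesic : ∀ x y : S, ∃ γ : ℝ → S, γ 0 = x ∧ γ (dist x y) = y ∧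
    ∀ s ∈ Set.Icc 0 (dist x y), ∀ t ∈ Set.Icc 0 (dist x y), dist (γ s) (γ t) = |s - t|
  regular : ∀ p, p ∉ V → IsRegularPoint p
  cone : ∀ v ∈ V, ∃ ω > 0, IsConePoint v ω

/-! ### Convex spherical polygons, given by their vertex sets -/

/-- The closed spherical polygon spanned by `W`. -/
def polygon (W : Finset E3) : Set E3 :=
  {x | ‖x‖ = 1 ∧ ∃ a : E3 → ℝ, (∀ w ∈ W, 0 ≤ a w) ∧ x = ∑ w ∈ W, a w • w}

/-- The interior of the spherical polygon spanned by `W`. -/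
def openPolygon (W : Finset E3) : Set E3 :=
  {x | ‖x‖ = 1 ∧ ∃ a : E3 → ℝ, (∀ w ∈ W, 0 < a w) ∧ x = ∑ w ∈ W, a w • w}

/-- The open great-circle arc between `p` and `q` (shorter than `π`). -/
def openArc (p q : E3) : Set E3 :=
  {x | ‖x‖ = 1 ∧ ∃ a b : ℝ, 0 < a ∧ 0 < b ∧ x = a • p + b • q}

/-- `W` is the vertex set of a convex spherical polygon: at least three points of the sphere, in
an open hemisphere, none of them in the spherical convex hull of the others. Thus the angles
are in `(0, π)`; an angle equal to `π` occurs neither in convex triangles nor in polygons with a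
circumscribed circle, the only polygons that are used below. -/
structure IsConvexPolygon (W : Finset E3) : Prop where
  three_le_card : 3 ≤ W.card
  norm_eq_one : ∀ w ∈ W, ‖w‖ = 1
  hemisphere : ∃ u : E3, ∀ w ∈ W, 0 < ⟪u, w⟫
  convex_position : ∀ w ∈ W,
    ¬ ∃ a : E3 → ℝ, (∀ x ∈ W, 0 ≤ a x) ∧ a w = 0 ∧ w = ∑ x ∈ W, a x • x

/-- The vertices `p`, `q` are the endpoints of a side of the polygon `W`, and `m` is normal to the
plane of this side and points to the side of the plane that contains the polygon. -/
def IsSide (W : Finset E3) (p q m : E3) : Prop :=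
  p ∈ W ∧ q ∈ W ∧ p ≠ q ∧ ⟪m, p⟫ = 0 ∧ ⟪m, q⟫ = 0 ∧
    ∀ w ∈ W, w ≠ p → w ≠ q → 0 < ⟪m, w⟫

/-- The vertices of `W` lie on the circle with centre `c` and angular radius `arccos h < π / 2`.
The closed circumscribed disk is then `{x | ‖x‖ = 1 ∧ h ≤ ⟪c, x⟫}`; it contains the polygon. -/
def IsCircumcircle (W : Finset E3) (c : E3) (h : ℝ) : Prop :=
  ‖c‖ = 1 ∧ 0 < h ∧ ∀ w ∈ W, ⟪c, w⟫ = h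

/-! ### Decompositions into convex spherical polygons -/

/-- `e` is the relative interior of a simple arc (possibly a simple loop) with endpoints in `V` and
no other points of `V`. -/
def IsOpenEdge (V : Finset S) (e : Set S) : Prop :=
  Disjoint e (V : Set S) ∧ ∃ γ : ℝ → S, ContinuousOn γ (Set.Icc 0 1) ∧ γ 0 ∈ V ∧ γ 1 ∈ V ∧
    Set.InjOn γ (Set.Ioo 0 1) ∧ γ '' Set.Ioo 0 1 = e

/-- The union of the vertices and of the edges. -/
def skeleton (V : Finset S) (𝓔 : Set (Set S)) : Set S := (V : Set S) ∪ ⋃₀ 𝓔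

/-- `φ` identifies the convex spherical polygon with vertex set `W` with a face cut out of `S` by
the edges `𝓔`: the interior of the polygon goes bijectively onto a connected component of the
complement of the skeleton, each open side goes bijectively onto an edge, vertices go to `V`, and
`φ` is isometric near each point which is not a vertex. (Different sides may go to the same edge
and different vertices to the same point.) -/
structure IsCell (V : Finset S) (𝓔 : Set (Set S)) (W : Finset E3) (φ : E3 → S) : Prop where
  convex : IsConvexPolygon W
  continuousOn : ContinuousOn φ (polygon W)
  injOn : Set.InjOn φ (openPolygon W)
  face : ∃ x ∉ skeleton V 𝓔, φ '' openPolygon W = connectedComponentIn (skeleton V 𝓔)ᶜ x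
  side : ∀ p q m, IsSide W p q m → Set.InjOn φ (openArc p q) ∧ φ '' openArc p q ∈ 𝓔
  vertex : ∀ w ∈ W, φ w ∈ V
  isometric : ∀ x ∈ polygon W, x ∉ W → ∃ ε > 0, ∀ y ∈ polygon W, ∀ z ∈ polygon W,
    dist y x < ε → dist z x < ε → dist (φ y) (φ z) = InnerProductGeometry.angle y z

/-- The finite collection `𝓔` of pairwise disjoint open edges is (the edge set of) a polygonal
decomposition of `(S, V)` each of whose faces is isometric to a convex spherical polygon. -/
structure IsConvexDecomposition (V : Finset S) (𝓔 : Set (Set S)) : Prop where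
  finite : 𝓔.Finite
  edge : ∀ e ∈ 𝓔, IsOpenEdge V e
  disjoint : 𝓔.PairwiseDisjoint id
  faces : ∀ x ∉ skeleton V 𝓔, ∃ W φ, IsCell V 𝓔 W φ ∧ x ∈ φ '' openPolygon W

/-- A geodesic triangulation of `(S, V)` into convex spherical triangles. -/
structure IsConvexTriangulation (V : Finset S) (𝓔 : Set (Set S)) : Prop
    extends IsConvexDecomposition V 𝓔 where
  triangle : ∀ W φ, IsCell V 𝓔 W φ → W.card = 3

/-- The polygons `W₁` and `W₂`, which `φ₁` and `φ₂` identify with faces of `S` (possibly with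
the same face), lie in the sphere as a development of these faces along an edge: they have the
side `pq` in common, lie on different sides of it, and `φ₁`, `φ₂` together are isometric near each
interior point of this side. -/
def IsDeveloped (W₁ : Finset E3) (φ₁ : E3 → S) (W₂ : Finset E3) (φ₂ : E3 → S) (p q : E3) : Prop :=
  (∃ m, IsSide W₁ p q m ∧ IsSide W₂ p q (-m)) ∧
  ∀ x ∈ openArc p q, ∃ ε > 0, ∀ y ∈ polygon W₁, ∀ z ∈ polygon W₂,
    dist y x < ε → dist z x < ε → dist (φ₁ y) (φ₂ z) = InnerProductGeometry.angle y z

/-- A Delaunay decomposition: every face has a circumscribed circle, and whenever two adjacent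
faces are developed to the sphere, the closed circumscribed disk of one of them contains no
vertices of the other, except those of the common side. (The condition is symmetric: exchange the
two faces.) -/
structure IsDelaunayDecomposition (V : Finset S) (𝓔 : Set (Set S)) : Prop
    extends IsConvexDecomposition V 𝓔 where
  circumscribed : ∀ W φ, IsCell V 𝓔 W φ → ∃ c h, IsCircumcircle W c h
  empty_disk : ∀ W₁ φ₁ W₂ φ₂ p q, IsCell V 𝓔 W₁ φ₁ → IsCell V 𝓔 W₂ φ₂ →
    IsDeveloped W₁ φ₁ W₂ φ₂ p q → ∀ c h, IsCircumcircle W₁ c h →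
      ∀ w ∈ W₂, h ≤ ⟪c, w⟫ → w = p ∨ w = q

end SphCone

end

noncomputable section

open scoped RealInnerProductSpace
open InnerProductGeometry Metric Set Filter Topology

namespace SphCone

variable {S : Type*} [MetricSpace S]

/-! ### Rigidity of angle-preserving maps -/

/-! The proof treats Delaunay polygons as solutions of a linear programme. A map on the sphere is
extended to be constant on rays of `E3`, so that a disc of radius less than `π / 2` becomes the open
convex cone `D ℓ` of a vector `ℓ`, and the points of the bounding circle are the unit vectors with
`⟪ℓ, p⟫ = 1`. An `EmptyDisc` is a local isometry of such a cone into `S` that avoids `V`. A point of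
`V` that is developed to `w` from inside the disc cannot lie in `D ℓ`, so `⟪ℓ, w⟫ ≤ 1` for unit `w`:
emptiness of a disc is a family of linear constraints on `ℓ`. Discs with a common germ at `x`
compete for the largest `⟪ℓ, x⟫`.

The maximum exists. If `x` is a nonnegative combination of the vertices of a cell, the constraints
at these vertices bound `⟪ℓ, x⟫`. With finitely many faces this bounds `‖ℓ‖`
(`IsConvexDecomposition.exists_norm_le`), and limits of empty discs are empty discs
(`exists_limit_disc`). This is the only use of the given triangulation. At a maximum `x` lies in the
cone over the contact points, the boundary points that go to `V`; otherwise the disc could be tilted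
to increase the objective (`EmptyDisc.exists_larger`, `IsOptimal.mem_cone`). A perturbation of `x`
provides at least three contact points (`exists_isFull`), and such a disc is called full.

The polygons spanned by the contact points of full discs are the Delaunay faces. Weak duality
(`EmptyDisc.inner_contact_le`) and complementary slackness (`EmptyDisc.mem_contact_of_pos`) show
that two of them with a common interior point coincide, that sides whose interiors meet coincide,
and that adjacent ones satisfy the empty disk condition. There are finitely many edges because the
radii of full discs are bounded below, their centres stay away from `V`, and the contact points of a
convergent sequence of discs are eventually among those of the limit (`exists_center_bound`,
`eventually_contact_subset`).

For uniqueness, a Delaunay decomposition assigns to each cell the linear form that is `1` at its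
vertices. Across an edge the Delaunay condition makes the two adjacent forms fit together as their
maximum, so on every empty disc they give a convex function. This function is at most `1` in the
limit at the contact points, hence at most `1` on the part of their cone where `⟪ℓ, ·⟫ = 1`
(`IsDelaunayDecomposition.isValue_le`). The constraints at the vertices of a cell give the opposite
inequality between the form of the cell and the full disc above it. Equality makes the full disc the
circumscribed disk of the cell, so every cell is the polygon of a full disc
(`IsDelaunayDecomposition.exists_isFull`). -/

lemma angle_map (A : E3 ≃ₗᵢ[ℝ] E3) (x y : E3) : angle (A x) (A y) = angle x y :=
  A.toLinearIsometry.angle_map x y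

lemma linearIsometryEquiv_eq_of_eventuallyEq {L M : E3 ≃ₗᵢ[ℝ] E3} {x : E3}
    (h : ∀ᶠ y in 𝓝 x, L y = M y) : L = M := by
  have : LinearMap.eqLocus (L.toLinearEquiv : E3 →ₗ[ℝ] E3) (M.toLinearEquiv : E3 →ₗ[ℝ] E3) = ⊤ :=
    Submodule.eq_top_of_nonempty_interior' _ ⟨x, mem_interior_iff_mem_nhds.2 h⟩
  ext1 y
  have hy : y ∈ LinearMap.eqLocus (L.toLinearEquiv : E3 →ₗ[ℝ] E3)
    (M.toLinearEquiv : E3 →ₗ[ℝ] E3) := this ▸ Submodule.mem_top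
  exact hy

lemma inner_eq_of_eventually {a b x : E3} (h : ∀ᶠ y in 𝓝 x, ⟪a, y⟫ = ⟪b, y⟫) : a = b := by
  have : LinearMap.ker (innerₗ E3 (a - b)) = ⊤ :=
    Submodule.eq_top_of_nonempty_interior' _ ⟨x, mem_interior_iff_mem_nhds.2 (by
      filter_upwards [h] with y hy
      simp [hy])⟩
  have hy : a - b ∈ LinearMap.ker (innerₗ E3 (a - b)) := this ▸ Submodule.mem_top
  have hy' : ⟪a - b, a - b⟫ = 0 := hy
  rwa [inner_self_eq_zero, sub_eq_zero] at hy'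

/-- A basis chosen inside `B` defines a linear map `f`. Inner products are tested on the basis, so
`f` is an isometry, and for `y ∈ B` the vector `b y - f y` is orthogonal to the range of `f`, hence
zero. -/
lemma exists_isometry_of_inner_eq {B : Set E3} (hB : Submodule.span ℝ B = ⊤) {b : E3 → E3}
    (hb : ∀ y ∈ B, ∀ z ∈ B, ⟪b y, b z⟫ = ⟪y, z⟫) :
    ∃ L : E3 ≃ₗᵢ[ℝ] E3, ∀ y ∈ B, b y = L y := by
  obtain ⟨c, hcB, hspan, hli⟩ := exists_linearIndependent ℝ B
  have htop : ⊤ ≤ Submodule.span ℝ (range ((↑) : c → E3)) := by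
    rw [Subtype.range_coe, hspan, hB]
  let e := Module.Basis.mk hli htop
  let f : E3 →ₗ[ℝ] E3 := e.constr ℝ (fun i => b i)
  have hf : ∀ i (hi : i ∈ c), f i = b i := by
    intro i hi
    have h := e.constr_basis ℝ (fun i : c => b i) ⟨i, hi⟩
    simpa [e, f] using h
  have hctop : ∀ x : E3, x ∈ Submodule.span ℝ c := fun x => by
    rw [hspan, hB]; trivial
  have key : ∀ (w w' : E3), (∀ i ∈ c, ⟪w', f i⟫ = ⟪w, i⟫) → ∀ z, ⟪w', f z⟫ = ⟪w, z⟫ := by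
    intro w w' h z
    refine Submodule.span_induction (p := fun z _ => ⟪w', f z⟫ = ⟪w, z⟫) ?_ ?_ ?_ ?_ (hctop z)
    · exact h
    · simp
    · intro x y _ _ hx hy
      rw [map_add, inner_add_right, inner_add_right, hx, hy]
    · intro r x _ hx
      rw [map_smul, inner_smul_right, inner_smul_right, hx]
  have h1 : ∀ y ∈ B, ∀ z, ⟪b y, f z⟫ = ⟪y, z⟫ := fun y hy =>
    key y (b y) fun i hi => by rw [hf i hi, hb y hy i (hcB hi)]
  have h2 : ∀ x z, ⟪f x, f z⟫ = ⟪x, z⟫ := fun x =>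
    key x (f x) fun i hi => by
      rw [real_inner_comm, hf i hi, h1 i (hcB hi), real_inner_comm]
  let F := f.isometryOfInner h2
  let L : E3 ≃ₗᵢ[ℝ] E3 := F.toLinearIsometryEquiv rfl
  refine ⟨L, fun y hy => ?_⟩
  have hL : ∀ z, L z = f z := fun z => rfl
  have h3 : ∀ z, ⟪b y - f y, f z⟫ = 0 := fun z => by
    rw [inner_sub_left, h1 y hy, h2, sub_self]
  have h4 := h3 (L.symm (b y - f y))
  rw [← hL (L.symm _), L.apply_symm_apply, inner_self_eq_zero, sub_eq_zero] at h4
  rw [hL, h4]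

lemma span_eq_top_of_isOpen {B : Set E3} (hB : IsOpen B) (hne : B.Nonempty) :
    Submodule.span ℝ B = ⊤ := by
  apply Submodule.eq_top_of_nonempty_interior'
  obtain ⟨x, hx⟩ := hne
  exact ⟨x, mem_interior_iff_mem_nhds.2
    (mem_of_superset (hB.mem_nhds hx) Submodule.subset_span)⟩

/-- The set of points near which `P` holds is open, and `step` makes it relatively closed in `U`.
All analytic continuation below has this form. -/
lemma forall_of_isPreconnected {U : Set E3} (hU : IsPreconnected U) {P : E3 → Prop} {x₀ : E3}
    (hx₀ : x₀ ∈ U) (h₀ : ∀ᶠ y in 𝓝 x₀, P y)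
    (step : ∀ x ∈ U, (∀ W ∈ 𝓝 x, ∃ z ∈ W, ∀ᶠ y in 𝓝 z, P y) → ∀ᶠ y in 𝓝 x, P y) :
    ∀ x ∈ U, P x := by
  have hopen : IsOpen {x | ∀ᶠ y in 𝓝 x, P y} := isOpen_setOfPred_eventually_nhds
  have := hU.subset_of_closure_inter_subset hopen ⟨x₀, hx₀, h₀⟩ (by
    rintro x ⟨hx, hxU⟩
    refine step x hxU fun W hW => ?_
    obtain ⟨z, hz1, hz2⟩ := mem_closure_iff_nhds.1 hx W hW
    exact ⟨z, hz1, hz2⟩)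
  exact fun x hx => (this hx).self_of_nhds

/-- The rescaled map `y ↦ ‖y‖ • a y` preserves inner products locally, so it is locally a linear
isometry. Linear isometries that agree on an open set are equal, so connectedness leaves only one.
-/
lemma exists_isometry_of_angle_eq {U : Set E3} (hUo : IsOpen U) (hU : IsPreconnected U)
    (h0 : (0 : E3) ∉ U) {a : E3 → E3} (ha : ∀ y ∈ U, ‖a y‖ = 1)
    (hloc : ∀ x ∈ U, ∃ ε > 0, ∀ y ∈ U, ∀ z ∈ U, dist y x < ε → dist z x < ε →
      angle (a y) (a z) = angle y z) :
    ∃ L : E3 ≃ₗᵢ[ℝ] E3, ∀ y ∈ U, a y = ‖y‖⁻¹ • L y := by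
  have hlocal : ∀ x ∈ U, ∃ L : E3 ≃ₗᵢ[ℝ] E3, ∀ᶠ y in 𝓝 x, a y = ‖y‖⁻¹ • L y := by
    intro x hx
    obtain ⟨ε, hε, h⟩ := hloc x hx
    have hBo : IsOpen (U ∩ ball x ε) := hUo.inter isOpen_ball
    have hxB : x ∈ U ∩ ball x ε := ⟨hx, mem_ball_self hε⟩
    obtain ⟨L, hL⟩ := exists_isometry_of_inner_eq (b := fun y => ‖y‖ • a y)
      (span_eq_top_of_isOpen hBo ⟨x, hxB⟩) (by
        rintro y ⟨hyU, hy⟩ z ⟨hzU, hz⟩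
        rw [real_inner_smul_left, real_inner_smul_right,
          ← cos_angle_mul_norm_mul_norm (a y) (a z), ha y hyU, ha z hzU, h y hyU z hzU hy hz,
          ← cos_angle_mul_norm_mul_norm y z]
        ring)
    refine ⟨L, ?_⟩
    filter_upwards [hBo.mem_nhds hxB] with y hy
    have hy0 : y ≠ 0 := fun h => h0 (h ▸ hy.1)
    rw [← hL y hy, smul_smul, inv_mul_cancel₀ (norm_ne_zero_iff.2 hy0), one_smul]
  rcases U.eq_empty_or_nonempty with rfl | ⟨x₀, hx₀⟩
  · exact ⟨LinearIsometryEquiv.refl ℝ E3, by simp⟩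
  obtain ⟨L, hL⟩ := hlocal x₀ hx₀
  refine ⟨L, forall_of_isPreconnected hU hx₀ hL fun x hx hW => ?_⟩
  obtain ⟨M, hM⟩ := hlocal x hx
  obtain ⟨z, ⟨hz1, hzU⟩, hz2⟩ := hW _ (inter_mem (eventually_eventually_nhds.2 hM)
    (hUo.mem_nhds hx))
  have : L = M := by
    apply linearIsometryEquiv_eq_of_eventuallyEq (x := z)
    filter_upwards [hz1, hz2, hUo.mem_nhds hzU] with y h1 h2 hyU
    have hy0 : ‖y‖⁻¹ ≠ 0 := inv_ne_zero (norm_ne_zero_iff.2 fun h => h0 (h ▸ hyU))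
    exact smul_right_injective _ hy0 (h2.symm.trans h1)
  rwa [this]

/-! ### Local isometries -/

/-- `ψ` maps directions in `U` to points of `S`, locally carrying angles to distances. -/
def LocIso (ψ : E3 → S) (U : Set E3) : Prop :=
  ∀ x ∈ U, ∃ ε > 0, ∀ y ∈ U, ∀ z ∈ U, dist y x < ε → dist z x < ε →
    dist (ψ y) (ψ z) = angle y z

lemma LocIso.mono {ψ : E3 → S} {U U' : Set E3} (h : LocIso ψ U) (hU : U' ⊆ U) : LocIso ψ U' := by
  intro x hx
  obtain ⟨ε, hε, h⟩ := h x (hU hx)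
  exact ⟨ε, hε, fun y hy z hz => h y (hU hy) z (hU hz)⟩

/-- The angle of the zero vector with itself is `π / 2` by convention, whereas the distance of a
point to itself is `0`. -/
lemma LocIso.ne_zero {ψ : E3 → S} {U : Set E3} (h : LocIso ψ U) {x : E3} (hx : x ∈ U) :
    x ≠ 0 := by
  rintro rfl
  obtain ⟨ε, hε, h⟩ := h 0 hx
  have := h 0 hx 0 hx (by simpa) (by simpa)
  simp only [dist_self, angle_zero_left] at this
  linarith [Real.pi_pos]

lemma LocIso.zero_notMem {ψ : E3 → S} {U : Set E3} (h : LocIso ψ U) : (0 : E3) ∉ U :=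
  fun h0 => h.ne_zero h0 rfl

lemma LocIso.comp {ψ : E3 → S} {U : Set E3} (h : LocIso ψ U) (A : E3 ≃ₗᵢ[ℝ] E3) :
    LocIso (ψ ∘ A) (A ⁻¹' U) := by
  intro x hx
  obtain ⟨ε, hε, h⟩ := h (A x) hx
  refine ⟨ε, hε, fun y hy z hz h1 h2 => ?_⟩
  rw [Function.comp, Function.comp, h (A y) hy (A z) hz (by simpa) (by simpa),
    angle_map]

lemma locIso_of_forall_dist_eq {ψ : E3 → S} {U : Set E3}
    (h : ∀ y ∈ U, ∀ z ∈ U, dist (ψ y) (ψ z) = angle y z) : LocIso ψ U :=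
  fun _ _ => ⟨1, one_pos, fun y hy z hz _ _ => h y hy z hz⟩

lemma tendsto_angle_self {x : E3} (hx : x ≠ 0) : Tendsto (fun y => angle y x) (𝓝 x) (𝓝 0) := by
  have h1 : ContinuousAt (fun y : E3 => angle y x) x :=
    (continuousAt_angle (x := (x, x)) hx hx).comp (f := fun y : E3 => (y, x)) (by fun_prop)
  have := h1.tendsto
  rwa [angle_self hx] at this

lemma continuousOn_angle {U : Set E3} (h0 : (0 : E3) ∉ U) {x : E3} (hx : x ≠ 0) :
    ContinuousOn (fun y => angle x y) U := by
  intro y hy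
  have h1 : ContinuousAt (fun y : E3 => angle x y) y :=
    (continuousAt_angle (x := (x, y)) hx (fun h => h0 (h ▸ hy))).comp
      (f := fun y : E3 => (x, y)) (by fun_prop)
  exact h1.continuousWithinAt

lemma LocIso.continuousOn {ψ : E3 → S} {U : Set E3} (h : LocIso ψ U) : ContinuousOn ψ U := by
  intro x hx
  have hx0 := h.ne_zero hx
  obtain ⟨ε, hε, h⟩ := h x hx
  rw [ContinuousWithinAt, tendsto_iff_dist_tendsto_zero]
  refine ((tendsto_angle_self hx0).mono_left nhdsWithin_le_nhds).congr' ?_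
  filter_upwards [self_mem_nhdsWithin, mem_nhdsWithin_of_mem_nhds (ball_mem_nhds x hε)]
    with y hy hyx
  rw [h y hy x hx hyx (by simpa)]

lemma LocIso.continuousAt {ψ : E3 → S} {U : Set E3} (h : LocIso ψ U) (hU : IsOpen U) {x : E3}
    (hx : x ∈ U) : ContinuousAt ψ x :=
  h.continuousOn.continuousAt (hU.mem_nhds hx)

lemma mem_span_pair_of_lt {y z : E3} {t t' : ℝ} (ht : 0 ≤ t) (htt' : t < t') :
    y + t • (z - y) ∈ Submodule.span NNReal {y, y + t' • (z - y)} := by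
  have ht' : 0 < t' := ht.trans_lt htt'
  rw [Submodule.mem_span_pair]
  refine ⟨⟨1 - t / t', sub_nonneg.2 ((div_le_one ht').2 htt'.le)⟩, ⟨t / t', by positivity⟩, ?_⟩
  change (1 - t / t') • y + (t / t') • (y + t' • (z - y)) = _
  match_scalars
  all_goals field_simp
  all_goals ring

/-- The segment from `y` to `z` projects to a geodesic of the sphere, along which angles add. The
closed set of parameters for which the inequality holds can thus always be enlarged to the right by
the local isometry property. -/
lemma LocIso.dist_le {ψ : E3 → S} {U : Set E3} (h : LocIso ψ U) (hU : Convex ℝ U) {y z : E3}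
    (hy : y ∈ U) (hz : z ∈ U) : dist (ψ y) (ψ z) ≤ angle y z := by
  set w : ℝ → E3 := fun t => y + t • (z - y) with hw
  have hwU : ∀ t ∈ Icc (0 : ℝ) 1, w t ∈ U := fun t ht => hU.add_smul_sub_mem hy hz ht
  have hwc : Continuous w := by fun_prop
  have hy0 := h.ne_zero hy
  have hcl : IsClosed ({t | dist (ψ y) (ψ (w t)) ≤ angle y (w t)} ∩ Icc 0 1) := by
    have h1 : ContinuousOn (fun t => dist (ψ y) (ψ (w t))) (Icc 0 1) :=
      continuous_dist.comp_continuousOn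
        (continuousOn_const.prodMk (h.continuousOn.comp hwc.continuousOn hwU))
    have h2 : ContinuousOn (fun t => angle y (w t)) (Icc 0 1) :=
      (continuousOn_angle h.zero_notMem hy0).comp hwc.continuousOn hwU
    have h3 := (h1.prodMk h2).preimage_isClosed_of_isClosed isClosed_Icc
      OrderClosedTopology.isClosed_le'
    rw [inter_comm]
    exact h3
  have := hcl.Icc_subset_of_forall_exists_gt (a := 0) (b := 1) (by simp [w, angle_self hy0]) (by
    rintro t ⟨ht, ht0, ht1⟩ t₁ ht₁
    have htU := hwU t ⟨ht0, ht1.le⟩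
    obtain ⟨ε, hε, hloc⟩ := h (w t) htU
    have hev : ∀ᶠ t' in 𝓝[>] t, dist (w t') (w t) < ε :=
      (hwc.tendsto t).mono_left nhdsWithin_le_nhds (ball_mem_nhds _ hε)
    have hev2 : ∀ᶠ t' in 𝓝[>] t, t' ∈ Ioc t (min t₁ 1) :=
      Ioc_mem_nhdsGT (lt_min ht₁ ht1)
    obtain ⟨t', h1, h2, h3⟩ := (hev.and hev2).exists
    have ht'1 : t' ≤ 1 := h3.trans (min_le_right _ _)
    refine ⟨t', ?_, h2, h3.trans (min_le_left _ _)⟩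
    have ht'U := hwU t' ⟨ht0.trans h2.le, ht'1⟩
    have hadd : angle y (w t') = angle y (w t) + angle (w t) (w t') :=
      angle_eq_angle_add_add_angle_add_of_mem_span (h.ne_zero htU) (mem_span_pair_of_lt ht0 h2)
    have h4 := hloc (w t) htU (w t') ht'U (by simpa) h1
    calc dist (ψ y) (ψ (w t')) ≤ dist (ψ y) (ψ (w t)) + dist (ψ (w t)) (ψ (w t')) :=
          dist_triangle _ _ _
      _ ≤ _ := by rw [hadd, h4]; gcongr; exact ht)
  have h1 := this (right_mem_Icc.2 zero_le_one)
  simpa [w] using h1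

/-! ### Open disks and charts -/

/-- The open convex cone over the open disk with centre `ℓ / ‖ℓ‖` and radius `arccos (1 / ‖ℓ‖)`. -/
def D (ℓ : E3) : Set E3 := {y | ‖y‖ < ⟪ℓ, y⟫}

lemma isOpen_D (ℓ : E3) : IsOpen (D ℓ) := isOpen_lt (by fun_prop) (by fun_prop)

lemma convex_D (ℓ : E3) : Convex ℝ (D ℓ) := by
  intro y hy z hz a b ha hb hab
  simp only [D, mem_ofPred_eq] at *
  calc ‖a • y + b • z‖ ≤ ‖a • y‖ + ‖b • z‖ := norm_add_le _ _
    _ = a * ‖y‖ + b * ‖z‖ := by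
      rw [norm_smul, norm_smul, Real.norm_of_nonneg ha, Real.norm_of_nonneg hb]
    _ < a * ⟪ℓ, y⟫ + b * ⟪ℓ, z⟫ := by
      rcases ha.eq_or_lt with rfl | ha'
      · have : b = 1 := by linarith
        subst this; simpa using hz
      · have h1 := mul_lt_mul_of_pos_left hy ha'
        have h2 := mul_le_mul_of_nonneg_left hz.le hb
        linarith
    _ = _ := by rw [inner_add_right, real_inner_smul_right, real_inner_smul_right]

lemma smul_mem_D {ℓ y : E3} (hy : y ∈ D ℓ) {r : ℝ} (hr : 0 < r) : r • y ∈ D ℓ := by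
  simp only [D, mem_ofPred_eq, norm_smul, real_inner_smul_right, Real.norm_of_nonneg hr.le] at *
  gcongr

lemma smul_mem_D_iff {ℓ y : E3} {r : ℝ} (hr : 0 < r) : r • y ∈ D ℓ ↔ y ∈ D ℓ := by
  refine ⟨fun h => ?_, fun h => smul_mem_D h hr⟩
  have := smul_mem_D h (inv_pos.2 hr)
  rwa [smul_smul, inv_mul_cancel₀ hr.ne', one_smul] at this

lemma ne_zero_of_mem_D {ℓ y : E3} (hy : y ∈ D ℓ) : y ≠ 0 := by
  rintro rfl
  simp [D] at hy

lemma preimage_D (ℓ : E3) (A : E3 ≃ₗᵢ[ℝ] E3) : A ⁻¹' (D ℓ) = D (A.symm ℓ) := by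
  ext y
  simp only [D, mem_preimage, mem_ofPred_eq, A.norm_map]
  rw [← A.inner_map_map (A.symm ℓ) y, A.apply_symm_apply]

/-- An immersed open disk in `S` that contains no points of `V`. -/
structure EmptyDisc (V : Finset S) (ℓ : E3) (ψ : E3 → S) : Prop where
  locIso : LocIso ψ (D ℓ)
  notMem : ∀ y ∈ D ℓ, ψ y ∉ V

lemma EmptyDisc.comp {V : Finset S} {ℓ : E3} {ψ : E3 → S} (h : EmptyDisc V ℓ ψ)
    (A : E3 ≃ₗᵢ[ℝ] E3) : EmptyDisc V (A.symm ℓ) (ψ ∘ A) := by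
  refine ⟨preimage_D ℓ A ▸ h.locIso.comp A, fun y hy => h.notMem (A y) ?_⟩
  rwa [← preimage_D] at hy

/-- An isometrically embedded open disk around `s` that contains no points of `V`. -/
structure IsChart (V : Finset S) (s : S) (x ℓ : E3) (g : E3 → S) (δ : ℝ) : Prop where
  dist_eq : ∀ y ∈ D ℓ, ∀ z ∈ D ℓ, dist (g y) (g z) = angle y z
  notMem : ∀ y ∈ D ℓ, g y ∉ V
  mem : x ∈ D ℓ
  map_center : g x = s
  pos : 0 < δ
  ball_subset : ball s δ ⊆ g '' D ℓ

lemma IsChart.emptyDisc {V : Finset S} {s : S} {x ℓ : E3} {g : E3 → S} {δ : ℝ}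
    (h : IsChart V s x ℓ g δ) : EmptyDisc V ℓ g :=
  ⟨locIso_of_forall_dist_eq h.dist_eq, h.notMem⟩

lemma exists_isometry_map_eq {x y : E3} (h : ‖x‖ = ‖y‖) : ∃ R : E3 ≃ₗᵢ[ℝ] E3, R x = y :=
  ⟨_, Submodule.reflection_sub h⟩

/-- The vector `ℓ = x / cos ε` has norm `1 / cos ε`, so `D ℓ` is the cone over the metric disk of
radius `ε` about `x`. -/
lemma mem_D_smul_iff {x y : E3} (hx : ‖x‖ = 1) (hy : y ≠ 0) {ε : ℝ} (h0 : 0 < ε)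
    (h1 : ε < Real.pi / 2) : y ∈ D ((Real.cos ε)⁻¹ • x) ↔ angle x y < ε := by
  have hc : 0 < Real.cos ε := Real.cos_pos_of_mem_Ioo ⟨by linarith, h1⟩
  have hy' : 0 < ‖y‖ := norm_pos_iff.2 hy
  rw [D, mem_ofPred_eq, real_inner_smul_left, ← cos_angle_mul_norm_mul_norm, hx, one_mul,
    inv_mul_eq_div, lt_div_iff₀ hc, mul_comm, mul_lt_mul_iff_left₀ hy',
    Real.strictAntiOn_cos.lt_iff_gt ⟨h0.le, by linarith [Real.pi_pos]⟩
      ⟨angle_nonneg _ _, angle_le_pi _ _⟩]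

lemma exists_chart {V : Finset S} {s : S} (hs : IsRegularPoint s) (hsV : s ∉ V) {x : E3}
    (hx : ‖x‖ = 1) : ∃ ℓ g δ, IsChart V s x ℓ g δ := by
  classical
  obtain ⟨ε, hε, f, hf1, hf2, hf3⟩ := hs
  obtain ⟨ε', hε', hV⟩ : ∃ ε' > 0, ∀ v ∈ V, ε' ≤ dist v s := by
    have : IsOpen ((V : Set S)ᶜ) := V.finite_toSet.isClosed.isOpen_compl
    obtain ⟨r, hr, h⟩ := Metric.isOpen_iff.1 this s (by simpa using hsV)
    refine ⟨r, hr, fun v hv => le_of_not_gt fun hlt => h hlt hv⟩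
  -- The radius `η` stays inside the given isometry, misses `V`, and is below `π / 2`, as is needed
  -- to write the disk as some `D ℓ`.
  set η := min (min ε ε') 1 with hη
  have hη0 : 0 < η := lt_min (lt_min hε hε') one_pos
  have hηε : η ≤ ε := (min_le_left _ _).trans (min_le_left _ _)
  have hηε' : η ≤ ε' := (min_le_left _ _).trans (min_le_right _ _)
  have hη1 : η < Real.pi / 2 := (min_le_right _ _).trans_lt (by linarith [Real.pi_gt_three])
  -- Composing with `R` allows the centre of the chart to be any prescribed unit vector.
  obtain ⟨R, hR⟩ := exists_isometry_map_eq (x := x) (y := f s)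
    (by rw [hx, hf1 s (mem_ball_self hε)])
  have hx0 : x ≠ 0 := by rintro rfl; simp at hx
  have hch : ∀ y : E3, ∃ p : S, y ≠ 0 → angle x y < η → p ∈ ball s ε ∧ f p = ‖y‖⁻¹ • R y := by
    intro y
    by_cases hy : y ≠ 0 ∧ angle x y < η
    · have hn : 0 < ‖y‖⁻¹ := inv_pos.2 (norm_pos_iff.2 hy.1)
      obtain ⟨p, hp1, hp2⟩ := hf3 (‖y‖⁻¹ • R y)
        (by rw [norm_smul, R.norm_map, norm_inv, norm_norm,
          inv_mul_cancel₀ (norm_ne_zero_iff.2 hy.1)])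
        (by rw [angle_smul_right_of_pos _ _ hn, ← hR, angle_map]; exact hy.2.trans_le hηε)
      exact ⟨p, fun _ _ => ⟨hp1, hp2⟩⟩
    · exact ⟨s, fun h1 h2 => absurd ⟨h1, h2⟩ hy⟩
  choose g hg using hch
  have hD : ∀ y, y ∈ D ((Real.cos η)⁻¹ • x) ↔ y ≠ 0 ∧ angle x y < η := by
    intro y
    constructor
    · intro h
      exact ⟨ne_zero_of_mem_D h, (mem_D_smul_iff hx (ne_zero_of_mem_D h) hη0 hη1).1 h⟩
    · rintro ⟨h1, h2⟩
      exact (mem_D_smul_iff hx h1 hη0 hη1).2 h2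
  have hdist : ∀ y ∈ D ((Real.cos η)⁻¹ • x), ∀ z ∈ D ((Real.cos η)⁻¹ • x),
      dist (g y) (g z) = angle y z := by
    intro y hy z hz
    rw [hD] at hy hz
    obtain ⟨hy1, hy2⟩ := hg y hy.1 hy.2
    obtain ⟨hz1, hz2⟩ := hg z hz.1 hz.2
    rw [hf2 _ hy1 _ hz1, hy2, hz2, angle_smul_right_of_pos _ _ (inv_pos.2 (norm_pos_iff.2 hz.1)),
      angle_smul_left_of_pos _ _ (inv_pos.2 (norm_pos_iff.2 hy.1)), angle_map]
  have hxD : x ∈ D ((Real.cos η)⁻¹ • x) := (hD x).2 ⟨hx0, by rwa [angle_self hx0]⟩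
  have hfinj : ∀ p ∈ ball s ε, ∀ q ∈ ball s ε, f p = f q → p = q := by
    intro p hp q hq hpq
    have := hf2 p hp q hq
    rw [hpq, angle_self (by rw [← norm_ne_zero_iff, hf1 q hq]; exact one_ne_zero)] at this
    exact dist_eq_zero.1 this
  have hgx : g x = s := by
    obtain ⟨h1, h2⟩ := hg x hx0 (by rwa [angle_self hx0])
    exact hfinj _ h1 _ (mem_ball_self hε) (by rw [h2, hx, hR, inv_one, one_smul])
  refine ⟨_, g, η, hdist, ?_, hxD, hgx, hη0, ?_⟩
  · intro y hy hyV
    have h1 := hdist y hy x hxD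
    rw [hgx] at h1
    have h2 := hV _ hyV
    have h3 := ((hD y).1 hy).2
    rw [angle_comm] at h3
    linarith
  · intro p hp
    have hpε : p ∈ ball s ε := ball_subset_ball hηε hp
    have hp1 := hf1 p hpε
    set y := R.symm (f p) with hy
    have hy0 : y ≠ 0 := by
      rw [← norm_ne_zero_iff, hy, R.symm.norm_map, hp1]; exact one_ne_zero
    have hxy : angle x y < η := by
      rw [← angle_map R, hR, hy, R.apply_symm_apply, ← hf2 _ (mem_ball_self hε) _ hpε, dist_comm]
      exact hp
    refine ⟨y, (hD y).2 ⟨hy0, hxy⟩, ?_⟩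
    obtain ⟨h1, h2⟩ := hg y hy0 hxy
    apply hfinj _ h1 _ hpε
    rw [h2, hy, R.apply_symm_apply, R.symm.norm_map, hp1, inv_one, one_smul]

/-- Reading `ψ` in the chart and normalising gives a locally angle-preserving map into the sphere,
which is a linear isometry by `exists_isometry_of_angle_eq`. Rescaling along rays is harmless
because `g` identifies points at angle `0`. -/
lemma LocIso.exists_eq_chart {V : Finset S} {s : S} {x ℓ : E3} {g : E3 → S} {δ : ℝ}
    (hg : IsChart V s x ℓ g δ) {U : Set E3} (hUo : IsOpen U) (hU : IsPreconnected U)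
    {ψ : E3 → S} (h : LocIso ψ U) (hψ : ∀ y ∈ U, dist (ψ y) s < δ) :
    ∃ L : E3 ≃ₗᵢ[ℝ] E3, ∀ y ∈ U, L y ∈ D ℓ ∧ ψ y = g (L y) := by
  have hch : ∀ y, ∃ z, y ∈ U → z ∈ D ℓ ∧ g z = ψ y := by
    intro y
    by_cases hy : y ∈ U
    · obtain ⟨z, hz⟩ := hg.ball_subset (hψ y hy)
      exact ⟨z, fun _ => hz⟩
    · exact ⟨0, fun h => absurd h hy⟩
  choose k hk using hch
  have hk0 : ∀ y ∈ U, 0 < ‖k y‖ := fun y hy => norm_pos_iff.2 (ne_zero_of_mem_D (hk y hy).1)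
  obtain ⟨L, hL⟩ := exists_isometry_of_angle_eq hUo hU h.zero_notMem
    (a := fun y => ‖k y‖⁻¹ • k y)
    (fun y hy => by rw [norm_smul, norm_inv, norm_norm, inv_mul_cancel₀ (hk0 y hy).ne'])
    (by
      intro w hw
      obtain ⟨ε, hε, hloc⟩ := h w hw
      refine ⟨ε, hε, fun y hy z hz h1 h2 => ?_⟩
      rw [angle_smul_right_of_pos _ _ (inv_pos.2 (hk0 z hz)),
        angle_smul_left_of_pos _ _ (inv_pos.2 (hk0 y hy)),
        ← hg.dist_eq _ (hk y hy).1 _ (hk z hz).1, (hk y hy).2, (hk z hz).2,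
        hloc y hy z hz h1 h2])
  refine ⟨L, fun y hy => ?_⟩
  have hy0 : 0 < ‖y‖ := norm_pos_iff.2 (h.ne_zero hy)
  have h1 : L y = (‖y‖ * ‖k y‖⁻¹) • k y := by
    rw [mul_smul, hL y hy, smul_smul, mul_inv_cancel₀ hy0.ne', one_smul]
  have hr : 0 < ‖y‖ * ‖k y‖⁻¹ := mul_pos hy0 (inv_pos.2 (hk0 y hy))
  have h2 : L y ∈ D ℓ := by rw [h1]; exact smul_mem_D (hk y hy).1 hr
  refine ⟨h2, ?_⟩
  rw [← (hk y hy).2, ← dist_eq_zero, hg.dist_eq _ (hk y hy).1 _ h2, h1,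
    angle_smul_right_of_pos _ _ hr, angle_self (ne_zero_of_mem_D (hk y hy).1)]

lemma IsChart.eq_of_map_eq {V : Finset S} {s : S} {x ℓ : E3} {g : E3 → S} {δ : ℝ}
    (hg : IsChart V s x ℓ g δ) {y z : E3} (hy : y ∈ D ℓ) (hz : z ∈ D ℓ) (h : g y = g z)
    (hn : ‖y‖ = ‖z‖) : y = z := by
  refine eq_of_angle_eq_zero_of_norm_eq ?_ hn
  rw [← hg.dist_eq y hy z hz, h, dist_self]

lemma norm_sub_le_angle {x y : E3} (hx : ‖x‖ = 1) (hy : ‖y‖ = 1) : ‖x - y‖ ≤ angle x y := by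
  apply le_of_sq_le_sq _ (angle_nonneg x y)
  rw [norm_sub_sq_real, hx, hy, ← cos_angle_mul_norm_mul_norm, hx, hy]
  have := Real.one_sub_sq_div_two_le_cos (x := angle x y)
  linarith

lemma LocIso.eventually_eq_chart {V : Finset S} {s : S} {x ℓ : E3} {g : E3 → S} {δ : ℝ}
    (hg : IsChart V s x ℓ g δ) {U : Set E3} (hUo : IsOpen U) {ψ : E3 → S} (h : LocIso ψ U)
    {y : E3} (hy : y ∈ U) (hψ : ψ y = s) :
    ∃ L : E3 ≃ₗᵢ[ℝ] E3, ∀ᶠ z in 𝓝 y, L z ∈ D ℓ ∧ ψ z = g (L z) := by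
  have h1 : ∀ᶠ z in 𝓝 y, z ∈ U ∧ dist (ψ z) s < δ := by
    have := (h.continuousAt hUo hy).tendsto
    rw [hψ] at this
    exact Filter.Eventually.and (hUo.mem_nhds hy) (this (ball_mem_nhds s hg.pos))
  obtain ⟨r, hr, hball⟩ := Metric.eventually_nhds_iff_ball.1 h1
  obtain ⟨L, hL⟩ := LocIso.exists_eq_chart hg isOpen_ball
    (convex_ball y r).isPreconnected (h.mono fun z hz => (hball z hz).1)
    (fun z hz => (hball z hz).2)
  exact ⟨L, eventually_of_mem (ball_mem_nhds y hr) hL⟩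

/-- Unique continuation: at a limit of points of agreement both maps have the same value by
continuity, and in a chart there they are linear isometries `L` and `M` that agree on an open set.
-/
lemma LocIso.eq_of_eventually_eq {V : Finset S} (hd : IsSphericalConeMetric V) {U : Set E3}
    (hUo : IsOpen U) (hU : IsPreconnected U) {ψ₁ ψ₂ : E3 → S} (h₁ : LocIso ψ₁ U)
    (h₂ : LocIso ψ₂ U) (hV : ∀ y ∈ U, ψ₁ y ∉ V) {x₀ : E3} (hx₀ : x₀ ∈ U)
    (h : ∀ᶠ y in 𝓝 x₀, ψ₁ y = ψ₂ y) : ∀ y ∈ U, ψ₁ y = ψ₂ y := by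
  refine forall_of_isPreconnected hU hx₀ h fun x hx hW => ?_
  have hs : ψ₁ x = ψ₂ x := by
    by_contra hne
    obtain ⟨z, hz1, hz2⟩ := hW _ (eventually_eventually_nhds.2
      (Filter.Tendsto.eventually_ne (Filter.Tendsto.dist (h₁.continuousAt hUo hx)
        (h₂.continuousAt hUo hx)) (dist_ne_zero.2 hne)))
    exact Eventually.self_of_nhds hz1 (dist_eq_zero.2 (Eventually.self_of_nhds hz2 :))
  obtain ⟨ℓ, g, δ, hg⟩ := exists_chart (V := V) (hd.regular _ (hV x hx)) (hV x hx)
    (x := EuclideanSpace.single 0 1) (by simp)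
  obtain ⟨L, hL⟩ := h₁.eventually_eq_chart hg hUo hx rfl
  obtain ⟨M, hM⟩ := h₂.eventually_eq_chart hg hUo hx hs.symm
  obtain ⟨z, hz1, hz2⟩ := hW _ (eventually_eventually_nhds.2 (hL.and hM))
  have hLM : L = M := by
    apply linearIsometryEquiv_eq_of_eventuallyEq (x := z)
    filter_upwards [hz1, hz2] with y ⟨h1, h2⟩ h3
    exact hg.eq_of_map_eq h1.1 h2.1 (by rw [← h1.2, h3, h2.2]) (by simp)
  subst hLM
  filter_upwards [hL, hM] with y h1 h2
  rw [h1.2, h2.2]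

/-- In one chart at the common value the maps are linear isometries `L` and `M` near `y₁` and `y₂`,
and `A = M⁻¹ ∘ L`. This turns a coincidence of values into a coincidence of germs. -/
lemma LocIso.exists_frame {V : Finset S} (hd : IsSphericalConeMetric V) {U₁ U₂ : Set E3}
    (hU₁ : IsOpen U₁) (hU₂ : IsOpen U₂) {ψ₁ ψ₂ : E3 → S} (h₁ : LocIso ψ₁ U₁)
    (h₂ : LocIso ψ₂ U₂) {y₁ y₂ : E3} (hy₁ : y₁ ∈ U₁) (hy₂ : y₂ ∈ U₂) (hn : ‖y₁‖ = ‖y₂‖)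
    (h : ψ₁ y₁ = ψ₂ y₂) (hV : ψ₁ y₁ ∉ V) :
    ∃ A : E3 ≃ₗᵢ[ℝ] E3, A y₁ = y₂ ∧ ∀ᶠ y in 𝓝 y₁, ψ₂ (A y) = ψ₁ y := by
  obtain ⟨ℓ, g, δ, hg⟩ := exists_chart (V := V) (hd.regular _ hV) hV
    (x := EuclideanSpace.single 0 1) (by simp)
  obtain ⟨L, hL⟩ := h₁.eventually_eq_chart hg hU₁ hy₁ rfl
  obtain ⟨M, hM⟩ := h₂.eventually_eq_chart hg hU₂ hy₂ h.symm
  have hLM : L y₁ = M y₂ := hg.eq_of_map_eq hL.self_of_nhds.1 hM.self_of_nhds.1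
    (by rw [← hL.self_of_nhds.2, ← hM.self_of_nhds.2, h]) (by simpa)
  have hA : (L.trans M.symm) y₁ = y₂ := by simp [hLM]
  refine ⟨L.trans M.symm, hA, ?_⟩
  have hcont : Tendsto (L.trans M.symm) (𝓝 y₁) (𝓝 y₂) := by
    have := (L.trans M.symm).continuous.tendsto y₁
    rwa [hA] at this
  filter_upwards [hL, hcont.eventually hM] with y h1 h2
  rw [h1.2, h2.2]
  simp

lemma LocIso.image_mem_nhds {V : Finset S} (hd : IsSphericalConeMetric V) {U : Set E3}
    (hUo : IsOpen U) {ψ : E3 → S} (h : LocIso ψ U) {y : E3} (hy : y ∈ U) (hV : ψ y ∉ V) :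
    ψ '' U ∈ 𝓝 (ψ y) := by
  obtain ⟨ℓ, g, δ, hg⟩ := exists_chart (V := V) (hd.regular _ hV) hV
    (x := EuclideanSpace.single 0 1) (by simp)
  obtain ⟨L, hL⟩ := h.eventually_eq_chart hg hUo hy rfl
  obtain ⟨r, hr, hball⟩ := Metric.eventually_nhds_iff_ball.1 (hL.and (hUo.mem_nhds hy))
  have hy0 : 0 < ‖y‖ := norm_pos_iff.2 (h.ne_zero hy)
  refine mem_of_superset (ball_mem_nhds _ (lt_min hg.pos (div_pos hr hy0))) fun s' hs' => ?_
  obtain ⟨z, hz, rfl⟩ := hg.ball_subset (ball_subset_ball (min_le_left _ _) hs')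
  have hz0 : 0 < ‖z‖ := norm_pos_iff.2 (ne_zero_of_mem_D hz)
  have hLy := (hball y (mem_ball_self hr)).1
  have hang : angle z (L y) < r / ‖y‖ := by
    rw [← hg.dist_eq z hz _ hLy.1, ← hLy.2]
    exact lt_of_lt_of_le hs' (min_le_right _ _)
  -- The preimage is rescaled to the norm of `y`, so that a small angle to `y` becomes a small
  -- Euclidean distance.
  set w := L.symm ((‖y‖ * ‖z‖⁻¹) • z) with hw
  have hr' : 0 < ‖y‖ * ‖z‖⁻¹ := by positivity
  have hwy : w ∈ ball y r := by
    have h1 := norm_sub_le_angle (x := ‖z‖⁻¹ • z) (y := ‖y‖⁻¹ • L y)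
      (by rw [norm_smul, norm_inv, norm_norm, inv_mul_cancel₀ hz0.ne'])
      (by rw [norm_smul, norm_inv, norm_norm, L.norm_map, inv_mul_cancel₀ hy0.ne'])
    rw [angle_smul_right_of_pos _ _ (inv_pos.2 hy0),
      angle_smul_left_of_pos _ _ (inv_pos.2 hz0)] at h1
    have h2 : w - y = ‖y‖ • L.symm (‖z‖⁻¹ • z - ‖y‖⁻¹ • L y) := by
      rw [map_sub, map_smul, map_smul, L.symm_apply_apply, smul_sub, smul_smul, smul_smul,
        mul_inv_cancel₀ hy0.ne', one_smul, hw, map_smul]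
    rw [mem_ball, dist_eq_norm, h2, norm_smul, norm_norm, L.symm.norm_map]
    calc ‖y‖ * _ ≤ ‖y‖ * angle z (L y) := by gcongr
      _ < ‖y‖ * (r / ‖y‖) := by gcongr
      _ = r := by field_simp
  refine ⟨w, (hball w hwy).2, ?_⟩
  have h3 := (hball w hwy).1
  rw [h3.2, ← dist_eq_zero, hg.dist_eq _ h3.1 _ hz, hw, L.apply_symm_apply,
    angle_smul_left_of_pos _ _ hr', angle_self (norm_pos_iff.1 hz0)]

/-! ### Limits at boundary points -/

/-- `s` is the limit at `p` of the map `ψ` on `U`. -/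
def IsLimitAt (ψ : E3 → S) (U : Set E3) (p : E3) (s : S) : Prop :=
  ∀ y ∈ U, dist (ψ y) s ≤ angle y p

lemma IsLimitAt.tendsto {ψ : E3 → S} {U : Set E3} {p : E3} {s : S} (h : IsLimitAt ψ U p s)
    (hp : p ≠ 0) : Tendsto ψ (𝓝[U] p) (𝓝 s) := by
  rw [tendsto_iff_dist_tendsto_zero]
  refine squeeze_zero' (Eventually.of_forall fun _ => dist_nonneg) ?_
    ((tendsto_angle_self hp).mono_left nhdsWithin_le_nhds)
  filter_upwards [self_mem_nhdsWithin] with y hy using h y hy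

lemma LocIso.isLimitAt {ψ : E3 → S} {U : Set E3} (h : LocIso ψ U) (hU : Convex ℝ U) {p : E3}
    (hp : p ∈ U) : IsLimitAt ψ U p (ψ p) :=
  fun _ hy => h.dist_le hU hy hp

lemma IsLimitAt.unique {ψ : E3 → S} {U : Set E3} {p : E3} {s s' : S} (h : IsLimitAt ψ U p s)
    (h' : IsLimitAt ψ U p s') (hp : p ≠ 0) (hpU : p ∈ closure U) : s = s' := by
  have := mem_closure_iff_nhdsWithin_neBot.1 hpU
  exact tendsto_nhds_unique (h.tendsto hp) (h'.tendsto hp)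

lemma LocIso.isLimitAt_of_tendsto {ψ : E3 → S} {U : Set E3} (h : LocIso ψ U) (hU : Convex ℝ U)
    {p : E3} (hp : p ≠ 0) {s : S} {ι : Type*} {F : Filter ι} [F.NeBot] {u : ι → E3}
    (hu : Tendsto u F (𝓝 p)) (huU : ∀ᶠ i in F, u i ∈ U) (hs : Tendsto (ψ ∘ u) F (𝓝 s)) :
    IsLimitAt ψ U p s := by
  intro y hy
  have h1 : Tendsto (fun i => dist (ψ y) (ψ (u i))) F (𝓝 (dist (ψ y) s)) :=
    tendsto_const_nhds.dist hs
  have h2 : Tendsto (fun i => angle y (u i)) F (𝓝 (angle y p)) := by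
    have h3 : ContinuousAt (fun z : E3 => angle y z) p :=
      (continuousAt_angle (x := (y, p)) (h.ne_zero hy) hp).comp (f := fun z : E3 => (y, z))
        (by fun_prop)
    exact h3.tendsto.comp hu
  exact le_of_tendsto_of_tendsto h1 h2 (huU.mono fun i hi => h.dist_le hU hy hi)

/-- Compactness gives a limit along one sequence only; since `ψ` does not increase distances, it
satisfies the estimate `IsLimitAt` for all of `U`. -/
lemma LocIso.exists_isLimitAt [CompactSpace S] {ψ : E3 → S} {U : Set E3} (h : LocIso ψ U)
    (hU : Convex ℝ U) {p : E3} (hp : p ∈ closure U) (hp0 : p ≠ 0) :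
    ∃ s, IsLimitAt ψ U p s := by
  obtain ⟨u, huU, hu⟩ := mem_closure_iff_seq_limit.1 hp
  obtain ⟨s, -, k, hk, hs⟩ := isCompact_univ.tendsto_subseq (x := ψ ∘ u) (fun _ => mem_univ _)
  exact ⟨s, h.isLimitAt_of_tendsto hU hp0 (hu.comp hk.tendsto_atTop)
    (Eventually.of_forall fun n => huU _) hs⟩

lemma IsLimitAt.dist_le {ψ : E3 → S} {U : Set E3} {p q : E3} {s t : S} (h : IsLimitAt ψ U p s)
    (h' : IsLimitAt ψ U q t) (hp : p ≠ 0) (hpU : p ∈ closure U) : dist s t ≤ angle p q := by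
  have := mem_closure_iff_nhdsWithin_neBot.1 hpU
  have h1 : Tendsto (fun y => angle y p + angle p q) (𝓝[U] p) (𝓝 (0 + angle p q)) :=
    ((tendsto_angle_self hp).mono_left nhdsWithin_le_nhds).add tendsto_const_nhds
  rw [zero_add] at h1
  refine le_of_tendsto_of_tendsto ((h.tendsto hp).dist tendsto_const_nhds) h1 ?_
  filter_upwards [self_mem_nhdsWithin] with y hy
  exact (h' y hy).trans (angle_le_angle_add_angle _ _ _)

/-- In a chart at `s` centred in the direction of `p`, the map is `g ∘ L` near `p` inside `U`. The
limit condition forces `L p = p`, so `g ∘ L` is defined in a full neighbourhood of `p`. -/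
lemma LocIso.exists_extension {V : Finset S} (hd : IsSphericalConeMetric V) {U : Set E3}
    (hUo : IsOpen U) (hU : Convex ℝ U) {ψ : E3 → S} (h : LocIso ψ U) {p : E3} (hp0 : p ≠ 0)
    (hpU : p ∈ closure U) {s : S} (hs : IsLimitAt ψ U p s) (hsV : s ∉ V) :
    ∃ δ > 0, ∃ Ψ : E3 → S, (∀ y ∈ ball p δ, ∀ z ∈ ball p δ, dist (Ψ y) (Ψ z) = angle y z) ∧
      Ψ p = s ∧ (∀ y ∈ ball p δ, Ψ y ∉ V) ∧ ∀ y ∈ U, y ∈ ball p δ → Ψ y = ψ y := by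
  have hn : 0 < ‖p‖ := norm_pos_iff.2 hp0
  obtain ⟨ℓ, g, δ, hg⟩ := exists_chart (V := V) (hd.regular _ hsV) hsV (x := ‖p‖⁻¹ • p)
    (by rw [norm_smul, norm_inv, norm_norm, inv_mul_cancel₀ hn.ne'])
  have hpD : p ∈ D ℓ := (smul_mem_D_iff (inv_pos.2 hn)).1 hg.mem
  have hgp : g p = s := by
    rw [← hg.map_center, ← dist_eq_zero, hg.dist_eq _ hpD _ hg.mem,
      angle_smul_right_of_pos _ _ (inv_pos.2 hn), angle_self hp0]
  obtain ⟨r, hr, hball⟩ := Metric.eventually_nhds_iff_ball.1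
    ((tendsto_angle_self hp0).eventually_lt_const hg.pos)
  obtain ⟨L, hL⟩ := LocIso.exists_eq_chart hg (hUo.inter isOpen_ball)
    (hU.inter (convex_ball p r)).isPreconnected (h.mono inter_subset_left)
    (fun y hy => (hs y hy.1).trans_lt (hball y hy.2))
  have hpU' : p ∈ closure (U ∩ ball p r) := by
    rw [mem_closure_iff_nhds] at hpU ⊢
    intro W hW
    obtain ⟨z, hz⟩ := hpU _ (inter_mem hW (ball_mem_nhds p hr))
    exact ⟨z, hz.1.1, hz.2, hz.1.2⟩
  have hLp : L p = p := by
    refine eq_of_angle_eq_zero_of_norm_eq (le_antisymm ?_ (angle_nonneg _ _)) (by simp)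
    have := mem_closure_iff_nhdsWithin_neBot.1 hpU'
    have h1 : Tendsto (fun y => angle (L y) p) (𝓝[U ∩ ball p r] p) (𝓝 (angle (L p) p)) := by
      have : ContinuousAt (fun y => angle (L y) p) p :=
        (continuousAt_angle (x := (L p, p)) (by simpa using hp0) hp0).comp
          (f := fun z : E3 => (L z, p)) (by fun_prop)
      exact this.tendsto.mono_left nhdsWithin_le_nhds
    refine le_of_tendsto_of_tendsto h1
      ((tendsto_angle_self hp0).mono_left nhdsWithin_le_nhds) ?_
    filter_upwards [self_mem_nhdsWithin] with y hy
    have := hs y hy.1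
    rwa [(hL y hy).2, ← hgp, hg.dist_eq _ (hL y hy).1 _ hpD] at this
  have hopen : IsOpen (L ⁻¹' D ℓ) := (isOpen_D ℓ).preimage L.continuous
  obtain ⟨r', hr', hball'⟩ := Metric.isOpen_iff.1 hopen p (by
    rw [mem_preimage, hLp]; exact hpD)
  refine ⟨min r r', lt_min hr hr', g ∘ L, ?_, ?_, ?_, ?_⟩
  · intro y hy z hz
    rw [Function.comp, Function.comp,
      hg.dist_eq _ (hball' (ball_subset_ball (min_le_right _ _) hy)) _
      (hball' (ball_subset_ball (min_le_right _ _) hz)), angle_map]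
  · rw [Function.comp, hLp, hgp]
  · exact fun y hy => hg.notMem _ (hball' (ball_subset_ball (min_le_right _ _) hy))
  · exact fun y hy hy' => (hL y ⟨hy, ball_subset_ball (min_le_left _ _) hy'⟩).2.symm

/-! ### The distance to a cone point -/

lemma cos_min_eq {ω : ℝ} (hω : 0 < ω) {t t' : ℝ} {θ θ' : AddCircle ω}
    (h : θ - θ' = ((t - t' : ℝ) : AddCircle ω)) (h1 : |t - t'| ≤ ω / 2)
    (h2 : |t - t'| ≤ Real.pi) : Real.cos (min ‖θ - θ'‖ Real.pi) = Real.cos (t - t') := by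
  rw [h, (AddCircle.norm_coe_eq_abs_iff ω hω.ne').2 (by rwa [abs_of_pos hω]), min_eq_left h2,
    Real.cos_abs]

lemma exists_lift {ω : ℝ} (hω : 0 < ω) (θ : AddCircle ω) :
    ∃ t : ℝ, (t : AddCircle ω) = θ ∧ |t| = ‖θ‖ := by
  have : Fact (0 < ω) := ⟨hω⟩
  obtain ⟨t, ht⟩ := (AddCircle.equivIoc ω (-(ω / 2))).symm.surjective θ
  have h1 : ((t : ℝ) : AddCircle ω) = θ := ht
  refine ⟨t, h1, ?_⟩
  have := t.2
  rw [← h1, (AddCircle.norm_coe_eq_abs_iff ω hω.ne').2]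
  rw [abs_of_pos hω, abs_le]
  constructor <;> linarith [this.1, this.2]

/-- Away from the apex, polar coordinates develop the cone onto the sphere, with the apex going to a
unit vector `a`. The cosine of the distance to the apex is then an inner product with `a`, which is
linear after multiplication by `‖y‖`. -/
lemma exists_inner_eq_cos_dist_aux {v : S} {ω ε : ℝ} (hω : 0 < ω) (hεπ : ε ≤ Real.pi / 2)
    {f : ℝ → AddCircle ω → S} (hf0 : ∀ θ, f 0 θ = v)
    (hf : ∀ r₁ ∈ Ico 0 ε, ∀ r₂ ∈ Ico 0 ε, ∀ θ₁ θ₂,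
      dist (f r₁ θ₁) (f r₂ θ₂) = coneDist ω r₁ θ₁ r₂ θ₂)
    (hfs : ∀ x ∈ ball v ε, ∃ r ∈ Ico 0 ε, ∃ θ, f r θ = x)
    {U : Set E3} (hUo : IsOpen U) {ψ : E3 → S} (h : LocIso ψ U)
    (hψ : ∀ y ∈ U, dist (ψ y) v < ε) {x : E3} (hx : x ∈ U) (hxv : ψ x ≠ v) :
    ∃ a : E3, ‖a‖ = 1 ∧ ∀ᶠ y in 𝓝 x, ⟪a, y⟫ = ‖y‖ * Real.cos (dist (ψ y) v) := by
  have hε0 : 0 < ε := dist_nonneg.trans_lt (hψ x hx)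
  have hch : ∀ y, ∃ r : ℝ, ∃ θ, y ∈ U → r ∈ Ico 0 ε ∧ f r θ = ψ y := by
    intro y
    by_cases hy : y ∈ U
    · obtain ⟨r, hr, θ, hθ⟩ := hfs _ (hψ y hy)
      exact ⟨r, θ, fun _ => ⟨hr, hθ⟩⟩
    · exact ⟨0, 0, fun h => absurd h hy⟩
  choose r θ hrθ using hch
  have hr : ∀ y ∈ U, dist (ψ y) v = r y := by
    intro y hy
    obtain ⟨⟨h1, h2⟩, h3⟩ := hrθ y hy
    rw [← h3, ← hf0 0, hf _ ⟨h1, h2⟩ 0 ⟨le_rfl, hε0⟩, coneDist]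
    simp only [Real.cos_zero, mul_one, Real.sin_zero, mul_zero, zero_mul, add_zero]
    exact Real.arccos_cos h1 (by linarith [Real.pi_pos])
  have hdist : ∀ y ∈ U, ∀ z ∈ U, dist (ψ y) (ψ z) = Real.arccos (Real.cos (r y) * Real.cos (r z) +
      Real.sin (r y) * Real.sin (r z) * Real.cos (min ‖θ y - θ z‖ Real.pi)) := by
    intro y hy z hz
    rw [← (hrθ y hy).2, ← (hrθ z hz).2, hf _ (hrθ y hy).1 _ (hrθ z hz).1, coneDist]
  have hsin : ∀ y ∈ U, 0 ≤ Real.sin (r y) := fun y hy =>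
    Real.sin_nonneg_of_nonneg_of_le_pi (hrθ y hy).1.1
      (by linarith [(hrθ y hy).1.2, Real.pi_pos])
  have hr0 : 0 < r x := by
    rw [← hr x hx]; exact dist_pos.2 hxv
  have hsin0 : 0 < Real.sin (r x) := Real.sin_pos_of_pos_of_lt_pi hr0
    (by linarith [(hrθ x hx).1.2, Real.pi_pos])
  -- Two lifts of size below `κ` differ by at most `2 * κ`. The bound `ω / 4` makes this difference
  -- compute the norm in the circle of length `ω`, and `π / 2` makes the truncation at `π`
  -- ineffective.
  set κ := min (ω / 4) (Real.pi / 2) with hκ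
  have hκ0 : 0 < κ := lt_min (by linarith) (by linarith [Real.pi_pos])
  have hcontd : ContinuousAt (fun y => dist (ψ y) (ψ x)) x :=
    ((h.continuousAt hUo hx).dist continuousAt_const)
  have hcontr : ContinuousAt (fun y => dist (ψ y) v) x :=
    ((h.continuousAt hUo hx).dist continuousAt_const)
  have hcosκ : Real.cos κ < 1 := by
    rw [← Real.cos_zero]
    exact Real.cos_lt_cos_of_nonneg_of_le_pi le_rfl
      (by linarith [min_le_right (ω / 4) (Real.pi / 2), Real.pi_pos]) hκ0
  have hev : ∀ᶠ y in 𝓝 x, y ∈ U ∧ Real.cos (dist (ψ y) v) * Real.cos (r x) +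
      Real.sin (dist (ψ y) v) * Real.sin (r x) * Real.cos κ < Real.cos (dist (ψ y) (ψ x)) := by
    refine Filter.Eventually.and (hUo.mem_nhds hx)
      (ContinuousAt.eventually_lt (by fun_prop) (by fun_prop) ?_)
    rw [hr x hx, dist_self, Real.cos_zero]
    nlinarith [Real.sin_sq_add_cos_sq (r x), mul_pos hsin0 hsin0]
  -- An angular difference of at least `κ` would push the cosine of the distance below the bound in
  -- `hev`. This gives continuity of the angular coordinate at `x`, about which nothing was assumed.
  have hθ : ∀ᶠ y in 𝓝 x, y ∈ U ∧ ‖θ y - θ x‖ < κ := by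
    filter_upwards [hev] with y ⟨hyU, hy⟩
    refine ⟨hyU, lt_of_not_ge fun hge => ?_⟩
    rw [hr y hyU, hdist y hyU x hx] at hy
    have hmin : κ ≤ min ‖θ y - θ x‖ Real.pi :=
      le_min hge ((min_le_right _ _).trans (by linarith [Real.pi_pos]))
    have h1 : Real.cos (min ‖θ y - θ x‖ Real.pi) ≤ Real.cos κ :=
      Real.cos_le_cos_of_nonneg_of_le_pi hκ0.le (min_le_right _ _) hmin
    have h2 := hsin y hyU
    have h3 : 0 ≤ Real.sin (r y) * Real.sin (r x) := mul_nonneg h2 hsin0.le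
    have h4 := mul_le_mul_of_nonneg_left h1 h3
    have h5 := mul_le_mul_of_nonneg_left (Real.neg_one_le_cos (min ‖θ y - θ x‖ Real.pi)) h3
    have h6 : -1 ≤ Real.cos (r y) * Real.cos (r x) +
        Real.sin (r y) * Real.sin (r x) * Real.cos (min ‖θ y - θ x‖ Real.pi) := by
      have := Real.neg_one_le_cos (r y + r x)
      rw [Real.cos_add] at this
      linarith
    have h7 : Real.cos (r y) * Real.cos (r x) +
        Real.sin (r y) * Real.sin (r x) * Real.cos (min ‖θ y - θ x‖ Real.pi) ≤ 1 := by
      have := Real.cos_le_one (r y - r x)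
      rw [Real.cos_sub] at this
      nlinarith [Real.cos_le_one (min ‖θ y - θ x‖ Real.pi)]
    rw [Real.cos_arccos h6 h7] at hy
    linarith
  obtain ⟨δ, hδ, hball⟩ := Metric.eventually_nhds_iff_ball.1 hθ
  choose t ht1 ht2 using fun y => exists_lift hω (θ y - θ x)
  let k : E3 → E3 := fun y => !₂[Real.cos (r y), Real.sin (r y) * Real.cos (t y),
    Real.sin (r y) * Real.sin (t y)]
  have hk : ∀ y z, ⟪k y, k z⟫ = Real.cos (r y) * Real.cos (r z) +
      Real.sin (r y) * Real.sin (r z) * Real.cos (t y - t z) := by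
    intro y z
    rw [Real.cos_sub]
    simp [k, PiLp.inner_apply, Fin.sum_univ_three]
    ring
  have hk1 : ∀ y, ‖k y‖ = 1 := by
    intro y
    have h1 : ‖k y‖ ^ 2 = 1 := by
      rw [← real_inner_self_eq_norm_sq, hk, sub_self, Real.cos_zero]
      nlinarith [Real.sin_sq_add_cos_sq (r y)]
    nlinarith [norm_nonneg (k y)]
  obtain ⟨L, hL⟩ := exists_isometry_of_angle_eq (U := ball x δ) isOpen_ball
    (convex_ball x δ).isPreconnected (fun h0 => h.zero_notMem (hball 0 h0).1) (a := k)
    (fun y _ => hk1 y) (by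
      intro w hw
      obtain ⟨η, hη, hloc⟩ := h w (hball w hw).1
      refine ⟨η, hη, fun y hy z hz h1 h2 => ?_⟩
      obtain ⟨hyU, hyθ⟩ := hball y hy
      obtain ⟨hzU, hzθ⟩ := hball z hz
      rw [← hloc y hyU z hzU h1 h2, hdist y hyU z hzU, angle, hk1, hk1, mul_one, div_one, hk]
      have htt : |t y - t z| ≤ 2 * κ := by
        have := abs_sub (t y) (t z)
        rw [ht2, ht2] at this
        linarith
      rw [cos_min_eq hω (t := t y) (t' := t z)]
      · rw [AddCircle.coe_sub, ht1, ht1]; abel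
      · linarith [min_le_left (ω / 4) (Real.pi / 2)]
      · linarith [min_le_right (ω / 4) (Real.pi / 2)])
  refine ⟨L.symm (EuclideanSpace.single 0 1), by simp, ?_⟩
  filter_upwards [ball_mem_nhds x hδ] with y hy
  have hyU := (hball y hy).1
  have hy0 : ‖y‖ ≠ 0 := norm_ne_zero_iff.2 (h.ne_zero hyU)
  have h1 : L y = ‖y‖ • k y := by
    rw [hL y hy, smul_smul, mul_inv_cancel₀ hy0, one_smul]
  rw [hr y hyU, ← L.inner_map_map, L.apply_symm_apply, h1, real_inner_smul_right]
  congr 1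
  simp [k, PiLp.inner_apply]

/-- The local vectors from `exists_inner_eq_cos_dist_aux` are determined by the function, hence
constant on a connected set. The vector `a` is the developed position of the cone point, whether or
not it lies in `U`. -/
lemma exists_inner_eq_cos_dist {V : Finset S} (hd : IsSphericalConeMetric V) {v : S} (hv : v ∈ V) :
    ∃ ε > 0, ε < Real.pi ∧ ∀ U : Set E3, IsOpen U → IsPreconnected U → ∀ ψ : E3 → S, LocIso ψ U →
      (∀ y ∈ U, dist (ψ y) v < ε) → (∀ y ∈ U, ψ y ∉ V) →
      ∃ a : E3, ‖a‖ = 1 ∧ ∀ y ∈ U, ⟪a, y⟫ = ‖y‖ * Real.cos (dist (ψ y) v) := by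
  obtain ⟨ω, hω, ε, hε, hεπ, f, hf0, hf, hfs⟩ := hd.cone v hv
  refine ⟨ε, hε, by linarith [Real.pi_pos], fun U hUo hU ψ h hψ hV => ?_⟩
  have hloc : ∀ x ∈ U, ∃ a : E3, ‖a‖ = 1 ∧
      ∀ᶠ y in 𝓝 x, ⟪a, y⟫ = ‖y‖ * Real.cos (dist (ψ y) v) := fun x hx =>
    exists_inner_eq_cos_dist_aux hω hεπ hf0 hf hfs hUo h hψ hx fun h => hV x hx (h ▸ hv)
  rcases U.eq_empty_or_nonempty with rfl | ⟨x₀, hx₀⟩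
  · exact ⟨EuclideanSpace.single 0 1, by simp, by simp⟩
  obtain ⟨a, ha, haev⟩ := hloc x₀ hx₀
  refine ⟨a, ha, forall_of_isPreconnected hU hx₀ haev fun x hx hW => ?_⟩
  obtain ⟨b, hb, hbev⟩ := hloc x hx
  obtain ⟨z, hz1, hz2⟩ := hW _ (eventually_eventually_nhds.2 hbev)
  have : a = b := inner_eq_of_eventually (x := z) (by
    filter_upwards [hz1, hz2] with y h1 h2
    rw [h1, h2])
  rwa [this]

/-! ### Cones over convex spherical polygons -/

/-- The convex cone spanned by `W`. -/
def cone (W : Finset E3) : Set E3 :=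
  {x | ∃ a : E3 → ℝ, (∀ w ∈ W, 0 ≤ a w) ∧ x = ∑ w ∈ W, a w • w}

/-- The combinations of `W` with positive coefficients. -/
def openCone (W : Finset E3) : Set E3 :=
  {x | ∃ a : E3 → ℝ, (∀ w ∈ W, 0 < a w) ∧ x = ∑ w ∈ W, a w • w}

/-- The combinations of `p` and `q` with positive coefficients. -/
def arcCone (p q : E3) : Set E3 := {x | ∃ a b : ℝ, 0 < a ∧ 0 < b ∧ x = a • p + b • q}

lemma mem_polygon {W : Finset E3} {x : E3} : x ∈ polygon W ↔ ‖x‖ = 1 ∧ x ∈ cone W := Iff.rfl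

lemma mem_openPolygon {W : Finset E3} {x : E3} :
    x ∈ openPolygon W ↔ ‖x‖ = 1 ∧ x ∈ openCone W := Iff.rfl

lemma mem_openArc {p q x : E3} : x ∈ openArc p q ↔ ‖x‖ = 1 ∧ x ∈ arcCone p q := Iff.rfl

lemma openCone_subset_cone (W : Finset E3) : openCone W ⊆ cone W := by
  rintro x ⟨a, ha, rfl⟩
  exact ⟨a, fun w hw => (ha w hw).le, rfl⟩

lemma smul_mem_cone {W : Finset E3} {x : E3} (hx : x ∈ cone W) {r : ℝ} (hr : 0 ≤ r) :
    r • x ∈ cone W := by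
  obtain ⟨a, ha, rfl⟩ := hx
  exact ⟨fun w => r * a w, fun w hw => mul_nonneg hr (ha w hw), by
    simp only [Finset.smul_sum, smul_smul]⟩

lemma add_mem_cone {W : Finset E3} {x y : E3} (hx : x ∈ cone W) (hy : y ∈ cone W) :
    x + y ∈ cone W := by
  obtain ⟨a, ha, rfl⟩ := hx
  obtain ⟨b, hb, rfl⟩ := hy
  exact ⟨fun w => a w + b w, fun w hw => add_nonneg (ha w hw) (hb w hw), by
    simp only [add_smul, Finset.sum_add_distrib]⟩

lemma mem_cone_of_mem {W : Finset E3} {w : E3} (hw : w ∈ W) : w ∈ cone W := by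
  classical
  exact ⟨fun x => if x = w then 1 else 0, fun x _ => by dsimp only; split_ifs <;> norm_num, by simp [hw]⟩

lemma smul_mem_openCone {W : Finset E3} {x : E3} (hx : x ∈ openCone W) {r : ℝ} (hr : 0 < r) :
    r • x ∈ openCone W := by
  obtain ⟨a, ha, rfl⟩ := hx
  exact ⟨fun w => r * a w, fun w hw => mul_pos hr (ha w hw), by
    simp only [Finset.smul_sum, smul_smul]⟩

lemma add_mem_openCone {W : Finset E3} {x y : E3} (hx : x ∈ openCone W) (hy : y ∈ cone W) :
    x + y ∈ openCone W := by
  obtain ⟨a, ha, rfl⟩ := hx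
  obtain ⟨b, hb, rfl⟩ := hy
  exact ⟨fun w => a w + b w, fun w hw => add_pos_of_pos_of_nonneg (ha w hw) (hb w hw), by
    simp only [add_smul, Finset.sum_add_distrib]⟩

lemma openCone_nonempty (W : Finset E3) : (openCone W).Nonempty :=
  ⟨_, fun _ => 1, fun _ _ => one_pos, rfl⟩

lemma convex_cone (W : Finset E3) : Convex ℝ (cone W) := fun _ hx _ hy _ _ ha hb _ =>
  add_mem_cone (smul_mem_cone hx ha) (smul_mem_cone hy hb)

lemma convex_openCone (W : Finset E3) : Convex ℝ (openCone W) := by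
  intro x hx y hy a b ha hb hab
  rcases ha.eq_or_lt with rfl | ha'
  · rw [zero_add] at hab
    simpa [hab] using hy
  · exact add_mem_openCone (smul_mem_openCone hx ha')
      (smul_mem_cone (openCone_subset_cone W hy) hb)

lemma convex_arcCone (p q : E3) : Convex ℝ (arcCone p q) := by
  rintro _ ⟨a, b, ha, hb, rfl⟩ _ ⟨a', b', ha', hb', rfl⟩ s t hs ht hst
  refine ⟨s * a + t * a', s * b + t * b', ?_, ?_, by module⟩
  · rcases hs.eq_or_lt with rfl | hs'
    · rw [zero_add] at hst; simpa [hst]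
    · positivity
  · rcases hs.eq_or_lt with rfl | hs'
    · rw [zero_add] at hst; simpa [hst]
    · positivity

lemma smul_mem_arcCone {p q x : E3} (hx : x ∈ arcCone p q) {r : ℝ} (hr : 0 < r) :
    r • x ∈ arcCone p q := by
  obtain ⟨a, b, ha, hb, rfl⟩ := hx
  exact ⟨r * a, r * b, by positivity, by positivity, by module⟩

lemma arcCone_comm (p q : E3) : arcCone p q = arcCone q p := by
  ext x
  constructor <;> rintro ⟨a, b, ha, hb, rfl⟩ <;> exact ⟨b, a, hb, ha, add_comm _ _⟩

lemma arcCone_subset_cone {W : Finset E3} {p q : E3} (hp : p ∈ W) (hq : q ∈ W) :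
    arcCone p q ⊆ cone W := by
  rintro x ⟨a, b, ha, hb, rfl⟩
  exact add_mem_cone (smul_mem_cone (mem_cone_of_mem hp) ha.le)
    (smul_mem_cone (mem_cone_of_mem hq) hb.le)

lemma cone_subset_closure_openCone (W : Finset E3) : cone W ⊆ closure (openCone W) := by
  intro x hx
  obtain ⟨k, hk⟩ := openCone_nonempty W
  have h1 : Tendsto (fun t : ℝ => t • k + x) (𝓝[>] 0) (𝓝 ((0 : ℝ) • k + x)) :=
    (Continuous.tendsto (by fun_prop) _).mono_left nhdsWithin_le_nhds
  rw [zero_smul, zero_add] at h1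
  refine mem_closure_of_tendsto h1 ?_
  filter_upwards [self_mem_nhdsWithin] with t ht
  exact add_mem_openCone (smul_mem_openCone hk ht) hx

/-- On a region `⟪u, y⟫ < R` the coefficients are bounded, since every generator has positive
product with `u`. There the cone is contained in the image of a compact box, itself part of the
cone. -/
lemma isClosed_cone {W : Finset E3} {u : E3} (hu : ∀ w ∈ W, 0 < ⟪u, w⟫) : IsClosed (cone W) := by
  let F : (W → ℝ) → E3 := fun a => ∑ w : W, a w • (w : E3)
  have hF : Continuous F := by fun_prop
  have hbox : ∀ R : ℝ, IsClosed (F '' (Set.pi univ fun w : W => Icc 0 (R / ⟪u, (w : E3)⟫))) :=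
    fun R => ((isCompact_univ_pi fun w => isCompact_Icc).image hF).isClosed
  refine isClosed_of_closure_subset fun x hx => ?_
  set R := ⟪u, x⟫ + 1 with hR
  have hsub : cone W ∩ {y | ⟪u, y⟫ < R} ⊆
      F '' (Set.pi univ fun w : W => Icc 0 (R / ⟪u, (w : E3)⟫)) := by
    rintro y ⟨⟨a, ha, rfl⟩, hy⟩
    refine ⟨fun w => a w, fun w _ => ⟨ha w w.2, ?_⟩, ?_⟩
    · rw [le_div_iff₀ (hu w w.2)]
      have hy' : ⟪u, ∑ w ∈ W, a w • w⟫ < R := hy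
      rw [inner_sum] at hy'
      simp only [real_inner_smul_right] at hy'
      exact (Finset.single_le_sum (f := fun w => a w * ⟪u, w⟫)
        (fun i hi => mul_nonneg (ha i hi) (hu i hi).le) w.2).trans hy'.le
    · exact Finset.sum_coe_sort W (fun w => a w • w)
  have hopen : IsOpen {y : E3 | ⟪u, y⟫ < R} := isOpen_lt (by fun_prop) (by fun_prop)
  have hxR : x ∈ {y : E3 | ⟪u, y⟫ < R} := by
    change ⟪u, x⟫ < ⟪u, x⟫ + 1
    linarith
  have h1 : x ∈ closure (cone W ∩ {y : E3 | ⟪u, y⟫ < R}) := by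
    rw [mem_closure_iff_nhds] at hx ⊢
    intro N hN
    obtain ⟨z, hz⟩ := hx _ (inter_mem hN (hopen.mem_nhds hxR))
    exact ⟨z, hz.1.1, hz.2, hz.1.2⟩
  obtain ⟨a, ha, rfl⟩ := closure_minimal hsub (hbox R) h1
  classical
  refine ⟨fun w => if h : w ∈ W then a ⟨w, h⟩ else 0, fun w hw => ?_, ?_⟩
  · simpa [hw] using (ha ⟨w, hw⟩ (mem_univ _)).1
  · rw [← Finset.sum_coe_sort W]
    simp [F]

lemma mem_openCone_of_mem_nhds {W : Finset E3} {x : E3} (hx : cone W ∈ 𝓝 x) : x ∈ openCone W := by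
  obtain ⟨k, hk⟩ := openCone_nonempty W
  have h1 : Tendsto (fun t : ℝ => x - t • k) (𝓝[>] 0) (𝓝 (x - (0 : ℝ) • k)) :=
    (Continuous.tendsto (by fun_prop) _).mono_left nhdsWithin_le_nhds
  rw [zero_smul, sub_zero] at h1
  obtain ⟨t, ht1, ht2⟩ := ((h1.eventually_mem hx).and self_mem_nhdsWithin).exists
  have h2 := add_mem_openCone (smul_mem_openCone hk ht2) ht1
  rwa [add_sub_cancel] at h2

namespace IsConvexPolygon

variable {W : Finset E3}

lemma ne_smul_add_smul (hW : IsConvexPolygon W) {w x y : E3} (hw : w ∈ W) (hx : x ∈ W)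
    (hy : y ∈ W) (hxw : x ≠ w) (hyw : y ≠ w) {a b : ℝ} (ha : 0 ≤ a) (hb : 0 ≤ b) :
    w ≠ a • x + b • y := by
  classical
  intro h
  refine hW.convex_position w hw
    ⟨fun z => (if z = x then a else 0) + (if z = y then b else 0), ?_, ?_, ?_⟩
  · intro z _
    dsimp only
    split_ifs <;> positivity
  · simp [hxw.symm, hyw.symm]
  · simp only [add_smul, Finset.sum_add_distrib, ite_smul, zero_smul, Finset.sum_ite_eq', hx, hy,
      if_true]
    exact h

/-- According to the signs of `β` and `γ`, either one of the three vertices becomes a nonnegative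
combination of the other two, against convex position, or all signs agree, against the open
hemisphere. Hence any three vertices form a basis, as used in `exists_coords`. -/
lemma not_pos_of_relation (hW : IsConvexPolygon W) {p q r : E3} (hp : p ∈ W) (hq : q ∈ W)
    (hr : r ∈ W) (hpq : p ≠ q) (hpr : p ≠ r) (hqr : q ≠ r) {α β γ : ℝ}
    (h : α • p + β • q + γ • r = 0) : ¬ 0 < α := by
  intro hα
  obtain ⟨u, hu⟩ := hW.hemisphere
  have h0 : α * ⟪u, p⟫ + β * ⟪u, q⟫ + γ * ⟪u, r⟫ = 0 := by
    have := congrArg (fun x => ⟪u, x⟫) h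
    simpa [inner_add_right, real_inner_smul_right] using this
  have hp' := mul_pos hα (hu p hp)
  rcases le_or_gt β 0 with hβ | hβ
  · rcases le_or_gt γ 0 with hγ | hγ
    · refine hW.ne_smul_add_smul hp hq hr hpq.symm hpr.symm (a := -β / α) (b := -γ / α)
        (div_nonneg (by linarith) hα.le) (div_nonneg (by linarith) hα.le) ?_
      have h1 : α • p = (-β) • q + (-γ) • r := by
        rw [← sub_eq_zero, ← h]; module
      rw [div_eq_inv_mul, div_eq_inv_mul, mul_smul, mul_smul, ← smul_add, ← h1, smul_smul,
        inv_mul_cancel₀ hα.ne', one_smul]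
    · rcases hβ.eq_or_lt with rfl | hβ'
      · have := mul_pos hγ (hu r hr)
        linarith
      · refine hW.ne_smul_add_smul hq hp hr hpq hqr.symm (a := α / -β) (b := γ / -β)
          (div_nonneg hα.le (by linarith)) (div_nonneg hγ.le (by linarith)) ?_
        have h1 : (-β) • q = α • p + γ • r := by
          rw [← sub_eq_zero, ← neg_eq_zero, ← h]; module
        rw [div_eq_inv_mul, div_eq_inv_mul, mul_smul, mul_smul, ← smul_add, ← h1, smul_smul,
          inv_mul_cancel₀ (by linarith), one_smul]
  · have hq' := mul_pos hβ (hu q hq)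
    rcases le_or_gt 0 γ with hγ | hγ
    · have := mul_nonneg hγ (hu r hr).le
      linarith
    · refine hW.ne_smul_add_smul hr hp hq hpr hqr (a := α / -γ) (b := β / -γ)
        (div_nonneg hα.le (by linarith)) (div_nonneg hβ.le (by linarith)) ?_
      have h1 : (-γ) • r = α • p + β • q := by
        rw [← sub_eq_zero, ← neg_eq_zero, ← h]; module
      rw [div_eq_inv_mul, div_eq_inv_mul, mul_smul, mul_smul, ← smul_add, ← h1, smul_smul,
        inv_mul_cancel₀ (by linarith), one_smul]

lemma eq_zero_of_relation (hW : IsConvexPolygon W) {p q r : E3} (hp : p ∈ W) (hq : q ∈ W)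
    (hr : r ∈ W) (hpq : p ≠ q) (hpr : p ≠ r) (hqr : q ≠ r) {α β γ : ℝ}
    (h : α • p + β • q + γ • r = 0) : α = 0 := by
  have h1 := hW.not_pos_of_relation hp hq hr hpq hpr hqr h
  have h2 := hW.not_pos_of_relation hp hq hr hpq hpr hqr (α := -α) (β := -β) (γ := -γ)
    (by rw [← neg_eq_zero, ← h]; module)
  linarith

lemma exists_coords (hW : IsConvexPolygon W) {p q r : E3} (hp : p ∈ W) (hq : q ∈ W)
    (hr : r ∈ W) (hpq : p ≠ q) (hpr : p ≠ r) (hqr : q ≠ r) :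
    ∃ f g h : E3 → ℝ, Continuous f ∧ Continuous g ∧ Continuous h ∧
      (∀ y, y = f y • p + g y • q + h y • r) ∧
      ∀ a b c : ℝ, f (a • p + b • q + c • r) = a ∧ g (a • p + b • q + c • r) = b ∧
        h (a • p + b • q + c • r) = c := by
  have hli : LinearIndependent ℝ ![p, q, r] := by
    rw [Fintype.linearIndependent_iff]
    intro g hg
    simp only [Fin.sum_univ_three, Matrix.cons_val_zero, Matrix.cons_val_one,
      Matrix.cons_val] at hg
    have h0 := hW.eq_zero_of_relation hp hq hr hpq hpr hqr hg
    have h1 := hW.eq_zero_of_relation hq hp hr hpq.symm hqr hpr (α := g 1) (β := g 0) (γ := g 2)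
      (by rw [← hg]; module)
    have h2 := hW.eq_zero_of_relation hr hp hq hpr.symm hqr.symm hpq (α := g 2) (β := g 0)
      (γ := g 1) (by rw [← hg]; module)
    intro i
    fin_cases i
    exacts [h0, h1, h2]
  let b := basisOfLinearIndependentOfCardEqFinrank hli (by simp)
  have hb : ⇑b = ![p, q, r] := coe_basisOfLinearIndependentOfCardEqFinrank hli (by simp)
  have hsum : ∀ y, y = b.coord 0 y • p + b.coord 1 y • q + b.coord 2 y • r := by
    intro y
    have := b.sum_repr y
    simp only [Fin.sum_univ_three, hb] at this
    exact this.symm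
  refine ⟨b.coord 0, b.coord 1, b.coord 2, LinearMap.continuous_of_finiteDimensional _,
    LinearMap.continuous_of_finiteDimensional _, LinearMap.continuous_of_finiteDimensional _,
    hsum, fun α β γ => ?_⟩
  have hp' : p = b 0 := by rw [hb]; rfl
  have hq' : q = b 1 := by rw [hb]; rfl
  have hr' : r = b 2 := by rw [hb]; rfl
  rw [hp', hq', hr']
  simp

lemma exists_three (hW : IsConvexPolygon W) :
    ∃ p ∈ W, ∃ q ∈ W, ∃ r ∈ W, p ≠ q ∧ p ≠ r ∧ q ≠ r := by
  obtain ⟨p, q, r, hp, hq, hr, h⟩ := Finset.two_lt_card_iff.1 hW.three_le_card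
  exact ⟨p, hp, q, hq, r, hr, h⟩

lemma exists_third (hW : IsConvexPolygon W) (p q : E3) : ∃ r ∈ W, r ≠ p ∧ r ≠ q := by
  classical
  have h1 : ¬ W ⊆ {p, q} := fun h => by
    have := (Finset.card_le_card h).trans Finset.card_le_two
    have := hW.three_le_card
    omega
  obtain ⟨r, hr, hr'⟩ := Finset.not_subset.1 h1
  exact ⟨r, hr, by simpa using hr'⟩

/-- A small displacement is absorbed by the coefficients of three linearly independent vertices, all
coefficients being larger than some `t > 0`. -/
lemma isOpen_openCone (hW : IsConvexPolygon W) : IsOpen (openCone W) := by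
  rw [isOpen_iff_mem_nhds]
  rintro x ⟨a, ha, hx⟩
  obtain ⟨p, hp, q, hq, r, hr, hpq, hpr, hqr⟩ := hW.exists_three
  obtain ⟨f, g, h, hf, hg, hh, hsum, hval⟩ := hW.exists_coords hp hq hr hpq hpr hqr
  have h0 : f 0 = 0 ∧ g 0 = 0 ∧ h 0 = 0 := by simpa using hval 0 0 0
  obtain ⟨k, hk⟩ := openCone_nonempty W
  obtain ⟨t, ht, hx'⟩ : ∃ t > 0, ∀ w ∈ W, t < a w := by
    have hne : W.Nonempty := ⟨p, hp⟩
    obtain ⟨w₀, hw₀, hmin⟩ := W.exists_min_image a hne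
    exact ⟨a w₀ / 2, half_pos (ha w₀ hw₀), fun w hw => by linarith [hmin w hw, ha w₀ hw₀]⟩
  have hev : ∀ᶠ y in 𝓝 x, -t < f (y - x) ∧ -t < g (y - x) ∧ -t < h (y - x) := by
    have hc : ∀ F : E3 → ℝ, Continuous F → F 0 = 0 → ∀ᶠ y in 𝓝 x, -t < F (y - x) := by
      intro F hF h0
      refine ContinuousAt.eventually_lt (by fun_prop) (by fun_prop) ?_
      rw [sub_self, h0]; linarith
    exact (hc f hf h0.1).and ((hc g hg h0.2.1).and (hc h hh h0.2.2))
  classical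
  filter_upwards [hev] with y ⟨h1, h2, h3⟩
  refine ⟨fun w => a w + ((if w = p then f (y - x) else 0) + (if w = q then g (y - x) else 0) +
    (if w = r then h (y - x) else 0)), fun w hw => ?_, ?_⟩
  · have := hx' w hw
    dsimp only
    by_cases hwp : w = p
    · rw [if_pos hwp, if_neg (hwp ▸ hpq), if_neg (hwp ▸ hpr)]; linarith
    · by_cases hwq : w = q
      · rw [if_neg hwp, if_pos hwq, if_neg (hwq ▸ hqr)]; linarith
      · by_cases hwr : w = r
        · rw [if_neg hwp, if_neg hwq, if_pos hwr]; linarith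
        · rw [if_neg hwp, if_neg hwq, if_neg hwr]; linarith
  · simp only [add_smul, Finset.sum_add_distrib, ite_smul, zero_smul, Finset.sum_ite_eq', hp, hq,
      hr, if_true]
    rw [← hx, ← hsum]
    abel

lemma zero_notMem_openCone (hW : IsConvexPolygon W) : (0 : E3) ∉ openCone W := by
  rintro ⟨a, ha, h⟩
  obtain ⟨u, hu⟩ := hW.hemisphere
  obtain ⟨p, hp, -⟩ := hW.exists_three
  have h1 : ⟪u, (0 : E3)⟫ = ∑ w ∈ W, a w * ⟪u, w⟫ := by
    rw [h, inner_sum]; simp [real_inner_smul_right]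
  have h2 : 0 < ∑ w ∈ W, a w * ⟪u, w⟫ :=
    Finset.sum_pos (fun w hw => mul_pos (ha w hw) (hu w hw)) ⟨p, hp⟩
  simp at h1
  linarith

lemma isClosed_cone (hW : IsConvexPolygon W) : IsClosed (cone W) := by
  obtain ⟨u, hu⟩ := hW.hemisphere
  exact SphCone.isClosed_cone hu

lemma closure_openCone (hW : IsConvexPolygon W) : closure (openCone W) = cone W :=
  (closure_minimal (openCone_subset_cone W) hW.isClosed_cone).antisymm
    (cone_subset_closure_openCone W)

/-- A supporting plane at `x` contains every vertex with a nonzero coefficient in `x`. It contains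
at most two vertices, since three would span the space and make the functional zero. -/
lemma side_or_vertex (hW : IsConvexPolygon W) {x : E3} (hx : x ∈ cone W) (hxo : x ∉ openCone W)
    (hx0 : x ≠ 0) :
    (∃ w ∈ W, ∃ r : ℝ, 0 < r ∧ x = r • w) ∨ ∃ p q m, IsSide W p q m ∧ x ∈ arcCone p q := by
  obtain ⟨f, hf⟩ := geometric_hahn_banach_point_open (convex_openCone W) hW.isOpen_openCone hxo
  obtain ⟨m, hm⟩ : ∃ m : E3, ∀ y, ⟪m, y⟫ = f y :=
    ⟨(InnerProductSpace.toDual ℝ E3).symm f, fun y => by simp⟩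
  obtain ⟨k, hk⟩ := openCone_nonempty W
  have hr : ∀ y ∈ openCone W, ∀ r : ℝ, 0 < r → f x < r * f y := fun y hy r hr => by
    simpa using hf _ (smul_mem_openCone hy hr)
  have hpos : ∀ y ∈ openCone W, 0 ≤ f y := by
    intro y hy
    by_contra! hlt
    have h1 := hr y hy ((|f x| + 1) / -f y) (div_pos (by positivity) (by linarith))
    have h2 : (|f x| + 1) / -f y * f y = -(|f x| + 1) := by
      rw [div_neg, neg_mul, div_mul_cancel₀ _ hlt.ne]
    rw [h2] at h1
    linarith [neg_abs_le (f x)]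
  have hx_nonpos : f x ≤ 0 := by
    refine le_of_forall_pos_le_add fun ε hε => ?_
    have h1 := hr k hk (ε / (f k + 1)) (div_pos hε (by linarith [hpos k hk]))
    have h2 : ε / (f k + 1) * f k ≤ ε := by
      rw [div_mul_eq_mul_div, div_le_iff₀ (by linarith [hpos k hk])]
      nlinarith
    linarith
  have hposc : ∀ y ∈ cone W, 0 ≤ f y := by
    intro y hy
    have := cone_subset_closure_openCone W hy
    exact closure_minimal (t := {z | 0 ≤ f z}) hpos
      (isClosed_le continuous_const f.continuous) this
  have hfx : f x = 0 := le_antisymm hx_nonpos (hposc x hx)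
  have hfk : 0 < f k := by have := hf k hk; linarith
  obtain ⟨a, ha, hxa⟩ := hx
  have hzero : ∀ w ∈ W, a w * f w = 0 := by
    have h1 : ∑ w ∈ W, a w * f w = 0 := by
      rw [← hfx, hxa, map_sum]; simp
    exact (Finset.sum_eq_zero_iff_of_nonneg fun w hw =>
      mul_nonneg (ha w hw) (hposc w (mem_cone_of_mem hw))).1 h1
  have hex : ∃ p ∈ W, a p ≠ 0 := by
    by_contra! hall
    exact hx0 (by rw [hxa]; exact Finset.sum_eq_zero fun w hw => by rw [hall w hw, zero_smul])
  obtain ⟨p, hp, hap⟩ := hex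
  have hfp : f p = 0 := (mul_eq_zero.1 (hzero p hp)).resolve_left hap
  have hap' : 0 < a p := (ha p hp).lt_of_ne' hap
  by_cases hq : ∃ q ∈ W, q ≠ p ∧ a q ≠ 0
  · right
    obtain ⟨q, hq, hqp, haq⟩ := hq
    have hfq : f q = 0 := (mul_eq_zero.1 (hzero q hq)).resolve_left haq
    have hthird : ∀ w ∈ W, w ≠ p → w ≠ q → 0 < f w := by
      intro w hw hwp hwq
      refine (hposc w (mem_cone_of_mem hw)).lt_of_ne' fun hfw => ?_
      obtain ⟨F, G, H, -, -, -, hsum, -⟩ := hW.exists_coords hp hq hw hqp.symm hwp.symm hwq.symm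
      have := congrArg f (hsum k)
      simp [hfp, hfq, hfw] at this
      linarith
    refine ⟨p, q, m, ⟨hp, hq, hqp.symm, by rw [hm, hfp], by rw [hm, hfq], fun w hw h1 h2 => by
      rw [hm]; exact hthird w hw h1 h2⟩, a p, a q, hap', (ha q hq).lt_of_ne' haq, ?_⟩
    rw [hxa, ← Finset.add_sum_erase W _ hp,
      ← Finset.add_sum_erase (W.erase p) _ (Finset.mem_erase.2 ⟨hqp, hq⟩), Finset.sum_eq_zero,
      add_zero]
    intro w hw
    simp only [Finset.mem_erase] at hw
    rw [(mul_eq_zero.1 (hzero w hw.2.2)).resolve_right (hthird w hw.2.2 hw.2.1 hw.1).ne',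
      zero_smul]
  · left
    push Not at hq
    refine ⟨p, hp, a p, hap', ?_⟩
    rw [hxa]
    exact Finset.sum_eq_single_of_mem p hp fun w hw hwp => by rw [hq w hw hwp, zero_smul]

lemma inner_nonneg_of_side {p q m : E3} (hs : IsSide W p q m) {y : E3}
    (hy : y ∈ cone W) : 0 ≤ ⟪m, y⟫ := by
  obtain ⟨a, ha, rfl⟩ := hy
  obtain ⟨-, -, -, h1, h2, h3⟩ := hs
  rw [inner_sum]
  refine Finset.sum_nonneg fun w hw => ?_
  rw [real_inner_smul_right]
  refine mul_nonneg (ha w hw) ?_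
  by_cases hwp : w = p
  · rw [hwp, h1]
  by_cases hwq : w = q
  · rw [hwq, h2]
  exact (h3 w hw hwp hwq).le

lemma inner_pos_of_side (hW : IsConvexPolygon W) {p q m : E3} (hs : IsSide W p q m) {y : E3}
    (hy : y ∈ openCone W) : 0 < ⟪m, y⟫ := by
  obtain ⟨r, hr, hrp, hrq⟩ := hW.exists_third p q
  obtain ⟨a, ha, rfl⟩ := hy
  obtain ⟨-, -, -, h1, h2, h3⟩ := hs
  rw [inner_sum]
  refine Finset.sum_pos' (fun w hw => ?_) ⟨r, hr, ?_⟩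
  · rw [real_inner_smul_right]
    refine mul_nonneg (ha w hw).le ?_
    by_cases hwp : w = p
    · rw [hwp, h1]
    by_cases hwq : w = q
    · rw [hwq, h2]
    exact (h3 w hw hwp hwq).le
  · rw [real_inner_smul_right]
    exact mul_pos (ha r hr) (h3 r hr hrp hrq)

/-- In the coordinates of `p`, `q` and a third vertex, the first two stay positive near `x`, and the
third has the sign of `⟪m, y⟫`. -/
lemma eventually_mem_of_side (hW : IsConvexPolygon W) {p q m : E3} (hs : IsSide W p q m) {x : E3}
    (hx : x ∈ arcCone p q) :
    ∀ᶠ y in 𝓝 x, (0 ≤ ⟪m, y⟫ → y ∈ cone W) ∧ (0 < ⟪m, y⟫ → y ∈ openCone W) := by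
  obtain ⟨r, hr, hrp, hrq⟩ := hW.exists_third p q
  obtain ⟨hp, hq, hpq, h1, h2, h3⟩ := hs
  obtain ⟨f, g, h, hf, hg, hh, hsum, hval⟩ := hW.exists_coords hp hq hr hpq hrp.symm hrq.symm
  obtain ⟨a, b, ha, hb, hx⟩ := hx
  obtain ⟨hfx, hgx, -⟩ : f x = a ∧ g x = b ∧ h x = 0 := by
    have := hval a b 0
    rwa [zero_smul, add_zero, ← hx] at this
  have hm : ∀ y, ⟪m, y⟫ = h y * ⟪m, r⟫ := by
    intro y
    conv_lhs => rw [hsum y]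
    simp [inner_add_right, real_inner_smul_right, h1, h2]
  have hmr := h3 r hr hrp hrq
  have hmem : ∀ y, 0 < f y → 0 < g y → 0 ≤ h y → y ∈ cone W := by
    intro y h1 h2 h3
    rw [hsum y]
    exact add_mem_cone (arcCone_subset_cone hp hq ⟨_, _, h1, h2, rfl⟩)
      (smul_mem_cone (mem_cone_of_mem hr) h3)
  have hfe : ∀ᶠ y in 𝓝 x, 0 < f y ∧ 0 < g y :=
    (ContinuousAt.eventually_lt (by fun_prop) (by fun_prop) (by rw [hfx]; exact ha)).and
      (ContinuousAt.eventually_lt (by fun_prop) (by fun_prop) (by rw [hgx]; exact hb))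
  filter_upwards [eventually_eventually_nhds.2 hfe] with y hy
  obtain ⟨hy1, hy2⟩ := hy.self_of_nhds
  refine ⟨fun hmy => hmem y hy1 hy2 ?_, fun hmy => mem_openCone_of_mem_nhds ?_⟩
  · rw [hm] at hmy
    exact nonneg_of_mul_nonneg_left hmy hmr
  · rw [hm] at hmy
    have hhy : 0 < h y := (mul_pos_iff_of_pos_right hmr).1 hmy
    filter_upwards [hy, ContinuousAt.eventually_lt (f := fun _ => (0 : ℝ)) (by fun_prop)
      (hh.continuousAt) hhy] with z hz1 hz2
    exact hmem z hz1.1 hz1.2 hz2.le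

/-- A segment from an interior point to `z` leaves the cone at a boundary point; if this is not on a
ray through a vertex, it lies on a side that separates `z` from the interior. -/
lemma exists_side_inner_neg (hW : IsConvexPolygon W) {z : E3} (hz : z ∉ cone W) :
    ∃ p q m, IsSide W p q m ∧ ⟪m, z⟫ < 0 := by
  -- A generic starting point avoids the finitely many planes through `z` and a vertex, so the
  -- segment does not leave the cone through a vertex.
  obtain ⟨k, hk, hkw⟩ : ∃ k ∈ openCone W, ∀ w ∈ W, k ∉ Submodule.span ℝ {w, z} := by
    have hdense : Dense (⋂ w ∈ (W : Set E3), ((Submodule.span ℝ {w, z} : Submodule ℝ E3) : Set E3)ᶜ) := by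
      refine dense_biInter_of_isOpen (fun w _ => ?_) W.countable_toSet fun w _ => ?_
      · exact (Submodule.closed_of_finiteDimensional _).isOpen_compl
      · rw [← interior_eq_empty_iff_dense_compl, ← not_nonempty_iff_eq_empty]
        intro hne
        have htop := Submodule.eq_top_of_nonempty_interior' _ hne
        have h1 : Module.finrank ℝ (Submodule.span ℝ ({w, z} : Set E3)) ≤ 2 := by
          classical
          have h2 := finrank_span_finset_le_card (R := ℝ) ({w, z} : Finset E3)
          rw [Finset.coe_pair] at h2
          exact h2.trans Finset.card_le_two
        rw [htop, finrank_top] at h1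
        simp at h1
    obtain ⟨k, hk1, hk2⟩ := hdense.inter_open_nonempty _ hW.isOpen_openCone (openCone_nonempty W)
    exact ⟨k, hk1, fun w hw => by simpa using (mem_iInter₂.1 hk2) w hw⟩
  let y : ℝ → E3 := fun t => (1 - t) • k + t • z
  have hy : Continuous y := by fun_prop
  have hcomp : IsCompact (Icc (0 : ℝ) 1 ∩ y ⁻¹' cone W) :=
    isCompact_Icc.inter_right (hW.isClosed_cone.preimage hy)
  obtain ⟨t, ⟨⟨ht0, ht1⟩, htW⟩, hmax⟩ := hcomp.exists_isMaxOn
    ⟨0, ⟨le_rfl, zero_le_one⟩, by simpa [y] using openCone_subset_cone W hk⟩ continuousOn_id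
  have hW0 : ∃ p, p ∈ W := ⟨_, hW.exists_three.choose_spec.1⟩
  have ht1' : t < 1 := ht1.lt_of_ne (by rintro rfl; exact hz (by simpa [y] using htW))
  have hkspan : ∀ w ∈ W, ∀ r : ℝ, y t ≠ r • w := by
    intro w hw r h
    refine hkw w hw (Submodule.mem_span_pair.2 ⟨(1 - t)⁻¹ * r, -((1 - t)⁻¹ * t), ?_⟩)
    have h1 : (1 - t) • k = r • w - t • z := by rw [← h]; simp [y]
    have h2 : k = (1 - t)⁻¹ • ((1 - t) • k) := by
      rw [smul_smul, inv_mul_cancel₀ (by linarith), one_smul]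
    rw [h2, h1]
    module
  have hne0 : y t ≠ 0 := by
    obtain ⟨p, hp⟩ := hW0
    simpa using hkspan p hp 0
  have hno : y t ∉ openCone W := by
    intro h
    have hev : ∀ᶠ t' in 𝓝[>] t, y t' ∈ openCone W ∧ t' ∈ Ioc t 1 :=
      (((hy.tendsto t).mono_left nhdsWithin_le_nhds).eventually
        (hW.isOpen_openCone.mem_nhds h)).and (Ioc_mem_nhdsGT ht1')
    obtain ⟨t', h1, h2, h3⟩ := hev.exists
    have := hmax (a := t') ⟨⟨ht0.trans h2.le, h3⟩, openCone_subset_cone W h1⟩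
    simp only [id] at this
    exact absurd h2 (not_lt.2 this)
  rcases hW.side_or_vertex htW hno hne0 with ⟨w, hw, r, -, h⟩ | ⟨p, q, m, hs, a, b, -, -, h⟩
  · exact absurd h (hkspan w hw r)
  · refine ⟨p, q, m, hs, ?_⟩
    have h1 : (1 - t) * ⟪m, k⟫ + t * ⟪m, z⟫ = 0 := by
      have h2 : ⟪m, y t⟫ = 0 := by
        rw [h, inner_add_right, real_inner_smul_right, real_inner_smul_right, hs.2.2.2.1,
          hs.2.2.2.2.1]
        simp
      rw [← h2]
      simp [y, inner_add_right, real_inner_smul_right]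
    have h2 := mul_pos (sub_pos.2 ht1') (hW.inner_pos_of_side hs hk)
    by_contra! h3
    have := mul_nonneg ht0 h3
    linarith

lemma exists_side (hW : IsConvexPolygon W) : ∃ p q m, IsSide W p q m := by
  obtain ⟨u, hu⟩ := hW.hemisphere
  obtain ⟨p, hp, -⟩ := hW.exists_three
  have : -p ∉ cone W := by
    rintro ⟨a, ha, h⟩
    have h1 : -⟪u, p⟫ = ∑ w ∈ W, a w * ⟪u, w⟫ := by
      rw [← inner_neg_right, h, inner_sum]; simp [real_inner_smul_right]
    have h2 : 0 ≤ ∑ w ∈ W, a w * ⟪u, w⟫ :=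
      Finset.sum_nonneg fun w hw => mul_nonneg (ha w hw) (hu w hw).le
    linarith [hu p hp]
  obtain ⟨p, q, m, h, -⟩ := hW.exists_side_inner_neg this
  exact ⟨p, q, m, h⟩

/-- Each vertex spans an extreme ray. Expanding `w` in `W'` and then back in `W` gives coefficients
`c`: convex position forces `1 ≤ c w`, and pairing with `u` makes the others vanish. Then some
element of `W'` is a multiple of `w`, equal to `w` by normalisation. -/
lemma subset_of_cone_eq (hW : IsConvexPolygon W) {W' : Finset E3}
    (hn : ∀ w ∈ W', ‖w‖ = 1) (h : cone W = cone W') : W ⊆ W' := by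
  classical
  intro w hw
  obtain ⟨u, hu⟩ := hW.hemisphere
  obtain ⟨b, hb, hwb⟩ : w ∈ cone W' := h ▸ mem_cone_of_mem hw
  have hch : ∀ x, ∃ a : E3 → ℝ, x ∈ W' → (∀ y ∈ W, 0 ≤ a y) ∧ x = ∑ y ∈ W, a y • y := by
    intro x
    by_cases hx : x ∈ W'
    · obtain ⟨a, ha⟩ : x ∈ cone W := h ▸ mem_cone_of_mem hx
      exact ⟨a, fun _ => ha⟩
    · exact ⟨0, fun h => absurd h hx⟩
  choose A hA using hch
  set c : E3 → ℝ := fun y => ∑ x ∈ W', b x * A x y with hc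
  have hc0 : ∀ y ∈ W, 0 ≤ c y := fun y hy =>
    Finset.sum_nonneg fun x hx => mul_nonneg (hb x hx) ((hA x hx).1 y hy)
  have hwc : w = ∑ y ∈ W, c y • y := by
    calc w = ∑ x ∈ W', b x • x := hwb
      _ = ∑ x ∈ W', ∑ y ∈ W, (b x * A x y) • y := by
        refine Finset.sum_congr rfl fun x hx => ?_
        refine (congrArg (b x • ·) (hA x hx).2).trans ?_
        simp only [Finset.smul_sum]
        exact Finset.sum_congr rfl fun y _ => by rw [smul_smul]
      _ = _ := by
        rw [Finset.sum_comm]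
        exact Finset.sum_congr rfl fun y _ => by rw [hc, Finset.sum_smul]
  have hrest : w - c w • w = ∑ y ∈ W.erase w, c y • y := by
    rw [← Finset.add_sum_erase W _ hw] at hwc
    nth_rewrite 1 [hwc]
    abel
  have hcw : 1 ≤ c w := by
    by_contra! hlt
    refine hW.convex_position w hw
      ⟨fun y => if y = w then 0 else (1 - c w)⁻¹ * c y, fun y hy => ?_, by simp, ?_⟩
    · dsimp only
      split_ifs
      · exact le_rfl
      · exact mul_nonneg (inv_nonneg.2 (by linarith)) (hc0 y hy)
    · rw [← Finset.add_sum_erase W _ hw]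
      simp only [if_true, zero_smul, zero_add]
      have h1 : ∑ y ∈ W.erase w, (if y = w then 0 else (1 - c w)⁻¹ * c y) • y =
          (1 - c w)⁻¹ • ∑ y ∈ W.erase w, c y • y := by
        rw [Finset.smul_sum]
        refine Finset.sum_congr rfl fun y hy => ?_
        rw [if_neg (Finset.ne_of_mem_erase hy), smul_smul]
      rw [h1, ← hrest]
      have h2 : w - c w • w = (1 - c w) • w := by module
      rw [h2, smul_smul, inv_mul_cancel₀ (by linarith), one_smul]
  have hinner : (1 - c w) * ⟪u, w⟫ = ∑ y ∈ W.erase w, c y * ⟪u, y⟫ := by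
    have h1 := congrArg (fun x => ⟪u, x⟫) hrest
    simp only [inner_sub_right, real_inner_smul_right, inner_sum] at h1
    linarith
  have hnn : ∀ y ∈ W.erase w, 0 ≤ c y * ⟪u, y⟫ := fun y hy =>
    mul_nonneg (hc0 y (Finset.mem_of_mem_erase hy)) (hu y (Finset.mem_of_mem_erase hy)).le
  have hzero : ∀ y ∈ W.erase w, c y * ⟪u, y⟫ = 0 := by
    refine (Finset.sum_eq_zero_iff_of_nonneg hnn).1 (le_antisymm ?_ (Finset.sum_nonneg hnn))
    rw [← hinner]
    nlinarith [hu w hw]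
  have hcz : ∀ y ∈ W, y ≠ w → c y = 0 := fun y hy hyw =>
    (mul_eq_zero.1 (hzero y (Finset.mem_erase.2 ⟨hyw, hy⟩))).resolve_right (hu y hy).ne'
  have hbx : ∃ x ∈ W', b x ≠ 0 := by
    by_contra! hall
    have : c w = 0 := Finset.sum_eq_zero fun x hx => by rw [hall x hx, zero_mul]
    linarith
  obtain ⟨x, hx, hbx⟩ := hbx
  have hAx : ∀ y ∈ W, y ≠ w → A x y = 0 := by
    intro y hy hyw
    have h1 := (Finset.sum_eq_zero_iff_of_nonneg fun x hx =>
      mul_nonneg (hb x hx) ((hA x hx).1 y hy)).1 (hcz y hy hyw) x hx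
    exact (mul_eq_zero.1 h1).resolve_left hbx
  have hxw : x = A x w • w := by
    conv_lhs => rw [(hA x hx).2]
    exact Finset.sum_eq_single_of_mem w hw fun y hy hyw => by rw [hAx y hy hyw, zero_smul]
  have h1 := hn x hx
  rw [hxw, norm_smul, hW.norm_eq_one w hw, mul_one, Real.norm_of_nonneg ((hA x hx).1 w hw)] at h1
  rw [h1, one_smul] at hxw
  rwa [← hxw]

lemma eq_of_cone_eq (hW : IsConvexPolygon W) {W' : Finset E3} (hW' : IsConvexPolygon W')
    (h : cone W = cone W') : W = W' :=
  (hW.subset_of_cone_eq hW'.norm_eq_one h).antisymm (hW'.subset_of_cone_eq hW.norm_eq_one h.symm)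

end IsConvexPolygon

/-! ### Rotations of polygons and cells -/

/-- The image of a finite set of vectors under a linear isometry. -/
def rot (A : E3 ≃ₗᵢ[ℝ] E3) (W : Finset E3) : Finset E3 := W.map A.toLinearEquiv.toEquiv.toEmbedding

lemma mem_rot {A : E3 ≃ₗᵢ[ℝ] E3} {W : Finset E3} {x : E3} : x ∈ rot A W ↔ A.symm x ∈ W := by
  simp only [rot, Finset.mem_map]
  constructor
  · rintro ⟨w, hw, rfl⟩
    simpa using hw
  · exact fun h => ⟨_, h, by simp⟩

lemma sum_rot {A : E3 ≃ₗᵢ[ℝ] E3} {W : Finset E3} (a : E3 → ℝ) :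
    A.symm (∑ w ∈ rot A W, a w • w) = ∑ w ∈ W, a (A w) • w := by
  rw [rot, Finset.sum_map, map_sum]
  simp

lemma mem_cone_rot {A : E3 ≃ₗᵢ[ℝ] E3} {W : Finset E3} {x : E3} :
    x ∈ cone (rot A W) ↔ A.symm x ∈ cone W := by
  constructor
  · rintro ⟨a, ha, rfl⟩
    exact ⟨fun w => a (A w), fun w hw => ha _ (mem_rot.2 (by simpa using hw)), sum_rot a⟩
  · rintro ⟨a, ha, h⟩
    refine ⟨fun w => a (A.symm w), fun w hw => ha _ (mem_rot.1 hw), ?_⟩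
    apply A.symm.injective
    rw [h, sum_rot]
    simp

lemma mem_openCone_rot {A : E3 ≃ₗᵢ[ℝ] E3} {W : Finset E3} {x : E3} :
    x ∈ openCone (rot A W) ↔ A.symm x ∈ openCone W := by
  constructor
  · rintro ⟨a, ha, rfl⟩
    exact ⟨fun w => a (A w), fun w hw => ha _ (mem_rot.2 (by simpa using hw)), sum_rot a⟩
  · rintro ⟨a, ha, h⟩
    refine ⟨fun w => a (A.symm w), fun w hw => ha _ (mem_rot.1 hw), ?_⟩
    apply A.symm.injective
    rw [h, sum_rot]
    simp

lemma mem_polygon_rot {A : E3 ≃ₗᵢ[ℝ] E3} {W : Finset E3} {x : E3} :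
    x ∈ polygon (rot A W) ↔ A.symm x ∈ polygon W := by
  rw [mem_polygon, mem_polygon, mem_cone_rot, A.symm.norm_map]

lemma mem_openPolygon_rot {A : E3 ≃ₗᵢ[ℝ] E3} {W : Finset E3} {x : E3} :
    x ∈ openPolygon (rot A W) ↔ A.symm x ∈ openPolygon W := by
  rw [mem_openPolygon, mem_openPolygon, mem_openCone_rot, A.symm.norm_map]

lemma mem_arcCone_map {A : E3 ≃ₗᵢ[ℝ] E3} {p q x : E3} :
    x ∈ arcCone p q ↔ A x ∈ arcCone (A p) (A q) := by
  constructor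
  · rintro ⟨a, b, ha, hb, rfl⟩
    exact ⟨a, b, ha, hb, by simp⟩
  · rintro ⟨a, b, ha, hb, h⟩
    exact ⟨a, b, ha, hb, A.injective (by simp [h])⟩

lemma mem_openArc_map {A : E3 ≃ₗᵢ[ℝ] E3} {p q x : E3} :
    x ∈ openArc p q ↔ A x ∈ openArc (A p) (A q) := by
  rw [mem_openArc, mem_openArc, ← mem_arcCone_map, A.norm_map]

lemma inner_symm_apply (A : E3 ≃ₗᵢ[ℝ] E3) (x y : E3) : ⟪A.symm x, y⟫ = ⟪x, A y⟫ := by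
  rw [← A.inner_map_map, A.apply_symm_apply]

lemma isSide_rot {A : E3 ≃ₗᵢ[ℝ] E3} {W : Finset E3} {p q m : E3} :
    IsSide (rot A W) p q m ↔ IsSide W (A.symm p) (A.symm q) (A.symm m) := by
  simp only [IsSide, mem_rot, inner_symm_apply, A.apply_symm_apply, A.symm.injective.ne_iff]
  refine and_congr_right fun _ => and_congr_right fun _ => and_congr_right fun _ =>
    and_congr_right fun _ => and_congr_right fun _ => ⟨fun h w hw h1 h2 => ?_, fun h w hw h1 h2 => ?_⟩
  · exact h (A w) (by simpa using hw) (by rintro rfl; simp at h1) (by rintro rfl; simp at h2)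
  · have := h (A.symm w) hw (by simpa using h1) (by simpa using h2)
    simpa using this

lemma IsConvexPolygon.rot {W : Finset E3} (hW : IsConvexPolygon W) (A : E3 ≃ₗᵢ[ℝ] E3) :
    IsConvexPolygon (rot A W) where
  three_le_card := by rw [SphCone.rot, Finset.card_map]; exact hW.three_le_card
  norm_eq_one w hw := by rw [← A.symm.norm_map]; exact hW.norm_eq_one _ (mem_rot.1 hw)
  hemisphere := by
    obtain ⟨u, hu⟩ := hW.hemisphere
    refine ⟨A u, fun w hw => ?_⟩
    rw [real_inner_comm, ← inner_symm_apply, real_inner_comm]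
    exact hu _ (mem_rot.1 hw)
  convex_position := by
    rintro w hw ⟨a, ha, h0, h⟩
    refine hW.convex_position _ (mem_rot.1 hw)
      ⟨fun x => a (A x), fun x hx => ha _ (mem_rot.2 (by simpa using hx)), by simpa using h0, ?_⟩
    rw [← sum_rot, ← h]

lemma IsCell.rot {V : Finset S} {𝓔 : Set (Set S)} {W : Finset E3} {φ : E3 → S}
    (h : IsCell V 𝓔 W φ) (A : E3 ≃ₗᵢ[ℝ] E3) : IsCell V 𝓔 (rot A W) (φ ∘ A.symm) where
  convex := h.convex.rot A
  continuousOn := h.continuousOn.comp A.symm.continuous.continuousOn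
    fun x hx => mem_polygon_rot.1 hx
  injOn x hx y hy hxy := A.symm.injective
    (h.injOn (mem_openPolygon_rot.1 hx) (mem_openPolygon_rot.1 hy) hxy)
  face := by
    obtain ⟨x, hx, hface⟩ := h.face
    refine ⟨x, hx, ?_⟩
    rw [← hface]
    ext y
    constructor
    · rintro ⟨z, hz, rfl⟩
      exact ⟨_, mem_openPolygon_rot.1 hz, rfl⟩
    · rintro ⟨z, hz, rfl⟩
      exact ⟨A z, mem_openPolygon_rot.2 (by simpa using hz), by simp⟩
  side p q m hs := by
    obtain ⟨h1, h2⟩ := h.side _ _ _ (isSide_rot.1 hs)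
    refine ⟨fun x hx y hy hxy => A.symm.injective
      (h1 (mem_openArc_map.1 hx) (mem_openArc_map.1 hy) hxy), ?_⟩
    convert h2 using 1
    ext y
    constructor
    · rintro ⟨z, hz, rfl⟩
      exact ⟨_, mem_openArc_map.1 hz, rfl⟩
    · rintro ⟨z, hz, rfl⟩
      exact ⟨A z, (mem_openArc_map (A := A.symm)).2 (by simpa using hz), by simp⟩
  vertex w hw := h.vertex _ (mem_rot.1 hw)
  isometric x hx hxW := by
    obtain ⟨ε, hε, h'⟩ := h.isometric _ (mem_polygon_rot.1 hx) (fun hx' => hxW (mem_rot.2 hx'))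
    refine ⟨ε, hε, fun y hy z hz h1 h2 => ?_⟩
    rw [Function.comp, Function.comp, h' _ (mem_polygon_rot.1 hy) _ (mem_polygon_rot.1 hz)
      (by simpa using h1) (by simpa using h2), angle_map]

/-! ### Homogeneous extension -/

/-- The extension of a map on the unit sphere that is constant on rays. -/
def radial {T : Type*} (φ : E3 → T) : E3 → T := fun y => φ (‖y‖⁻¹ • y)

lemma norm_inv_smul {y : E3} (hy : y ≠ 0) : ‖‖y‖⁻¹ • y‖ = 1 := by
  rw [norm_smul, norm_inv, norm_norm, inv_mul_cancel₀ (norm_ne_zero_iff.2 hy)]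

lemma radial_of_norm_eq_one {T : Type*} (φ : E3 → T) {y : E3} (hy : ‖y‖ = 1) : radial φ y = φ y := by
  rw [radial, hy, inv_one, one_smul]

lemma radial_smul {T : Type*} (φ : E3 → T) (y : E3) {r : ℝ} (hr : 0 < r) : radial φ (r • y) = radial φ y := by
  rw [radial, radial, norm_smul, Real.norm_of_nonneg hr.le, smul_smul, mul_inv, mul_comm r⁻¹,
    mul_assoc, inv_mul_cancel₀ hr.ne', mul_one]

lemma radial_comp {T : Type*} (φ : E3 → T) (A : E3 ≃ₗᵢ[ℝ] E3) : radial (φ ∘ A) = radial φ ∘ A := by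
  funext y
  simp [radial]

lemma continuousAt_normalize {x : E3} (hx : x ≠ 0) : ContinuousAt (fun y : E3 => ‖y‖⁻¹ • y) x :=
  (continuous_norm.continuousAt.inv₀ (norm_ne_zero_iff.2 hx)).smul continuousAt_id

lemma normalize_mem_polygon {W : Finset E3} {y : E3} (hy : y ∈ cone W) (hy0 : y ≠ 0) :
    ‖y‖⁻¹ • y ∈ polygon W :=
  ⟨norm_inv_smul hy0, smul_mem_cone hy (inv_nonneg.2 (norm_nonneg _))⟩

lemma normalize_mem_openPolygon {W : Finset E3} {y : E3} (hy : y ∈ openCone W) (hy0 : y ≠ 0) :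
    ‖y‖⁻¹ • y ∈ openPolygon W :=
  ⟨norm_inv_smul hy0, smul_mem_openCone hy (inv_pos.2 (norm_pos_iff.2 hy0))⟩

lemma normalize_mem_openArc {p q y : E3} (hy : y ∈ arcCone p q) (hy0 : y ≠ 0) :
    ‖y‖⁻¹ • y ∈ openArc p q :=
  ⟨norm_inv_smul hy0, smul_mem_arcCone hy (inv_pos.2 (norm_pos_iff.2 hy0))⟩

lemma radial_mem_image_openArc {T : Type*} (φ : E3 → T) {p q x : E3} (hx : x ∈ arcCone p q)
    (hx0 : x ≠ 0) : radial φ x ∈ φ '' openArc p q :=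
  mem_image_of_mem φ (normalize_mem_openArc hx hx0)

lemma isCompact_polygon {W : Finset E3} (h : IsClosed (cone W)) : IsCompact (polygon W) := by
  have : polygon W = sphere 0 1 ∩ cone W := by
    ext x
    rw [mem_polygon, mem_inter_iff, mem_sphere_zero_iff_norm]
  rw [this]
  exact (isCompact_sphere 0 1).inter_right h

namespace IsCell

variable {V : Finset S} {𝓔 : Set (Set S)} {W : Finset E3} {φ : E3 → S}

lemma notMem_skeleton (h : IsCell V 𝓔 W φ) {x : E3} (hx : x ∈ openPolygon W) :
    φ x ∉ skeleton V 𝓔 := by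
  obtain ⟨z, hz, hface⟩ := h.face
  have : φ x ∈ connectedComponentIn (skeleton V 𝓔)ᶜ z := hface ▸ mem_image_of_mem φ hx
  exact connectedComponentIn_subset _ _ this

lemma radial_notMem_skeleton (h : IsCell V 𝓔 W φ) {x : E3} (hx : x ∈ openCone W) :
    radial φ x ∉ skeleton V 𝓔 :=
  h.notMem_skeleton (normalize_mem_openPolygon hx
    fun h0 => h.convex.zero_notMem_openCone (h0 ▸ hx))

lemma radial_continuousOn (h : IsCell V 𝓔 W φ) : ContinuousOn (radial φ) (cone W \ {0}) :=
  h.continuousOn.comp (fun _ hx => (continuousAt_normalize hx.2).continuousWithinAt)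
    fun _ hx => normalize_mem_polygon hx.1 hx.2

lemma radial_locIso (h : IsCell V 𝓔 W φ) :
    LocIso (radial φ) {x | x ∈ cone W ∧ x ≠ 0 ∧ ‖x‖⁻¹ • x ∉ W} := by
  rintro x ⟨hx, hx0, hxW⟩
  obtain ⟨ε, hε, hiso⟩ := h.isometric _ (normalize_mem_polygon hx hx0) hxW
  obtain ⟨δ, hδ, hcont⟩ := Metric.continuousAt_iff.1 (continuousAt_normalize hx0) ε hε
  refine ⟨δ, hδ, fun y hy z hz h1 h2 => ?_⟩
  rw [radial, radial, hiso _ (normalize_mem_polygon hy.1 hy.2.1) _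
    (normalize_mem_polygon hz.1 hz.2.1) (hcont h1) (hcont h2),
    angle_smul_left_of_pos _ _ (inv_pos.2 (norm_pos_iff.2 hy.2.1)),
    angle_smul_right_of_pos _ _ (inv_pos.2 (norm_pos_iff.2 hz.2.1))]

lemma radial_locIso_openCone (h : IsCell V 𝓔 W φ) : LocIso (radial φ) (openCone W) := by
  refine h.radial_locIso.mono fun x hx => ?_
  have hx0 : x ≠ 0 := fun h0 => h.convex.zero_notMem_openCone (h0 ▸ hx)
  exact ⟨openCone_subset_cone W hx, hx0, fun hW =>
    h.radial_notMem_skeleton hx (Or.inl (h.vertex _ hW))⟩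

lemma radial_notMem (h : IsCell V 𝓔 W φ) {x : E3} (hx : x ∈ openCone W) : radial φ x ∉ V :=
  fun hV => h.radial_notMem_skeleton hx (Or.inl hV)

lemma radial_mem_skeleton (h : IsCell V 𝓔 W φ) {x : E3} (hx : x ∈ cone W)
    (hxo : x ∉ openCone W) (hx0 : x ≠ 0) : radial φ x ∈ skeleton V 𝓔 := by
  rcases h.convex.side_or_vertex hx hxo hx0 with ⟨w, hw, r, hr, rfl⟩ | ⟨p, q, m, hs, harc⟩
  · left
    rw [radial_smul _ _ hr, radial_of_norm_eq_one _ (h.convex.norm_eq_one w hw)]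
    exact h.vertex w hw
  · right
    exact ⟨_, (h.side p q m hs).2, radial_mem_image_openArc φ harc hx0⟩

lemma image_eq_of_mem {W₁ W₂ : Finset E3} {φ₁ φ₂ : E3 → S} (h₁ : IsCell V 𝓔 W₁ φ₁)
    (h₂ : IsCell V 𝓔 W₂ φ₂) {s : S} (hs₁ : s ∈ φ₁ '' openPolygon W₁)
    (hs₂ : s ∈ φ₂ '' openPolygon W₂) : φ₁ '' openPolygon W₁ = φ₂ '' openPolygon W₂ := by
  obtain ⟨x₁, -, hf₁⟩ := h₁.face
  obtain ⟨x₂, -, hf₂⟩ := h₂.face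
  rw [hf₁] at hs₁ ⊢
  rw [hf₂] at hs₂ ⊢
  rw [connectedComponentIn_eq hs₁, connectedComponentIn_eq hs₂]

/-- The maps agree on the connected overlap. If `H` met the boundary of the cell at `z`, then `ψ z`
would be the limit of the cell map there, a point of the skeleton. -/
lemma subset_openCone (hd : IsSphericalConeMetric V) (h : IsCell V 𝓔 W φ) {H : Set E3}
    (hHo : IsOpen H) (hH : Convex ℝ H) {ψ : E3 → S} (hψ : LocIso ψ H)
    (hskel : ∀ y ∈ H, ψ y ∉ skeleton V 𝓔) {x₀ : E3} (hx₀ : x₀ ∈ H) (hx₀W : x₀ ∈ openCone W)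
    (heq : ∀ᶠ y in 𝓝 x₀, ψ y = radial φ y) :
    H ⊆ openCone W ∧ ∀ y ∈ H, ψ y = radial φ y := by
  have hWo := h.convex.isOpen_openCone
  have hagree : ∀ y ∈ H ∩ openCone W, ψ y = radial φ y :=
    LocIso.eq_of_eventually_eq hd (hHo.inter hWo) (hH.inter (convex_openCone W)).isPreconnected
      (hψ.mono inter_subset_left) (h.radial_locIso_openCone.mono inter_subset_right)
      (fun y hy hV => hskel y hy.1 (Or.inl hV)) ⟨hx₀, hx₀W⟩ heq
  have hsub : H ⊆ openCone W := by
    refine hH.isPreconnected.subset_of_closure_inter_subset hWo ⟨x₀, hx₀, hx₀W⟩ ?_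
    rintro z ⟨hz, hzH⟩
    rw [h.convex.closure_openCone] at hz
    by_contra hzo
    have hz0 := hψ.ne_zero hzH
    have htend : Tendsto (fun t : ℝ => t • x₀ + (1 - t) • z) (𝓝[>] 0) (𝓝 z) := by
      have : Tendsto (fun t : ℝ => t • x₀ + (1 - t) • z) (𝓝 0)
          (𝓝 ((0 : ℝ) • x₀ + (1 - (0 : ℝ)) • z)) := Continuous.tendsto (by fun_prop) _
      rw [zero_smul, zero_add, sub_zero, one_smul] at this
      exact this.mono_left nhdsWithin_le_nhds
    have hev : ∀ᶠ t : ℝ in 𝓝[>] 0, t • x₀ + (1 - t) • z ∈ H ∩ openCone W := by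
      filter_upwards [Ioc_mem_nhdsGT (zero_lt_one' ℝ)] with t ht
      exact ⟨hH hx₀ hzH ht.1.le (by linarith [ht.2]) (by ring),
        add_mem_openCone (smul_mem_openCone hx₀W ht.1) (smul_mem_cone hz (by linarith [ht.2]))⟩
    have h1 : Tendsto (fun t : ℝ => ψ (t • x₀ + (1 - t) • z)) (𝓝[>] 0) (𝓝 (ψ z)) :=
      (hψ.continuousAt hHo hzH).tendsto.comp htend
    have h2 : Tendsto (fun t : ℝ => radial φ (t • x₀ + (1 - t) • z)) (𝓝[>] 0)
        (𝓝 (radial φ z)) := by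
      refine (h.radial_continuousOn z ⟨hz, hz0⟩).tendsto.comp
        (tendsto_nhdsWithin_iff.2 ⟨htend, hev.mono fun t ht => ⟨openCone_subset_cone W ht.2, ?_⟩⟩)
      exact fun h0 => h.convex.zero_notMem_openCone (h0 ▸ ht.2)
    have h3 : ψ z = radial φ z := tendsto_nhds_unique
      (h1.congr' (hev.mono fun t ht => hagree _ ht)) h2
    exact hskel z hzH (h3 ▸ h.radial_mem_skeleton hz hzo hz0)
  exact ⟨hsub, fun y hy => hagree y ⟨hy, hsub hy⟩⟩

/-- The containment `subset_openCone` applies in both directions, and the closed cone determines its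
unit vertices. A cell is therefore determined by its germ at one interior point. -/
lemma eq_of_eventually_eq (hd : IsSphericalConeMetric V) {W₁ W₂ : Finset E3} {φ₁ φ₂ : E3 → S}
    (h₁ : IsCell V 𝓔 W₁ φ₁) (h₂ : IsCell V 𝓔 W₂ φ₂) {x : E3} (hx₁ : x ∈ openCone W₁)
    (hx₂ : x ∈ openCone W₂) (heq : ∀ᶠ y in 𝓝 x, radial φ₁ y = radial φ₂ y) :
    W₁ = W₂ ∧ ∀ y ∈ polygon W₁, φ₁ y = φ₂ y := by
  obtain ⟨hsub₁, hag⟩ := h₂.subset_openCone hd h₁.convex.isOpen_openCone (convex_openCone W₁)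
    h₁.radial_locIso_openCone (fun y hy => h₁.radial_notMem_skeleton hy) hx₁ hx₂ heq
  obtain ⟨hsub₂, -⟩ := h₁.subset_openCone hd h₂.convex.isOpen_openCone (convex_openCone W₂)
    h₂.radial_locIso_openCone (fun y hy => h₂.radial_notMem_skeleton hy) hx₂ hx₁
    (heq.mono fun _ => Eq.symm)
  have hopen : openCone W₁ = openCone W₂ := hsub₁.antisymm hsub₂
  have hW : W₁ = W₂ := h₁.convex.eq_of_cone_eq h₂.convex
    (by rw [← h₁.convex.closure_openCone, hopen, h₂.convex.closure_openCone])
  subst hW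
  refine ⟨rfl, fun y hy => ?_⟩
  have hy0 : y ≠ 0 := by rintro rfl; simpa using hy.1
  have hcl : y ∈ closure (openCone W₁) := by rw [h₁.convex.closure_openCone]; exact hy.2
  have := mem_closure_iff_nhdsWithin_neBot.1 hcl
  have hle : 𝓝[openCone W₁] y ≤ 𝓝[cone W₁ \ {0}] y := nhdsWithin_mono _ fun z hz =>
    ⟨openCone_subset_cone _ hz, fun h0 => h₁.convex.zero_notMem_openCone (h0 ▸ hz)⟩
  have t1 := (h₁.radial_continuousOn y ⟨hy.2, hy0⟩).tendsto.mono_left hle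
  have t2 := (h₂.radial_continuousOn y ⟨hy.2, hy0⟩).tendsto.mono_left hle
  have := tendsto_nhds_unique_of_eventuallyEq t1 t2
    (eventually_of_mem self_mem_nhdsWithin fun z hz => hag z hz)
  rwa [radial_of_norm_eq_one _ hy.1, radial_of_norm_eq_one _ hy.1] at this

lemma exists_rot (hd : IsSphericalConeMetric V) (h : IsCell V 𝓔 W φ) {U : Set E3}
    (hU : IsOpen U) {ψ : E3 → S} (hψ : LocIso ψ U) {y : E3} (hy : y ∈ U)
    (hyW : ψ y ∈ φ '' openPolygon W) :
    ∃ A : E3 ≃ₗᵢ[ℝ] E3, y ∈ openCone (SphCone.rot A W) ∧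
      ∀ᶠ z in 𝓝 y, ψ z = radial (φ ∘ A.symm) z := by
  obtain ⟨z, hz, hzy⟩ := hyW
  have hy0 : 0 < ‖y‖ := norm_pos_iff.2 (hψ.ne_zero hy)
  have hz' := smul_mem_openCone hz.2 hy0
  obtain ⟨A, hA, hev⟩ := LocIso.exists_frame hd hU h.convex.isOpen_openCone hψ
    h.radial_locIso_openCone hy hz' (by rw [norm_smul, norm_norm, hz.1, mul_one])
    (by rw [radial_smul _ _ hy0, radial_of_norm_eq_one _ hz.1, hzy])
    (fun hV => h.notMem_skeleton hz (Or.inl (hzy ▸ hV)))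
  refine ⟨A.symm, mem_openCone_rot.2 ?_, ?_⟩
  · rw [LinearIsometryEquiv.symm_symm, hA]
    exact hz'
  · filter_upwards [hev] with x hx
    rw [radial_comp, LinearIsometryEquiv.symm_symm, Function.comp, hx]

end IsCell

lemma IsConvexDecomposition.exists_cell {V : Finset S} {𝓔 : Set (Set S)}
    (hd : IsSphericalConeMetric V) (h : IsConvexDecomposition V 𝓔) {U : Set E3}
    (hU : IsOpen U) {ψ : E3 → S} (hψ : LocIso ψ U) {y : E3} (hy : y ∈ U)
    (hskel : ψ y ∉ skeleton V 𝓔) :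
    ∃ W φ, IsCell V 𝓔 W φ ∧ y ∈ openCone W ∧ ∀ᶠ z in 𝓝 y, ψ z = radial φ z := by
  obtain ⟨W, φ, hc, hmem⟩ := h.faces _ hskel
  obtain ⟨A, hA, hev⟩ := hc.exists_rot hd hU hψ hy hmem
  exact ⟨_, _, hc.rot A, hA, hev⟩

variable {V : Finset S} {𝓔 : Set (Set S)}

/-! ### Edges and the skeleton -/

lemma IsOpenEdge.isClosed_union {e : Set S} (h : IsOpenEdge V e) : IsClosed (e ∪ (V : Set S)) := by
  obtain ⟨-, γ, hγ, h0, h1, -, rfl⟩ := h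
  have : γ '' Ioo 0 1 ∪ (V : Set S) = γ '' Icc 0 1 ∪ (V : Set S) := by
    refine (union_subset_union_left _ (image_mono Ioo_subset_Icc_self)).antisymm ?_
    rintro x (⟨t, ⟨ht0, ht1⟩, rfl⟩ | hx)
    · rcases ht0.eq_or_lt with rfl | ht0
      · exact Or.inr h0
      rcases ht1.eq_or_lt with rfl | ht1
      · exact Or.inr h1
      exact Or.inl ⟨t, ⟨ht0, ht1⟩, rfl⟩
    · exact Or.inr hx
  rw [this]
  exact (isCompact_Icc.image_of_continuousOn hγ).isClosed.union V.finite_toSet.isClosed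

lemma IsConvexDecomposition.isClosed_biUnion (h : IsConvexDecomposition V 𝓔) {𝓕 : Set (Set S)}
    (h𝓕 : 𝓕 ⊆ 𝓔) : IsClosed ((V : Set S) ∪ ⋃₀ 𝓕) := by
  have : (V : Set S) ∪ ⋃₀ 𝓕 = (V : Set S) ∪ ⋃ e ∈ 𝓕, (e ∪ (V : Set S)) := by
    ext x
    simp only [mem_union, mem_sUnion, mem_iUnion, exists_prop]
    constructor
    · rintro (hx | ⟨e, he, hx⟩)
      · exact Or.inl hx
      · exact Or.inr ⟨e, he, Or.inl hx⟩
    · rintro (hx | ⟨e, he, hx | hx⟩)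
      · exact Or.inl hx
      · exact Or.inr ⟨e, he, hx⟩
      · exact Or.inl hx
  rw [this]
  exact V.finite_toSet.isClosed.union
    ((h.finite.subset h𝓕).isClosed_biUnion fun e he => (h.edge e (h𝓕 he)).isClosed_union)

/-- An arc contains no open piece of surface. Otherwise a small circle in `U` would map continuously
to the parameter interval; by the intermediate value theorem two opposite points of the circle would
have the same parameter, although `ψ` separates them. -/
lemma not_forall_mem_edge {e : Set S} (he : IsOpenEdge V e) {U : Set E3} (hU : IsOpen U)
    (hne : U.Nonempty) {ψ : E3 → S} (hψ : LocIso ψ U) : ∃ y ∈ U, ψ y ∉ e := by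
  by_contra! hall
  obtain ⟨hVe, γ, hγ, h0, h1, hinj, rfl⟩ := he
  obtain ⟨y₀, hy₀⟩ := hne
  have hy₀0 : 0 < ‖y₀‖ := norm_pos_iff.2 (hψ.ne_zero hy₀)
  obtain ⟨ε, hε, hiso⟩ := hψ y₀ hy₀
  obtain ⟨ε', hε', hball⟩ := Metric.isOpen_iff.1 hU y₀ hy₀
  set ρ := min ε ε' / 2 with hρ
  have hρ0 : 0 < ρ := half_pos (lt_min hε hε')
  have hρε : ρ < min ε ε' := half_lt_self (lt_min hε hε')
  obtain ⟨A, hA⟩ := exists_isometry_map_eq (x := ‖y₀‖ • EuclideanSpace.single (0 : Fin 3) (1 : ℝ))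
    (y := y₀) (by simp [norm_smul])
  let k : ℝ → E3 := fun t => !₂[‖y₀‖, ρ * Real.cos t, ρ * Real.sin t]
  have hkc : Continuous k := by fun_prop
  have hkdist : ∀ t, dist (A (k t)) y₀ = ρ := by
    intro t
    rw [← hA, A.dist_map, EuclideanSpace.dist_eq]
    have h1 : ∀ i, k t i - (‖y₀‖ • EuclideanSpace.single (0 : Fin 3) (1 : ℝ) : E3) i =
        ![0, ρ * Real.cos t, ρ * Real.sin t] i := by
      intro i
      fin_cases i <;> simp [k]
    simp only [Fin.sum_univ_three, Real.dist_eq, h1, sq_abs]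
    rw [show (![0, ρ * Real.cos t, ρ * Real.sin t] 0) ^ 2 +
      (![0, ρ * Real.cos t, ρ * Real.sin t] 1) ^ 2 + (![0, ρ * Real.cos t, ρ * Real.sin t] 2) ^ 2
      = ρ ^ 2 by simp; nlinarith [Real.sin_sq_add_cos_sq t], Real.sqrt_sq hρ0.le]
  have hnorm : ∀ t, ‖k t‖ = Real.sqrt (‖y₀‖ ^ 2 + ρ ^ 2) := by
    intro t
    rw [EuclideanSpace.norm_eq]
    congr 1
    simp [Fin.sum_univ_three, k]
    nlinarith [Real.sin_sq_add_cos_sq t]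
  have hkU : ∀ t, A (k t) ∈ U := fun t => hball (by
    rw [mem_ball, hkdist]; exact hρε.trans_le (min_le_right _ _))
  have hne : ∀ t, ψ (A (k t)) ≠ ψ (A (k (t + Real.pi))) := by
    intro t h
    have h2 := hiso _ (hkU t) _ (hkU (t + Real.pi))
      (by rw [hkdist]; exact hρε.trans_le (min_le_left _ _))
      (by rw [hkdist]; exact hρε.trans_le (min_le_left _ _))
    rw [h, dist_self, angle_map] at h2
    have h3 := eq_of_angle_eq_zero_of_norm_eq h2.symm (by rw [hnorm, hnorm])
    have h4 := congrArg (fun x : E3 => x 1) h3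
    have h5 := congrArg (fun x : E3 => x 2) h3
    simp [k] at h4 h5
    have h6 : Real.cos t = 0 := by nlinarith
    have h7 : Real.sin t = 0 := by nlinarith
    have := Real.sin_sq_add_cos_sq t
    rw [h6, h7] at this
    norm_num at this
  choose τ hτ hγτ using fun t => hall _ (hkU t)
  have huniq : ∀ t, ∀ s ∈ Icc (0 : ℝ) 1, γ s = ψ (A (k t)) → s = τ t := by
    intro t s hs hst
    have hnV : γ s ∉ (V : Set S) := fun hV =>
      disjoint_left.1 hVe (by rw [hst, ← hγτ t]; exact mem_image_of_mem γ (hτ t)) hV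
    have hs' : s ∈ Ioo (0 : ℝ) 1 := by
      refine ⟨hs.1.lt_of_ne ?_, hs.2.lt_of_ne ?_⟩
      · rintro rfl; exact hnV h0
      · rintro rfl; exact hnV h1
    exact hinj hs' (hτ t) (hst.trans (hγτ t).symm)
  have hψc : Continuous fun t => ψ (A (k t)) := continuous_iff_continuousAt.2 fun t =>
    ContinuousAt.comp (f := fun t => A (k t)) (hψ.continuousAt hU (hkU t)) (by fun_prop)
  have hτc : Continuous τ := by
    rw [← continuousOn_univ]
    refine continuousOn_of_forall_continuousAt fun t _ => ?_
    rw [ContinuousAt, tendsto_order]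
    -- Continuity of `τ`: the image under `γ` of a closed set of parameters is compact, so not
    -- having a parameter in it is an open condition.
    have key : ∀ K : Set ℝ, IsClosed K → τ t ∉ K → ∀ᶠ t' in 𝓝 t, τ t' ∉ K := by
      intro K hK htK
      have hcl : IsClosed (γ '' (Icc 0 1 ∩ K)) :=
        ((isCompact_Icc.inter_right hK).image_of_continuousOn (hγ.mono inter_subset_left)).isClosed
      have hnot : ψ (A (k t)) ∉ γ '' (Icc 0 1 ∩ K) := by
        rintro ⟨s, ⟨hs, hsK⟩, hst⟩
        exact htK (huniq t s hs hst ▸ hsK)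
      filter_upwards [hψc.continuousAt.eventually_mem (hcl.isOpen_compl.mem_nhds hnot)]
        with t' ht' hK'
      exact ht' ⟨τ t', ⟨Ioo_subset_Icc_self (hτ t'), hK'⟩, hγτ t'⟩
    refine ⟨fun a ha => ?_, fun a ha => ?_⟩
    · filter_upwards [key (Iic a) isClosed_Iic (not_le.2 ha)] with t' ht' using not_le.1 ht'
    · filter_upwards [key (Ici a) isClosed_Ici (not_le.2 ha)] with t' ht' using not_le.1 ht'
  have hper : τ (Real.pi + Real.pi) = τ 0 := by
    apply huniq 0 _ (Ioo_subset_Icc_self (hτ _))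
    rw [hγτ]
    simp [k, ← two_mul]
  have hzero : ∃ t, τ t - τ (t + Real.pi) = 0 := by
    have hc : Continuous fun t => τ t - τ (t + Real.pi) := by fun_prop
    rcases le_total (τ 0) (τ Real.pi) with h | h
    · exact mem_range_of_exists_le_of_exists_ge hc ⟨0, by simpa using h⟩
        ⟨Real.pi, by simpa [hper] using h⟩
    · exact mem_range_of_exists_le_of_exists_ge hc ⟨Real.pi, by simpa [hper] using h⟩
        ⟨0, by simpa using h⟩
  obtain ⟨t, ht⟩ := hzero
  exact hne t (by rw [← hγτ, ← hγτ, sub_eq_zero.1 ht])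

/-- The open set is shrunk once for each of the finitely many edges; each edge together with `V` is
closed and misses the image of some point. -/
lemma IsConvexDecomposition.exists_notMem_skeleton (h : IsConvexDecomposition V 𝓔) {U : Set E3}
    (hU : IsOpen U) (hne : U.Nonempty) {ψ : E3 → S} (hψ : LocIso ψ U) (hV : ∀ y ∈ U, ψ y ∉ V) :
    ∃ y ∈ U, ψ y ∉ skeleton V 𝓔 := by
  have key : ∀ 𝓕 : Set (Set S), 𝓕.Finite → 𝓕 ⊆ 𝓔 →
      ∃ U' ⊆ U, IsOpen U' ∧ U'.Nonempty ∧ ∀ y ∈ U', ψ y ∉ ⋃₀ 𝓕 := by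
    intro 𝓕 hfin
    induction 𝓕, hfin using Set.Finite.induction_on with
    | empty => exact fun _ => ⟨U, subset_rfl, hU, hne, by simp⟩
    | @insert e 𝓕 _ _ ih =>
      intro hsub
      obtain ⟨U', hU'U, hU'o, hU'ne, hU'⟩ := ih ((subset_insert _ _).trans hsub)
      have he := h.edge e (hsub (mem_insert _ _))
      obtain ⟨y, hy, hye⟩ := not_forall_mem_edge he hU'o hU'ne (hψ.mono hU'U)
      refine ⟨U' ∩ ψ ⁻¹' (e ∪ (V : Set S))ᶜ, inter_subset_left.trans hU'U,
        (hψ.mono hU'U).continuousOn.isOpen_inter_preimage hU'o he.isClosed_union.isOpen_compl,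
        ⟨y, hy, ?_⟩, ?_⟩
      · rintro (h1 | h1)
        exacts [hye h1, hV y (hU'U hy) h1]
      · rintro z ⟨hz, hz'⟩
        rw [sUnion_insert]
        rintro (h1 | h1)
        exacts [hz' (Or.inl h1), hU' z hz h1]
  obtain ⟨U', hU'U, -, ⟨y, hy⟩, hU'⟩ := key 𝓔 h.finite subset_rfl
  exact ⟨y, hU'U hy, fun hs => hs.elim (hV y (hU'U hy)) (hU' y hy)⟩

/-! ### Adjacent cells -/

lemma IsSide.ne_zero {W : Finset E3} (hW : IsConvexPolygon W) {p q m : E3} (hs : IsSide W p q m) :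
    m ≠ 0 := by
  rintro rfl
  obtain ⟨r, hr, h1, h2⟩ := hW.exists_third p q
  simpa using hs.2.2.2.2.2 r hr h1 h2

lemma IsSide.inner_arcCone {W : Finset E3} {p q m : E3} (hs : IsSide W p q m) {x : E3}
    (hx : x ∈ arcCone p q) : ⟪m, x⟫ = 0 := by
  obtain ⟨a, b, -, -, rfl⟩ := hx
  rw [inner_add_right, real_inner_smul_right, real_inner_smul_right, hs.2.2.2.1, hs.2.2.2.2.1]
  simp

lemma IsSide.symm {W : Finset E3} {p q m : E3} (hs : IsSide W p q m) : IsSide W q p m :=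
  ⟨hs.2.1, hs.1, hs.2.2.1.symm, hs.2.2.2.2.1, hs.2.2.2.1, fun w hw h1 h2 =>
    hs.2.2.2.2.2 w hw h2 h1⟩

lemma IsSide.notMem_openCone {W : Finset E3} (hW : IsConvexPolygon W) {p q m : E3}
    (hs : IsSide W p q m) {x : E3} (hx : x ∈ arcCone p q) : x ∉ openCone W := fun h =>
  (hW.inner_pos_of_side hs h).ne' (hs.inner_arcCone hx)

lemma IsSide.ne_zero_of_mem_arcCone {W : Finset E3} (hW : IsConvexPolygon W) {p q m : E3}
    (hs : IsSide W p q m) {x : E3} (hx : x ∈ arcCone p q) : x ≠ 0 := by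
  rintro rfl
  obtain ⟨u, hu⟩ := hW.hemisphere
  obtain ⟨a, b, ha, hb, h⟩ := hx
  have h1 : ⟪u, (0 : E3)⟫ = a * ⟪u, p⟫ + b * ⟪u, q⟫ := by
    rw [h, inner_add_right, real_inner_smul_right, real_inner_smul_right]
  rw [inner_zero_right] at h1
  have := mul_pos ha (hu p hs.1)
  have := mul_pos hb (hu q hs.2.1)
  linarith

lemma tendsto_add_smul (x v : E3) : Tendsto (fun t : ℝ => x + t • v) (𝓝[>] 0) (𝓝 x) := by
  have : Tendsto (fun t : ℝ => x + t • v) (𝓝 0) (𝓝 (x + (0 : ℝ) • v)) :=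
    Continuous.tendsto (by fun_prop) _
  rw [zero_smul, add_zero] at this
  exact this.mono_left nhdsWithin_le_nhds

lemma IsCell.tendsto_radial {W : Finset E3} {φ : E3 → S} (h : IsCell V 𝓔 W φ) {x : E3}
    (hx : x ∈ cone W) (hx0 : x ≠ 0) : Tendsto (radial φ) (𝓝[openCone W] x) (𝓝 (radial φ x)) :=
  (h.radial_continuousOn x ⟨hx, hx0⟩).tendsto.mono_left (nhdsWithin_mono _ fun _ hz =>
    ⟨openCone_subset_cone _ hz, fun h0 => h.convex.zero_notMem_openCone (h0 ▸ hz)⟩)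

lemma IsCell.isLimitAt {W : Finset E3} {φ : E3 → S} (h : IsCell V 𝓔 W φ) {x : E3}
    (hx : x ∈ cone W) (hx0 : x ≠ 0) : IsLimitAt (radial φ) (openCone W) x (radial φ x) := by
  have hcl : x ∈ closure (openCone W) := h.convex.closure_openCone ▸ hx
  have := mem_closure_iff_nhdsWithin_neBot.1 hcl
  exact h.radial_locIso_openCone.isLimitAt_of_tendsto (convex_openCone W) hx0
    (F := 𝓝[openCone W] x) (u := id) (tendsto_id.mono_left nhdsWithin_le_nhds) self_mem_nhdsWithin (h.tendsto_radial hx hx0)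

/-- Two functions agreeing on an open cone near a boundary point agree there. -/
lemma IsCell.eq_radial_of_mem_cone {W : Finset E3} {φ : E3 → S} (h : IsCell V 𝓔 W φ) {B : Set E3}
    (hB : IsOpen B) {ψ : E3 → S} (hψ : ContinuousOn ψ B)
    (heq : ∀ y ∈ B, y ∈ openCone W → ψ y = radial φ y) {y : E3} (hy : y ∈ B) (hyW : y ∈ cone W)
    (hy0 : y ≠ 0) : ψ y = radial φ y := by
  have hcl : y ∈ closure (openCone W) := h.convex.closure_openCone ▸ hyW
  have := mem_closure_iff_nhdsWithin_neBot.1 hcl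
  refine tendsto_nhds_unique_of_eventuallyEq (l := 𝓝[openCone W] y)
    ((hψ.continuousAt (hB.mem_nhds hy)).tendsto.mono_left nhdsWithin_le_nhds)
    (h.tendsto_radial hyW hy0) ?_
  filter_upwards [self_mem_nhdsWithin, mem_nhdsWithin_of_mem_nhds (hB.mem_nhds hy)] with z h1 h2
  exact heq z h2 h1

lemma IsCell.radial_side_notMem {W : Finset E3} {φ : E3 → S} (h : IsCell V 𝓔 W φ)
    (hdec : IsConvexDecomposition V 𝓔) {p q m x : E3} (hs : IsSide W p q m)
    (hx : x ∈ arcCone p q) : radial φ x ∉ V := fun hV =>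
  disjoint_left.1 (hdec.edge _ (h.side p q m hs).2).1
    (radial_mem_image_openArc φ hx (hs.ne_zero_of_mem_arcCone h.convex hx)) hV

/-- `ψ` extends the cell `(W, φ)` isometrically to a neighbourhood `ball x δ` of the interior
point `x` of the side `p q`, without meeting the skeleton on the other side. -/
structure IsSideExtension (V : Finset S) (𝓔 : Set (Set S)) (W : Finset E3) (φ : E3 → S)
    (m x : E3) (δ : ℝ) (ψ : E3 → S) : Prop where
  pos : 0 < δ
  dist_eq : ∀ y ∈ ball x δ, ∀ z ∈ ball x δ, dist (ψ y) (ψ z) = angle y z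
  notMem : ∀ y ∈ ball x δ, ψ y ∉ V
  mem_cone : ∀ y ∈ ball x δ, 0 ≤ ⟪m, y⟫ → y ∈ cone W ∧ ψ y = radial φ y
  mem_openCone : ∀ y ∈ ball x δ, 0 < ⟪m, y⟫ → y ∈ openCone W
  notMem_skeleton : ∀ y ∈ ball x δ, ⟪m, y⟫ < 0 → ψ y ∉ skeleton V 𝓔

lemma IsSideExtension.locIso {W : Finset E3} {φ ψ : E3 → S} {m x : E3} {δ : ℝ}
    (h : IsSideExtension V 𝓔 W φ m x δ ψ) : LocIso ψ (ball x δ) :=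
  locIso_of_forall_dist_eq h.dist_eq

lemma IsSideExtension.mono {W : Finset E3} {φ ψ : E3 → S} {m x : E3} {δ δ' : ℝ}
    (h : IsSideExtension V 𝓔 W φ m x δ ψ) (h0 : 0 < δ') (hδ : δ' ≤ δ) :
    IsSideExtension V 𝓔 W φ m x δ' ψ where
  pos := h0
  dist_eq y hy z hz := h.dist_eq y (ball_subset_ball hδ hy) z (ball_subset_ball hδ hz)
  notMem y hy := h.notMem y (ball_subset_ball hδ hy)
  mem_cone y hy := h.mem_cone y (ball_subset_ball hδ hy)
  mem_openCone y hy := h.mem_openCone y (ball_subset_ball hδ hy)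
  notMem_skeleton y hy := h.notMem_skeleton y (ball_subset_ball hδ hy)

/-- The map extends across `x` because side interiors do not go to `V`. Beyond the side, `V` and the
other edges are excluded by closedness. Far parts of the same edge are excluded by compactness and
injectivity on the side; its part near `x` comes from the plane `⟪m, ·⟫ = 0`, and the extension
separates directions. -/
lemma IsCell.exists_sideExtension (hd : IsSphericalConeMetric V)
    (hdec : IsConvexDecomposition V 𝓔) {W : Finset E3} {φ : E3 → S} (h : IsCell V 𝓔 W φ)
    {p q m x : E3} (hs : IsSide W p q m) (hx : x ∈ arcCone p q) :
    ∃ δ ψ, IsSideExtension V 𝓔 W φ m x δ ψ := by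
  classical
  have hx0 := hs.ne_zero_of_mem_arcCone h.convex hx
  have hxn : 0 < ‖x‖ := norm_pos_iff.2 hx0
  have hxW : x ∈ cone W := arcCone_subset_cone hs.1 hs.2.1 hx
  obtain ⟨hinj, hmem⟩ := h.side p q m hs
  set e := φ '' openArc p q with he
  obtain ⟨δ₁, hδ₁, ψ, hiso, hψx, hψV, hψ⟩ := h.radial_locIso_openCone.exists_extension hd
    h.convex.isOpen_openCone (convex_openCone W) hx0 (h.convex.closure_openCone ▸ hxW)
    (h.isLimitAt hxW hx0) (h.radial_side_notMem hdec hs hx)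
  have hψloc : LocIso ψ (ball x δ₁) := locIso_of_forall_dist_eq hiso
  have hψcone : ∀ y ∈ ball x δ₁, y ∈ cone W → ψ y = radial φ y := fun y hy hyW =>
    h.eq_radial_of_mem_cone isOpen_ball hψloc.continuousOn (fun z h1 h2 => hψ z h2 h1) hy hyW
      (hψloc.ne_zero hy)
  have hψc : ContinuousAt ψ x := hψloc.continuousAt isOpen_ball (mem_ball_self hδ₁)
  have hpairW : polygon {p, q} ⊆ polygon W := by
    rintro z ⟨hz, a, ha, h1⟩
    refine ⟨hz, ?_⟩
    rw [h1, Finset.sum_pair hs.2.2.1]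
    exact add_mem_cone (smul_mem_cone (mem_cone_of_mem hs.1) (ha p (by simp)))
      (smul_mem_cone (mem_cone_of_mem hs.2.1) (ha q (by simp)))
  -- The closed side with a neighbourhood of `x` removed. Its endpoints go to `V` and its interior
  -- is mapped injectively, so its image misses `ψ x`.
  have hcomp : IsCompact (polygon {p, q} \ ball (‖x‖⁻¹ • x) (δ₁ / ‖x‖)) := by
    obtain ⟨u, hu⟩ := h.convex.hemisphere
    refine (isCompact_polygon (isClosed_cone (u := u) fun w hw => ?_)).diff isOpen_ball
    rcases Finset.mem_insert.1 hw with rfl | hw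
    · exact hu _ hs.1
    · rw [Finset.mem_singleton.1 hw]; exact hu _ hs.2.1
  have hcl := (hcomp.image_of_continuousOn
    (h.continuousOn.mono (sdiff_subset.trans hpairW))).isClosed
  have hnot : ψ x ∉ φ '' (polygon {p, q} \ ball (‖x‖⁻¹ • x) (δ₁ / ‖x‖)) := by
    rintro ⟨z, ⟨⟨hz1, a, ha, hza⟩, hzb⟩, hzx⟩
    rw [Finset.sum_pair hs.2.2.1] at hza
    have hap := ha p (by simp)
    have haq := ha q (by simp)
    rw [hψx] at hzx
    have hn1 := h.convex.norm_eq_one p hs.1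
    have hn2 := h.convex.norm_eq_one q hs.2.1
    rcases hap.eq_or_lt with hap | hap
    · rw [← hap, zero_smul, zero_add] at hza
      have : a q = 1 := by
        rw [hza, norm_smul, hn2, mul_one, Real.norm_of_nonneg haq] at hz1; exact hz1
      rw [this, one_smul] at hza
      exact h.radial_side_notMem hdec hs hx (by rw [← hzx, hza]; exact h.vertex q hs.2.1)
    rcases haq.eq_or_lt with haq | haq
    · rw [← haq, zero_smul, add_zero] at hza
      have : a p = 1 := by
        rw [hza, norm_smul, hn1, mul_one, Real.norm_of_nonneg hap.le] at hz1; exact hz1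
      rw [this, one_smul] at hza
      exact h.radial_side_notMem hdec hs hx (by rw [← hzx, hza]; exact h.vertex p hs.1)
    have := hinj (⟨hz1, a p, a q, hap, haq, hza⟩ : z ∈ openArc p q)
      (normalize_mem_openArc hx hx0) hzx
    rw [this] at hzb
    exact hzb (mem_ball_self (div_pos hδ₁ hxn))
  have hcl2 : IsClosed ((V : Set S) ∪ ⋃₀ (𝓔 \ {e})) := hdec.isClosed_biUnion sdiff_subset
  have hnot2 : ψ x ∉ (V : Set S) ∪ ⋃₀ (𝓔 \ {e}) := by
    rintro (hV | ⟨e', ⟨he', hne⟩, hxe'⟩)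
    · exact hψV x (mem_ball_self hδ₁) hV
    · refine disjoint_left.1 (hdec.disjoint he' hmem hne) hxe' ?_
      rw [hψx]
      exact radial_mem_image_openArc φ hx hx0
  have hev : ∀ᶠ y in 𝓝 x, y ∈ ball x δ₁ ∧ ((0 ≤ ⟪m, y⟫ → y ∈ cone W) ∧
      (0 < ⟪m, y⟫ → y ∈ openCone W)) ∧ ψ y ∉ (V : Set S) ∪ ⋃₀ (𝓔 \ {e}) ∧
      ψ y ∉ φ '' (polygon {p, q} \ ball (‖x‖⁻¹ • x) (δ₁ / ‖x‖)) :=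
    Filter.Eventually.and (ball_mem_nhds x hδ₁)
      ((h.convex.eventually_mem_of_side hs hx).and
      ((hψc.eventually_mem (hcl2.isOpen_compl.mem_nhds hnot2)).and
        (hψc.eventually_mem (hcl.isOpen_compl.mem_nhds hnot))))
  obtain ⟨δ, hδ, hball⟩ := Metric.eventually_nhds_iff_ball.1 hev
  have hsub : ∀ y ∈ ball x δ, y ∈ ball x δ₁ := fun y hy => (hball y hy).1
  refine ⟨δ, ψ, hδ, fun y hy z hz => hiso y (hsub y hy) z (hsub z hz),
    fun y hy => hψV y (hsub y hy), fun y hy hmy => ?_, fun y hy => (hball y hy).2.1.2,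
    fun y hy hmy => ?_⟩
  · have := (hball y hy).2.1.1 hmy
    exact ⟨this, hψcone y (hsub y hy) this⟩
  · rintro (hV | ⟨e', he', hye'⟩)
    · exact hψV y (hsub y hy) hV
    · by_cases hee : e' = e
      · rw [hee] at hye'
        obtain ⟨z, hz, hzy⟩ := hye'
        have hzpair : z ∈ polygon {p, q} := by
          obtain ⟨h1, a, b, ha, hb, h2⟩ := hz
          exact ⟨h1, arcCone_subset_cone (by simp) (by simp) ⟨a, b, ha, hb, h2⟩⟩
        have hzb : z ∈ ball (‖x‖⁻¹ • x) (δ₁ / ‖x‖) := by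
          by_contra hzb
          exact (hball y hy).2.2.2 ⟨z, ⟨hzpair, hzb⟩, hzy⟩
        have hz' : ‖x‖ • z ∈ ball x δ₁ := by
          have h1 : ‖x‖ • z - x = ‖x‖ • (z - ‖x‖⁻¹ • x) := by
            rw [smul_sub, smul_smul, mul_inv_cancel₀ hxn.ne', one_smul]
          rw [mem_ball, dist_eq_norm, h1, norm_smul, norm_norm]
          rw [mem_ball, dist_eq_norm, lt_div_iff₀ hxn] at hzb
          linarith
        have h2 : ψ (‖x‖ • z) = φ z := by
          rw [hψcone _ hz' (smul_mem_cone (hpairW hzpair).2 hxn.le), radial_smul _ _ hxn,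
            radial_of_norm_eq_one _ hz.1]
        have h3 := hiso y (hsub y hy) _ hz'
        rw [h2, hzy, dist_self] at h3
        obtain ⟨-, r, hr, hyr⟩ := angle_eq_zero_iff.1 h3.symm
        have h4 : ⟪m, ‖x‖ • z⟫ = 0 := by
          rw [real_inner_smul_right, hs.inner_arcCone hz.2, mul_zero]
        rw [hyr, real_inner_smul_right] at h4
        rcases mul_eq_zero.1 h4 with h5 | h5 <;> linarith
      · exact (hball y hy).2.2.1 (Or.inr ⟨e', ⟨he', hee⟩, hye'⟩)

/-- `ψ` is a common isometric extension to `ball c δ` of the cells `(W₁, φ₁)` and `(W₂, φ₂)`, which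
lie on different sides of the plane with normal `m`. -/
structure IsGlued (V : Finset S) (W₁ : Finset E3) (φ₁ : E3 → S) (W₂ : Finset E3) (φ₂ : E3 → S)
    (m c : E3) (δ : ℝ) (ψ : E3 → S) : Prop where
  pos : 0 < δ
  dist_eq : ∀ y ∈ ball c δ, ∀ z ∈ ball c δ, dist (ψ y) (ψ z) = angle y z
  notMem : ∀ y ∈ ball c δ, ψ y ∉ V
  left : ∀ y ∈ ball c δ, 0 ≤ ⟪m, y⟫ → y ∈ cone W₁ ∧ ψ y = radial φ₁ y
  right : ∀ y ∈ ball c δ, ⟪m, y⟫ ≤ 0 → y ∈ cone W₂ ∧ ψ y = radial φ₂ y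

section

variable {W₁ W₂ : Finset E3} {φ₁ φ₂ ψ : E3 → S} {m c : E3} {δ : ℝ}

lemma IsGlued.locIso (h : IsGlued V W₁ φ₁ W₂ φ₂ m c δ ψ) : LocIso ψ (ball c δ) :=
  locIso_of_forall_dist_eq h.dist_eq

lemma IsGlued.recenter (h : IsGlued V W₁ φ₁ W₂ φ₂ m c δ ψ) {x : E3} (hx : x ∈ ball c δ) :
    IsGlued V W₁ φ₁ W₂ φ₂ m x (δ - dist x c) ψ := by
  have hsub : ball x (δ - dist x c) ⊆ ball c δ := ball_subset_ball' (by linarith)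
  exact ⟨sub_pos.2 hx, fun y hy z hz => h.dist_eq y (hsub hy) z (hsub hz),
    fun y hy => h.notMem y (hsub hy), fun y hy => h.left y (hsub hy),
    fun y hy => h.right y (hsub hy)⟩

end

/-- A component `k` of `m'` orthogonal to `m` would let `⟪m', ·⟫` change sign inside the half-space,
as moving along `k` does not change `⟪m, ·⟫`. -/
lemma exists_eq_neg_smul {m m' : E3} (hm : m ≠ 0) (h : ∀ v, ⟪m, v⟫ < 0 → 0 < ⟪m', v⟫) :
    ∃ r : ℝ, 0 < r ∧ m' = -(r • m) := by
  have hmm : 0 < ⟪m, m⟫ := real_inner_self_pos.2 hm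
  set k := m' - (⟪m, m'⟫ / ⟪m, m⟫) • m with hk
  have hmk : ⟪m, k⟫ = 0 := by
    rw [hk, inner_sub_right, real_inner_smul_right, div_mul_cancel₀ _ hmm.ne', sub_self]
  have hm'k : ⟪m', k⟫ = ⟪k, k⟫ := by
    have : m' = k + (⟪m, m'⟫ / ⟪m, m⟫) • m := by rw [hk]; abel
    rw [this, inner_add_left, real_inner_smul_left, hmk, mul_zero, add_zero]
  have h1 : ∀ s : ℝ, 0 < -⟪m', m⟫ - s * ⟪k, k⟫ := by
    intro s
    have := h (-m - s • k) (by
      rw [inner_sub_right, inner_neg_right, real_inner_smul_right, hmk]; linarith)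
    rwa [inner_sub_right, inner_neg_right, real_inner_smul_right, hm'k] at this
  have hk0 : k = 0 := by
    by_contra hk0
    have hkk : 0 < ⟪k, k⟫ := real_inner_self_pos.2 hk0
    have := h1 (-⟪m', m⟫ / ⟪k, k⟫)
    rw [div_mul_cancel₀ _ hkk.ne', sub_self] at this
    exact this.false
  have h2 := h1 0
  rw [zero_mul, sub_zero, real_inner_comm] at h2
  refine ⟨-(⟪m, m'⟫ / ⟪m, m⟫), ?_, ?_⟩
  · rw [← neg_div]; exact div_pos h2 hmm
  · rw [neg_smul, neg_neg]; exact sub_eq_zero.1 (hk ▸ hk0)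

lemma IsSide.of_eq_neg_smul {W : Finset E3} {p q m m' : E3} (hs : IsSide W p q m') {r : ℝ}
    (hr : 0 < r) (h : m' = -(r • m)) : IsSide W p q (-m) := by
  have key : ∀ y, ⟪m', y⟫ = r * ⟪-m, y⟫ := fun y => by
    rw [h, inner_neg_left, inner_neg_left, real_inner_smul_left]; ring
  obtain ⟨h1, h2, h3, h4, h5, h6⟩ := hs
  refine ⟨h1, h2, h3, ?_, ?_, fun w hw hp hq => ?_⟩
  · rw [key] at h4; exact (mul_eq_zero.1 h4).resolve_left hr.ne'
  · rw [key] at h5; exact (mul_eq_zero.1 h5).resolve_left hr.ne'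
  · have := h6 w hw hp hq
    rw [key] at this
    exact pos_of_mul_pos_right this hr.le

/-- The half-ball beyond the side is connected and misses the skeleton, so it lies in one cell. The
point `x` is on the boundary of that cell and does not go to `V`, hence lies on a side, whose normal
must be a negative multiple of `m`. -/
lemma IsCell.exists_isGlued (hd : IsSphericalConeMetric V) (hdec : IsConvexDecomposition V 𝓔)
    {W : Finset E3} {φ : E3 → S} (h : IsCell V 𝓔 W φ) {p q m x : E3} (hs : IsSide W p q m)
    (hx : x ∈ arcCone p q) :
    ∃ W₂ φ₂ p₂ q₂ δ ψ, IsCell V 𝓔 W₂ φ₂ ∧ IsSide W₂ p₂ q₂ (-m) ∧ x ∈ arcCone p₂ q₂ ∧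
      IsGlued V W φ W₂ φ₂ m x δ ψ := by
  obtain ⟨δ, ψ, hψ⟩ := h.exists_sideExtension hd hdec hs hx
  have hm := hs.ne_zero h.convex
  have hmm : 0 < ⟪m, m⟫ := real_inner_self_pos.2 hm
  have hmx := hs.inner_arcCone hx
  have hx0 := hs.ne_zero_of_mem_arcCone h.convex hx
  set H := ball x δ ∩ {y | ⟪m, y⟫ < 0} with hH
  have hHo : IsOpen H := isOpen_ball.inter (isOpen_lt (by fun_prop) continuous_const)
  have hHc : Convex ℝ H := (convex_ball x δ).inter
    (convex_halfSpace_lt (f := fun y => ⟪m, y⟫) (innerₛₗ ℝ m).isLinear 0)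
  have hbnd : ∀ y ∈ ball x δ, ⟪m, y⟫ = 0 → ∀ᶠ t : ℝ in 𝓝[>] 0, y + t • -m ∈ H := by
    intro y hy hmy
    filter_upwards [(tendsto_add_smul y (-m)).eventually_mem (isOpen_ball.mem_nhds hy),
      self_mem_nhdsWithin] with t ht ht0
    refine ⟨ht, ?_⟩
    have : ⟪m, y + t • -m⟫ = -(t * ⟪m, m⟫) := by
      rw [inner_add_right, hmy, real_inner_smul_right, inner_neg_right]; ring
    rw [mem_ofPred_eq, this]
    have := mul_pos ht0 hmm
    linarith
  have hxb : x ∈ ball x δ := mem_ball_self hψ.pos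
  obtain ⟨t₀, hy₀⟩ := (hbnd x hxb hmx).exists
  set y₀ := x + t₀ • -m with hy₀def
  have hψH : LocIso ψ H := hψ.locIso.mono inter_subset_left
  obtain ⟨W₂, φ₂, h₂, hy₀W, heq⟩ := hdec.exists_cell hd hHo hψH hy₀
    (hψ.notMem_skeleton y₀ hy₀.1 hy₀.2)
  obtain ⟨hHW, -⟩ := h₂.subset_openCone hd hHo hHc hψH
    (fun y hy => hψ.notMem_skeleton y hy.1 hy.2) hy₀ hy₀W heq
  have hagree : ∀ y ∈ ball x δ, y ∈ cone W₂ → ψ y = radial φ₂ y := fun y hy hyW =>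
    h₂.eq_radial_of_mem_cone isOpen_ball hψ.locIso.continuousOn (fun z hz hzW =>
      LocIso.eq_of_eventually_eq hd (isOpen_ball.inter h₂.convex.isOpen_openCone)
        ((convex_ball x δ).inter (convex_openCone W₂)).isPreconnected
        (hψ.locIso.mono inter_subset_left) (h₂.radial_locIso_openCone.mono inter_subset_right)
        (fun y hy => hψ.notMem y hy.1) ⟨hy₀.1, hy₀W⟩ heq z ⟨hz, hzW⟩) hy hyW
      (hψ.locIso.ne_zero hy)
  have hright : ∀ y ∈ ball x δ, ⟪m, y⟫ ≤ 0 → y ∈ cone W₂ := by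
    intro y hy hmy
    rcases hmy.lt_or_eq with hmy | hmy
    · exact openCone_subset_cone _ (hHW ⟨hy, hmy⟩)
    · exact h₂.convex.isClosed_cone.mem_of_tendsto (tendsto_add_smul y (-m))
        ((hbnd y hy hmy).mono fun t ht => openCone_subset_cone _ (hHW ht))
  have hxW₂ := hright x hxb hmx.le
  have hψx : ψ x = radial φ₂ x := hagree x hxb hxW₂
  have hψx' : ψ x = radial φ x := (hψ.mem_cone x hxb hmx.ge).2
  have hxo : x ∉ openCone W₂ := fun hxo => h₂.radial_notMem_skeleton hxo (by
    rw [← hψx, hψx']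
    exact h.radial_mem_skeleton (arcCone_subset_cone hs.1 hs.2.1 hx)
      (hs.notMem_openCone h.convex hx) hx0)
  rcases h₂.convex.side_or_vertex hxW₂ hxo hx0 with ⟨w, hw, r, hr, hxw⟩ | ⟨p₂, q₂, m₂, hs₂, hx₂⟩
  · refine absurd ?_ (hψ.notMem x hxb)
    rw [hψx, hxw, radial_smul _ _ hr, radial_of_norm_eq_one _ (h₂.convex.norm_eq_one w hw)]
    exact h₂.vertex w hw
  · obtain ⟨r, hr, hrm⟩ := exists_eq_neg_smul hm (m' := m₂) fun v hv => by
      obtain ⟨t, ht, ht0⟩ := (((tendsto_add_smul x v).eventually_mem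
        (isOpen_ball.mem_nhds hxb)).and self_mem_nhdsWithin).exists
      have h1 : ⟪m, x + t • v⟫ < 0 := by
        rw [inner_add_right, hmx, real_inner_smul_right, zero_add]
        exact mul_neg_of_pos_of_neg ht0 hv
      have h2 := h₂.convex.inner_pos_of_side hs₂ (hHW ⟨ht, h1⟩)
      rw [inner_add_right, hs₂.inner_arcCone hx₂, real_inner_smul_right, zero_add] at h2
      exact pos_of_mul_pos_right h2 (le_of_lt ht0)
    exact ⟨W₂, φ₂, p₂, q₂, δ, ψ, h₂, hs₂.of_eq_neg_smul hr hrm, hx₂, hψ.pos, hψ.dist_eq, hψ.notMem,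
      hψ.mem_cone, fun y hy hmy => ⟨hright y hy hmy, hagree y hy (hright y hy hmy)⟩⟩

/-- The extension across the side at `x` agrees with a gluing at a nearby point by unique
continuation, first on the side of `W₁`, then on the overlap, and finally on `W₂`. So the neighbour
does not change along the side. -/
lemma IsGlued.of_mem_closure (hd : IsSphericalConeMetric V) (hdec : IsConvexDecomposition V 𝓔)
    {W₁ W₂ : Finset E3} {φ₁ φ₂ : E3 → S} (h₁ : IsCell V 𝓔 W₁ φ₁) (h₂ : IsCell V 𝓔 W₂ φ₂)
    {p q p₂ q₂ m x : E3} (hs : IsSide W₁ p q m) (hs₂ : IsSide W₂ p₂ q₂ (-m))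
    (hx : x ∈ arcCone p q) (hx₂ : x ∈ arcCone p₂ q₂)
    (hcl : x ∈ closure {x | ∃ c δ ψ, ⟪m, c⟫ = 0 ∧ IsGlued V W₁ φ₁ W₂ φ₂ m c δ ψ ∧ x ∈ ball c δ}) :
    ∃ δ ψ, IsGlued V W₁ φ₁ W₂ φ₂ m x δ ψ := by
  have hm := hs.ne_zero h₁.convex
  have hmm : 0 < ⟪m, m⟫ := real_inner_self_pos.2 hm
  have hmx := hs.inner_arcCone hx
  obtain ⟨δ₁, ψ, hψ⟩ := h₁.exists_sideExtension hd hdec hs hx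
  obtain ⟨δ₂, hδ₂, hball⟩ :=
    Metric.eventually_nhds_iff_ball.1 (h₂.convex.eventually_mem_of_side hs₂ hx₂)
  replace hψ := hψ.mono (lt_min hψ.pos hδ₂) (min_le_left _ _)
  set δ := min δ₁ δ₂ with hδ
  have hball' : ∀ y ∈ ball x δ, (⟪m, y⟫ ≤ 0 → y ∈ cone W₂) ∧ (⟪m, y⟫ < 0 → y ∈ openCone W₂) := by
    intro y hy
    have := hball y (ball_subset_ball (min_le_right _ _) hy)
    rwa [inner_neg_left, neg_nonneg, neg_pos] at this
  obtain ⟨x', hx'b, c, δ', ψ', hmc, hψ', hx'c⟩ := mem_closure_iff.1 hcl (ball x δ) isOpen_ball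
    (mem_ball_self hψ.pos)
  -- Projection to the plane of the side stays within both balls, since their centres lie in this
  -- plane. Both sides of the plane are then reached inside the overlap.
  set k := x' - (⟪m, x'⟫ / ⟪m, m⟫) • m with hk
  have hmk : ⟪m, k⟫ = 0 := by
    rw [hk, inner_sub_right, real_inner_smul_right, div_mul_cancel₀ _ hmm.ne', sub_self]
  have hproj : ∀ y, ⟪m, y⟫ = 0 → dist k y ≤ dist x' y := by
    intro y hy
    rw [dist_eq_norm, dist_eq_norm]
    have h1 : x' - y = (k - y) + (⟪m, x'⟫ / ⟪m, m⟫) • m := by rw [hk]; abel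
    have h2 : ⟪k - y, (⟪m, x'⟫ / ⟪m, m⟫) • m⟫ = 0 := by
      rw [real_inner_smul_right, show ⟪k - y, m⟫ = ⟪m, k - y⟫ from real_inner_comm _ _,
        inner_sub_right, hmk, hy]; simp
    have h3 := norm_add_sq_eq_norm_sq_add_norm_sq_of_inner_eq_zero _ _ h2
    rw [← h1] at h3
    nlinarith [norm_nonneg (k - y), norm_nonneg (x' - y), norm_nonneg ((⟪m, x'⟫ / ⟪m, m⟫) • m)]
  have hkB : k ∈ ball x δ ∩ ball c δ' :=
    ⟨(hproj x hmx).trans_lt hx'b, (hproj c hmc).trans_lt hx'c⟩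
  have hBo : IsOpen (ball x δ ∩ ball c δ') := isOpen_ball.inter isOpen_ball
  have hin : ∀ v, ∀ᶠ t : ℝ in 𝓝[>] 0, k + t • v ∈ ball x δ ∩ ball c δ' := fun v =>
    (tendsto_add_smul k v).eventually_mem (hBo.mem_nhds hkB)
  obtain ⟨t₁, ht₁, ht₁0⟩ := ((hin m).and self_mem_nhdsWithin).exists
  obtain ⟨t₂, ht₂, ht₂0⟩ := ((hin (-m)).and self_mem_nhdsWithin).exists
  have hpos : 0 < ⟪m, k + t₁ • m⟫ := by
    rw [inner_add_right, hmk, real_inner_smul_right, zero_add]; exact mul_pos ht₁0 hmm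
  have hneg : ⟪m, k + t₂ • -m⟫ < 0 := by
    rw [inner_add_right, hmk, real_inner_smul_right, zero_add, inner_neg_right]
    have := mul_pos ht₂0 hmm
    linarith
  have hψψ' : ∀ y ∈ ball x δ ∩ ball c δ', ψ y = ψ' y := by
    refine LocIso.eq_of_eventually_eq hd hBo
      ((convex_ball x δ).inter (convex_ball c δ')).isPreconnected
      (hψ.locIso.mono inter_subset_left) (hψ'.locIso.mono inter_subset_right)
      (fun y hy => hψ.notMem y hy.1) ht₁ ?_
    filter_upwards [hBo.mem_nhds ht₁,
      (isOpen_lt (f := fun _ => (0 : ℝ)) (g := fun y => ⟪m, y⟫) continuous_const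
        (by fun_prop)).mem_nhds hpos] with y hy hy0
    rw [(hψ.mem_cone y hy.1 (le_of_lt hy0)).2, (hψ'.left y hy.2 (le_of_lt hy0)).2]
  have hagree : ∀ y ∈ ball x δ, y ∈ openCone W₂ → ψ y = radial φ₂ y := fun y hy hyW => by
    refine LocIso.eq_of_eventually_eq hd (isOpen_ball.inter h₂.convex.isOpen_openCone)
      ((convex_ball x δ).inter (convex_openCone W₂)).isPreconnected
      (hψ.locIso.mono inter_subset_left) (h₂.radial_locIso_openCone.mono inter_subset_right)
      (fun y hy => hψ.notMem y hy.1) ⟨ht₂.1, (hball' _ ht₂.1).2 hneg⟩ ?_ y ⟨hy, hyW⟩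
    filter_upwards [hBo.mem_nhds ht₂,
      (isOpen_lt (f := fun y => ⟪m, y⟫) (g := fun _ => (0 : ℝ)) (by fun_prop)
        continuous_const).mem_nhds hneg] with y hy hy0
    rw [hψψ' y hy, (hψ'.right y hy.2 (le_of_lt hy0)).2]
  refine ⟨δ, ψ, hψ.pos, hψ.dist_eq, hψ.notMem, hψ.mem_cone, fun y hy hmy => ?_⟩
  have hyW := (hball' y hy).1 hmy
  exact ⟨hyW, h₂.eq_radial_of_mem_cone isOpen_ball hψ.locIso.continuousOn hagree hy hyW
    (hψ.locIso.ne_zero hy)⟩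

lemma IsConvexPolygon.exists_eq_add_of_inner_eq_zero {W : Finset E3} (hW : IsConvexPolygon W)
    {p q m y : E3} (hs : IsSide W p q m) (hy : ⟪m, y⟫ = 0) : ∃ a b : ℝ, y = a • p + b • q := by
  obtain ⟨r, hr, hrp, hrq⟩ := hW.exists_third p q
  obtain ⟨f, g, k, -, -, -, hsum, -⟩ :=
    hW.exists_coords hs.1 hs.2.1 hr hs.2.2.1 hrp.symm hrq.symm
  refine ⟨f y, g y, ?_⟩
  have h1 := congrArg (fun z => ⟪m, z⟫) (hsum y)
  simp only [inner_add_right, real_inner_smul_right, hs.2.2.2.1, hs.2.2.2.2.1, hy] at h1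
  have h2 : k y = 0 := by
    have := hs.2.2.2.2.2 r hr hrp hrq
    have h3 : k y * ⟪m, r⟫ = 0 := by linarith
    exact (mul_eq_zero.1 h3).resolve_right this.ne'
  conv_lhs => rw [hsum y, h2, zero_smul, add_zero]

lemma IsConvexPolygon.eq_and_eq_of_relation {W : Finset E3} (hW : IsConvexPolygon W)
    {p q m : E3} (hs : IsSide W p q m) {a b a' b' : ℝ} (h : a • p + b • q = a' • p + b' • q) :
    a = a' ∧ b = b' := by
  obtain ⟨r, hr, hrp, hrq⟩ := hW.exists_third p q
  obtain ⟨f, g, k, -, -, -, -, hval⟩ :=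
    hW.exists_coords hs.1 hs.2.1 hr hs.2.2.1 hrp.symm hrq.symm
  have h1 := hval a b 0
  have h2 := hval a' b' 0
  rw [h] at h1
  exact ⟨h1.1.symm.trans h2.1, h1.2.1.symm.trans h2.2.1⟩

lemma eq_of_pos_smul_eq {x y : E3} (hx : ‖x‖ = 1) (hy : ‖y‖ = 1) {r : ℝ} (hr : 0 < r)
    (h : x = r • y) : x = y := by
  rw [h, norm_smul, hy, mul_one, Real.norm_of_nonneg hr.le] at hx
  rw [h, hx, one_smul]

/-- The two-by-two system for `p₂` and `q₂` is inverted: its determinant `Δ` is positive, and unless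
`α` and `β'` vanish, `p` or `q` would be interior to the second arc. -/
lemma endpoints_eq_aux {p q p₂ q₂ : E3} (hp : ‖p‖ = 1) (hq : ‖q‖ = 1) (hp₂n : ‖p₂‖ = 1)
    (hq₂n : ‖q₂‖ = 1) {α β α' β' c d : ℝ} (hp₂ : p₂ = α • p + β • q)
    (hq₂ : q₂ = α' • p + β' • q) (hc : 0 < c) (hd : 0 < d) (ha : 0 < c * α + d * α')
    (hb : 0 < c * β + d * β') (hα : α ≤ 0) (h1 : ¬ (0 < α' ∧ 0 < β'))
    (hp' : p ∉ arcCone p₂ q₂) (hq' : q ∉ arcCone p₂ q₂) : p₂ = q ∧ q₂ = p := by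
  have hα' : 0 < α' := by
    by_contra! h; nlinarith [mul_nonneg hc.le (neg_nonneg.2 hα), mul_nonneg hd.le (neg_nonneg.2 h)]
  have hβ' : β' ≤ 0 := not_lt.1 fun h => h1 ⟨hα', h⟩
  have hβ : 0 < β := by
    by_contra! h; nlinarith [mul_nonneg hc.le (neg_nonneg.2 h), mul_nonneg hd.le (neg_nonneg.2 hβ')]
  have hdet : 0 < α' * β - α * β' := by
    have e1 : 0 ≤ c * -α := mul_nonneg hc.le (neg_nonneg.2 hα)
    have e2 : 0 ≤ d * -β' := mul_nonneg hd.le (neg_nonneg.2 hβ')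
    have e3 : (c * -α) * (d * -β') < (d * α') * (c * β) :=
      mul_lt_mul'' (by linarith) (by linarith) e1 e2
    have e4 : 0 < (c * d) * (α' * β - α * β') := by nlinarith
    exact pos_of_mul_pos_right e4 (mul_pos hc hd).le
  set Δ := α' * β - α * β' with hΔ
  have ep : p = (-β' / Δ) • p₂ + (β / Δ) • q₂ := by
    have : (-β' / Δ) • p₂ + (β / Δ) • q₂ = (Δ / Δ) • p := by
      rw [hp₂, hq₂, hΔ]; module
    rw [this, div_self hdet.ne', one_smul]
  have eq : q = (α' / Δ) • p₂ + (-α / Δ) • q₂ := by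
    have : (α' / Δ) • p₂ + (-α / Δ) • q₂ = (Δ / Δ) • q := by
      rw [hp₂, hq₂, hΔ]; module
    rw [this, div_self hdet.ne', one_smul]
  have hβ0 : β' = 0 := by
    by_contra h
    exact hp' ⟨_, _, div_pos (neg_pos.2 (hβ'.lt_of_ne h)) hdet, div_pos hβ hdet, ep⟩
  have hα0 : α = 0 := by
    by_contra h
    exact hq' ⟨_, _, div_pos hα' hdet, div_pos (neg_pos.2 (hα.lt_of_ne h)) hdet, eq⟩
  rw [hα0, zero_smul, zero_add] at hp₂
  rw [hβ0, zero_smul, add_zero] at hq₂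
  exact ⟨eq_of_pos_smul_eq hp₂n hq hβ hp₂, eq_of_pos_smul_eq hq₂n hp hα' hq₂⟩

/-- Overlapping arcs of one great circle, neither of which contains an endpoint of the other in its
interior, have the same endpoints. -/
lemma endpoints_eq {W W₂ : Finset E3} (hW : IsConvexPolygon W) (hW₂ : IsConvexPolygon W₂)
    {p q p₂ q₂ m x : E3} (hs : IsSide W p q m) (hs₂ : IsSide W₂ p₂ q₂ (-m))
    (hx : x ∈ arcCone p q) (hx₂ : x ∈ arcCone p₂ q₂) (hp : p ∉ arcCone p₂ q₂)
    (hq : q ∉ arcCone p₂ q₂) (hp₂ : p₂ ∉ arcCone p q) (hq₂ : q₂ ∉ arcCone p q) :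
    IsSide W₂ p q (-m) := by
  have hn := hW.norm_eq_one
  have hn₂ := hW₂.norm_eq_one
  have e1 : ⟪m, p₂⟫ = 0 := by simpa using hs₂.2.2.2.1
  have e2 : ⟪m, q₂⟫ = 0 := by simpa using hs₂.2.2.2.2.1
  obtain ⟨α, β, h1⟩ := hW.exists_eq_add_of_inner_eq_zero hs e1
  obtain ⟨α', β', h2⟩ := hW.exists_eq_add_of_inner_eq_zero hs e2
  obtain ⟨a, b, ha, hb, hxab⟩ := hx
  obtain ⟨c, d, hc, hd, hxcd⟩ := hx₂
  have h3 : a • p + b • q = (c * α + d * α') • p + (c * β + d * β') • q := by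
    rw [← hxab, hxcd, h1, h2]; module
  obtain ⟨h4, h5⟩ := hW.eq_and_eq_of_relation hs h3
  rw [h4] at ha
  rw [h5] at hb
  have h6 : ¬ (0 < α ∧ 0 < β) := fun h => hp₂ ⟨α, β, h.1, h.2, h1⟩
  have h7 : ¬ (0 < α' ∧ 0 < β') := fun h => hq₂ ⟨α', β', h.1, h.2, h2⟩
  by_cases hα : 0 < α
  · have hβ : β ≤ 0 := not_lt.1 fun h => h6 ⟨hα, h⟩
    obtain ⟨h8, h9⟩ := endpoints_eq_aux (hn q hs.2.1) (hn p hs.1) (hn₂ _ hs₂.1) (hn₂ _ hs₂.2.1)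
      (by rw [h1, add_comm]) (by rw [h2, add_comm]) hc hd hb ha hβ (fun h => h7 h.symm) hq hp
    rw [← h8, ← h9]; exact hs₂
  · obtain ⟨h8, h9⟩ := endpoints_eq_aux (hn p hs.1) (hn q hs.2.1) (hn₂ _ hs₂.1) (hn₂ _ hs₂.2.1)
      h1 h2 hc hd ha hb (not_lt.1 hα) h7 hp hq
    rw [← h8, ← h9]; exact hs₂.symm

/-- The cells `(W₁, φ₁)` and `(W₂, φ₂)` are adjacent along the side `p q`, with a common isometric
extension near each interior point of this side. -/
structure IsAdjacent (V : Finset S) (W₁ : Finset E3) (φ₁ : E3 → S) (W₂ : Finset E3) (φ₂ : E3 → S)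
    (p q m : E3) : Prop where
  left : IsSide W₁ p q m
  right : IsSide W₂ p q (-m)
  glued : ∀ x ∈ arcCone p q, ∃ δ ψ, IsGlued V W₁ φ₁ W₂ φ₂ m x δ ψ

lemma IsAdjacent.isDeveloped {W₁ W₂ : Finset E3} {φ₁ φ₂ : E3 → S} {p q m : E3}
    (h : IsAdjacent V W₁ φ₁ W₂ φ₂ p q m) : IsDeveloped W₁ φ₁ W₂ φ₂ p q := by
  refine ⟨⟨m, h.left, h.right⟩, fun x hx => ?_⟩
  obtain ⟨δ, ψ, hψ⟩ := h.glued x hx.2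
  refine ⟨δ, hψ.pos, fun y hy z hz hyx hzx => ?_⟩
  have h1 := (hψ.left y hyx (IsConvexPolygon.inner_nonneg_of_side h.left hy.2)).2
  have h2 := IsConvexPolygon.inner_nonneg_of_side h.right hz.2
  rw [inner_neg_left, neg_nonneg] at h2
  have h3 := (hψ.right z hzx h2).2
  rw [radial_of_norm_eq_one _ hy.1] at h1
  rw [radial_of_norm_eq_one _ hz.1] at h3
  rw [← h1, ← h3]
  exact hψ.dist_eq y hyx z hzx

lemma IsCell.radial_eq_of_segment {W₁ W₂ : Finset E3} {φ₁ φ₂ : E3 → S} (h₁ : IsCell V 𝓔 W₁ φ₁)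
    (h₂ : IsCell V 𝓔 W₂ φ₂) {x y : E3} (hy₁ : y ∈ cone W₁) (hy₂ : y ∈ cone W₂) (hy0 : y ≠ 0)
    {I : Set E3} (hI : I ⊆ (cone W₁ ∩ cone W₂) \ {0}) (h : ∀ z ∈ I, radial φ₁ z = radial φ₂ z)
    (hyI : ∀ t : ℝ, 0 < t → y + t • x ∈ I) : radial φ₁ y = radial φ₂ y := by
  have hev : ∀ᶠ t : ℝ in 𝓝[>] 0, y + t • x ∈ I := by
    filter_upwards [self_mem_nhdsWithin] with t ht using hyI t ht
  have ht := tendsto_add_smul y x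
  have t₁ : Tendsto (fun t : ℝ => radial φ₁ (y + t • x)) (𝓝[>] 0) (𝓝 (radial φ₁ y)) :=
    Tendsto.comp (g := radial φ₁) (f := fun t : ℝ => y + t • x)
      (h₁.radial_continuousOn y ⟨hy₁, hy0⟩)
      (tendsto_nhdsWithin_iff.2 ⟨ht, hev.mono fun t ht => ⟨(hI ht).1.1, (hI ht).2⟩⟩)
  have t₂ : Tendsto (fun t : ℝ => radial φ₂ (y + t • x)) (𝓝[>] 0) (𝓝 (radial φ₂ y)) :=
    Tendsto.comp (g := radial φ₂) (f := fun t : ℝ => y + t • x)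
      (h₂.radial_continuousOn y ⟨hy₂, hy0⟩)
      (tendsto_nhdsWithin_iff.2 ⟨ht, hev.mono fun t ht => ⟨(hI ht).1.2, (hI ht).2⟩⟩)
  exact tendsto_nhds_unique_of_eventuallyEq t₁ t₂ (hev.mono fun t ht => h _ ht)

lemma arcCone_add_smul_left {p q x : E3} (hx : x ∈ arcCone p q) {a b t : ℝ} (ha : 0 ≤ a)
    (hb : 0 ≤ b) (ht : 0 < t) : (a • p + b • q) + t • x ∈ arcCone p q := by
  obtain ⟨a', b', ha', hb', rfl⟩ := hx
  exact ⟨a + t * a', b + t * b', by positivity, by positivity, by module⟩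

/-- Every side of a cell is a side of another cell. -/
lemma IsCell.exists_isAdjacent (hd : IsSphericalConeMetric V) (hdec : IsConvexDecomposition V 𝓔)
    {W : Finset E3} {φ : E3 → S} (h : IsCell V 𝓔 W φ) {p q m : E3} (hs : IsSide W p q m) :
    ∃ W₂ φ₂, IsCell V 𝓔 W₂ φ₂ ∧ IsAdjacent V W φ W₂ φ₂ p q m := by
  have hx : p + q ∈ arcCone p q := ⟨1, 1, one_pos, one_pos, by simp⟩
  obtain ⟨W₂, φ₂, p₂, q₂, δ, ψ, h₂, hs₂, hx₂, hψ⟩ := h.exists_isGlued hd hdec hs hx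
  set G := {x | ∃ c δ ψ, ⟪m, c⟫ = 0 ∧ IsGlued V W φ W₂ φ₂ m c δ ψ ∧ x ∈ ball c δ} with hG
  have hGo : IsOpen G := by
    rw [isOpen_iff_mem_nhds]
    rintro y ⟨c, δ, ψ, hc, hψ, hy⟩
    exact Filter.mem_of_superset (isOpen_ball.mem_nhds hy) fun z hz => ⟨c, δ, ψ, hc, hψ, hz⟩
  -- The overlap of the two sides is convex, hence connected, and being glued is an open and closed
  -- condition on it.
  have hsub : arcCone p q ∩ arcCone p₂ q₂ ⊆ G := by
    refine ((convex_arcCone p q).inter (convex_arcCone p₂ q₂)).isPreconnected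
      |>.subset_of_closure_inter_subset hGo ⟨p + q, ⟨hx, hx₂⟩, p + q, δ, ψ,
        hs.inner_arcCone hx, hψ, mem_ball_self hψ.pos⟩ ?_
    rintro y ⟨hcl, hy, hy₂⟩
    obtain ⟨δ', ψ', hψ'⟩ := IsGlued.of_mem_closure hd hdec h h₂ hs hs₂ hy hy₂ hcl
    exact ⟨y, δ', ψ', hs.inner_arcCone hy, hψ', mem_ball_self hψ'.pos⟩
  have heq : ∀ y ∈ arcCone p q ∩ arcCone p₂ q₂, radial φ y = radial φ₂ y := by
    intro y hy
    obtain ⟨c, δ, ψ, -, hψ, hyc⟩ := hsub hy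
    rw [← (hψ.left y hyc (hs.inner_arcCone hy.1).ge).2,
      ← (hψ.right y hyc (hs.inner_arcCone hy.1).le).2]
  have hI : arcCone p q ∩ arcCone p₂ q₂ ⊆ (cone W ∩ cone W₂) \ {0} := fun y hy =>
    ⟨⟨arcCone_subset_cone hs.1 hs.2.1 hy.1, arcCone_subset_cone hs₂.1 hs₂.2.1 hy.2⟩,
      hs.ne_zero_of_mem_arcCone h.convex hy.1⟩
  have key : ∀ y : E3, (∃ a b : ℝ, 0 ≤ a ∧ 0 ≤ b ∧ y = a • p + b • q) →
      (∃ a b : ℝ, 0 ≤ a ∧ 0 ≤ b ∧ y = a • p₂ + b • q₂) → y ≠ 0 →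
      radial φ y = radial φ₂ y := by
    rintro y ⟨a, b, ha, hb, hy⟩ ⟨a', b', ha', hb', hy'⟩ hy0
    refine h.radial_eq_of_segment h₂ (x := p + q) ?_ ?_ hy0 hI heq fun t ht => ⟨?_, ?_⟩
    · rw [hy]; exact add_mem_cone (smul_mem_cone (mem_cone_of_mem hs.1) ha)
        (smul_mem_cone (mem_cone_of_mem hs.2.1) hb)
    · rw [hy']; exact add_mem_cone (smul_mem_cone (mem_cone_of_mem hs₂.1) ha')
        (smul_mem_cone (mem_cone_of_mem hs₂.2.1) hb')
    · rw [hy]; exact arcCone_add_smul_left hx ha hb ht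
    · rw [hy']; exact arcCone_add_smul_left hx₂ ha' hb' ht
  have hvert : ∀ {W : Finset E3} {φ : E3 → S}, IsCell V 𝓔 W φ → ∀ w ∈ W, radial φ w ∈ V :=
    fun h w hw => by
      rw [radial_of_norm_eq_one _ (h.convex.norm_eq_one w hw)]; exact h.vertex w hw
  -- Vertices go to `V` and interiors of sides do not, so a vertex of one cell cannot be interior to
  -- the side of the other. This makes the two sides equal.
  have hl : ∀ y, y = p ∨ y = q → y ∉ arcCone p₂ q₂ := by
    intro y hy hmem
    have hyW : y ∈ W := by rcases hy with rfl | rfl; exacts [hs.1, hs.2.1]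
    have hrep : ∃ a b : ℝ, 0 ≤ a ∧ 0 ≤ b ∧ y = a • p + b • q := by
      rcases hy with rfl | rfl
      exacts [⟨1, 0, one_pos.le, le_rfl, by simp⟩, ⟨0, 1, le_rfl, one_pos.le, by simp⟩]
    refine h₂.radial_side_notMem hdec hs₂ hmem ?_
    obtain ⟨a, b, ha, hb, hab⟩ := hmem
    rw [← key y hrep ⟨a, b, ha.le, hb.le, hab⟩
      (hs₂.ne_zero_of_mem_arcCone h₂.convex ⟨a, b, ha, hb, hab⟩)]
    exact hvert h y hyW
  have hr : ∀ y, y = p₂ ∨ y = q₂ → y ∉ arcCone p q := by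
    intro y hy hmem
    have hyW : y ∈ W₂ := by rcases hy with rfl | rfl; exacts [hs₂.1, hs₂.2.1]
    have hrep : ∃ a b : ℝ, 0 ≤ a ∧ 0 ≤ b ∧ y = a • p₂ + b • q₂ := by
      rcases hy with rfl | rfl
      exacts [⟨1, 0, one_pos.le, le_rfl, by simp⟩, ⟨0, 1, le_rfl, one_pos.le, by simp⟩]
    refine h.radial_side_notMem hdec hs hmem ?_
    obtain ⟨a, b, ha, hb, hab⟩ := hmem
    rw [key y ⟨a, b, ha.le, hb.le, hab⟩ hrep
      (hs.ne_zero_of_mem_arcCone h.convex ⟨a, b, ha, hb, hab⟩)]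
    exact hvert h₂ y hyW
  have hs' := endpoints_eq h.convex h₂.convex hs hs₂ hx hx₂ (hl p (Or.inl rfl)) (hl q (Or.inr rfl))
    (hr p₂ (Or.inl rfl)) (hr q₂ (Or.inr rfl))
  have harc : arcCone p q ⊆ arcCone p₂ q₂ := by
    have h3 := endpoints_eq h₂.convex h.convex hs₂ (by rwa [neg_neg]) hx₂ hx (hr p₂ (Or.inl rfl))
      (hr q₂ (Or.inr rfl)) (hl p (Or.inl rfl)) (hl q (Or.inr rfl))
    rw [neg_neg] at h3
    have hp₂ : p₂ = p ∨ p₂ = q := by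
      by_contra! hne
      exact (h3.2.2.2.1 ▸ hs.2.2.2.2.2 p₂ h3.1 hne.1 hne.2).false
    have hq₂ : q₂ = p ∨ q₂ = q := by
      by_contra! hne
      exact (h3.2.2.2.2.1 ▸ hs.2.2.2.2.2 q₂ h3.2.1 hne.1 hne.2).false
    have hne := h3.2.2.1
    rcases hp₂ with rfl | rfl <;> rcases hq₂ with rfl | rfl
    · exact absurd rfl hne
    · exact subset_rfl
    · rw [arcCone_comm]
    · exact absurd rfl hne
  refine ⟨W₂, φ₂, h₂, hs, hs', fun y hy => ?_⟩
  obtain ⟨c, δ, ψ, -, hψ, hyc⟩ := hsub ⟨hy, harc hy⟩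
  exact ⟨_, _, hψ.recenter hyc⟩

/-! ### Finiteness of the set of faces -/

/-- The set of faces of a decomposition. -/
def faceSet (V : Finset S) (𝓔 : Set (Set S)) : Set (Set S) :=
  {F | ∃ W φ, IsCell V 𝓔 W φ ∧ F = φ '' openPolygon W}

lemma IsCell.mem_face_of_radial {W : Finset E3} {φ : E3 → S} (h : IsCell V 𝓔 W φ) {y : E3}
    (hy : y ∈ openCone W) : radial φ y ∈ φ '' openPolygon W :=
  ⟨_, normalize_mem_openPolygon hy fun h0 => h.convex.zero_notMem_openCone (h0 ▸ hy), rfl⟩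

lemma IsCell.mem_openCone_of_notMem_skeleton {W : Finset E3} {φ : E3 → S} (h : IsCell V 𝓔 W φ)
    {y : E3} (hy : y ∈ cone W) (hy0 : y ≠ 0) (hs : radial φ y ∉ skeleton V 𝓔) : y ∈ openCone W := by
  by_contra hyo
  exact hs (h.radial_mem_skeleton hy hyo hy0)

/-- Each face has a side, which goes to one of finitely many edges. Near a point of an edge the
surface is covered by two glued cells, so a face with a side on this edge is one of these two. -/
lemma IsConvexDecomposition.finite_faceSet (hd : IsSphericalConeMetric V)
    (hdec : IsConvexDecomposition V 𝓔) : (faceSet V 𝓔).Finite := by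
  have hsub : faceSet V 𝓔 ⊆ ⋃ e ∈ 𝓔, {F | ∃ W φ p q m, IsCell V 𝓔 W φ ∧ IsSide W p q m ∧
      φ '' openArc p q = e ∧ F = φ '' openPolygon W} := by
    rintro F ⟨W, φ, h, rfl⟩
    obtain ⟨p, q, m, hs⟩ := h.convex.exists_side
    exact mem_biUnion (h.side p q m hs).2 ⟨W, φ, p, q, m, h, hs, rfl, rfl⟩
  refine (hdec.finite.biUnion fun e _ => ?_).subset hsub
  rcases eq_empty_or_nonempty {F | ∃ W φ p q m, IsCell V 𝓔 W φ ∧ IsSide W p q m ∧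
      φ '' openArc p q = e ∧ F = φ '' openPolygon W} with hem | ⟨F, W, φ, p, q, m, h, hs, he, hF⟩
  · rw [hem]; exact finite_empty
  obtain ⟨W₂, φ₂, h₂, hadj⟩ := h.exists_isAdjacent hd hdec hs
  refine (toFinite {φ '' openPolygon W, φ₂ '' openPolygon W₂}).subset ?_
  rintro F' ⟨W', φ', p', q', m', h', hs', he', rfl⟩
  have hx : p + q ∈ arcCone p q := ⟨1, 1, one_pos, one_pos, by simp⟩
  obtain ⟨δ, ψ, hψ⟩ := hadj.glued _ hx
  have hxb : p + q ∈ ball (p + q) δ := mem_ball_self hψ.pos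
  have hx0 := hs.ne_zero_of_mem_arcCone h.convex hx
  have hψx := (hψ.left _ hxb (hs.inner_arcCone hx).ge).2
  obtain ⟨x', hx', hx'e⟩ : radial φ (p + q) ∈ φ' '' openArc p' q' := by
    rw [he', ← he]; exact radial_mem_image_openArc φ hx hx0
  have hN := hψ.locIso.image_mem_nhds hd isOpen_ball hxb (hψ.notMem _ hxb)
  rw [hψx, ← hx'e, ← radial_of_norm_eq_one φ' hx'.1] at hN
  have hx'W : x' ∈ cone W' := arcCone_subset_cone hs'.1 hs'.2.1 hx'.2
  have hx'0 : x' ≠ 0 := hs'.ne_zero_of_mem_arcCone h'.convex hx'.2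
  have hcl : x' ∈ closure (openCone W') := h'.convex.closure_openCone ▸ hx'W
  have := mem_closure_iff_nhdsWithin_neBot.1 hcl
  obtain ⟨y', ⟨y, hy, hyy'⟩, hy'W⟩ :=
    (((h'.tendsto_radial hx'W hx'0).eventually_mem hN).and self_mem_nhdsWithin).exists
  have hnot := h'.radial_notMem_skeleton hy'W
  have hmem := h'.mem_face_of_radial hy'W
  rw [← hyy'] at hnot hmem
  have hy0 := hψ.locIso.ne_zero hy
  rcases le_total 0 ⟪m, y⟫ with hmy | hmy
  · obtain ⟨h3, h4⟩ := hψ.left y hy hmy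
    rw [h4] at hnot hmem
    exact Or.inl (h'.image_eq_of_mem h hmem
      (h.mem_face_of_radial (h.mem_openCone_of_notMem_skeleton h3 hy0 hnot)))
  · obtain ⟨h3, h4⟩ := hψ.right y hy hmy
    rw [h4] at hnot hmem
    exact Or.inr (h'.image_eq_of_mem h₂ hmem
      (h₂.mem_face_of_radial (h₂.mem_openCone_of_notMem_skeleton h3 hy0 hnot)))

lemma exists_norm_eq_one : ∃ x : E3, ‖x‖ = 1 := ⟨EuclideanSpace.single 0 1, by simp⟩

/-- In a chart the complement of the skeleton is dense, so `s` is in the closure of the union of the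
faces. With finitely many faces it is in the closure of one, which is covered by the compact image
of a closed polygon. -/
lemma IsConvexDecomposition.exists_mem_polygon (hd : IsSphericalConeMetric V)
    (hdec : IsConvexDecomposition V 𝓔) {s : S} (hs : s ∉ V) :
    ∃ W φ z, IsCell V 𝓔 W φ ∧ z ∈ polygon W ∧ φ z = s := by
  obtain ⟨x, hx⟩ := exists_norm_eq_one
  obtain ⟨ℓ, g, δ, hg⟩ := exists_chart (hd.regular s hs) hs hx
  have hcl : s ∈ closure (⋃₀ faceSet V 𝓔) := by
    rw [_root_.mem_closure_iff]
    intro O hO hsO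
    have hUo := hg.emptyDisc.locIso.continuousOn.isOpen_inter_preimage (isOpen_D ℓ) hO
    obtain ⟨y, hy, hyn⟩ := hdec.exists_notMem_skeleton hUo
      ⟨x, hg.mem, by rwa [mem_preimage, hg.map_center]⟩
      (hg.emptyDisc.locIso.mono inter_subset_left) (fun y hy => hg.notMem y hy.1)
    obtain ⟨W, φ, h, hmem⟩ := hdec.faces _ hyn
    exact ⟨g y, hy.2, _, ⟨W, φ, h, rfl⟩, hmem⟩
  rw [sUnion_eq_biUnion, (hdec.finite_faceSet hd).closure_biUnion] at hcl
  obtain ⟨F, ⟨W, φ, h, rfl⟩, hsF⟩ := mem_iUnion₂.1 hcl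
  have hc : IsClosed (φ '' polygon W) :=
    ((isCompact_polygon h.convex.isClosed_cone).image_of_continuousOn h.continuousOn).isClosed
  have hsub : openPolygon W ⊆ polygon W := fun y hy => ⟨hy.1, openCone_subset_cone _ hy.2⟩
  obtain ⟨z, hz, hzs⟩ := closure_minimal (image_mono hsub) hc hsF
  exact ⟨W, φ, z, h, hz, hzs⟩

lemma IsConvexDecomposition.exists_side_image_eq (hd : IsSphericalConeMetric V)
    (hdec : IsConvexDecomposition V 𝓔) {e : Set S} (he : e ∈ 𝓔) :
    ∃ W φ p q m, IsCell V 𝓔 W φ ∧ IsSide W p q m ∧ φ '' openArc p q = e := by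
  obtain ⟨hdisj, γ, -, -, -, -, hγe⟩ := hdec.edge e he
  have hmem : γ (1 / 2) ∈ e := by
    rw [← hγe]
    exact mem_image_of_mem γ ⟨by norm_num, by norm_num⟩
  have hV : γ (1 / 2) ∉ V := fun h => disjoint_left.1 hdisj hmem h
  obtain ⟨W, φ, z, h, hz, hzs⟩ := hdec.exists_mem_polygon hd hV
  have hz0 : z ≠ 0 := by rintro rfl; simpa using hz.1
  have hzo : z ∉ openCone W := fun hzo => h.notMem_skeleton ⟨hz.1, hzo⟩
    (hzs ▸ Or.inr ⟨e, he, hmem⟩)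
  rcases h.convex.side_or_vertex hz.2 hzo hz0 with ⟨w, hw, r, hr, hzw⟩ | ⟨p, q, m, hs, hzpq⟩
  · rw [eq_of_pos_smul_eq hz.1 (h.convex.norm_eq_one w hw) hr hzw] at hzs
    exact absurd (hzs ▸ h.vertex w hw) hV
  · refine ⟨W, φ, p, q, m, h, hs, ?_⟩
    by_contra hne
    exact disjoint_left.1 (hdec.disjoint (h.side p q m hs).2 he hne) ⟨z, ⟨hz.1, hzpq⟩, hzs⟩ hmem

/-! ### Weak duality -/

lemma mem_closure_D {ℓ x p : E3} (hx : x ∈ D ℓ) (hp : ‖p‖ ≤ ⟪ℓ, p⟫) : p ∈ closure (D ℓ) := by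
  refine mem_closure_of_tendsto (tendsto_add_smul p x) ?_
  filter_upwards [self_mem_nhdsWithin] with t ht
  have ht0 : 0 < t := ht
  change ‖p + t • x‖ < ⟪ℓ, p + t • x⟫
  have h1 : ‖x‖ < ⟪ℓ, x⟫ := hx
  have h2 := norm_add_le p (t • x)
  rw [norm_smul, Real.norm_of_nonneg ht0.le] at h2
  rw [inner_add_right, real_inner_smul_right]
  nlinarith

lemma add_smul_mem_of_mem_closure {K : Set E3} (hKo : IsOpen K) (hK : Convex ℝ K) {x w : E3}
    (hx : x ∈ K) (hw : w ∈ closure K) {t : ℝ} (ht0 : 0 < t) (ht1 : t < 1) :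
    w + t • (x - w) ∈ K := by
  have := hK.openSegment_interior_closure_subset_interior (hKo.interior_eq.symm ▸ hx) hw
    ⟨t, 1 - t, ht0, by linarith, by ring, rfl⟩
  rw [hKo.interior_eq] at this
  convert this using 1
  module

lemma IsLimitAt.of_agree (hd : IsSphericalConeMetric V) {K₁ K₂ : Set E3} (hK₁o : IsOpen K₁)
    (hK₁ : Convex ℝ K₁) (hK₂o : IsOpen K₂) (hK₂ : Convex ℝ K₂) {ψ₁ ψ₂ : E3 → S}
    (h₁ : LocIso ψ₁ K₁) (h₂ : LocIso ψ₂ K₂) (hV : ∀ y ∈ K₁, ψ₁ y ∉ V) {x w : E3} (hx₁ : x ∈ K₁)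
    (hx₂ : x ∈ K₂) (heq : ∀ᶠ y in 𝓝 x, ψ₁ y = ψ₂ y) (hw₁ : w ∈ closure K₁)
    (hw₂ : w ∈ closure K₂) (hw0 : w ≠ 0) {v : S} (hlim : IsLimitAt ψ₁ K₁ w v) :
    IsLimitAt ψ₂ K₂ w v := by
  have hag := LocIso.eq_of_eventually_eq hd (hK₁o.inter hK₂o) (hK₁.inter hK₂).isPreconnected
    (h₁.mono inter_subset_left) (h₂.mono inter_subset_right) (fun y hy => hV y hy.1)
    ⟨hx₁, hx₂⟩ heq
  have hu := tendsto_add_smul w (x - w)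
  have hev : ∀ᶠ t : ℝ in 𝓝[>] 0, w + t • (x - w) ∈ K₁ ∩ K₂ := by
    filter_upwards [Ioo_mem_nhdsGT (zero_lt_one' ℝ)] with t ht
    exact ⟨add_smul_mem_of_mem_closure hK₁o hK₁ hx₁ hw₁ ht.1 ht.2,
      add_smul_mem_of_mem_closure hK₂o hK₂ hx₂ hw₂ ht.1 ht.2⟩
  refine h₂.isLimitAt_of_tendsto hK₂ hw0 hu (hev.mono fun t ht => ht.2) ?_
  have h3 : Tendsto (fun t : ℝ => ψ₁ (w + t • (x - w))) (𝓝[>] 0) (𝓝 v) :=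
    (hlim.tendsto hw0).comp (tendsto_nhdsWithin_iff.2 ⟨hu, hev.mono fun t ht => ht.1⟩)
  exact h3.congr' (hev.mono fun t ht => hag _ ht)

/-- If `w` were in `D ℓ`, both maps would have the same limit at `w`, and `ψ w` would be the cone
point `v`. These inequalities are the constraints of the linear programme. -/
lemma EmptyDisc.inner_le_norm (hd : IsSphericalConeMetric V) {ℓ : E3} {ψ₁ ψ : E3 → S}
    (h : EmptyDisc V ℓ ψ) {K : Set E3} (hKo : IsOpen K) (hK : Convex ℝ K) (h₁ : LocIso ψ₁ K)
    (hV : ∀ y ∈ K, ψ₁ y ∉ V) {x w : E3} (hxK : x ∈ K) (hx : x ∈ D ℓ)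
    (heq : ∀ᶠ y in 𝓝 x, ψ₁ y = ψ y) (hw : w ∈ closure K) (hw0 : w ≠ 0) {v : S} (hv : v ∈ V)
    (hlim : IsLimitAt ψ₁ K w v) : ⟪ℓ, w⟫ ≤ ‖w‖ := by
  by_contra! hlt
  have hwD : w ∈ D ℓ := hlt
  have h2 := IsLimitAt.of_agree hd hKo hK (isOpen_D ℓ) (convex_D ℓ) h₁ h.locIso hV hxK hx heq hw
    (subset_closure hwD) hw0 hlim
  have h3 := h2.unique (h.locIso.isLimitAt (convex_D ℓ) hwD) hw0 (subset_closure hwD)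
  exact h.notMem w hwD (h3 ▸ hv)

lemma IsCell.isLimitAt_vertex {W : Finset E3} {φ : E3 → S} (h : IsCell V 𝓔 W φ) {w : E3}
    (hw : w ∈ W) : IsLimitAt (radial φ) (openCone W) w (φ w) := by
  have hn := h.convex.norm_eq_one w hw
  have := h.isLimitAt (mem_cone_of_mem hw) (by rintro rfl; simp at hn)
  rwa [radial_of_norm_eq_one _ hn] at this

lemma IsCell.inner_vertex_le_one (hd : IsSphericalConeMetric V) {W : Finset E3} {φ : E3 → S}
    (h : IsCell V 𝓔 W φ) {ℓ : E3} {ψ : E3 → S} (hψ : EmptyDisc V ℓ ψ) {x : E3}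
    (hxW : x ∈ openCone W) (hx : x ∈ D ℓ) (heq : ∀ᶠ y in 𝓝 x, radial φ y = ψ y) :
    ∀ w ∈ W, ⟪ℓ, w⟫ ≤ 1 := by
  intro w hw
  have hn := h.convex.norm_eq_one w hw
  rw [← hn]
  exact hψ.inner_le_norm hd h.convex.isOpen_openCone (convex_openCone W) h.radial_locIso_openCone
    (fun y hy => h.radial_notMem hy) hxW hx heq
    (cone_subset_closure_openCone W (mem_cone_of_mem hw)) (by rintro rfl; simp at hn)
    (h.vertex w hw) (h.isLimitAt_vertex hw)

lemma IsConvexPolygon.exists_sum_le {W : Finset E3} (hW : IsConvexPolygon W) :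
    ∃ C : ℝ, ∀ a : E3 → ℝ, (∀ w ∈ W, 0 ≤ a w) → ∑ w ∈ W, a w ≤ C * ‖∑ w ∈ W, a w • w‖ := by
  obtain ⟨u, hu⟩ := hW.hemisphere
  obtain ⟨p, hp, -⟩ := hW.exists_three
  obtain ⟨w₀, hw₀, hmin⟩ := W.exists_min_image (fun w => ⟪u, w⟫) ⟨p, hp⟩
  refine ⟨‖u‖ / ⟪u, w₀⟫, fun a ha => ?_⟩
  rw [div_mul_eq_mul_div, le_div_iff₀ (hu w₀ hw₀)]
  refine le_trans ?_ (real_inner_le_norm u _)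
  rw [inner_sum, Finset.sum_mul]
  refine Finset.sum_le_sum fun w hw => ?_
  rw [real_inner_smul_right]
  exact mul_le_mul_of_nonneg_left (hmin w hw) (ha w hw)

lemma IsCell.exists_map_mem_openCone (hd : IsSphericalConeMetric V) {W : Finset E3} {φ : E3 → S}
    (h : IsCell V 𝓔 W φ) {U : Set E3} (hU : IsOpen U) {ψ : E3 → S} (hψ : LocIso ψ U) {y : E3}
    (hy : y ∈ U) (hyW : ψ y ∈ φ '' openPolygon W) :
    ∃ A : E3 ≃ₗᵢ[ℝ] E3, A y ∈ openCone W ∧ ∀ᶠ z in 𝓝 (A y), radial φ z = (ψ ∘ A.symm) z := by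
  obtain ⟨A, hA, heq⟩ := h.exists_rot hd hU hψ hy hyW
  refine ⟨A.symm, mem_openCone_rot.1 hA, ?_⟩
  rw [radial_comp] at heq
  have ht : Tendsto A (𝓝 (A.symm y)) (𝓝 y) := by
    simpa using A.continuous.tendsto (A.symm y)
  filter_upwards [ht.eventually heq] with z hz
  simpa using hz.symm

lemma mem_D_self {ℓ x : E3} (hx : x ∈ D ℓ) : ℓ ∈ D ℓ := by
  have h1 : ‖x‖ < ⟪ℓ, x⟫ := hx
  have h2 := real_inner_le_norm ℓ x
  have h3 : 0 < ‖x‖ := norm_pos_iff.2 (ne_zero_of_mem_D hx)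
  have h4 : 1 < ‖ℓ‖ := by
    by_contra! h
    nlinarith
  change ‖ℓ‖ < ⟪ℓ, ℓ⟫
  rw [real_inner_self_eq_norm_sq]
  nlinarith

lemma one_lt_norm_of_mem_D {ℓ x : E3} (hx : x ∈ D ℓ) : 1 < ‖ℓ‖ := by
  have h1 : ‖ℓ‖ < ⟪ℓ, ℓ⟫ := mem_D_self hx
  rw [real_inner_self_eq_norm_sq] at h1
  by_contra! h
  nlinarith [norm_nonneg ℓ]

/-- If `y` is a combination of the vertices of a cell, the vertex constraints bound `⟪ℓ, y⟫` by the
sum of its coefficients, and hence by a multiple of `‖y‖` depending only on the face. There are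
finitely many faces. -/
lemma IsConvexDecomposition.exists_norm_le (hd : IsSphericalConeMetric V)
    (hdec : IsConvexDecomposition V 𝓔) :
    ∃ M : ℝ, ∀ ℓ ψ, EmptyDisc V ℓ ψ → (D ℓ).Nonempty → ‖ℓ‖ ≤ M := by
  -- The condition `‖ℓ‖ * ‖y‖ < 2 * ⟪ℓ, y⟫` keeps `y` within angle `π / 3` of the centre, so that a
  -- bound for `⟪ℓ, y⟫` yields one for `‖ℓ‖`.
  have hF : ∀ F ∈ faceSet V 𝓔, ∃ M : ℝ, ∀ ℓ ψ, EmptyDisc V ℓ ψ → ∀ y ∈ D ℓ,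
      ‖ℓ‖ * ‖y‖ < 2 * ⟪ℓ, y⟫ → ψ y ∈ F → ‖ℓ‖ ≤ M := by
    rintro F ⟨W, φ, h, rfl⟩
    obtain ⟨C, hC⟩ := h.convex.exists_sum_le
    refine ⟨2 * C, fun ℓ ψ hψ y hy hyℓ hyF => ?_⟩
    obtain ⟨A, hAy, heq⟩ := h.exists_map_mem_openCone hd (isOpen_D ℓ) hψ.locIso hy hyF
    have h1 := h.inner_vertex_le_one hd (hψ.comp A.symm) hAy
      (by rw [← preimage_D]; simpa using hy) heq
    obtain ⟨a, ha, hay⟩ := hAy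
    have h2 := hC a fun w hw => (ha w hw).le
    rw [← hay, A.norm_map] at h2
    have h3 : ⟪ℓ, y⟫ ≤ ∑ w ∈ W, a w := by
      rw [← A.inner_map_map, hay, inner_sum]
      refine Finset.sum_le_sum fun w hw => ?_
      rw [real_inner_smul_right]
      have : ⟪A ℓ, w⟫ ≤ 1 := by simpa using h1 w hw
      nlinarith [ha w hw]
    have h4 : 0 < ‖y‖ := norm_pos_iff.2 (ne_zero_of_mem_D hy)
    have h5 : ‖ℓ‖ * ‖y‖ < (2 * C) * ‖y‖ := by linarith
    exact (lt_of_mul_lt_mul_right h5 h4.le).le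
  choose! M hM using hF
  obtain ⟨B, hB⟩ := ((hdec.finite_faceSet hd).image M).bddAbove
  refine ⟨B, fun ℓ ψ hψ ⟨x, hx⟩ => ?_⟩
  have hℓ := mem_D_self hx
  have hℓ1 := one_lt_norm_of_mem_D hx
  obtain ⟨y, hy, hys⟩ := hdec.exists_notMem_skeleton
    ((isOpen_D ℓ).inter (isOpen_lt (f := fun y => ‖ℓ‖ * ‖y‖) (g := fun y => 2 * ⟪ℓ, y⟫)
      (by fun_prop) (by fun_prop)))
    ⟨ℓ, hℓ, by rw [mem_ofPred_eq, real_inner_self_eq_norm_sq]; nlinarith⟩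
    (hψ.locIso.mono inter_subset_left) (fun y hy => hψ.notMem y hy.1)
  obtain ⟨W, φ, h, hyW⟩ := hdec.faces _ hys
  exact (hM _ ⟨W, φ, h, rfl⟩ ℓ ψ hψ y hy.1 hy.2 hyW).trans
    (hB (mem_image_of_mem M ⟨W, φ, h, rfl⟩))

/-! ### The cone points on the boundary of an empty disc -/

/-- The points on the boundary circle of an immersed disc which go to `V`. -/
def contact (V : Finset S) (ℓ : E3) (ψ : E3 → S) : Set E3 :=
  {p | ‖p‖ = 1 ∧ ⟪ℓ, p⟫ = 1 ∧ ∃ v ∈ V, IsLimitAt ψ (D ℓ) p v}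

lemma ne_zero_of_norm_eq_one {p : E3} (hp : ‖p‖ = 1) : p ≠ 0 := by
  rintro rfl; simp at hp

lemma add_smul_mem_D {ℓ x p : E3} (hx : x ∈ D ℓ) (hp : ‖p‖ ≤ ⟪ℓ, p⟫) {t : ℝ} (ht : 0 < t) :
    p + t • x ∈ D ℓ := by
  change ‖p + t • x‖ < ⟪ℓ, p + t • x⟫
  have h1 : ‖x‖ < ⟪ℓ, x⟫ := hx
  have h2 := norm_add_le p (t • x)
  rw [norm_smul, Real.norm_of_nonneg ht.le] at h2
  rw [inner_add_right, real_inner_smul_right]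
  nlinarith

/-- The distance to `v` is given by some developed position `a` of `v`. Approaching `p` inside the
disc shows `⟪a, p⟫ = 1`, so `a = p`. The radius `r` depends only on `v`, not on the disc. -/
lemma exists_inner_contact_eq (hd : IsSphericalConeMetric V) {v : S} (hv : v ∈ V) :
    ∃ r > 0, ∀ ℓ ψ p, EmptyDisc V ℓ ψ → ‖p‖ = 1 → ⟪ℓ, p⟫ = 1 → IsLimitAt ψ (D ℓ) p v →
      ∀ y ∈ D ℓ, angle p y < r → ⟪p, y⟫ = ‖y‖ * Real.cos (dist (ψ y) v) := by
  obtain ⟨ε, hε, hεπ, hcone⟩ := exists_inner_eq_cos_dist hd hv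
  have hpi := Real.pi_pos
  obtain ⟨r, hr, hr'⟩ : ∃ r, 0 < r ∧ r < min ε (Real.pi / 2) :=
    exists_between (lt_min hε (by linarith))
  have hr1 := hr'.trans_le (min_le_left _ _)
  have hr2 := hr'.trans_le (min_le_right _ _)
  refine ⟨r, hr, fun ℓ ψ p h hp hℓp hlim y hy hyr => ?_⟩
  have hp0 := ne_zero_of_norm_eq_one hp
  have hmem : ∀ {y}, y ∈ D ℓ → (y ∈ D ((Real.cos r)⁻¹ • p) ↔ angle p y < r) := fun hy =>
    mem_D_smul_iff hp (ne_zero_of_mem_D hy) hr hr2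
  obtain ⟨a, ha, haeq⟩ := hcone (D ℓ ∩ D ((Real.cos r)⁻¹ • p))
    ((isOpen_D _).inter (isOpen_D _)) ((convex_D _).inter (convex_D _)).isPreconnected ψ
    (h.locIso.mono inter_subset_left) (fun y hy => by
      have h1 := (hmem hy.1).1 hy.2
      rw [angle_comm] at h1
      exact ((hlim y hy.1).trans_lt h1).trans hr1) (fun y hy => h.notMem y hy.1)
  have hpD : p ∈ D ((Real.cos r)⁻¹ • p) :=
    (mem_D_smul_iff hp hp0 hr hr2).2 (by rw [angle_self hp0]; exact hr)
  have hu := tendsto_add_smul p y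
  have hap : ⟪a, p⟫ = 1 := by
    have h1 : Tendsto (fun t : ℝ => ⟪a, p + t • y⟫) (𝓝[>] 0) (𝓝 ⟪a, p⟫) :=
      ((Continuous.tendsto (f := fun z => ⟪a, z⟫) (by fun_prop) p).comp hu)
    have h2 : Tendsto (fun t : ℝ => ψ (p + t • y)) (𝓝[>] 0) (𝓝 v) :=
      (hlim.tendsto hp0).comp (tendsto_nhdsWithin_iff.2 ⟨hu, by
        filter_upwards [self_mem_nhdsWithin] with t ht
        exact add_smul_mem_D hy (by rw [hp, hℓp]) ht⟩)
    have h3 : Tendsto (fun t : ℝ => ‖p + t • y‖ * Real.cos (dist (ψ (p + t • y)) v)) (𝓝[>] 0)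
        (𝓝 (‖p‖ * Real.cos (dist v v))) :=
      hu.norm.mul ((Real.continuous_cos.tendsto _).comp (h2.dist tendsto_const_nhds))
    rw [dist_self, Real.cos_zero, hp, mul_one] at h3
    refine tendsto_nhds_unique_of_eventuallyEq h1 h3 ?_
    filter_upwards [self_mem_nhdsWithin, hu.eventually_mem ((isOpen_D _).mem_nhds hpD)] with t ht ht'
    exact haeq _ ⟨add_smul_mem_D hy (by rw [hp, hℓp]) ht, ht'⟩
  have hap' : a = p := (inner_eq_one_iff_of_norm_eq_one ha hp).1 hap
  rw [← hap']
  exact haeq y ⟨hy, (hmem hy).2 hyr⟩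

lemma tendsto_angle {p y : E3} (hp : p ≠ 0) (hy : y ≠ 0) {ι : Type*} {F : Filter ι} {a b : ι → E3}
    (ha : Tendsto a F (𝓝 p)) (hb : Tendsto b F (𝓝 y)) :
    Tendsto (fun i => angle (a i) (b i)) F (𝓝 (angle p y)) :=
  Tendsto.comp (g := fun z : E3 × E3 => angle z.1 z.2) (f := fun i => (a i, b i)) (y := 𝓝 (p, y))
    (continuousAt_angle (x := (p, y)) hp hy) (ha.prodMk_nhds hb)

/-- Contact points of overlapping discs which go to the same cone point coincide, provided that
they are close to each other. -/
lemma exists_contact_radius (hd : IsSphericalConeMetric V) {v : S} (hv : v ∈ V) :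
    ∃ r > 0, ∀ ℓ ψ ℓ' ψ' p p', EmptyDisc V ℓ ψ → EmptyDisc V ℓ' ψ' →
      (∀ y ∈ D ℓ ∩ D ℓ', ψ y = ψ' y) → ‖p‖ = 1 → ⟪ℓ, p⟫ = 1 → IsLimitAt ψ (D ℓ) p v →
      ‖p'‖ = 1 → ⟪ℓ', p'⟫ = 1 → IsLimitAt ψ' (D ℓ') p' v →
      ∀ y ∈ D ℓ ∩ D ℓ', angle p y < r → angle p' y < r → p = p' := by
  obtain ⟨r, hr, h⟩ := exists_inner_contact_eq hd hv
  refine ⟨r, hr, fun ℓ ψ ℓ' ψ' p p' hψ hψ' hag hp hℓp hlim hp' hℓp' hlim' y hy h1 h2 => ?_⟩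
  -- Near `y` both linear forms are equal to `‖z‖` times the cosine of the distance to `v`.
  refine inner_eq_of_eventually (x := y) ?_
  have hy0 := ne_zero_of_mem_D hy.1
  filter_upwards [((isOpen_D ℓ).inter (isOpen_D ℓ')).mem_nhds hy,
    (tendsto_angle (ne_zero_of_norm_eq_one hp) hy0 tendsto_const_nhds tendsto_id).eventually_lt_const
      h1,
    (tendsto_angle (ne_zero_of_norm_eq_one hp') hy0 tendsto_const_nhds tendsto_id).eventually_lt_const
      h2] with z hz hz1 hz2
  rw [h ℓ ψ p hψ hp hℓp hlim z hz.1 hz1, h ℓ' ψ' p' hψ' hp' hℓp' hlim' z hz.2 hz2, hag z hz]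

/-- Infinitely many contact points over one `v` would accumulate, and two of them would be closer
than the radius of `exists_contact_radius`. -/
lemma EmptyDisc.finite_contact (hd : IsSphericalConeMetric V) {ℓ x : E3} {ψ : E3 → S}
    (h : EmptyDisc V ℓ ψ) (hx : x ∈ D ℓ) : (contact V ℓ ψ).Finite := by
  have hsub : contact V ℓ ψ ⊆ ⋃ v ∈ (V : Set S), {p | ‖p‖ = 1 ∧ ⟪ℓ, p⟫ = 1 ∧
      IsLimitAt ψ (D ℓ) p v} := by
    rintro p ⟨h1, h2, v, hv, h3⟩
    exact mem_biUnion (Finset.mem_coe.2 hv) ⟨h1, h2, h3⟩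
  refine (V.finite_toSet.biUnion fun v hv => ?_).subset hsub
  by_contra hinf
  obtain ⟨r, hr, hrad⟩ := exists_contact_radius hd hv
  obtain ⟨p, hp, hacc⟩ := Set.Infinite.exists_accPt_of_subset_isCompact hinf
    (isCompact_sphere (0 : E3) 1) (fun q hq => by simpa using hq.1)
  have hp1 : ‖p‖ = 1 := by simpa using hp
  have hp0 := ne_zero_of_norm_eq_one hp1
  have hnhds : {q | angle q p < r / 2} ∈ 𝓝 p :=
    (tendsto_angle_self hp0).eventually_lt_const (half_pos hr)
  obtain ⟨q, ⟨hq, hq1, hq2, hq3⟩, hqp⟩ := accPt_iff_nhds.1 hacc _ hnhds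
  have hnhds2 : {q' | angle q' p < r / 2} ∩ {q' | q' ≠ q} ∈ 𝓝 p :=
    Filter.inter_mem hnhds (isOpen_ne.mem_nhds hqp.symm)
  obtain ⟨q', ⟨⟨hq', hne⟩, hq'1, hq'2, hq'3⟩, -⟩ := accPt_iff_nhds.1 hacc _ hnhds2
  have hq0 := ne_zero_of_norm_eq_one hq1
  have hqq' : angle q' q < r := by
    have := angle_le_angle_add_angle q' p q
    rw [angle_comm p q] at this
    have h1 : angle q' p < r / 2 := hq'
    have h2 : angle q p < r / 2 := hq
    linarith
  have hu := tendsto_add_smul q x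
  obtain ⟨t, ⟨ht1, ht2⟩, ht0⟩ := (((tendsto_angle hq0 hq0 tendsto_const_nhds hu).eventually_lt_const
    (by rwa [angle_self hq0])).and ((tendsto_angle (ne_zero_of_norm_eq_one hq'1) hq0
      tendsto_const_nhds hu).eventually_lt_const hqq') |>.and self_mem_nhdsWithin).exists
  have hmem := add_smul_mem_D hx (hq1.trans hq2.symm).le ht0
  exact hne (hrad ℓ ψ ℓ ψ q q' h h (fun _ _ => rfl) hq1 hq2 hq3 hq'1 hq'2 hq'3 _ ⟨hmem, hmem⟩
    ht1 ht2).symm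

open Classical in
/-- The set `contact V ℓ ψ` as a finite set. -/
def vertices (V : Finset S) (ℓ : E3) (ψ : E3 → S) : Finset E3 :=
  if h : (contact V ℓ ψ).Finite then h.toFinset else ∅

lemma EmptyDisc.mem_vertices (hd : IsSphericalConeMetric V) {ℓ x : E3} {ψ : E3 → S}
    (h : EmptyDisc V ℓ ψ) (hx : x ∈ D ℓ) {p : E3} : p ∈ vertices V ℓ ψ ↔
      ‖p‖ = 1 ∧ ⟪ℓ, p⟫ = 1 ∧ ∃ v ∈ V, IsLimitAt ψ (D ℓ) p v := by
  rw [vertices, dif_pos (h.finite_contact hd hx), Set.Finite.mem_toFinset]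
  rfl

/-! ### Limits of empty discs -/

lemma EmptyDisc.agree (hd : IsSphericalConeMetric V) {ℓ ℓ' x : E3} {ψ ψ' : E3 → S}
    (h : EmptyDisc V ℓ ψ) (h' : EmptyDisc V ℓ' ψ') (hx : x ∈ D ℓ) (hx' : x ∈ D ℓ')
    (heq : ∀ᶠ y in 𝓝 x, ψ y = ψ' y) : ∀ y ∈ D ℓ ∩ D ℓ', ψ y = ψ' y :=
  LocIso.eq_of_eventually_eq hd ((isOpen_D ℓ).inter (isOpen_D ℓ'))
    ((convex_D ℓ).inter (convex_D ℓ')).isPreconnected (h.locIso.mono inter_subset_left)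
    (h'.locIso.mono inter_subset_right) (fun y hy => h.notMem y hy.1) ⟨hx, hx'⟩ heq

lemma eventually_mem_D {ι : Type*} {F : Filter ι} {ℓ : ι → E3} {l y : E3} (hl : Tendsto ℓ F (𝓝 l))
    (hy : y ∈ D l) : ∀ᶠ n in F, y ∈ D (ℓ n) := by
  have h1 : Tendsto (fun n => ⟪ℓ n, y⟫) F (𝓝 ⟪l, y⟫) := hl.inner tendsto_const_nhds
  exact h1.eventually_const_lt hy

section Limit

variable {ℓ : ℕ → E3} {ψ : ℕ → E3 → S} {l ℓ₀ x : E3} {ψ₀ : E3 → S}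

/-- Each `y ∈ D l` is in `D (ℓ n)` together with `x` for large `n`. Maps of discs that contain `x`
agree on their overlap by unique continuation, so the limit map at `y` may be taken from any such
`n`. -/
lemma exists_limit_disc (hd : IsSphericalConeMetric V) (h : ∀ n, EmptyDisc V (ℓ n) (ψ n))
    (hl : Tendsto ℓ atTop (𝓝 l)) (hx₀ : x ∈ D ℓ₀) (hx : x ∈ D l)
    (hag : ∀ n, ∀ y ∈ D ℓ₀ ∩ D (ℓ n), ψ n y = ψ₀ y) :
    ∃ ψ', EmptyDisc V l ψ' ∧ (∀ y ∈ D ℓ₀ ∩ D l, ψ' y = ψ₀ y) ∧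
      ∀ n, x ∈ D (ℓ n) → ∀ y ∈ D l ∩ D (ℓ n), ψ' y = ψ n y := by
  have hnm : ∀ n m, x ∈ D (ℓ n) → x ∈ D (ℓ m) → ∀ y ∈ D (ℓ n) ∩ D (ℓ m), ψ n y = ψ m y := by
    intro n m hn hm
    refine (h n).agree hd (h m) hn hm ?_
    filter_upwards [(isOpen_D _).mem_nhds hn, (isOpen_D _).mem_nhds hm,
      (isOpen_D _).mem_nhds hx₀] with y h1 h2 h3
    rw [hag n y ⟨h3, h1⟩, hag m y ⟨h3, h2⟩]
  have hex : ∀ y ∈ D l, ∃ n, y ∈ D (ℓ n) ∧ x ∈ D (ℓ n) := fun y hy =>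
    ((eventually_mem_D hl hy).and (eventually_mem_D hl hx)).exists
  choose! N hN hN' using hex
  have hlast : ∀ n, x ∈ D (ℓ n) → ∀ y ∈ D l ∩ D (ℓ n), ψ (N y) y = ψ n y := fun n hn y hy =>
    hnm _ _ (hN' y hy.1) hn y ⟨hN y hy.1, hy.2⟩
  refine ⟨fun y => ψ (N y) y, ⟨fun y hy => ?_, fun y hy => (h _).notMem y (hN y hy)⟩,
    fun y hy => hag _ y ⟨hy.1, hN y hy.2⟩, hlast⟩
  obtain ⟨ε, hε, hiso⟩ := (h (N y)).locIso y (hN y hy)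
  obtain ⟨ε', hε', hball⟩ := Metric.isOpen_iff.1 (isOpen_D (ℓ (N y))) y (hN y hy)
  refine ⟨min ε ε', lt_min hε hε', fun z hz w hw h1 h2 => ?_⟩
  have hz' := hball (h1.trans_le (min_le_right _ _))
  have hw' := hball (h2.trans_le (min_le_right _ _))
  rw [hlast _ (hN' y hy) z ⟨hz, hz'⟩, hlast _ (hN' y hy) w ⟨hw, hw'⟩]
  exact hiso z hz' w hw' (h1.trans_le (min_le_left _ _)) (h2.trans_le (min_le_left _ _))

/-- Otherwise contact points over one `v` and outside the limit set would converge along a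
subsequence to some `q`, which is a contact point of the limit disc over `v`. Once they are close to
`q`, `exists_contact_radius` makes them equal to it. -/
lemma eventually_contact_subset (hd : IsSphericalConeMetric V) (h : ∀ n, EmptyDisc V (ℓ n) (ψ n))
    (hl : Tendsto ℓ atTop (𝓝 l)) (hx : x ∈ D l) (hψ₀ : EmptyDisc V l ψ₀)
    (hag : ∀ n, x ∈ D (ℓ n) → ∀ y ∈ D l ∩ D (ℓ n), ψ₀ y = ψ n y) :
    ∀ᶠ n in atTop, contact V (ℓ n) (ψ n) ⊆ contact V l ψ₀ := by
  have key : ∀ v ∈ V, ∀ᶠ n in atTop, ∀ p, ‖p‖ = 1 → ⟪ℓ n, p⟫ = 1 →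
      IsLimitAt (ψ n) (D (ℓ n)) p v → p ∈ contact V l ψ₀ := by
    intro v hv
    by_contra hfreq
    obtain ⟨k, hk, hkp⟩ := extraction_of_frequently_atTop (not_eventually.1 hfreq)
    push Not at hkp
    choose p hp1 hp2 hp3 hp4 using hkp
    obtain ⟨q, hq, j, hj, hlim⟩ := (isCompact_sphere (0 : E3) 1).tendsto_subseq
      (fun n => by simpa using hp1 n : ∀ n, p n ∈ sphere (0 : E3) 1)
    have hq1 : ‖q‖ = 1 := by simpa using hq
    have hq0 := ne_zero_of_norm_eq_one hq1
    have hkj : Tendsto (fun n => ℓ (k (j n))) atTop (𝓝 l) :=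
      hl.comp (hk.tendsto_atTop.comp hj.tendsto_atTop)
    have hlq : ⟪l, q⟫ = 1 := by
      refine tendsto_nhds_unique (hkj.inner hlim) ?_
      simp only [Function.comp, hp2]
      exact tendsto_const_nhds
    have hxev := eventually_mem_D hkj hx
    have hqlim : IsLimitAt ψ₀ (D l) q v := by
      intro y hy
      have hy0 := ne_zero_of_mem_D hy
      refine ge_of_tendsto (tendsto_angle hy0 hq0 tendsto_const_nhds hlim) ?_
      filter_upwards [hxev, eventually_mem_D hkj hy] with n h1 h2
      rw [hag _ h1 y ⟨hy, h2⟩]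
      exact hp3 _ y h2
    obtain ⟨r, hr, hrad⟩ := exists_contact_radius hd hv
    obtain ⟨t, ht1, ht0⟩ := (((tendsto_angle hq0 hq0 tendsto_const_nhds
      (tendsto_add_smul q x)).eventually_lt_const (by rwa [angle_self hq0])).and
      self_mem_nhdsWithin).exists
    have hmem : q + t • x ∈ D l := add_smul_mem_D hx (hq1.trans hlq.symm).le ht0
    obtain ⟨n, ⟨h1, h2⟩, h3⟩ := ((hxev.and (eventually_mem_D hkj hmem)).and
      ((tendsto_angle hq0 (ne_zero_of_mem_D hmem) hlim tendsto_const_nhds).eventually_lt_const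
        ht1)).exists
    have := hrad l ψ₀ _ _ q (p (j n)) hψ₀ (h (k (j n))) (hag _ h1) hq1 hlq hqlim (hp1 _) (hp2 _)
      (hp3 _) _ ⟨hmem, h2⟩ ht1 h3
    exact hp4 (j n) (this ▸ ⟨hq1, hlq, v, hv, hqlim⟩)
  filter_upwards [(Filter.eventually_all_finset V).2 key] with n hn
  rintro p ⟨h1, h2, v, hv, h3⟩
  exact hn v hv p h1 h2 h3

end Limit

/-! ### Optimal discs -/

/-- The disc `(ℓ, ψ)` maximises `⟪ℓ, x⟫` among the empty discs with the same germ at `x`. -/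
structure IsOptimal (V : Finset S) (ℓ : E3) (ψ : E3 → S) (x : E3) : Prop where
  emptyDisc : EmptyDisc V ℓ ψ
  mem : x ∈ D ℓ
  le : ∀ ℓ' ψ', EmptyDisc V ℓ' ψ' → x ∈ D ℓ' → (∀ᶠ y in 𝓝 x, ψ' y = ψ y) → ⟪ℓ', x⟫ ≤ ⟪ℓ, x⟫

lemma eventuallyEq_of_agree {T : Type*} {ℓ ℓ' x : E3} {ψ ψ' : E3 → T} (h : ∀ y ∈ D ℓ ∩ D ℓ', ψ y = ψ' y)
    (hx : x ∈ D ℓ) (hx' : x ∈ D ℓ') : ∀ᶠ y in 𝓝 x, ψ y = ψ' y := by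
  filter_upwards [((isOpen_D ℓ).inter (isOpen_D ℓ')).mem_nhds ⟨hx, hx'⟩] with y hy using h y hy

/-- A maximising sequence has bounded `ℓ`, and the limit of a convergent subsequence is again an
empty disc with the same germ. -/
lemma exists_isOptimal (hd : IsSphericalConeMetric V) (hdec : IsConvexDecomposition V 𝓔)
    {ℓ₀ x : E3} {ψ₀ : E3 → S} (h₀ : EmptyDisc V ℓ₀ ψ₀) (hx₀ : x ∈ D ℓ₀) :
    ∃ ℓ ψ, IsOptimal V ℓ ψ x ∧ ∀ y ∈ D ℓ₀ ∩ D ℓ, ψ y = ψ₀ y := by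
  obtain ⟨M, hM⟩ := hdec.exists_norm_le hd
  set T := {t | ∃ ℓ ψ, EmptyDisc V ℓ ψ ∧ x ∈ D ℓ ∧ (∀ y ∈ D ℓ₀ ∩ D ℓ, ψ y = ψ₀ y) ∧ t = ⟪ℓ, x⟫}
    with hT
  have hTne : T.Nonempty := ⟨_, ℓ₀, ψ₀, h₀, hx₀, fun _ _ => rfl, rfl⟩
  have hTb : BddAbove T := by
    refine ⟨M * ‖x‖, ?_⟩
    rintro t ⟨ℓ, ψ, h, hx, -, rfl⟩
    exact (real_inner_le_norm ℓ x).trans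
      (mul_le_mul_of_nonneg_right (hM ℓ ψ h ⟨x, hx⟩) (norm_nonneg x))
  obtain ⟨u, -, hu, huT⟩ := exists_seq_tendsto_sSup hTne hTb
  choose ℓ ψ h hx hag hu' using huT
  obtain ⟨l, -, k, hk, hl⟩ := (isCompact_closedBall (0 : E3) M).tendsto_subseq
    (fun n => by simpa using hM (ℓ n) (ψ n) (h n) ⟨x, hx n⟩ : ∀ n, ℓ n ∈ closedBall (0 : E3) M)
  have hlx : ⟪l, x⟫ = sSup T := by
    refine tendsto_nhds_unique (hl.inner tendsto_const_nhds) ?_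
    refine (hu.comp hk.tendsto_atTop).congr fun n => ?_
    simp [hu']
  have hxl : x ∈ D l := by
    change ‖x‖ < ⟪l, x⟫
    rw [hlx]
    exact lt_of_lt_of_le (show ‖x‖ < ⟪ℓ₀, x⟫ from hx₀)
      (le_csSup hTb ⟨ℓ₀, ψ₀, h₀, hx₀, fun _ _ => rfl, rfl⟩)
  obtain ⟨ψ', hψ', hag', -⟩ := exists_limit_disc hd (fun n => h (k n)) hl hx₀ hxl
    (fun n => hag (k n))
  refine ⟨l, ψ', ⟨hψ', hxl, fun ℓ₁ ψ₁ h₁ hx₁ heq => ?_⟩, hag'⟩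
  rw [hlx]
  refine le_csSup hTb ⟨ℓ₁, ψ₁, h₁, hx₁, ?_, rfl⟩
  have h2 := h₁.agree hd h₀ hx₁ hx₀ (heq.and (eventuallyEq_of_agree hag' hx₀ hxl) |>.mono
    fun y hy => hy.1.trans hy.2)
  exact fun y hy => h2 y hy.symm

lemma locIso_of_normalize {ψ : E3 → S} {U : Set E3} (h0 : (0 : E3) ∉ U)
    (h : ∀ x ∈ U, ∃ N, IsOpen N ∧ ‖x‖⁻¹ • x ∈ N ∧ ∃ Ψ : E3 → S, LocIso Ψ N ∧
      ∀ y ∈ U, ‖y‖⁻¹ • y ∈ N → ψ y = Ψ (‖y‖⁻¹ • y)) : LocIso ψ U := by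
  intro x hx
  have hne : ∀ {y}, y ∈ U → y ≠ 0 := fun hy h => h0 (h ▸ hy)
  obtain ⟨N, hN, hxN, Ψ, hΨ, heq⟩ := h x hx
  obtain ⟨ε, hε, hiso⟩ := hΨ _ hxN
  have hev := (continuousAt_normalize (hne hx)).eventually_mem
    (Filter.inter_mem (hN.mem_nhds hxN) (ball_mem_nhds _ hε))
  obtain ⟨δ, hδ, hball⟩ := Metric.eventually_nhds_iff_ball.1 hev
  refine ⟨δ, hδ, fun y hy z hz h1 h2 => ?_⟩
  rw [heq y hy (hball y h1).1, heq z hz (hball z h2).1, hiso _ (hball y h1).1 _ (hball z h2).1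
    (hball y h1).2 (hball z h2).2, angle_smul_left_of_pos _ _ (inv_pos.2 (norm_pos_iff.2 (hne hy))),
    angle_smul_right_of_pos _ _ (inv_pos.2 (norm_pos_iff.2 (hne hz)))]

lemma EmptyDisc.map_smul {ℓ y : E3} {ψ : E3 → S} (h : EmptyDisc V ℓ ψ) (hy : y ∈ D ℓ) {r : ℝ}
    (hr : 0 < r) : ψ (r • y) = ψ y := by
  have := h.locIso.dist_le (convex_D ℓ) (smul_mem_D hy hr) hy
  rw [angle_smul_left_of_pos _ _ hr, angle_self (ne_zero_of_mem_D hy)] at this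
  exact dist_le_zero.1 this

/-- Tilting `ℓ` by a small multiple of `m` adds points only near the boundary points with `⟪m, p⟫ ≥
0`. None of these is a contact point, so the immersion extends across each of them. -/
lemma EmptyDisc.exists_larger [CompactSpace S] (hd : IsSphericalConeMetric V) {ℓ x m : E3}
    {ψ : E3 → S} (h : EmptyDisc V ℓ ψ) (hx : x ∈ D ℓ) (hm : ∀ p ∈ contact V ℓ ψ, ⟪m, p⟫ < 0) :
    ∃ t : ℝ, 0 < t ∧ ∃ ψ', EmptyDisc V (ℓ + t • m) ψ' ∧ ∀ y ∈ D ℓ, ψ' y = ψ y := by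
  classical
  set K := {p : E3 | ‖p‖ = 1 ∧ ⟪ℓ, p⟫ = 1 ∧ 0 ≤ ⟪m, p⟫} with hK
  have hKcl : ∀ p ∈ K, p ∈ closure (D ℓ) := fun p hp => mem_closure_D hx (hp.1.trans hp.2.1.symm).le
  have hext : ∀ p ∈ K, ∃ δ > 0, ∃ Ψ : E3 → S,
      (∀ y ∈ ball p δ, ∀ z ∈ ball p δ, dist (Ψ y) (Ψ z) = angle y z) ∧
      (∀ y ∈ ball p δ, Ψ y ∉ V) ∧ ∀ y ∈ D ℓ, y ∈ ball p δ → Ψ y = ψ y := by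
    intro p hp
    have hp0 := ne_zero_of_norm_eq_one hp.1
    obtain ⟨s, hs⟩ := h.locIso.exists_isLimitAt (convex_D ℓ) (hKcl p hp) hp0
    have hsV : s ∉ V := fun hsV => (hm p ⟨hp.1, hp.2.1, s, hsV, hs⟩).not_ge hp.2.2
    obtain ⟨δ, hδ, Ψ, h1, -, h2, h3⟩ := h.locIso.exists_extension hd (isOpen_D ℓ) (convex_D ℓ) hp0
      (hKcl p hp) hs hsV
    exact ⟨δ, hδ, Ψ, h1, h2, h3⟩
  have : Nonempty (E3 → S) := ⟨ψ⟩
  choose! δ hδ Ψ hiso hV heq using hext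
  -- If the balls of one third of the radii meet, the larger full ball contains the other centre.
  -- That centre is in the closure of `D ℓ`, so the two extensions share an open set on which both
  -- equal `ψ`.
  have hagree : ∀ p ∈ K, ∀ q ∈ K, ∀ y ∈ ball p (δ p / 3), y ∈ ball q (δ q / 3) → Ψ p y = Ψ q y := by
    have aux : ∀ p ∈ K, ∀ q ∈ K, δ q ≤ δ p → ∀ y ∈ ball p (δ p / 3), y ∈ ball q (δ q / 3) →
        Ψ p y = Ψ q y := by
      intro p hp q hq hle y hyp hyq
      have hδp := hδ p hp
      have hδq := hδ q hq
      have hqp : q ∈ ball p (δ p) := by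
        have h1 := dist_triangle q y p
        rw [mem_ball] at hyp hyq ⊢
        rw [dist_comm] at hyq
        linarith
      obtain ⟨z, ⟨hzp, hzq⟩, hz⟩ := _root_.mem_closure_iff.1 (hKcl q hq) (ball p (δ p) ∩ ball q (δ q))
        (isOpen_ball.inter isOpen_ball) ⟨hqp, mem_ball_self hδq⟩
      refine LocIso.eq_of_eventually_eq hd (isOpen_ball.inter isOpen_ball)
        ((convex_ball p (δ p)).inter (convex_ball q (δ q))).isPreconnected
        ((locIso_of_forall_dist_eq (hiso p hp)).mono inter_subset_left)
        ((locIso_of_forall_dist_eq (hiso q hq)).mono inter_subset_right)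
        (fun y hy => hV p hp y hy.1) ⟨hzp, hzq⟩ ?_ y
        ⟨ball_subset_ball (by linarith) hyp, ball_subset_ball (by linarith) hyq⟩
      filter_upwards [isOpen_ball.mem_nhds hzp, isOpen_ball.mem_nhds hzq,
        (isOpen_D ℓ).mem_nhds hz] with w h1 h2 h3
      rw [heq p hp w h3 h1, heq q hq w h3 h2]
    intro p hp q hq y hyp hyq
    rcases le_total (δ q) (δ p) with hle | hle
    · exact aux p hp q hq hle y hyp hyq
    · exact (aux q hq p hp hle y hyq hyp).symm
  -- With `t = 1 / (n + 1)`, points left uncovered for every `n` would accumulate at a point of `K`,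
  -- inside one of the balls.
  obtain ⟨t, ht, hcov⟩ : ∃ t : ℝ, 0 < t ∧ ∀ y : E3, ‖y‖ = 1 → 1 < ⟪ℓ + t • m, y⟫ →
      y ∈ D ℓ ∨ ∃ p ∈ K, y ∈ ball p (δ p / 3) := by
    by_contra! hcon
    choose y hy1 hy2 hy3 hy4 using fun n : ℕ => hcon (1 / ((n : ℝ) + 1)) Nat.one_div_pos_of_nat
    obtain ⟨q, hq, j, hj, hlim⟩ := (isCompact_sphere (0 : E3) 1).tendsto_subseq
      (fun n => by simpa using hy1 n : ∀ n, y n ∈ sphere (0 : E3) 1)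
    have hq1 : ‖q‖ = 1 := by simpa using hq
    have h1 : ∀ n, ⟪ℓ, y n⟫ ≤ 1 := fun n => by
      have : ¬ ‖y n‖ < ⟪ℓ, y n⟫ := hy3 n
      rwa [hy1, not_lt] at this
    have h2 : ∀ n : ℕ, 1 - ⟪ℓ, y n⟫ < 1 / ((n : ℝ) + 1) * ⟪m, y n⟫ := fun n => by
      have := hy2 n
      rw [inner_add_left, real_inner_smul_left] at this
      linarith
    have h3 : ∀ n, 0 ≤ ⟪m, y n⟫ := fun n =>
      (pos_of_mul_pos_right ((sub_nonneg.2 (h1 n)).trans_lt (h2 n))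
        Nat.one_div_pos_of_nat.le).le
    have t1 : Tendsto (fun n => ⟪ℓ, y (j n)⟫) atTop (𝓝 ⟪ℓ, q⟫) := tendsto_const_nhds.inner hlim
    have t2 : Tendsto (fun n => ⟪m, y (j n)⟫) atTop (𝓝 ⟪m, q⟫) := tendsto_const_nhds.inner hlim
    have t3 : Tendsto (fun n : ℕ => 1 / (((j n : ℕ) : ℝ) + 1)) atTop (𝓝 0) :=
      (tendsto_one_div_add_atTop_nhds_zero_nat (𝕜 := ℝ)).comp hj.tendsto_atTop
    have h4 : 1 - ⟪ℓ, q⟫ ≤ 0 * ⟪m, q⟫ :=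
      le_of_tendsto_of_tendsto' (tendsto_const_nhds.sub t1) (t3.mul t2) fun n => (h2 (j n)).le
    have h5 : ⟪ℓ, q⟫ ≤ 1 := le_of_tendsto' t1 fun n => h1 _
    have hqK : q ∈ K := ⟨hq1, by linarith, ge_of_tendsto' t2 fun n => h3 _⟩
    obtain ⟨n, hn⟩ := (hlim.eventually_mem
      (ball_mem_nhds q (div_pos (hδ q hqK) zero_lt_three))).exists
    exact hy4 (j n) q hqK hn
  let ψ' : E3 → S := fun y => if ‖y‖⁻¹ • y ∈ D ℓ then ψ (‖y‖⁻¹ • y) else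
    if hp : ∃ p ∈ K, ‖y‖⁻¹ • y ∈ ball p (δ p / 3) then Ψ hp.choose (‖y‖⁻¹ • y) else ψ y
  have hψ'D : ∀ y, ‖y‖⁻¹ • y ∈ D ℓ → ψ' y = ψ (‖y‖⁻¹ • y) := fun y hy => if_pos hy
  have hψ'K : ∀ y, ∀ p ∈ K, ‖y‖⁻¹ • y ∈ ball p (δ p / 3) → ψ' y = Ψ p (‖y‖⁻¹ • y) := by
    intro y p hp hy
    by_cases hyD : ‖y‖⁻¹ • y ∈ D ℓ
    · rw [hψ'D y hyD, heq p hp _ hyD (ball_subset_ball (by have := hδ p hp; linarith) hy)]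
    · have hex : ∃ p ∈ K, ‖y‖⁻¹ • y ∈ ball p (δ p / 3) := ⟨p, hp, hy⟩
      have : ψ' y = Ψ hex.choose (‖y‖⁻¹ • y) := by
        simp only [ψ', if_neg hyD, dif_pos hex]
      rw [this]
      exact hagree _ hex.choose_spec.1 p hp _ hex.choose_spec.2 hy
  have hcov' : ∀ y ∈ D (ℓ + t • m), ‖y‖⁻¹ • y ∈ D ℓ ∨ ∃ p ∈ K, ‖y‖⁻¹ • y ∈ ball p (δ p / 3) := by
    intro y hy
    have hy0 := ne_zero_of_mem_D hy
    have hn := norm_inv_smul hy0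
    refine hcov _ hn ?_
    have : ‖‖y‖⁻¹ • y‖ < ⟪ℓ + t • m, ‖y‖⁻¹ • y⟫ := smul_mem_D hy (inv_pos.2 (norm_pos_iff.2 hy0))
    rwa [hn] at this
  refine ⟨t, ht, ψ', ⟨?_, ?_⟩, fun y hy => ?_⟩
  · refine locIso_of_normalize (fun h0 => ne_zero_of_mem_D h0 rfl) fun y hy => ?_
    rcases hcov' y hy with hyD | ⟨p, hp, hyp⟩
    · exact ⟨D ℓ, isOpen_D ℓ, hyD, ψ, h.locIso, fun z _ hz => hψ'D z hz⟩
    · exact ⟨ball p (δ p / 3), isOpen_ball, hyp, Ψ p, (locIso_of_forall_dist_eq (hiso p hp)).mono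
        (ball_subset_ball (by have := hδ p hp; linarith)), fun z _ hz => hψ'K z p hp hz⟩
  · intro y hy
    rcases hcov' y hy with hyD | ⟨p, hp, hyp⟩
    · rw [hψ'D y hyD]; exact h.notMem _ hyD
    · rw [hψ'K y p hp hyp]
      exact hV p hp _ (ball_subset_ball (by have := hδ p hp; linarith) hyp)
  · have hr := inv_pos.2 (norm_pos_iff.2 (ne_zero_of_mem_D hy))
    rw [hψ'D y (smul_mem_D hy hr), h.map_smul hy hr]

/-- Farkas' lemma with strict inequalities: a separating form is nonpositive on `W`, and subtracting
a small multiple of `u` makes it negative without losing positivity at `x`. -/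
lemma exists_inner_pos_of_notMem_cone {W : Finset E3} {u x : E3} (hu : ∀ w ∈ W, 0 < ⟪u, w⟫)
    (hx : x ∉ cone W) : ∃ m, 0 < ⟪m, x⟫ ∧ ∀ w ∈ W, ⟪m, w⟫ < 0 := by
  obtain ⟨f, c, hf, hc⟩ := geometric_hahn_banach_closed_point (convex_cone W) (isClosed_cone hu) hx
  obtain ⟨m, hm⟩ : ∃ m : E3, ∀ y, ⟪m, y⟫ = f y :=
    ⟨(InnerProductSpace.toDual ℝ E3).symm f, fun y => by simp⟩
  simp only [← hm] at hf hc
  have hc0 : 0 < c := by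
    have := hf 0 ⟨0, fun _ _ => le_rfl, by simp⟩
    rwa [inner_zero_right] at this
  have hle : ∀ w ∈ W, ⟪m, w⟫ ≤ 0 := by
    intro w hw
    by_contra! hpos
    have := hf ((c / ⟪m, w⟫) • w) (smul_mem_cone (mem_cone_of_mem hw) (div_pos hc0 hpos).le)
    rw [real_inner_smul_right, div_mul_cancel₀ _ hpos.ne'] at this
    exact this.false
  set η := ⟪m, x⟫ / (2 * (|⟪u, x⟫| + 1)) with hη
  have hη0 : 0 < η := div_pos (hc0.trans hc) (by positivity)
  refine ⟨m - η • u, ?_, fun w hw => ?_⟩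
  · rw [inner_sub_left, real_inner_smul_left]
    have h1 : η * (2 * (|⟪u, x⟫| + 1)) = ⟪m, x⟫ := div_mul_cancel₀ _ (by positivity)
    nlinarith [le_abs_self ⟪u, x⟫, abs_nonneg ⟪u, x⟫]
  · rw [inner_sub_left, real_inner_smul_left]
    have := mul_pos hη0 (hu w hw)
    linarith [hle w hw]

/-- A direction `m` positive at `x` and negative at all contact points would give, by
`EmptyDisc.exists_larger`, an empty disc with a larger value at `x`. -/
lemma IsOptimal.mem_cone [CompactSpace S] (hd : IsSphericalConeMetric V) {ℓ x : E3} {ψ : E3 → S}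
    (h : IsOptimal V ℓ ψ x) : x ∈ cone (vertices V ℓ ψ) := by
  by_contra hx
  have hmem := fun p => h.emptyDisc.mem_vertices hd h.mem (p := p)
  obtain ⟨m, hmx, hm⟩ := exists_inner_pos_of_notMem_cone (u := ℓ)
    (fun w hw => by rw [((hmem w).1 hw).2.1]; exact one_pos) hx
  obtain ⟨t, ht, ψ', hψ', heq⟩ := h.emptyDisc.exists_larger hd h.mem
    (fun p hp => hm p ((hmem p).2 hp))
  have h1 : ⟪ℓ, x⟫ < ⟪ℓ + t • m, x⟫ := by
    rw [inner_add_left, real_inner_smul_left]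
    have := mul_pos ht hmx
    linarith
  refine (h.le _ _ hψ' (lt_trans (show ‖x‖ < ⟪ℓ, x⟫ from h.mem) h1) ?_).not_gt h1
  filter_upwards [(isOpen_D ℓ).mem_nhds h.mem] with y hy using heq y hy

/-- Weak duality between empty discs. -/
lemma EmptyDisc.inner_contact_le (hd : IsSphericalConeMetric V) {ℓ ℓ' x : E3} {ψ ψ' : E3 → S}
    (h : EmptyDisc V ℓ ψ) (h' : EmptyDisc V ℓ' ψ') (hx : x ∈ D ℓ) (hx' : x ∈ D ℓ')
    (heq : ∀ᶠ y in 𝓝 x, ψ y = ψ' y) {p : E3} (hp : p ∈ contact V ℓ ψ) :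
    ⟪ℓ', p⟫ ≤ 1 ∧ (⟪ℓ', p⟫ = 1 → p ∈ contact V ℓ' ψ') := by
  obtain ⟨hp1, hp2, v, hv, hlim⟩ := hp
  have hp0 := ne_zero_of_norm_eq_one hp1
  have hcl := mem_closure_D hx (hp1.trans hp2.symm).le
  constructor
  · rw [← hp1]
    exact h'.inner_le_norm hd (isOpen_D ℓ) (convex_D ℓ) h.locIso h.notMem hx hx' heq hcl hp0 hv hlim
  · intro h1
    exact ⟨hp1, h1, v, hv, IsLimitAt.of_agree hd (isOpen_D ℓ) (convex_D ℓ) (isOpen_D ℓ')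
      (convex_D ℓ') h.locIso h'.locIso h.notMem hx hx' heq hcl
      (mem_closure_D hx' (hp1.trans h1.symm).le) hp0 hlim⟩

/-! ### Centres and radii of empty discs with several contact points -/

lemma angle_lt_iff {x y : E3} (hx : x ≠ 0) (hy : y ≠ 0) {r : ℝ} (h0 : 0 ≤ r) (h1 : r ≤ Real.pi) :
    angle x y < r ↔ ‖x‖ * ‖y‖ * Real.cos r < ⟪x, y⟫ := by
  rw [← cos_angle_mul_norm_mul_norm, mul_comm (‖x‖ * ‖y‖),
    mul_lt_mul_iff_left₀ (mul_pos (norm_pos_iff.2 hx) (norm_pos_iff.2 hy))]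
  exact (Real.strictAntiOn_cos.lt_iff_gt ⟨h0, h1⟩ ⟨angle_nonneg x y, angle_le_pi x y⟩).symm

/-- A disc of radius below `r` with two contact points would bring two cone points too close, or two
developed positions of one cone point too close. If the centre is closer than `r` to `v`, the
developed position of `v` lies inside the disc, whose radius is at least `r`. -/
lemma exists_center_bound (hd : IsSphericalConeMetric V) :
    ∃ r > 0, r < Real.pi / 2 ∧ ∀ ℓ ψ p q, EmptyDisc V ℓ ψ → (D ℓ).Nonempty →
      p ∈ contact V ℓ ψ → q ∈ contact V ℓ ψ → p ≠ q →
      1 ≤ ‖ℓ‖ * Real.cos r ∧ ∀ v ∈ V, r ≤ dist (ψ ℓ) v := by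
  have hpi := Real.pi_pos
  choose! R hR hrad using fun v (hv : v ∈ V) => exists_contact_radius hd hv
  choose! ε hε hεπ hcone using fun v (hv : v ∈ V) => exists_inner_eq_cos_dist hd hv
  -- The number `r` is below each contact radius, below half the radius of each cone neighbourhood,
  -- and below half the distance between distinct cone points.
  have hev : ∀ᶠ r : ℝ in 𝓝[>] 0, r < Real.pi / 2 ∧ ∀ v ∈ V, r < R v ∧ r < ε v / 2 ∧
      ∀ w ∈ V, v ≠ w → r < dist v w / 2 := by
    have hlt : ∀ c : ℝ, 0 < c → ∀ᶠ r : ℝ in 𝓝[>] 0, r < c := fun c hc =>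
      (Filter.eventually_of_mem (Ioo_mem_nhdsGT hc) fun r hr => hr.2)
    refine (hlt _ (by linarith)).and ((Filter.eventually_all_finset V).2 fun v hv =>
      (hlt _ (hR v hv)).and ((hlt _ (half_pos (hε v hv))).and
        ((Filter.eventually_all_finset V).2 fun w hw => ?_)))
    by_cases hvw : v = w
    · exact Filter.Eventually.of_forall fun r h => absurd hvw h
    · exact (hlt _ (half_pos (dist_pos.2 hvw))).mono fun r hr _ => hr
  obtain ⟨r, ⟨hr2, hrV⟩, hr0⟩ := (hev.and self_mem_nhdsWithin).exists
  have hr0 : 0 < r := hr0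
  refine ⟨r, hr0, hr2, fun ℓ ψ p q h ⟨x, hx⟩ hp hq hpq => ?_⟩
  have hℓD := mem_D_self hx
  have hℓ0 : ℓ ≠ 0 := ne_zero_of_mem_D hℓD
  have hbig : 1 ≤ ‖ℓ‖ * Real.cos r := by
    by_contra! hlt
    have hang : ∀ p, p ∈ contact V ℓ ψ → angle p ℓ < r := by
      intro p hp
      rw [angle_lt_iff (ne_zero_of_norm_eq_one hp.1) hℓ0 hr0.le (by linarith), hp.1, one_mul,
        real_inner_comm, hp.2.1]
      exact hlt
    obtain ⟨hp1, hp2, v, hv, hpv⟩ := hp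
    obtain ⟨hq1, hq2, w, hw, hqw⟩ := hq
    have hap := hang p ⟨hp1, hp2, v, hv, hpv⟩
    have haq := hang q ⟨hq1, hq2, w, hw, hqw⟩
    by_cases hvw : v = w
    · subst hvw
      have h1 := (hrV v hv).1
      exact hpq (hrad v hv ℓ ψ ℓ ψ p q h h (fun _ _ => rfl) hp1 hp2 hpv hq1 hq2 hqw ℓ ⟨hℓD, hℓD⟩
        (hap.trans h1) (haq.trans h1))
    · have h1 := (hrV v hv).2.2 w hw hvw
      have h2 := hpv ℓ hℓD
      have h3 := hqw ℓ hℓD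
      rw [angle_comm] at h2 h3
      have h4 := dist_triangle_left v w (ψ ℓ)
      linarith
  refine ⟨hbig, fun v hv => ?_⟩
  by_contra! hlt
  have hn := norm_inv_smul hℓ0
  have hnpos := norm_pos_iff.2 hℓ0
  have hmem : ∀ {y}, y ≠ 0 → (y ∈ D ((Real.cos r)⁻¹ • (‖ℓ‖⁻¹ • ℓ)) ↔ angle ℓ y < r) := by
    intro y hy
    rw [mem_D_smul_iff hn hy hr0 hr2, angle_smul_left_of_pos _ _ (inv_pos.2 hnpos)]
  have hdist : ∀ y ∈ D ℓ, angle ℓ y < r → dist (ψ y) v < ε v := by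
    intro y hy hyr
    have h1 := dist_triangle (ψ y) (ψ ℓ) v
    have h2 := h.locIso.dist_le (convex_D ℓ) hy hℓD
    rw [angle_comm] at h2
    have h3 := (hrV v hv).2.1
    linarith
  obtain ⟨a, ha, haeq⟩ := hcone v hv (D ℓ ∩ D ((Real.cos r)⁻¹ • (‖ℓ‖⁻¹ • ℓ)))
    ((isOpen_D _).inter (isOpen_D _)) ((convex_D _).inter (convex_D _)).isPreconnected ψ
    (h.locIso.mono inter_subset_left)
    (fun y hy => hdist y hy.1 ((hmem (ne_zero_of_mem_D hy.1)).1 hy.2))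
    (fun y hy => h.notMem y hy.1)
  have h1 := haeq ℓ ⟨hℓD, (hmem hℓ0).2 (by rwa [angle_self hℓ0])⟩
  have h2 : Real.cos r < Real.cos (dist (ψ ℓ) v) :=
    Real.cos_lt_cos_of_nonneg_of_le_pi dist_nonneg (by linarith) hlt
  have h3 : ‖ℓ‖ * Real.cos r < ⟪ℓ, a⟫ := by
    rw [real_inner_comm, h1]; exact mul_lt_mul_of_pos_left h2 hnpos
  have haD : a ∈ D ℓ := by
    change ‖a‖ < ⟪ℓ, a⟫
    rw [ha]; linarith
  have har : angle ℓ a < r := by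
    rw [angle_lt_iff hℓ0 (ne_zero_of_mem_D haD) hr0.le (by linarith), ha, mul_one]; exact h3
  have h4 := haeq a ⟨haD, (hmem (ne_zero_of_mem_D haD)).2 har⟩
  rw [real_inner_self_eq_norm_sq, ha, one_pow, one_mul] at h4
  have h5 : dist (ψ a) v = 0 := Real.injOn_cos ⟨dist_nonneg,
    (hdist a haD har).le.trans (hεπ v hv).le⟩ ⟨le_rfl, hpi.le⟩ (by rw [← h4, Real.cos_zero])
  exact h.notMem a haD (dist_eq_zero.1 h5 ▸ hv)

/-! ### The polygon spanned by the contact points -/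

/-- An empty disc with at least three contact points. -/
structure IsFull (V : Finset S) (ℓ : E3) (ψ : E3 → S) : Prop where
  emptyDisc : EmptyDisc V ℓ ψ
  nonempty : (D ℓ).Nonempty
  three_le_card : 3 ≤ (vertices V ℓ ψ).card

lemma inner_lt_one {x y : E3} (hx : ‖x‖ = 1) (hy : ‖y‖ = 1) (hxy : x ≠ y) : ⟪x, y⟫ < 1 := by
  have := (inner_lt_norm_mul_iff_real (x := x) (y := y)).2 (by rwa [hx, hy, one_smul, one_smul])
  rwa [hx, hy, one_mul] at this

/-- A finite set of points of the circle `⟪ℓ, ·⟫ = 1` of the unit sphere. -/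
def OnCircle (ℓ : E3) (W : Finset E3) : Prop := ∀ w ∈ W, ‖w‖ = 1 ∧ ⟪ℓ, w⟫ = 1

namespace OnCircle

variable {ℓ : E3} {W : Finset E3}

lemma inner_sum (h : OnCircle ℓ W) (a : E3 → ℝ) : ⟪ℓ, ∑ w ∈ W, a w • w⟫ = ∑ w ∈ W, a w := by
  rw [_root_.inner_sum]
  exact Finset.sum_congr rfl fun w hw => by rw [real_inner_smul_right, (h w hw).2, mul_one]

lemma isConvexPolygon (h : OnCircle ℓ W) (h3 : 3 ≤ W.card) : IsConvexPolygon W where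
  three_le_card := h3
  norm_eq_one w hw := (h w hw).1
  hemisphere := ⟨ℓ, fun w hw => by rw [(h w hw).2]; exact one_pos⟩
  convex_position := by
    rintro w hw ⟨a, ha, haw, hsum⟩
    have h1 : ∑ x ∈ W, a x = 1 := by rw [← h.inner_sum, ← hsum, (h w hw).2]
    have h2 : ∑ x ∈ W, a x * ⟪x, w⟫ = 1 := by
      have : ⟪∑ x ∈ W, a x • x, w⟫ = 1 := by
        rw [← hsum, real_inner_self_eq_norm_sq, (h w hw).1, one_pow]
      rw [sum_inner] at this
      rw [← this]
      exact Finset.sum_congr rfl fun x _ => (real_inner_smul_left _ _ _).symm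
    -- The weights sum to `1` and the average of `⟪x, w⟫` is `1`, although distinct unit vectors
    -- have product below `1`: points of a circle are in convex position.
    have h3 : ∑ x ∈ W, a x * (1 - ⟪x, w⟫) = 0 := by
      simp only [mul_sub, mul_one, Finset.sum_sub_distrib, h1, h2, sub_self]
    have h4 := (Finset.sum_eq_zero_iff_of_nonneg fun x hx => mul_nonneg (ha x hx)
      (sub_nonneg.2 (by
        have := real_inner_le_norm x w
        rwa [(h x hx).1, (h w hw).1, one_mul] at this))).1 h3
    have h5 : ∑ x ∈ W, a x = 0 := Finset.sum_eq_zero fun x hx => by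
      by_cases hxw : x = w
      · rw [hxw, haw]
      · exact (mul_eq_zero.1 (h4 x hx)).resolve_right
          (sub_pos.2 (inner_lt_one (h x hx).1 (h w hw).1 hxw)).ne'
    rw [h1] at h5
    exact one_ne_zero h5

lemma norm_le (h : OnCircle ℓ W) {z : E3} (hz : z ∈ cone W) : ‖z‖ ≤ ⟪ℓ, z⟫ := by
  obtain ⟨a, ha, rfl⟩ := hz
  rw [h.inner_sum]
  refine (norm_sum_le _ _).trans (Finset.sum_le_sum fun w hw => ?_)
  rw [norm_smul, (h w hw).1, mul_one, Real.norm_of_nonneg (ha w hw)]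

lemma exists_eq_smul (h : OnCircle ℓ W) {z : E3} (hz : z ∈ cone W) (hz0 : z ≠ 0) (hzD : z ∉ D ℓ) :
    ∃ w ∈ W, ∃ r : ℝ, 0 < r ∧ z = r • w := by
  have heq : ⟪ℓ, z⟫ = ‖z‖ := le_antisymm (not_lt.1 hzD) (h.norm_le hz)
  obtain ⟨a, ha, hsum⟩ := hz
  have h1 : ∑ x ∈ W, a x = ‖z‖ := by rw [← h.inner_sum, ← hsum, heq]
  have hzn : 0 < ‖z‖ := norm_pos_iff.2 hz0
  have h2 : ∑ x ∈ W, a x * ⟪x, z⟫ = ‖z‖ * ‖z‖ := by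
    have : ⟪∑ x ∈ W, a x • x, z⟫ = ‖z‖ * ‖z‖ := by rw [← hsum, real_inner_self_eq_norm_mul_norm]
    rw [sum_inner] at this
    rw [← this]
    exact Finset.sum_congr rfl fun x _ => (real_inner_smul_left _ _ _).symm
  have h3 : ∑ x ∈ W, a x * (‖z‖ - ⟪x, z⟫) = 0 := by
    simp only [mul_sub, Finset.sum_sub_distrib, ← Finset.sum_mul, h1, h2, sub_self]
  have h4 := (Finset.sum_eq_zero_iff_of_nonneg fun x hx => mul_nonneg (ha x hx)
    (sub_nonneg.2 (by
      have := real_inner_le_norm x z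
      rwa [(h x hx).1, one_mul] at this))).1 h3
  obtain ⟨w, hw, hne⟩ : ∃ w ∈ W, a w ≠ 0 := by
    by_contra! hall
    rw [Finset.sum_eq_zero hall] at h1
    exact hzn.ne h1
  have h5 : ⟪w, z⟫ = ‖z‖ := by
    have := (mul_eq_zero.1 (h4 w hw)).resolve_left hne
    linarith
  refine ⟨w, hw, ‖z‖, hzn, ?_⟩
  have h6 := (inner_eq_norm_mul_iff_real (x := w) (y := z)).1 (by rw [h5, (h w hw).1, one_mul])
  rw [(h w hw).1, one_smul] at h6
  exact h6.symm

lemma exists_two_pos (h : OnCircle ℓ W) {a : E3 → ℝ} (ha : ∀ w ∈ W, 0 ≤ a w)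
    (hz : ∑ w ∈ W, a w • w ∈ D ℓ) : ∃ p ∈ W, ∃ q ∈ W, p ≠ q ∧ 0 < a p ∧ 0 < a q := by
  have hlt : ‖∑ w ∈ W, a w • w‖ < ∑ w ∈ W, a w := by rw [← h.inner_sum]; exact hz
  obtain ⟨p, hp, hpos⟩ : ∃ p ∈ W, 0 < a p := by
    by_contra! hcon
    exact ((norm_nonneg _).trans_lt hlt).not_ge (Finset.sum_nonpos hcon)
  by_contra! hcon
  have h0 : ∀ w ∈ W, w ≠ p → a w = 0 := fun w hw hne =>
    le_antisymm (hcon p hp w hw hne.symm hpos) (ha w hw)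
  rw [Finset.sum_eq_single_of_mem p hp fun w hw hne => by rw [h0 w hw hne, zero_smul],
    Finset.sum_eq_single_of_mem p hp h0, norm_smul, (h p hp).1, mul_one,
    Real.norm_of_nonneg hpos.le] at hlt
  exact hlt.false

lemma openCone_subset (h : OnCircle ℓ W) (h3 : 3 ≤ W.card) : openCone W ⊆ D ℓ := by
  rintro z hz
  by_contra hzD
  have hW := h.isConvexPolygon h3
  have hz0 : z ≠ 0 := fun h0 => hW.zero_notMem_openCone (h0 ▸ hz)
  obtain ⟨w, hw, r, hr, rfl⟩ := h.exists_eq_smul (openCone_subset_cone _ hz) hz0 hzD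
  have h1 : w ∈ openCone W := by
    have := smul_mem_openCone hz (inv_pos.2 hr)
    rwa [smul_smul, inv_mul_cancel₀ hr.ne', one_smul] at this
  have hwn := hW.norm_eq_one w hw
  obtain ⟨a, ha, haw⟩ := h1
  obtain ⟨q, hq, hqw, -⟩ := hW.exists_third w w
  have h2 : ∑ x ∈ W, a x = 1 := by rw [← h.inner_sum, ← haw, (h w hw).2]
  have h3 : ∑ x ∈ W, a x * ⟪x, w⟫ = 1 := by
    have : ⟪∑ x ∈ W, a x • x, w⟫ = 1 := by
      rw [← haw, real_inner_self_eq_norm_sq, hwn, one_pow]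
    rw [sum_inner] at this
    rw [← this]
    exact Finset.sum_congr rfl fun x _ => (real_inner_smul_left _ _ _).symm
  have h4 : ∑ x ∈ W, a x * ⟪x, w⟫ < ∑ x ∈ W, a x := by
    refine Finset.sum_lt_sum (fun x hx => ?_) ⟨q, hq, ?_⟩
    · have := real_inner_le_norm x w
      rw [(h x hx).1, hwn, one_mul] at this
      nlinarith [ha x hx]
    · have := inner_lt_one (h q hq).1 hwn hqw
      nlinarith [ha q hq]
  linarith

lemma arcCone_subset (h : OnCircle ℓ W) {p q : E3} (hp : p ∈ W) (hq : q ∈ W) (hpq : p ≠ q) :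
    arcCone p q ⊆ D ℓ := by
  rintro _ ⟨a, b, ha, hb, rfl⟩
  have hp1 := (h p hp).1
  have hq1 := (h q hq).1
  have h1 := inner_lt_one hp1 hq1 hpq
  change ‖a • p + b • q‖ < ⟪ℓ, a • p + b • q⟫
  rw [inner_add_right, real_inner_smul_right, real_inner_smul_right, (h p hp).2, (h q hq).2]
  refine lt_of_pow_lt_pow_left₀ 2 (by linarith) ?_
  rw [norm_add_sq_real, norm_smul, norm_smul, real_inner_smul_left, real_inner_smul_right, hp1, hq1,
    Real.norm_of_nonneg ha.le, Real.norm_of_nonneg hb.le]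
  nlinarith [mul_pos ha hb]

lemma mem_D_or_mem (h : OnCircle ℓ W) {z : E3} (hz : z ∈ polygon W) : z ∈ D ℓ ∨ z ∈ W := by
  by_contra! hcon
  obtain ⟨w, hw, r, hr, hzw⟩ := h.exists_eq_smul hz.2 (ne_zero_of_norm_eq_one hz.1) hcon.1
  exact hcon.2 (eq_of_pos_smul_eq hz.1 (h w hw).1 hr hzw ▸ hw)

end OnCircle

lemma EmptyDisc.onCircle (hd : IsSphericalConeMetric V) {ℓ x : E3} {ψ : E3 → S}
    (h : EmptyDisc V ℓ ψ) (hx : x ∈ D ℓ) : OnCircle ℓ (vertices V ℓ ψ) := fun w hw => by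
  obtain ⟨h1, h2, -⟩ := (h.mem_vertices hd hx).1 hw
  exact ⟨h1, h2⟩

lemma IsFull.onCircle (hd : IsSphericalConeMetric V) {ℓ : E3} {ψ : E3 → S} (h : IsFull V ℓ ψ) :
    OnCircle ℓ (vertices V ℓ ψ) := by
  obtain ⟨x, hx⟩ := h.nonempty
  exact h.emptyDisc.onCircle hd hx

lemma IsFull.mem_vertices (hd : IsSphericalConeMetric V) {ℓ : E3} {ψ : E3 → S} (h : IsFull V ℓ ψ)
    {p : E3} : p ∈ vertices V ℓ ψ ↔ p ∈ contact V ℓ ψ := by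
  obtain ⟨x, hx⟩ := h.nonempty
  exact h.emptyDisc.mem_vertices hd hx

lemma IsFull.isConvexPolygon (hd : IsSphericalConeMetric V) {ℓ : E3} {ψ : E3 → S}
    (h : IsFull V ℓ ψ) : IsConvexPolygon (vertices V ℓ ψ) :=
  (h.onCircle hd).isConvexPolygon h.three_le_card

lemma cone_mono {W W' : Finset E3} (h : W ⊆ W') : cone W ⊆ cone W' := by
  classical
  rintro x ⟨a, ha, rfl⟩
  refine ⟨fun w => if w ∈ W then a w else 0, fun w _ => ?_, ?_⟩
  · dsimp only; split_ifs with hw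
    exacts [ha w hw, le_rfl]
  · rw [← Finset.sum_subset h fun w _ hw => by simp only [if_neg hw, zero_smul]]
    exact Finset.sum_congr rfl fun w hw => by simp only [if_pos hw]

/-- Complementary slackness. -/
lemma EmptyDisc.mem_contact_of_pos (hd : IsSphericalConeMetric V) {ℓ ℓ' x : E3} {ψ ψ' : E3 → S}
    (h : EmptyDisc V ℓ ψ) (h' : EmptyDisc V ℓ' ψ') (hx : x ∈ D ℓ) (hx' : x ∈ D ℓ')
    (heq : ∀ᶠ y in 𝓝 x, ψ y = ψ' y) {a : E3 → ℝ} (ha : ∀ w ∈ vertices V ℓ ψ, 0 ≤ a w)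
    (hxa : x = ∑ w ∈ vertices V ℓ ψ, a w • w) :
    ⟪ℓ', x⟫ ≤ ⟪ℓ, x⟫ ∧ (⟪ℓ, x⟫ ≤ ⟪ℓ', x⟫ → ∀ w ∈ vertices V ℓ ψ, 0 < a w →
      w ∈ contact V ℓ' ψ') := by
  have hdual : ∀ p ∈ vertices V ℓ ψ, ⟪ℓ', p⟫ ≤ 1 ∧ (⟪ℓ', p⟫ = 1 → p ∈ contact V ℓ' ψ') :=
    fun p hp => h.inner_contact_le hd h' hx hx' heq ((h.mem_vertices hd hx).1 hp)
  have hnn : ∀ w ∈ vertices V ℓ ψ, 0 ≤ a w * (1 - ⟪ℓ', w⟫) := fun w hw =>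
    mul_nonneg (ha w hw) (sub_nonneg.2 (hdual w hw).1)
  have h1 : ⟪ℓ', x⟫ = ∑ w ∈ vertices V ℓ ψ, a w * ⟪ℓ', w⟫ := by
    rw [hxa, inner_sum]; exact Finset.sum_congr rfl fun w _ => real_inner_smul_right _ _ _
  have h2 : ⟪ℓ, x⟫ = ∑ w ∈ vertices V ℓ ψ, a w := by rw [hxa, (h.onCircle hd hx).inner_sum]
  have h3 : ∑ w ∈ vertices V ℓ ψ, a w * (1 - ⟪ℓ', w⟫) = ⟪ℓ, x⟫ - ⟪ℓ', x⟫ := by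
    simp only [mul_sub, mul_one, Finset.sum_sub_distrib, h1, h2]
  refine ⟨?_, fun hle w hw hpos => ?_⟩
  · have := Finset.sum_nonneg hnn
    linarith
  · have h4 : ∑ w ∈ vertices V ℓ ψ, a w * (1 - ⟪ℓ', w⟫) = 0 :=
      le_antisymm (by linarith) (Finset.sum_nonneg hnn)
    have := (mul_eq_zero.1 ((Finset.sum_eq_zero_iff_of_nonneg hnn).1 h4 w hw)).resolve_left hpos.ne'
    exact (hdual w hw).2 (by linarith)

/-- An optimal disc at `x` whose polygon contains `x` can be chosen with at least three contact
points. -/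
lemma exists_isFull [CompactSpace S] (hd : IsSphericalConeMetric V)
    (hdec : IsConvexDecomposition V 𝓔) {ℓ₀ x : E3} {ψ₀ : E3 → S} (h₀ : EmptyDisc V ℓ₀ ψ₀)
    (hx₀ : x ∈ D ℓ₀) :
    ∃ ℓ ψ, IsFull V ℓ ψ ∧ x ∈ D ℓ ∧ x ∈ cone (vertices V ℓ ψ) ∧
      ∀ y ∈ D ℓ₀ ∩ D ℓ, ψ y = ψ₀ y := by
  classical
  obtain ⟨ℓ, ψ, hopt, hag⟩ := exists_isOptimal hd hdec h₀ hx₀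
  have hx := hopt.mem
  have hc := hopt.emptyDisc.onCircle hd hx
  obtain ⟨a, ha, hxa⟩ := hopt.mem_cone hd
  obtain ⟨p, hp, q, hq, hpq, hap, haq⟩ := hc.exists_two_pos ha (hxa ▸ hx)
  -- The point `x` is approached by points off the plane of `p` and `q`; the limit of their optimal
  -- discs is shown to have a third contact point.
  obtain ⟨w, hw⟩ : ∃ w : E3, w ∉ Submodule.span ℝ {p, q} := by
    by_contra! hall
    have htop : Submodule.span ℝ ({p, q} : Set E3) = ⊤ := Submodule.eq_top_iff'.2 hall
    have h1 := finrank_span_finset_le_card (R := ℝ) ({p, q} : Finset E3)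
    rw [Finset.coe_pair, Set.finrank, htop, finrank_top, finrank_euclideanSpace_fin] at h1
    have := Finset.card_le_two (a := p) (b := q)
    omega
  have hyt : Tendsto (fun n : ℕ => x + (1 / ((n : ℝ) + 1)) • w) atTop (𝓝 x) := by
    have := (tendsto_one_div_add_atTop_nhds_zero_nat (𝕜 := ℝ)).smul_const w
    rw [zero_smul] at this
    simpa using tendsto_const_nhds (x := x).add this
  obtain ⟨N, hN⟩ := eventually_atTop.1 (hyt.eventually_mem ((isOpen_D ℓ).mem_nhds hx))
  set y : ℕ → E3 := fun n => x + (1 / (((n + N : ℕ) : ℝ) + 1)) • w with hy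
  have hyt' : Tendsto y atTop (𝓝 x) := hyt.comp (tendsto_add_atTop_nat N)
  have hyD : ∀ n, y n ∈ D ℓ := fun n => hN (n + N) (Nat.le_add_left N n)
  choose ℓ' ψ' hopt' hag' using fun n => exists_isOptimal hd hdec hopt.emptyDisc (hyD n)
  obtain ⟨M, hM⟩ := hdec.exists_norm_le hd
  obtain ⟨l, -, k, hk, hl⟩ := (isCompact_closedBall (0 : E3) M).tendsto_subseq
    (fun n => by simpa using hM (ℓ' n) (ψ' n) (hopt' n).emptyDisc ⟨_, (hopt' n).mem⟩ :
      ∀ n, ℓ' n ∈ closedBall (0 : E3) M)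
  have hyk := hyt'.comp hk.tendsto_atTop
  have hle : ⟪ℓ, x⟫ ≤ ⟪l, x⟫ := le_of_tendsto_of_tendsto' (tendsto_const_nhds.inner hyk)
    (hl.inner hyk) fun n => (hopt' (k n)).le ℓ ψ hopt.emptyDisc (hyD (k n))
      (eventuallyEq_of_agree (fun z hz => (hag' (k n) z hz).symm) (hyD _) (hopt' _).mem)
  have hxl : x ∈ D l := lt_of_lt_of_le (show ‖x‖ < ⟪ℓ, x⟫ from hx) hle
  obtain ⟨Ψ, hΨ, hΨag, hΨn⟩ := exists_limit_disc hd (fun n => (hopt' (k n)).emptyDisc) hl hx hxl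
    (fun n => hag' (k n))
  have hsub := eventually_contact_subset hd (fun n => (hopt' (k n)).emptyDisc) hl hxl hΨ hΨn
  have heq : ∀ᶠ z in 𝓝 x, Ψ z = ψ z := eventuallyEq_of_agree (fun z hz => hΨag z hz.symm) hxl hx
  -- The limit disc has at least the optimal value at `x`, so it is another optimal disc there.
  have hopt'' : IsOptimal V l Ψ x := ⟨hΨ, hxl, fun ℓ₁ ψ₁ h₁ hx₁ h => (hopt.le ℓ₁ ψ₁ h₁ hx₁
    (h.and heq |>.mono fun z hz => hz.1.trans hz.2)).trans hle⟩
  have hΨ₀ : ∀ z ∈ D ℓ₀ ∩ D l, Ψ z = ψ₀ z := fun z hz => by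
    refine hΨ.agree hd h₀ hxl hx₀ ?_ z hz.symm
    exact heq.and (eventuallyEq_of_agree hag hx₀ hx) |>.mono fun z hz => hz.1.trans hz.2
  refine ⟨l, Ψ, ⟨hΨ, ⟨x, hxl⟩, ?_⟩, hxl, hopt''.mem_cone hd, hΨ₀⟩
  by_contra! hcard
  have hcontact : ∀ w ∈ vertices V ℓ ψ, 0 < a w → w ∈ vertices V l Ψ := fun w hw hpos =>
    (hΨ.mem_vertices hd hxl).2 ((hopt.emptyDisc.mem_contact_of_pos hd hΨ hx hxl
      (heq.mono fun _ h => h.symm) ha hxa).2 hle w hw hpos)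
  -- By complementary slackness `p` and `q` are contact points of the limit disc. If there were no
  -- others, an approximating point would lie in the cone over `p` and `q`, hence in their plane.
  have hpair : ({p, q} : Finset E3) = vertices V l Ψ := by
    refine Finset.eq_of_subset_of_card_le (fun w hw => ?_) ?_
    · rcases Finset.mem_insert.1 hw with rfl | hw
      · exact hcontact _ hp hap
      · rw [Finset.mem_singleton.1 hw]; exact hcontact _ hq haq
    · rw [Finset.card_pair hpq]; omega
  have hspan : ∀ z ∈ cone (vertices V l Ψ), z ∈ Submodule.span ℝ ({p, q} : Set E3) := by
    rw [← hpair]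
    rintro z ⟨b, -, rfl⟩
    exact Submodule.sum_mem _ fun w hw => Submodule.smul_mem _ _
      (Submodule.subset_span (by simpa using hw))
  obtain ⟨n, hn⟩ := hsub.exists
  have hyn : y (k n) ∈ cone (vertices V l Ψ) := by
    refine cone_mono (fun w hw => ?_) ((hopt' (k n)).mem_cone hd)
    exact (hΨ.mem_vertices hd hxl).2
      (hn (((hopt' (k n)).emptyDisc.mem_vertices hd (hopt' (k n)).mem).1 hw))
  have h1 := Submodule.sub_mem _ (hspan _ hyn) (hspan _ (hopt''.mem_cone hd))
  rw [hy, add_sub_cancel_left] at h1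
  have h2 := Submodule.smul_mem _ (((k n + N : ℕ) : ℝ) + 1) h1
  rw [smul_smul, mul_one_div_cancel (by positivity), one_smul] at h2
  exact hw h2

/-! ### Comparison of full discs -/

lemma mem_D_comp {ℓ y : E3} {A : E3 ≃ₗᵢ[ℝ] E3} : y ∈ D (A.symm ℓ) ↔ A y ∈ D ℓ := by
  rw [← preimage_D]; rfl

lemma mem_contact_comp {ℓ p : E3} {ψ : E3 → S} {A : E3 ≃ₗᵢ[ℝ] E3} :
    p ∈ contact V (A.symm ℓ) (ψ ∘ A) ↔ A p ∈ contact V ℓ ψ := by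
  have h : ∀ v, IsLimitAt (ψ ∘ A) (D (A.symm ℓ)) p v ↔ IsLimitAt ψ (D ℓ) (A p) v := by
    intro v
    constructor
    · intro h y hy
      have := h (A.symm y) (mem_D_comp.2 (by simpa using hy))
      rwa [Function.comp, ← angle_map A, A.apply_symm_apply] at this
    · intro h y hy
      have := h (A y) (mem_D_comp.1 hy)
      rwa [angle_map] at this
  simp only [contact, mem_ofPred_eq, h, A.norm_map, inner_symm_apply]

lemma IsFull.vertices_comp (hd : IsSphericalConeMetric V) {ℓ : E3} {ψ : E3 → S}
    (h : IsFull V ℓ ψ) (A : E3 ≃ₗᵢ[ℝ] E3) :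
    vertices V (A.symm ℓ) (ψ ∘ A) = rot A.symm (vertices V ℓ ψ) := by
  obtain ⟨x, hx⟩ := h.nonempty
  ext p
  rw [(h.emptyDisc.comp A).mem_vertices hd (mem_D_comp.2 (by simpa using hx) : A.symm x ∈ _),
    mem_rot, h.mem_vertices hd]
  exact mem_contact_comp

lemma IsFull.comp (hd : IsSphericalConeMetric V) {ℓ : E3} {ψ : E3 → S} (h : IsFull V ℓ ψ)
    (A : E3 ≃ₗᵢ[ℝ] E3) : IsFull V (A.symm ℓ) (ψ ∘ A) where
  emptyDisc := h.emptyDisc.comp A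
  nonempty := by
    obtain ⟨x, hx⟩ := h.nonempty
    exact ⟨A.symm x, mem_D_comp.2 (by simpa using hx)⟩
  three_le_card := by
    rw [h.vertices_comp hd, rot, Finset.card_map]
    exact h.three_le_card

lemma contact_congr {ℓ : E3} {ψ ψ' : E3 → S} (h : ∀ y ∈ D ℓ, ψ y = ψ' y) :
    contact V ℓ ψ = contact V ℓ ψ' := by
  have : ∀ p v, IsLimitAt ψ (D ℓ) p v ↔ IsLimitAt ψ' (D ℓ) p v := fun p v =>
    forall₂_congr fun y hy => by rw [h y hy]
  simp only [contact, this]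

lemma IsConvexPolygon.eq_of_inner_eq {W : Finset E3} (hW : IsConvexPolygon W) {m m' : E3}
    (h : ∀ w ∈ W, ⟪m, w⟫ = ⟪m', w⟫) : m = m' := by
  obtain ⟨k, hk⟩ := openCone_nonempty W
  refine inner_eq_of_eventually (x := k) ?_
  filter_upwards [hW.isOpen_openCone.mem_nhds hk] with y hy
  obtain ⟨a, -, rfl⟩ := hy
  rw [inner_sum, inner_sum]
  exact Finset.sum_congr rfl fun w hw => by
    rw [real_inner_smul_right, real_inner_smul_right, h w hw]

section Compare

variable {ℓ₁ ℓ₂ y : E3} {ψ₁ ψ₂ : E3 → S}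

lemma IsFull.agree_of_eq (hd : IsSphericalConeMetric V) (h₁ : IsFull V ℓ₁ ψ₁)
    (h₂ : IsFull V ℓ₂ ψ₂) (hy₁ : y ∈ D ℓ₁) (hy₂ : y ∈ D ℓ₂) (heq : ∀ᶠ z in 𝓝 y, ψ₁ z = ψ₂ z)
    (h : ℓ₁ = ℓ₂) : vertices V ℓ₁ ψ₁ = vertices V ℓ₂ ψ₂ ∧ ∀ z ∈ D ℓ₁, ψ₁ z = ψ₂ z := by
  subst h
  have hag : ∀ z ∈ D ℓ₁, ψ₁ z = ψ₂ z := fun z hz =>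
    h₁.emptyDisc.agree hd h₂.emptyDisc hy₁ hy₂ heq z ⟨hz, hz⟩
  refine ⟨?_, hag⟩
  ext p
  rw [h₁.mem_vertices hd, h₂.mem_vertices hd, contact_congr hag]

lemma IsFull.inner_eq (hd : IsSphericalConeMetric V) (h₁ : IsFull V ℓ₁ ψ₁) (h₂ : IsFull V ℓ₂ ψ₂)
    (hy₁ : y ∈ D ℓ₁) (hy₂ : y ∈ D ℓ₂) (heq : ∀ᶠ z in 𝓝 y, ψ₁ z = ψ₂ z)
    (hc₁ : y ∈ cone (vertices V ℓ₁ ψ₁)) (hc₂ : y ∈ cone (vertices V ℓ₂ ψ₂)) :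
    ⟪ℓ₁, y⟫ = ⟪ℓ₂, y⟫ := by
  obtain ⟨a, ha, hya⟩ := hc₁
  obtain ⟨b, hb, hyb⟩ := hc₂
  exact le_antisymm (h₂.emptyDisc.mem_contact_of_pos hd h₁.emptyDisc hy₂ hy₁
    (heq.mono fun _ h => h.symm) hb hyb).1
    (h₁.emptyDisc.mem_contact_of_pos hd h₂.emptyDisc hy₁ hy₂ heq ha hya).1

/-- Both discs have the same value at `y`. All coefficients of `y` over the first polygon are
positive, so slackness puts all its vertices on the second circle. The vertices span, which forces
`ℓ₁ = ℓ₂`. -/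
lemma IsFull.eq_of_mem_openCone (hd : IsSphericalConeMetric V) (h₁ : IsFull V ℓ₁ ψ₁)
    (h₂ : IsFull V ℓ₂ ψ₂) (hy₂ : y ∈ D ℓ₂) (heq : ∀ᶠ z in 𝓝 y, ψ₁ z = ψ₂ z)
    (hc₁ : y ∈ openCone (vertices V ℓ₁ ψ₁)) (hc₂ : y ∈ cone (vertices V ℓ₂ ψ₂)) :
    ℓ₁ = ℓ₂ ∧ vertices V ℓ₁ ψ₁ = vertices V ℓ₂ ψ₂ ∧ ∀ z ∈ D ℓ₁, ψ₁ z = ψ₂ z := by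
  have hy₁ := (h₁.onCircle hd).openCone_subset h₁.three_le_card hc₁
  have hle := (h₁.inner_eq hd h₂ hy₁ hy₂ heq (openCone_subset_cone _ hc₁) hc₂).le
  obtain ⟨a, ha, hya⟩ := hc₁
  have hℓ : ℓ₁ = ℓ₂ := (h₁.isConvexPolygon hd).eq_of_inner_eq fun w hw => by
    have := (h₁.emptyDisc.mem_contact_of_pos hd h₂.emptyDisc hy₁ hy₂ heq (fun w hw => (ha w hw).le)
      hya).2 hle w hw (ha w hw)
    rw [this.2.1, ((h₁.onCircle hd) w hw).2]
  exact ⟨hℓ, h₁.agree_of_eq hd h₂ hy₁ hy₂ heq hℓ⟩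

/-- Slackness makes `p` and `q` contact points of both discs. If the discs differ, `ℓ₂ - ℓ₁` is the
normal of the side: it vanishes at `p` and `q` and is nonnegative at the contact points of the
second disc by weak duality. A further zero would give three independent vectors on which `ℓ₁` and
`ℓ₂` agree. -/
lemma IsFull.isSide_of_mem_arcCone (hd : IsSphericalConeMetric V) (h₁ : IsFull V ℓ₁ ψ₁)
    (h₂ : IsFull V ℓ₂ ψ₂) (hy₂ : y ∈ D ℓ₂) (heq : ∀ᶠ z in 𝓝 y, ψ₁ z = ψ₂ z) {p q m : E3}
    (hs : IsSide (vertices V ℓ₁ ψ₁) p q m) (hpq : y ∈ arcCone p q)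
    (hc₂ : y ∈ cone (vertices V ℓ₂ ψ₂)) : ∃ m', IsSide (vertices V ℓ₂ ψ₂) p q m' := by
  have hc := h₁.onCircle hd
  have hc' := h₂.onCircle hd
  have hy₁ := hc.arcCone_subset hs.1 hs.2.1 hs.2.2.1 hpq
  have hyy := h₁.inner_eq hd h₂ hy₁ hy₂ heq (arcCone_subset_cone hs.1 hs.2.1 hpq) hc₂
  have hdual := fun w hw => h₁.emptyDisc.inner_contact_le hd h₂.emptyDisc hy₁ hy₂ heq (p := w)
    ((h₁.mem_vertices hd).1 hw)
  have hdual' := fun w hw => h₂.emptyDisc.inner_contact_le hd h₁.emptyDisc hy₂ hy₁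
    (heq.mono fun _ h => h.symm) (p := w) ((h₂.mem_vertices hd).1 hw)
  obtain ⟨a, b, ha, hb, hyab⟩ := hpq
  have hp1 := (hc p hs.1).2
  have hq1 := (hc q hs.2.1).2
  have h3 : ⟪ℓ₂, p⟫ = 1 ∧ ⟪ℓ₂, q⟫ = 1 := by
    rw [hyab] at hyy
    simp only [inner_add_right, real_inner_smul_right, hp1, hq1] at hyy
    have h4 := (hdual p hs.1).1
    have h5 := (hdual q hs.2.1).1
    constructor <;> nlinarith [mul_nonneg ha.le (sub_nonneg.2 h4), mul_nonneg hb.le (sub_nonneg.2 h5)]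
  have hp₂ := (h₂.mem_vertices hd).2 ((hdual p hs.1).2 h3.1)
  have hq₂ := (h₂.mem_vertices hd).2 ((hdual q hs.2.1).2 h3.2)
  by_cases hℓ : ℓ₁ = ℓ₂
  · rw [← (h₁.agree_of_eq hd h₂ hy₁ hy₂ heq hℓ).1]
    exact ⟨m, hs⟩
  refine ⟨ℓ₂ - ℓ₁, hp₂, hq₂, hs.2.2.1, by rw [inner_sub_left, h3.1, hp1, sub_self],
    by rw [inner_sub_left, h3.2, hq1, sub_self], fun w hw hwp hwq => ?_⟩
  have h6 := (hdual' w hw).1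
  have h7 := (hc' w hw).2
  rw [inner_sub_left, h7, sub_pos]
  refine lt_of_le_of_ne h6 fun h8 => ?_
  have hW := h₁.isConvexPolygon hd
  have hmw : ⟪m, w⟫ ≠ 0 := by
    intro h0
    obtain ⟨f, g, hw'⟩ := hW.exists_eq_add_of_inner_eq_zero hs h0
    have e1 : f + g = 1 := by
      have := h7
      rw [hw', inner_add_right, real_inner_smul_right, real_inner_smul_right, h3.1, h3.2] at this
      linarith
    have e2 : ⟪w, w⟫ = 1 := by rw [real_inner_self_eq_norm_sq, (hc' w hw).1, one_pow]
    have e3 : ⟪p, p⟫ = 1 := by rw [real_inner_self_eq_norm_sq, (hc p hs.1).1, one_pow]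
    have e4 : ⟪q, q⟫ = 1 := by rw [real_inner_self_eq_norm_sq, (hc q hs.2.1).1, one_pow]
    rw [hw'] at e2
    simp only [inner_add_left, inner_add_right, real_inner_smul_left, real_inner_smul_right, e3, e4,
      real_inner_comm p q] at e2
    have e5 := inner_lt_one (hc p hs.1).1 (hc q hs.2.1).1 hs.2.2.1
    -- A unit vector in the plane of `p` and `q` with value `1` lies on the line through them, and a
    -- line meets the sphere in at most two points.
    have e6 : f * g * (1 - ⟪p, q⟫) = 0 := by
      have : g = 1 - f := by linarith
      subst this
      nlinarith
    rcases mul_eq_zero.1 ((mul_eq_zero.1 e6).resolve_right (sub_pos.2 e5).ne') with e | e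
    · rw [e, zero_add] at e1
      exact hwq (by rw [hw', e, e1, zero_smul, one_smul, zero_add])
    · rw [e, add_zero] at e1
      exact hwp (by rw [hw', e, e1, zero_smul, one_smul, add_zero])
  refine hℓ ?_
  -- both linear forms agree on `p`, `q` and `w`
  obtain ⟨r, hr, hrp, hrq⟩ := hW.exists_third p q
  obtain ⟨f, g, k, -, -, -, hsum, -⟩ :=
    hW.exists_coords hs.1 hs.2.1 hr hs.2.2.1 hrp.symm hrq.symm
  have e1 : ⟪m, w⟫ = k w * ⟪m, r⟫ := by
    conv_lhs => rw [hsum w]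
    simp only [inner_add_right, real_inner_smul_right, hs.2.2.2.1, hs.2.2.2.2.1]
    ring
  have e2 : k w ≠ 0 := fun h0 => hmw (by rw [e1, h0, zero_mul])
  have e3 : k w * (⟪ℓ₁, r⟫ - ⟪ℓ₂, r⟫) = 0 := by
    have e4 : ⟪ℓ₁, w⟫ - ⟪ℓ₂, w⟫ = 0 := by rw [h7, h8, sub_self]
    rw [hsum w] at e4
    simp only [inner_add_right, real_inner_smul_right, hp1, hq1, h3.1, h3.2] at e4
    linarith
  have e4 : ⟪ℓ₁, r⟫ = ⟪ℓ₂, r⟫ := sub_eq_zero.1 ((mul_eq_zero.1 e3).resolve_left e2)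
  refine inner_eq_of_eventually (x := 0) (Filter.Eventually.of_forall fun z => ?_)
  rw [hsum z]
  simp only [inner_add_right, real_inner_smul_right, hp1, hq1, h3.1, h3.2, e4]

end Compare

lemma IsSide.eq_or_eq {W : Finset E3} {p q m p' q' m' y : E3} (hs : IsSide W p q m)
    (hs' : IsSide W p' q' m') (hy : y ∈ arcCone p q) (hy' : y ∈ arcCone p' q') :
    (p' = p ∧ q' = q) ∨ (p' = q ∧ q' = p) := by
  have h0 := hs.inner_arcCone hy
  obtain ⟨a, b, ha, hb, rfl⟩ := hy'
  rw [inner_add_right, real_inner_smul_right, real_inner_smul_right] at h0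
  have hnn : ∀ w ∈ W, 0 ≤ ⟪m, w⟫ := fun w hw =>
    IsConvexPolygon.inner_nonneg_of_side hs (mem_cone_of_mem hw)
  have hmem : ∀ w ∈ W, ⟪m, w⟫ ≤ 0 → w = p ∨ w = q := by
    intro w hw hle
    by_contra! hne
    exact (hs.2.2.2.2.2 w hw hne.1 hne.2).not_ge hle
  have e1 := mul_nonneg ha.le (hnn p' hs'.1)
  have e2 := mul_nonneg hb.le (hnn q' hs'.2.1)
  have hp' := hmem p' hs'.1 (by by_contra! h; linarith [mul_pos ha h])
  have hq' := hmem q' hs'.2.1 (by by_contra! h; linarith [mul_pos hb h])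
  have hne := hs'.2.2.1
  rcases hp' with rfl | rfl <;> rcases hq' with rfl | rfl
  · exact absurd rfl hne
  · exact Or.inl ⟨rfl, rfl⟩
  · exact Or.inr ⟨rfl, rfl⟩
  · exact absurd rfl hne

lemma LocIso.apply_eq_self {ψ : E3 → S} {U : Set E3} (h : LocIso ψ U) (hU : IsOpen U) {c : E3}
    (hc : c ∈ U) {A : E3 ≃ₗᵢ[ℝ] E3} (hA : A c = c) (heq : ∀ᶠ y in 𝓝 c, ψ y = ψ (A y)) (y : E3) :
    A y = y := by
  obtain ⟨ε, hε, hiso⟩ := h c hc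
  have hAt : Tendsto A (𝓝 c) (𝓝 c) := by
    have := A.continuous.tendsto c
    rwa [hA] at this
  have hN : U ∩ ball c ε ∈ 𝓝 c := Filter.inter_mem (hU.mem_nhds hc) (ball_mem_nhds c hε)
  have : A = LinearIsometryEquiv.refl ℝ E3 := by
    refine linearIsometryEquiv_eq_of_eventuallyEq (x := c) ?_
    filter_upwards [heq, hN, hAt.eventually_mem hN] with z h1 h2 h3
    have h4 := hiso _ h3.1 _ h2.1 h3.2 h2.2
    rw [h1, dist_self] at h4
    exact eq_of_angle_eq_zero_of_norm_eq h4.symm (A.norm_map z)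
  rw [this]; rfl

/-- Two full discs with a common value can be rotated so that they have a common germ. -/
lemma IsFull.exists_comp (hd : IsSphericalConeMetric V) {ℓ₁ ℓ₂ y₁ y₂ : E3} {ψ₁ ψ₂ : E3 → S}
    (h₁ : IsFull V ℓ₁ ψ₁) (h₂ : IsFull V ℓ₂ ψ₂) (hy₁ : y₁ ∈ D ℓ₁) (hy₂ : y₂ ∈ D ℓ₂)
    (hn : ‖y₁‖ = ‖y₂‖) (h : ψ₁ y₁ = ψ₂ y₂) :
    ∃ A : E3 ≃ₗᵢ[ℝ] E3, A y₁ = y₂ ∧ y₁ ∈ D (A.symm ℓ₂) ∧ IsFull V (A.symm ℓ₂) (ψ₂ ∘ A) ∧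
      ∀ᶠ z in 𝓝 y₁, ψ₁ z = (ψ₂ ∘ A) z := by
  obtain ⟨A, hA, heq⟩ := h₁.emptyDisc.locIso.exists_frame hd (isOpen_D ℓ₁) (isOpen_D ℓ₂)
    h₂.emptyDisc.locIso hy₁ hy₂ hn h (h₁.emptyDisc.notMem _ hy₁)
  exact ⟨A, hA, mem_D_comp.2 (hA ▸ hy₂), h₂.comp hd A, heq.mono fun _ h => h.symm⟩

lemma image_comp_openPolygon {T : Type*} (ψ : E3 → T) (A : E3 ≃ₗᵢ[ℝ] E3) (W : Finset E3) :
    (ψ ∘ A) '' openPolygon (rot A.symm W) = ψ '' openPolygon W := by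
  ext s
  constructor
  · rintro ⟨z, hz, rfl⟩
    exact ⟨A z, by simpa using mem_openPolygon_rot.1 hz, rfl⟩
  · rintro ⟨z, hz, rfl⟩
    exact ⟨A.symm z, mem_openPolygon_rot.2 (by simpa using hz), by simp⟩

lemma image_comp_openArc {T : Type*} (ψ : E3 → T) (A : E3 ≃ₗᵢ[ℝ] E3) (p q : E3) :
    (ψ ∘ A) '' openArc (A.symm p) (A.symm q) = ψ '' openArc p q := by
  ext s
  constructor
  · rintro ⟨z, hz, rfl⟩
    exact ⟨A z, by simpa using (mem_openArc_map (A := A)).1 hz, rfl⟩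
  · rintro ⟨z, hz, rfl⟩
    exact ⟨A.symm z, (mem_openArc_map (A := A.symm)).1 hz, by simp⟩

/-! ### The Delaunay edges and faces -/

/-- The images of the sides of the polygons spanned by the contact points of full discs. -/
def delaunayEdges (V : Finset S) : Set (Set S) :=
  {e | ∃ ℓ ψ p q m, IsFull V ℓ ψ ∧ IsSide (vertices V ℓ ψ) p q m ∧ e = ψ '' openArc p q}

namespace IsFull

variable {ℓ ℓ₁ ℓ₂ : E3} {ψ ψ₁ ψ₂ : E3 → S}

lemma openPolygon_subset (hd : IsSphericalConeMetric V) (h : IsFull V ℓ ψ) :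
    openPolygon (vertices V ℓ ψ) ⊆ D ℓ := fun _ hy =>
  (h.onCircle hd).openCone_subset h.three_le_card hy.2

lemma openArc_subset (hd : IsSphericalConeMetric V) (h : IsFull V ℓ ψ) {p q m : E3}
    (hs : IsSide (vertices V ℓ ψ) p q m) : openArc p q ⊆ D ℓ := fun _ hy =>
  (h.onCircle hd).arcCone_subset hs.1 hs.2.1 hs.2.2.1 hy.2

lemma image_eq_of_mem (hd : IsSphericalConeMetric V) (h₁ : IsFull V ℓ₁ ψ₁) (h₂ : IsFull V ℓ₂ ψ₂)
    {s : S} (hs₁ : s ∈ ψ₁ '' openPolygon (vertices V ℓ₁ ψ₁))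
    (hs₂ : s ∈ ψ₂ '' openPolygon (vertices V ℓ₂ ψ₂)) :
    ψ₁ '' openPolygon (vertices V ℓ₁ ψ₁) = ψ₂ '' openPolygon (vertices V ℓ₂ ψ₂) := by
  obtain ⟨y₁, hy₁, rfl⟩ := hs₁
  obtain ⟨y₂, hy₂, hyy⟩ := hs₂
  obtain ⟨A, hA, hyD, h, heq⟩ := h₁.exists_comp hd h₂ (h₁.openPolygon_subset hd hy₁)
    (h₂.openPolygon_subset hd hy₂) (hy₁.1.trans hy₂.1.symm) hyy.symm
  have hv := h₂.vertices_comp hd A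
  obtain ⟨-, h3, h4⟩ := h₁.eq_of_mem_openCone hd h hyD heq hy₁.2 (by
    rw [hv, mem_cone_rot, LinearIsometryEquiv.symm_symm, hA]
    exact openCone_subset_cone _ hy₂.2)
  rw [← image_comp_openPolygon ψ₂ A, ← hv, ← h3]
  exact image_congr fun z hz => h4 z (h₁.openPolygon_subset hd hz)

/-- Two points with the same image give a rotation `A` that carries one to the other and preserves
the germ of `ψ`. By `eq_of_mem_openCone` it preserves the disc, so it fixes the centre; since `ψ` is
injective near the centre, `A` is the identity. -/
lemma injOn_openPolygon (hd : IsSphericalConeMetric V) (h : IsFull V ℓ ψ) :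
    InjOn ψ (openPolygon (vertices V ℓ ψ)) := by
  intro y₁ hy₁ y₂ hy₂ hyy
  obtain ⟨A, hA, hyD, h', heq⟩ := h.exists_comp hd h (h.openPolygon_subset hd hy₁)
    (h.openPolygon_subset hd hy₂) (hy₁.1.trans hy₂.1.symm) hyy
  obtain ⟨h2, -, h4⟩ := h.eq_of_mem_openCone hd h' hyD heq hy₁.2 (by
    rw [h.vertices_comp hd, mem_cone_rot, LinearIsometryEquiv.symm_symm, hA]
    exact openCone_subset_cone _ hy₂.2)
  obtain ⟨x, hx⟩ := h.nonempty
  have hℓ := mem_D_self hx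
  have hAℓ : A ℓ = ℓ := by conv_lhs => rw [h2]
                           simp
  rw [← hA]
  refine (h.emptyDisc.locIso.apply_eq_self (isOpen_D ℓ) hℓ hAℓ ?_ y₁).symm
  filter_upwards [(isOpen_D ℓ).mem_nhds hℓ] with z hz using h4 z hz

lemma notMem_skeleton (hd : IsSphericalConeMetric V) (h : IsFull V ℓ ψ) {y : E3}
    (hy : y ∈ openPolygon (vertices V ℓ ψ)) : ψ y ∉ skeleton V (delaunayEdges V) := by
  have hyD := h.openPolygon_subset hd hy
  rintro (hV | ⟨e, ⟨ℓ₂, ψ₂, p, q, m, h₂, hs, rfl⟩, z, hz, hzy⟩)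
  · exact h.emptyDisc.notMem y hyD hV
  · obtain ⟨A, hA, hyD', h', heq⟩ := h.exists_comp hd h₂ hyD (h₂.openArc_subset hd hs hz)
      (hy.1.trans hz.1.symm) hzy.symm
    have hv := h₂.vertices_comp hd A
    obtain ⟨-, h3, -⟩ := h.eq_of_mem_openCone hd h' hyD' heq hy.2 (by
      rw [hv, mem_cone_rot, LinearIsometryEquiv.symm_symm, hA]
      exact arcCone_subset_cone hs.1 hs.2.1 hz.2)
    have h4 : y ∈ openCone (vertices V ℓ ψ) := hy.2
    rw [h3, hv, mem_openCone_rot, LinearIsometryEquiv.symm_symm, hA] at h4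
    exact hs.notMem_openCone (h₂.isConvexPolygon hd) hz.2 h4

/-- Two sides of full discs whose images meet are the same side after a rotation. -/
lemma exists_isSide_comp (hd : IsSphericalConeMetric V) (h₁ : IsFull V ℓ₁ ψ₁)
    (h₂ : IsFull V ℓ₂ ψ₂) {p₁ q₁ m₁ p₂ q₂ m₂ y₁ y₂ : E3}
    (hs₁ : IsSide (vertices V ℓ₁ ψ₁) p₁ q₁ m₁) (hs₂ : IsSide (vertices V ℓ₂ ψ₂) p₂ q₂ m₂)
    (hy₁ : y₁ ∈ openArc p₁ q₁) (hy₂ : y₂ ∈ openArc p₂ q₂) (hyy : ψ₁ y₁ = ψ₂ y₂) :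
    ∃ A : E3 ≃ₗᵢ[ℝ] E3, A y₁ = y₂ ∧ (∀ z ∈ D ℓ₁ ∩ D (A.symm ℓ₂), ψ₁ z = (ψ₂ ∘ A) z) ∧
      openArc p₁ q₁ ⊆ D (A.symm ℓ₂) ∧
      ((A.symm p₂ = p₁ ∧ A.symm q₂ = q₁) ∨ (A.symm p₂ = q₁ ∧ A.symm q₂ = p₁)) := by
  have hyD₁ := h₁.openArc_subset hd hs₁ hy₁
  obtain ⟨A, hA, hyD, h, heq⟩ := h₁.exists_comp hd h₂ hyD₁
    (h₂.openArc_subset hd hs₂ hy₂) (hy₁.1.trans hy₂.1.symm) hyy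
  have hv := h₂.vertices_comp hd A
  have hs₂' : IsSide (vertices V (A.symm ℓ₂) (ψ₂ ∘ A)) (A.symm p₂) (A.symm q₂) (A.symm m₂) := by
    rw [hv, isSide_rot]; simpa using hs₂
  have hyA : y₁ ∈ arcCone (A.symm p₂) (A.symm q₂) := by
    rw [mem_arcCone_map (A := A), A.apply_symm_apply, A.apply_symm_apply, hA]; exact hy₂.2
  obtain ⟨m', hs'⟩ := h₁.isSide_of_mem_arcCone hd h hyD heq hs₁ hy₁.2
    (arcCone_subset_cone hs₂'.1 hs₂'.2.1 hyA)
  exact ⟨A, hA, h₁.emptyDisc.agree hd h.emptyDisc hyD₁ hyD heq, h.openArc_subset hd hs',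
    hs'.eq_or_eq hs₂' hy₁.2 hyA⟩

/-- As for the interior, but here the rotation is only known to preserve the pair of endpoints. It
therefore fixes `p + q`, which is in the disc and serves as the centre. -/
lemma injOn_openArc (hd : IsSphericalConeMetric V) (h : IsFull V ℓ ψ) {p q m : E3}
    (hs : IsSide (vertices V ℓ ψ) p q m) : InjOn ψ (openArc p q) := by
  intro y₁ hy₁ y₂ hy₂ hyy
  obtain ⟨A, hA, hag, hsub, hpq⟩ := h.exists_isSide_comp hd h hs hs hy₁ hy₂ hyy
  have hAc : A (p + q) = p + q := by
    have e : ∀ x y, A.symm x = y → A y = x := fun x y h => by rw [← h, A.apply_symm_apply]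
    rcases hpq with ⟨h1, h2⟩ | ⟨h1, h2⟩
    · rw [map_add, e _ _ h1, e _ _ h2]
    · rw [map_add, e _ _ h1, e _ _ h2, add_comm]
  have hc : p + q ∈ D ℓ := (h.onCircle hd).arcCone_subset hs.1 hs.2.1 hs.2.2.1
    ⟨1, 1, one_pos, one_pos, by simp⟩
  rw [← hA]
  refine (h.emptyDisc.locIso.apply_eq_self (isOpen_D ℓ) hc hAc ?_ y₁).symm
  filter_upwards [(isOpen_D ℓ).mem_nhds hc,
    (isOpen_D (A.symm ℓ)).mem_nhds (mem_D_comp.2 (by rwa [hAc]))] with z hz hz'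
  exact hag z ⟨hz, hz'⟩

lemma openArc_comm (p q : E3) : openArc p q = openArc q p := by
  ext z; rw [mem_openArc, mem_openArc, arcCone_comm]

lemma image_openArc_eq (hd : IsSphericalConeMetric V) (h₁ : IsFull V ℓ₁ ψ₁)
    (h₂ : IsFull V ℓ₂ ψ₂) {p₁ q₁ m₁ p₂ q₂ m₂ : E3} (hs₁ : IsSide (vertices V ℓ₁ ψ₁) p₁ q₁ m₁)
    (hs₂ : IsSide (vertices V ℓ₂ ψ₂) p₂ q₂ m₂) {s : S} (h : s ∈ ψ₁ '' openArc p₁ q₁)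
    (h' : s ∈ ψ₂ '' openArc p₂ q₂) : ψ₁ '' openArc p₁ q₁ = ψ₂ '' openArc p₂ q₂ := by
  obtain ⟨y₁, hy₁, rfl⟩ := h
  obtain ⟨y₂, hy₂, hyy⟩ := h'
  obtain ⟨A, -, hag, hsub, hpq⟩ := h₁.exists_isSide_comp hd h₂ hs₁ hs₂ hy₁ hy₂ hyy.symm
  have hpq' : openArc (A.symm p₂) (A.symm q₂) = openArc p₁ q₁ := by
    rcases hpq with ⟨h1, h2⟩ | ⟨h1, h2⟩
    · rw [h1, h2]
    · rw [h1, h2, openArc_comm]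
  rw [← image_comp_openArc ψ₂ A, hpq']
  exact image_congr fun z hz => hag z ⟨h₁.openArc_subset hd hs₁ hz, hsub hz⟩

end IsFull

/-- Every point outside `V` lies in the polygon of a full disc. -/
lemma exists_isFull_of_notMem [CompactSpace S] (hd : IsSphericalConeMetric V)
    (hdec : IsConvexDecomposition V 𝓔) {s : S} (hs : s ∉ V) :
    ∃ ℓ ψ y, IsFull V ℓ ψ ∧ ‖y‖ = 1 ∧ y ∈ D ℓ ∧ ψ y = s ∧ y ∈ cone (vertices V ℓ ψ) := by
  obtain ⟨x, hx⟩ := exists_norm_eq_one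
  obtain ⟨ℓ₀, g, δ, hg⟩ := exists_chart (hd.regular s hs) hs hx
  obtain ⟨ℓ, ψ, h, hxD, hxc, hag⟩ := exists_isFull hd hdec hg.emptyDisc hg.mem
  exact ⟨ℓ, ψ, x, h, hx, hxD, by rw [hag x ⟨hg.mem, hxD⟩, hg.map_center], hxc⟩

lemma exists_mem_face [CompactSpace S] (hd : IsSphericalConeMetric V)
    (hdec : IsConvexDecomposition V 𝓔) {s : S} (hs : s ∉ skeleton V (delaunayEdges V)) :
    ∃ ℓ ψ, IsFull V ℓ ψ ∧ s ∈ ψ '' openPolygon (vertices V ℓ ψ) := by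
  obtain ⟨ℓ, ψ, y, h, hy, hyD, rfl, hyc⟩ := exists_isFull_of_notMem hd hdec
    (fun hV => hs (Or.inl hV))
  refine ⟨ℓ, ψ, h, y, ⟨hy, ?_⟩, rfl⟩
  by_contra hyo
  have hc := h.onCircle hd
  rcases (h.isConvexPolygon hd).side_or_vertex hyc hyo (ne_zero_of_norm_eq_one hy) with
    ⟨w, hw, r, hr, hyw⟩ | ⟨p, q, m, hside, hypq⟩
  · have h1 : ‖y‖ < ⟪ℓ, y⟫ := hyD
    rw [eq_of_pos_smul_eq hy (hc w hw).1 hr hyw, (hc w hw).1, (hc w hw).2] at h1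
    exact h1.false
  · exact hs (Or.inr ⟨_, ⟨ℓ, ψ, p, q, m, h, hside, rfl⟩, y, ⟨hy, hypq⟩, rfl⟩)

lemma IsFull.image_openPolygon (hd : IsSphericalConeMetric V) {ℓ : E3} {ψ : E3 → S}
    (h : IsFull V ℓ ψ) :
    ψ '' openPolygon (vertices V ℓ ψ) = ψ '' openCone (vertices V ℓ ψ) := by
  refine (image_mono fun y hy => hy.2).antisymm ?_
  rintro _ ⟨y, hy, rfl⟩
  have hyD := (h.onCircle hd).openCone_subset h.three_le_card hy
  have hy0 := ne_zero_of_mem_D hyD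
  exact ⟨_, normalize_mem_openPolygon hy hy0,
    h.emptyDisc.map_smul hyD (inv_pos.2 (norm_pos_iff.2 hy0))⟩

lemma IsFull.isOpen_image (hd : IsSphericalConeMetric V) {ℓ : E3} {ψ : E3 → S}
    (h : IsFull V ℓ ψ) : IsOpen (ψ '' openPolygon (vertices V ℓ ψ)) := by
  rw [h.image_openPolygon hd, isOpen_iff_mem_nhds]
  rintro _ ⟨y, hy, rfl⟩
  have hsub := (h.onCircle hd).openCone_subset h.three_le_card
  exact (h.emptyDisc.locIso.mono hsub).image_mem_nhds hd (h.isConvexPolygon hd).isOpen_openCone hy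
    (h.emptyDisc.notMem y (hsub hy))

/-- The face is connected and open, and the union of the other faces is open and disjoint from it.
Since the faces cover the complement of the skeleton, a component cannot leave a face. -/
lemma IsFull.image_eq_connectedComponentIn [CompactSpace S] (hd : IsSphericalConeMetric V)
    (hdec : IsConvexDecomposition V 𝓔) {ℓ : E3} {ψ : E3 → S} (h : IsFull V ℓ ψ) {s : S}
    (hs : s ∈ ψ '' openPolygon (vertices V ℓ ψ)) : ψ '' openPolygon (vertices V ℓ ψ) =
      connectedComponentIn (skeleton V (delaunayEdges V))ᶜ s := by
  set F := ψ '' openPolygon (vertices V ℓ ψ) with hF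
  have hsub : F ⊆ (skeleton V (delaunayEdges V))ᶜ := by
    rintro _ ⟨y, hy, rfl⟩
    exact h.notMem_skeleton hd hy
  have hpre : IsPreconnected F := by
    rw [hF, h.image_openPolygon hd]
    exact (convex_openCone _).isPreconnected.image _ (h.emptyDisc.locIso.continuousOn.mono
      ((h.onCircle hd).openCone_subset h.three_le_card))
  refine (hpre.subset_connectedComponentIn hs hsub).antisymm ?_
  set G := ⋃₀ {F' | F' ≠ F ∧ ∃ ℓ' ψ', IsFull V ℓ' ψ' ∧ F' = ψ' '' openPolygon (vertices V ℓ' ψ')}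
    with hG
  have hGo : IsOpen G := by
    refine isOpen_sUnion ?_
    rintro _ ⟨-, ℓ', ψ', h', rfl⟩
    exact h'.isOpen_image hd
  have hdisj : Disjoint F G := by
    rw [disjoint_left]
    rintro x hx ⟨F', ⟨hne, ℓ', ψ', h', rfl⟩, hx'⟩
    exact hne (h'.image_eq_of_mem hd h hx' hx)
  refine isPreconnected_connectedComponentIn.subset_left_of_subset_union (h.isOpen_image hd) hGo
    hdisj (fun x hx => ?_) ⟨s, mem_connectedComponentIn (hsub hs), hs⟩
  obtain ⟨ℓ', ψ', h', hx'⟩ := exists_mem_face hd hdec (connectedComponentIn_subset _ _ hx)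
  by_cases hFF : ψ' '' openPolygon (vertices V ℓ' ψ') = F
  · exact Or.inl (hFF ▸ hx')
  · exact Or.inr ⟨_, ⟨hFF, ℓ', ψ', h', rfl⟩, hx'⟩

open Classical in
/-- The extension of an immersed disc to its contact points. -/
def fill (V : Finset S) (ℓ : E3) (ψ : E3 → S) (y : E3) : S :=
  if h : ∃ v ∈ V, IsLimitAt ψ (D ℓ) y v then h.choose else ψ y

lemma EmptyDisc.fill_eq {ℓ y : E3} {ψ : E3 → S} (h : EmptyDisc V ℓ ψ) (hy : y ∈ D ℓ) :
    fill V ℓ ψ y = ψ y := by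
  refine dif_neg ?_
  rintro ⟨v, hv, hlim⟩
  exact h.notMem y hy (hlim.unique (h.locIso.isLimitAt (convex_D ℓ) hy) (ne_zero_of_mem_D hy)
    (subset_closure hy) ▸ hv)

lemma fill_of_mem_contact {ℓ p : E3} {ψ : E3 → S} (hp : p ∈ contact V ℓ ψ) :
    fill V ℓ ψ p ∈ V ∧ IsLimitAt ψ (D ℓ) p (fill V ℓ ψ p) := by
  obtain ⟨-, -, h⟩ := hp
  rw [fill, dif_pos h]
  exact h.choose_spec

namespace IsFull

variable {ℓ : E3} {ψ : E3 → S}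

lemma continuousOn_fill (hd : IsSphericalConeMetric V) (h : IsFull V ℓ ψ) :
    ContinuousOn (fill V ℓ ψ) (polygon (vertices V ℓ ψ)) := by
  have hc := h.onCircle hd
  intro z hz
  rcases hc.mem_D_or_mem hz with hzD | hzv
  · refine ContinuousAt.continuousWithinAt ?_
    refine (h.emptyDisc.locIso.continuousAt (isOpen_D ℓ) hzD).congr ?_
    filter_upwards [(isOpen_D ℓ).mem_nhds hzD] with y hy using (h.emptyDisc.fill_eq hy).symm
  · have hzc := (h.mem_vertices hd).1 hzv
    obtain ⟨-, hlim⟩ := fill_of_mem_contact hzc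
    have hz0 := ne_zero_of_norm_eq_one hz.1
    rw [ContinuousWithinAt, tendsto_iff_dist_tendsto_zero]
    refine squeeze_zero' (Filter.Eventually.of_forall fun _ => dist_nonneg) ?_
      ((tendsto_angle_self hz0).mono_left nhdsWithin_le_nhds)
    filter_upwards [self_mem_nhdsWithin] with y hy
    rcases hc.mem_D_or_mem hy with hyD | hyv
    · rw [h.emptyDisc.fill_eq hyD]; exact hlim y hyD
    · have hyc := (h.mem_vertices hd).1 hyv
      obtain ⟨-, hlim'⟩ := fill_of_mem_contact hyc
      obtain ⟨x, hx⟩ := h.nonempty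
      exact hlim'.dist_le hlim (ne_zero_of_norm_eq_one hy.1)
        (mem_closure_D hx (hyc.1.trans hyc.2.1.symm).le)

lemma fill_image_openArc (hd : IsSphericalConeMetric V) (h : IsFull V ℓ ψ) {p q m : E3}
    (hs : IsSide (vertices V ℓ ψ) p q m) : fill V ℓ ψ '' openArc p q = ψ '' openArc p q :=
  image_congr fun _ hz => h.emptyDisc.fill_eq (h.openArc_subset hd hs hz)

lemma isCell [CompactSpace S] (hd : IsSphericalConeMetric V) (hdec : IsConvexDecomposition V 𝓔)
    (h : IsFull V ℓ ψ) : IsCell V (delaunayEdges V) (vertices V ℓ ψ) (fill V ℓ ψ) where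
  convex := h.isConvexPolygon hd
  continuousOn := h.continuousOn_fill hd
  injOn := (h.injOn_openPolygon hd).congr fun _ hz =>
    (h.emptyDisc.fill_eq (h.openPolygon_subset hd hz)).symm
  face := by
    obtain ⟨k, hk⟩ := openCone_nonempty (vertices V ℓ ψ)
    have hk0 : k ≠ 0 := fun h0 => (h.isConvexPolygon hd).zero_notMem_openCone (h0 ▸ hk)
    have hx := normalize_mem_openPolygon hk hk0
    refine ⟨_, h.notMem_skeleton hd hx, ?_⟩
    rw [← h.image_eq_connectedComponentIn hd hdec (mem_image_of_mem ψ hx)]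
    exact image_congr fun _ hz => h.emptyDisc.fill_eq (h.openPolygon_subset hd hz)
  side p q m hs := by
    refine ⟨(h.injOn_openArc hd hs).congr fun _ hz =>
      (h.emptyDisc.fill_eq (h.openArc_subset hd hs hz)).symm, ?_⟩
    rw [h.fill_image_openArc hd hs]
    exact ⟨ℓ, ψ, p, q, m, h, hs, rfl⟩
  vertex w hw := (fill_of_mem_contact ((h.mem_vertices hd).1 hw)).1
  isometric x hx hxW := by
    have hxD := ((h.onCircle hd).mem_D_or_mem hx).resolve_right hxW
    obtain ⟨ε, hε, hiso⟩ := h.emptyDisc.locIso x hxD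
    obtain ⟨ε', hε', hball⟩ := Metric.isOpen_iff.1 (isOpen_D ℓ) x hxD
    refine ⟨min ε ε', lt_min hε hε', fun y _ z _ hyx hzx => ?_⟩
    have hy := hball (hyx.trans_le (min_le_right _ _))
    have hz := hball (hzx.trans_le (min_le_right _ _))
    rw [h.emptyDisc.fill_eq hy, h.emptyDisc.fill_eq hz]
    exact hiso y hy z hz (hyx.trans_le (min_le_left _ _)) (hzx.trans_le (min_le_left _ _))

/-- Normalised linear parametrisation of the side `p q`. -/
lemma isOpenEdge (hd : IsSphericalConeMetric V) (h : IsFull V ℓ ψ) {p q m : E3}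
    (hs : IsSide (vertices V ℓ ψ) p q m) : IsOpenEdge V (ψ '' openArc p q) := by
  have hc := h.onCircle hd
  have hW := h.isConvexPolygon hd
  have hp1 := (hc p hs.1).1
  have hq1 := (hc q hs.2.1).1
  set L : ℝ → E3 := fun t => (1 - t) • p + t • q with hL
  have hLc : ∀ t ∈ Icc (0 : ℝ) 1, L t ∈ cone (vertices V ℓ ψ) := fun t ht =>
    add_mem_cone (smul_mem_cone (mem_cone_of_mem hs.1) (sub_nonneg.2 ht.2))
      (smul_mem_cone (mem_cone_of_mem hs.2.1) ht.1)
  have hL0 : ∀ t, L t ≠ 0 := by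
    intro t h0
    obtain ⟨h1, h2⟩ := hW.eq_and_eq_of_relation hs (a := 1 - t) (b := t) (a' := 0) (b' := 0)
      (by rw [show (1 - t) • p + t • q = 0 from h0]; simp)
    linarith
  have hLcont : Continuous L := by fun_prop
  have hkcont : ContinuousOn (fun t => ‖L t‖⁻¹ • L t) (Icc 0 1) := fun t _ =>
    (ContinuousAt.comp (f := L) (continuousAt_normalize (hL0 t))
      hLcont.continuousAt).continuousWithinAt
  have harc : ∀ t ∈ Ioo (0 : ℝ) 1, ‖L t‖⁻¹ • L t ∈ openArc p q := fun t ht =>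
    normalize_mem_openArc ⟨1 - t, t, sub_pos.2 ht.2, ht.1, rfl⟩ (hL0 t)
  have hfill : EqOn (fill V ℓ ψ) ψ (openArc p q) := fun z hz =>
    h.emptyDisc.fill_eq (h.openArc_subset hd hs hz)
  refine ⟨?_, fun t => fill V ℓ ψ (‖L t‖⁻¹ • L t), ?_, ?_, ?_, ?_, ?_⟩
  · rw [disjoint_left]
    rintro _ ⟨z, hz, rfl⟩ hzV
    exact h.emptyDisc.notMem z (h.openArc_subset hd hs hz) hzV
  · exact (h.continuousOn_fill hd).comp hkcont fun t ht => normalize_mem_polygon (hLc t ht) (hL0 t)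
  · simp only [hL, sub_zero, one_smul, zero_smul, add_zero, hp1, inv_one]
    exact (fill_of_mem_contact ((h.mem_vertices hd).1 hs.1)).1
  · simp only [hL, sub_self, one_smul, zero_smul, zero_add, hq1, inv_one]
    exact (fill_of_mem_contact ((h.mem_vertices hd).1 hs.2.1)).1
  · intro t ht t' ht' htt
    dsimp only at htt
    rw [hfill (harc t ht), hfill (harc t' ht')] at htt
    have h1 := h.injOn_openArc hd hs (harc t ht) (harc t' ht') htt
    have hr : 0 < ‖L t‖⁻¹ := inv_pos.2 (norm_pos_iff.2 (hL0 t))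
    have hr' : 0 < ‖L t'‖⁻¹ := inv_pos.2 (norm_pos_iff.2 (hL0 t'))
    generalize ‖L t‖⁻¹ = r at h1 hr
    generalize ‖L t'‖⁻¹ = r' at h1 hr'
    simp only [hL, smul_add, smul_smul] at h1
    obtain ⟨h2, h3⟩ := hW.eq_and_eq_of_relation hs h1
    have h4 : r = r' := by linarith
    rw [h4] at h3
    exact mul_left_cancel₀ hr'.ne' h3
  · ext s
    constructor
    · rintro ⟨t, ht, rfl⟩
      exact ⟨_, harc t ht, (hfill (harc t ht)).symm⟩
    · rintro ⟨z, hz, rfl⟩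
      obtain ⟨hz1, a, b, ha, hb, hzab⟩ := hz
      have hab : 0 < a + b := add_pos ha hb
      refine ⟨b / (a + b), ⟨div_pos hb hab, (div_lt_one hab).2 (by linarith)⟩, ?_⟩
      have h1 : L (b / (a + b)) = (a + b)⁻¹ • z := by
        have : 1 - b / (a + b) = (a + b)⁻¹ * a := by field_simp; ring
        simp only [hL]
        rw [this, hzab, smul_add, smul_smul, smul_smul, div_eq_inv_mul]
      have h2 : ‖L (b / (a + b))‖⁻¹ • L (b / (a + b)) = z := by
        rw [h1, norm_smul, hz1, mul_one, norm_inv, inv_inv, Real.norm_of_nonneg hab.le, smul_smul,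
          mul_inv_cancel₀ hab.ne', one_smul]
      dsimp only
      rw [h2, hfill ⟨hz1, a, b, ha, hb, hzab⟩]

end IsFull

/-! ### Finiteness -/

/-- For infinitely many edges, the centres of the discs have a convergent subsequence, with limit `s
∉ V` by `exists_center_bound`. After rotation into one chart at `s` the discs converge, and
eventually their contact points are among the finitely many of the limit disc. The edges are then
images of arcs between pairs from a finite set. -/
lemma finite_delaunayEdges [CompactSpace S] (hd : IsSphericalConeMetric V)
    (hdec : IsConvexDecomposition V 𝓔) : (delaunayEdges V).Finite := by
  by_contra hinf
  have hinf : (delaunayEdges V).Infinite := hinf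
  set e := hinf.natEmbedding with he
  choose ℓ ψ p q m h hs hes using fun n => (e n).2
  have hinj : Function.Injective fun n => (e n : Set S) := fun a b hab =>
    e.injective (Subtype.ext hab)
  obtain ⟨r, hr0, hr2, hcen⟩ := exists_center_bound hd
  obtain ⟨M, hM⟩ := hdec.exists_norm_le hd
  have hcos : 0 < Real.cos r := Real.cos_pos_of_mem_Ioo ⟨by linarith, hr2⟩
  have hcos1 : Real.cos r < 1 := by
    rw [← Real.cos_zero]
    exact Real.cos_lt_cos_of_nonneg_of_le_pi le_rfl (by linarith [Real.pi_pos]) hr0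
  have hbd := fun n => hcen (ℓ n) (ψ n) (p n) (q n) (h n).emptyDisc (h n).nonempty
    (((h n).mem_vertices hd).1 (hs n).1) (((h n).mem_vertices hd).1 (hs n).2.1) (hs n).2.2.1
  obtain ⟨s, k, hk, hlim⟩ := CompactSpace.tendsto_subseq fun n => ψ n (ℓ n)
  have hsV : s ∉ V := fun hsV => by
    have h1 : r ≤ dist s s := ge_of_tendsto' (hlim.dist tendsto_const_nhds)
      fun n => (hbd (k n)).2 s hsV
    rw [dist_self] at h1
    linarith
  obtain ⟨x, hx⟩ := exists_norm_eq_one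
  have hx0 := ne_zero_of_norm_eq_one hx
  obtain ⟨ℓ₀, g, δ, hg⟩ := exists_chart (hd.regular s hsV) hsV hx
  obtain ⟨N, hN⟩ := eventually_atTop.1 (hlim.eventually_mem (ball_mem_nhds s hg.pos))
  set j : ℕ → ℕ := fun n => k (n + N) with hj
  have hjlim : Tendsto (fun n => ψ (j n) (ℓ (j n))) atTop (𝓝 s) :=
    hlim.comp (tendsto_add_atTop_nat N)
  have hℓD : ∀ n, ℓ n ∈ D (ℓ n) := fun n => mem_D_self (h n).nonempty.some_mem
  have hframe : ∀ n, ∃ A : E3 ≃ₗᵢ[ℝ] E3, A.symm (ℓ (j n)) ∈ D ℓ₀ ∧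
      g (A.symm (ℓ (j n))) = ψ (j n) (ℓ (j n)) ∧
      ∀ᶠ z in 𝓝 (A.symm (ℓ (j n))), (ψ (j n) ∘ A) z = g z := by
    intro n
    obtain ⟨y, hy, hyg⟩ := hg.ball_subset (hN (n + N) (Nat.le_add_left N n))
    have hℓn : 0 < ‖ℓ (j n)‖ := norm_pos_iff.2 (ne_zero_of_mem_D (hℓD _))
    have hyn : 0 < ‖y‖ := norm_pos_iff.2 (ne_zero_of_mem_D hy)
    have hrat := div_pos hℓn hyn
    have hgy := (hg.emptyDisc.map_smul hy hrat).trans hyg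
    obtain ⟨A, hA, heq⟩ := hg.emptyDisc.locIso.exists_frame hd (isOpen_D ℓ₀) (isOpen_D (ℓ (j n)))
      (h (j n)).emptyDisc.locIso (smul_mem_D hy hrat) (hℓD (j n))
      (by rw [norm_smul, Real.norm_of_nonneg hrat.le, div_mul_cancel₀ _ hyn.ne']) hgy
      (hg.notMem _ (smul_mem_D hy hrat))
    have hA' : A.symm (ℓ (j n)) = (‖ℓ (j n)‖ / ‖y‖) • y :=
      A.symm_apply_eq.2 hA.symm
    refine ⟨A, ?_, ?_, ?_⟩
    · rw [hA']; exact smul_mem_D hy hrat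
    · rw [hA', hgy]; rfl
    · rw [hA']; exact heq
  choose A hAD hAg hAeq using hframe
  set ℓ' : ℕ → E3 := fun n => (A n).symm (ℓ (j n)) with hℓ'
  have hfull : ∀ n, IsFull V (ℓ' n) (ψ (j n) ∘ A n) := fun n => (h (j n)).comp hd (A n)
  have hℓ'D : ∀ n, ℓ' n ∈ D (ℓ' n) := fun n => mem_D_self (hfull n).nonempty.some_mem
  obtain ⟨l, -, i, hi, hl⟩ := (isCompact_closedBall (0 : E3) M).tendsto_subseq
    (fun n => by simpa using hM _ _ (hfull n).emptyDisc (hfull n).nonempty :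
      ∀ n, ℓ' n ∈ closedBall (0 : E3) M)
  have hlnorm : 1 ≤ ‖l‖ * Real.cos r := by
    refine ge_of_tendsto' (hl.norm.mul_const _) fun n => ?_
    simp only [Function.comp, hℓ', LinearIsometryEquiv.norm_map]
    exact (hbd _).1
  have hl1 : 1 < ‖l‖ := by
    by_contra! hle
    nlinarith
  have hl0 : l ≠ 0 := by rintro rfl; simp at hl1; linarith
  have hang : angle l x = 0 := by
    refine tendsto_nhds_unique (tendsto_angle hl0 hx0 hl tendsto_const_nhds) ?_
    have h1 : Tendsto (fun n => dist (ψ (j (i n)) (ℓ (j (i n)))) s) atTop (𝓝 0) := by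
      have := (hjlim.comp hi.tendsto_atTop).dist (tendsto_const_nhds (x := s))
      rwa [dist_self] at this
    refine h1.congr fun n => ?_
    rw [← hAg, ← hg.map_center, hg.dist_eq _ (hAD _) _ hg.mem]
    rfl
  have hxl : x ∈ D l := by
    change ‖x‖ < ⟪l, x⟫
    rw [inner_eq_mul_norm_of_angle_eq_zero hang, hx, mul_one]
    exact hl1
  have hag : ∀ n, ∀ y ∈ D ℓ₀ ∩ D (ℓ' (i n)), (ψ (j (i n)) ∘ A (i n)) y = g y := fun n y hy =>
    (hfull (i n)).emptyDisc.agree hd hg.emptyDisc (hℓ'D _) (hAD _) (hAeq _) y hy.symm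
  obtain ⟨Ψ, hΨ, -, hΨn⟩ := exists_limit_disc hd (fun n => (hfull (i n)).emptyDisc) hl hg.mem hxl
    hag
  obtain ⟨N', hN'⟩ := eventually_atTop.1 ((eventually_contact_subset hd
    (fun n => (hfull (i n)).emptyDisc) hl hxl hΨ hΨn).and (eventually_mem_D hl hxl))
  set c := contact V l Ψ with hc
  have hcfin : c.Finite := hΨ.finite_contact hd hxl
  have hT : ((fun z : E3 × E3 => Ψ '' openArc z.1 z.2) '' (c ×ˢ c)).Finite :=
    (hcfin.prod hcfin).image _
  refine Set.infinite_of_injective_forall_mem (f := fun n => (e (j (i (n + N'))) : Set S))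
    (fun a b hab => ?_) (fun n => ?_) hT
  · have h1 := hinj hab
    have h2 := hi.injective (add_right_cancel (hk.injective h1))
    exact add_right_cancel h2
  · obtain ⟨h1, h2⟩ := hN' (n + N') (Nat.le_add_left N' n)
    -- Both endpoints of this edge, rotated by `B.symm`, are contact points of the limit disc, and
    -- along the arc between them the two immersions agree.
    set a := j (i (n + N')) with ha
    set B := A (i (n + N')) with hB
    have hpc : ∀ w ∈ vertices V (ℓ a) (ψ a), B.symm w ∈ c := fun w hw => h1
      (mem_contact_comp.2 (by rw [B.apply_symm_apply]; exact ((h a).mem_vertices hd).1 hw))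
    refine ⟨(B.symm (p a), B.symm (q a)), ⟨hpc _ (hs a).1, hpc _ (hs a).2.1⟩, ?_⟩
    dsimp only
    rw [hes a, ← image_comp_openArc (ψ a) B]
    refine image_congr fun z hz => hΨn _ h2 z ⟨?_, ?_⟩
    · exact (hΨ.onCircle hd hxl).arcCone_subset ((hΨ.mem_vertices hd hxl).2 (hpc _ (hs a).1))
        ((hΨ.mem_vertices hd hxl).2 (hpc _ (hs a).2.1))
        (fun h => (hs a).2.2.1 (B.symm.injective h)) hz.2
    · exact mem_D_comp.2 ((h a).openArc_subset hd (hs a)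
        (by simpa using (mem_openArc_map (A := B)).1 hz))

lemma isConvexDecomposition_delaunayEdges [CompactSpace S] (hd : IsSphericalConeMetric V)
    (hdec : IsConvexDecomposition V 𝓔) : IsConvexDecomposition V (delaunayEdges V) where
  finite := finite_delaunayEdges hd hdec
  edge := by
    rintro _ ⟨ℓ, ψ, p, q, m, h, hs, rfl⟩
    exact h.isOpenEdge hd hs
  disjoint := by
    rintro _ ⟨ℓ₁, ψ₁, p₁, q₁, m₁, h₁, hs₁, rfl⟩ _ ⟨ℓ₂, ψ₂, p₂, q₂, m₂, h₂, hs₂, rfl⟩ hne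
    rw [Function.onFun, disjoint_left]
    exact fun s hs hs' => hne (h₁.image_openArc_eq hd h₂ hs₁ hs₂ hs hs')
  faces s hs := by
    obtain ⟨ℓ, ψ, h, hmem⟩ := exists_mem_face hd hdec hs
    refine ⟨_, _, h.isCell hd hdec, ?_⟩
    obtain ⟨y, hy, rfl⟩ := hmem
    exact ⟨y, hy, h.emptyDisc.fill_eq (h.openPolygon_subset hd hy)⟩

/-- Every cell comes from a full disc. -/
lemma IsCell.exists_isFull [CompactSpace S] (hd : IsSphericalConeMetric V)
    (hdec : IsConvexDecomposition V 𝓔) {W : Finset E3} {φ : E3 → S}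
    (h : IsCell V (delaunayEdges V) W φ) : ∃ ℓ ψ, IsFull V ℓ ψ ∧ W = vertices V ℓ ψ ∧
      ∀ y ∈ polygon W, y ∈ D ℓ → φ y = ψ y := by
  obtain ⟨k, hk⟩ := openCone_nonempty W
  obtain ⟨ℓ, ψ, hfull, y, hy, hyk⟩ := exists_mem_face hd hdec (h.radial_notMem_skeleton hk)
  have hcell := hfull.isCell hd hdec
  obtain ⟨A, hA, heq⟩ := hcell.exists_rot hd h.convex.isOpen_openCone h.radial_locIso_openCone hk
    (by rw [← hyk]; exact ⟨y, hy, hfull.emptyDisc.fill_eq (hfull.openPolygon_subset hd hy)⟩)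
  obtain ⟨hW, hφ⟩ := h.eq_of_eventually_eq hd (hcell.rot A) hk hA heq
  have hfull' := hfull.comp hd A.symm
  refine ⟨_, _, hfull', ?_, fun z hz hzD => ?_⟩
  · rw [hfull.vertices_comp hd, hW]; rfl
  · rw [hφ z hz, Function.comp, Function.comp, hfull.emptyDisc.fill_eq (mem_D_comp.1 hzD)]

/-! ### Circumcircles as linear forms, and the Delaunay condition for full discs -/

lemma IsCircumcircle.inv_smul_eq {W : Finset E3} (hW : IsConvexPolygon W) {c ℓ : E3} {h : ℝ}
    (hc : IsCircumcircle W c h) (hℓ : OnCircle ℓ W) : ℓ = h⁻¹ • c :=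
  hW.eq_of_inner_eq fun w hw => by
    rw [(hℓ w hw).2, real_inner_smul_left, hc.2.2 w hw, inv_mul_cancel₀ hc.2.1.ne']

lemma OnCircle.exists_isCircumcircle {W : Finset E3} {ℓ : E3} (h : OnCircle ℓ W) (hℓ : ℓ ≠ 0) :
    ∃ c r, IsCircumcircle W c r := by
  have hn := norm_pos_iff.2 hℓ
  refine ⟨‖ℓ‖⁻¹ • ℓ, ‖ℓ‖⁻¹, norm_inv_smul hℓ, inv_pos.2 hn, fun w hw => ?_⟩
  rw [real_inner_smul_left, (h w hw).2, mul_one]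

/-- Developed cells of full discs have a common germ along the common side. -/
lemma IsFull.eventually_eq_of_isDeveloped (hd : IsSphericalConeMetric V) {ℓ₁ ℓ₂ : E3}
    {ψ₁ ψ₂ φ₁ φ₂ : E3 → S} (h₁ : IsFull V ℓ₁ ψ₁) (h₂ : IsFull V ℓ₂ ψ₂)
    (hφ₁ : ∀ y ∈ polygon (vertices V ℓ₁ ψ₁), y ∈ D ℓ₁ → φ₁ y = ψ₁ y)
    (hφ₂ : ∀ y ∈ polygon (vertices V ℓ₂ ψ₂), y ∈ D ℓ₂ → φ₂ y = ψ₂ y) {p q m x : E3}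
    (hs₁ : IsSide (vertices V ℓ₁ ψ₁) p q m) (hs₂ : IsSide (vertices V ℓ₂ ψ₂) p q (-m))
    (hx : x ∈ openArc p q) (hdev : ∃ ε > 0, ∀ y ∈ polygon (vertices V ℓ₁ ψ₁),
      ∀ z ∈ polygon (vertices V ℓ₂ ψ₂), dist y x < ε → dist z x < ε →
        dist (φ₁ y) (φ₂ z) = angle y z) : ∀ᶠ y in 𝓝 x, ψ₁ y = ψ₂ y := by
  obtain ⟨ε, hε, hdev⟩ := hdev
  have hx₁ := h₁.openArc_subset hd hs₁ hx
  have hx₂ := h₂.openArc_subset hd hs₂ hx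
  have hx0 := ne_zero_of_norm_eq_one hx.1
  have hW₁ := h₁.isConvexPolygon hd
  have hW₂ := h₂.isConvexPolygon hd
  have hcone₁ : x ∈ cone (vertices V ℓ₁ ψ₁) := arcCone_subset_cone hs₁.1 hs₁.2.1 hx.2
  have hcone₂ : x ∈ cone (vertices V ℓ₂ ψ₂) := arcCone_subset_cone hs₂.1 hs₂.2.1 hx.2
  have hxx : ψ₁ x = ψ₂ x := by
    have := hdev x ⟨hx.1, hcone₁⟩ x ⟨hx.1, hcone₂⟩ (by simpa) (by simpa)
    rw [hφ₁ x ⟨hx.1, hcone₁⟩ hx₁, hφ₂ x ⟨hx.1, hcone₂⟩ hx₂, angle_self hx0] at this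
    exact dist_eq_zero.1 this
  obtain ⟨A, hA, heq⟩ := h₁.emptyDisc.locIso.exists_frame hd (isOpen_D ℓ₁) (isOpen_D ℓ₂)
    h₂.emptyDisc.locIso hx₁ hx₂ rfl hxx (h₁.emptyDisc.notMem x hx₁)
  obtain ⟨ε', hε', hiso⟩ := h₂.emptyDisc.locIso x hx₂
  have hnorm : Tendsto (fun y : E3 => ‖y‖⁻¹ • y) (𝓝 x) (𝓝 x) := by
    have := continuousAt_normalize hx0
    rwa [ContinuousAt, hx.1, inv_one, one_smul] at this
  have hAt : Tendsto A (𝓝 x) (𝓝 x) := by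
    have := A.continuous.tendsto x
    rwa [hA] at this
  have hN₁ : ∀ᶠ y in 𝓝 x, (dist y x < ε ∧ y ∈ D ℓ₁) ∧ (dist (A y) x < ε' ∧ A y ∈ D ℓ₂) ∧
      ψ₂ (A y) = ψ₁ y :=
    (Filter.Eventually.and (ball_mem_nhds x hε) ((isOpen_D ℓ₁).mem_nhds hx₁)).and
      (((hAt.eventually_mem (ball_mem_nhds x hε')).and
        (hAt.eventually_mem ((isOpen_D ℓ₂).mem_nhds hx₂))).and heq)
  have hN₂ : ∀ᶠ y in 𝓝 x, (dist y x < ε ∧ dist y x < ε') ∧ y ∈ D ℓ₂ :=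
    (Filter.Eventually.and (ball_mem_nhds x hε) (ball_mem_nhds x hε')).and
      ((isOpen_D ℓ₂).mem_nhds hx₂)
  have hcl₁ := cone_subset_closure_openCone _ hcone₁
  have hcl₂ := cone_subset_closure_openCone _ hcone₂
  obtain ⟨O₁, hO₁, hO₁o, hxO₁⟩ := _root_.eventually_nhds_iff.1 (hnorm.eventually hN₁)
  obtain ⟨O₂, hO₂, hO₂o, hxO₂⟩ := _root_.eventually_nhds_iff.1 (hnorm.eventually hN₂)
  obtain ⟨y₀, hy₀, hy₀c⟩ := _root_.mem_closure_iff.1 hcl₁ O₁ hO₁o hxO₁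
  obtain ⟨z₀, hz₀, hz₀c⟩ := _root_.mem_closure_iff.1 hcl₂ O₂ hO₂o hxO₂
  -- The frame `A` describes the true relative position of the two discs, while the development
  -- condition computes the same distances without it. Comparing them on open sets of `y` and `z`
  -- shows that `A` is the identity.
  have key : ∀ y ∈ O₁ ∩ openCone (vertices V ℓ₁ ψ₁), ∀ z ∈ O₂ ∩ openCone (vertices V ℓ₂ ψ₂),
      ⟪A y, z⟫ = ⟪y, z⟫ := by
    rintro y ⟨hyO, hyc⟩ z ⟨hzO, hzc⟩
    have hy0 : y ≠ 0 := fun h => hW₁.zero_notMem_openCone (h ▸ hyc)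
    have hz0 : z ≠ 0 := fun h => hW₂.zero_notMem_openCone (h ▸ hzc)
    obtain ⟨⟨e1, e2⟩, ⟨e3, e4⟩, e5⟩ := hO₁ y hyO
    obtain ⟨⟨e6, e7⟩, e8⟩ := hO₂ z hzO
    have hyp := normalize_mem_polygon (openCone_subset_cone _ hyc) hy0
    have hzp := normalize_mem_polygon (openCone_subset_cone _ hzc) hz0
    have h1 := hdev _ hyp _ hzp e1 e6
    have h2 := hiso _ e4 _ e8 e3 e7
    rw [hφ₁ _ hyp e2, hφ₂ _ hzp e8, ← e5, h2, map_smul,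
      angle_smul_left_of_pos _ _ (inv_pos.2 (norm_pos_iff.2 hy0)),
      angle_smul_left_of_pos _ _ (inv_pos.2 (norm_pos_iff.2 hy0)),
      angle_smul_right_of_pos _ _ (inv_pos.2 (norm_pos_iff.2 hz0)),
      angle_smul_right_of_pos _ _ (inv_pos.2 (norm_pos_iff.2 hz0))] at h1
    rw [← cos_angle_mul_norm_mul_norm (A y) z, h1, A.norm_map, cos_angle_mul_norm_mul_norm]
  have hfix : ∀ y ∈ O₁ ∩ openCone (vertices V ℓ₁ ψ₁), A y = y := fun y hy =>
    inner_eq_of_eventually (x := z₀) (by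
      filter_upwards [(hO₂o.inter hW₂.isOpen_openCone).mem_nhds ⟨hz₀, hz₀c⟩] with z hz
      exact key y hy z hz)
  have hrefl : A = LinearIsometryEquiv.refl ℝ E3 :=
    linearIsometryEquiv_eq_of_eventuallyEq (x := y₀) (by
      filter_upwards [(hO₁o.inter hW₁.isOpen_openCone).mem_nhds ⟨hy₀, hy₀c⟩] with y hy
      exact hfix y hy)
  rw [hrefl] at heq
  exact heq.mono fun y hy => hy.symm

lemma isDelaunayDecomposition_delaunayEdges [CompactSpace S] (hd : IsSphericalConeMetric V)
    (hdec : IsConvexDecomposition V 𝓔) : IsDelaunayDecomposition V (delaunayEdges V) where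
  toIsConvexDecomposition := isConvexDecomposition_delaunayEdges hd hdec
  circumscribed W φ h := by
    obtain ⟨ℓ, ψ, hfull, rfl, -⟩ := h.exists_isFull hd hdec
    exact (hfull.onCircle hd).exists_isCircumcircle
      (ne_zero_of_mem_D (mem_D_self hfull.nonempty.some_mem))
  empty_disk W₁ φ₁ W₂ φ₂ p q h₁ h₂ hdev c r hc w hw hle := by
    obtain ⟨ℓ₁, ψ₁, hf₁, rfl, hφ₁⟩ := h₁.exists_isFull hd hdec
    obtain ⟨ℓ₂, ψ₂, hf₂, rfl, hφ₂⟩ := h₂.exists_isFull hd hdec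
    obtain ⟨⟨m, hs₁, hs₂⟩, hdev⟩ := hdev
    have hpq : p + q ∈ arcCone p q := ⟨1, 1, one_pos, one_pos, by simp⟩
    have hx := normalize_mem_openArc hpq (hs₁.ne_zero_of_mem_arcCone h₁.convex hpq)
    have heq := hf₁.eventually_eq_of_isDeveloped hd hf₂ hφ₁ hφ₂ hs₁ hs₂ hx (hdev _ hx)
    have hdual := hf₂.emptyDisc.inner_contact_le hd hf₁.emptyDisc (hf₂.openArc_subset hd hs₂ hx)
      (hf₁.openArc_subset hd hs₁ hx) (heq.mono fun _ h => h.symm) ((hf₂.mem_vertices hd).1 hw)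
    have hℓ := hc.inv_smul_eq h₁.convex (hf₁.onCircle hd)
    have h1 : 1 ≤ ⟪ℓ₁, w⟫ := by
      rw [hℓ, real_inner_smul_left, ← div_eq_inv_mul, le_div_iff₀ hc.2.1, one_mul]
      exact hle
    -- By weak duality a vertex of the second face in the closed disk of the first is a contact
    -- point of the first. It would lie strictly on both sides of the common edge, unless it is an
    -- endpoint.
    have hw₁ := (hf₁.mem_vertices hd).2 (hdual.2 (le_antisymm hdual.1 h1))
    by_contra! hne
    have h2 := hs₁.2.2.2.2.2 w hw₁ hne.1 hne.2
    have h3 := hs₂.2.2.2.2.2 w hw hne.1 hne.2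
    rw [inner_neg_left] at h3
    linarith

/-! ### Local cells at a point of an immersion -/

/-- Near `y`, the immersion `ψ` agrees with the cell `(W, φ)` inside this cell. -/
structure IsLocalCell (V : Finset S) (𝓔 : Set (Set S)) (ψ : E3 → S) (y : E3) (W : Finset E3)
    (φ : E3 → S) : Prop where
  isCell : IsCell V 𝓔 W φ
  mem_cone : y ∈ cone W
  eventually_eq : ∀ᶠ z in 𝓝 y, z ∈ openCone W → ψ z = radial φ z

lemma IsLocalCell.apply_eq {ψ φ : E3 → S} {y : E3} {W : Finset E3}
    (h : IsLocalCell V 𝓔 ψ y W φ) {U : Set E3} (hU : IsOpen U) (hψ : LocIso ψ U) (hy : y ∈ U) :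
    ψ y = radial φ y := by
  obtain ⟨O, hO, hOo, hyO⟩ := _root_.eventually_nhds_iff.1 h.eventually_eq
  exact h.isCell.eq_radial_of_mem_cone (hOo.inter hU) (hψ.continuousOn.mono inter_subset_right)
    (fun z hz hzW => hO z hz.1 hzW) ⟨hyO, hy⟩ h.mem_cone (hψ.ne_zero hy)

lemma exists_isLocalCell (hd : IsSphericalConeMetric V) (hdec : IsConvexDecomposition V 𝓔)
    {U : Set E3} (hU : IsOpen U) {ψ : E3 → S} (hψ : LocIso ψ U) {y : E3} (hy : y ∈ U)
    (hV : ψ y ∉ V) : ∃ W φ, IsLocalCell V 𝓔 ψ y W φ := by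
  obtain ⟨W, φ, z, h, hz, hzy⟩ := hdec.exists_mem_polygon hd hV
  have hy0 : 0 < ‖y‖ := norm_pos_iff.2 (hψ.ne_zero hy)
  set z' := ‖y‖ • z with hz'
  have hz'c : z' ∈ cone W := smul_mem_cone hz.2 hy0.le
  have hz'n : ‖z'‖ = ‖y‖ := by rw [hz', norm_smul, hz.1, mul_one, norm_norm]
  have hz'0 : z' ≠ 0 := norm_pos_iff.1 (by rw [hz'n]; exact hy0)
  have hrad : radial φ z' = ψ y := by
    rw [hz', radial_smul _ _ hy0, radial_of_norm_eq_one _ hz.1, hzy]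
  obtain ⟨δ, hδ, Ψ, hiso, hΨz, hΨV, hΨ⟩ := h.radial_locIso_openCone.exists_extension hd
    h.convex.isOpen_openCone (convex_openCone W) hz'0 (h.convex.closure_openCone ▸ hz'c)
    (h.isLimitAt hz'c hz'0) (hrad ▸ hV)
  obtain ⟨A, hA, heq⟩ := hψ.exists_frame hd hU isOpen_ball (locIso_of_forall_dist_eq hiso) hy
    (mem_ball_self hδ) hz'n.symm (by rw [hΨz, hrad]) hV
  refine ⟨_, _, h.rot A.symm, mem_cone_rot.2 (by rwa [LinearIsometryEquiv.symm_symm, hA]), ?_⟩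
  have hAt : Tendsto A (𝓝 y) (𝓝 z') := hA ▸ A.continuous.tendsto y
  filter_upwards [heq, hAt.eventually_mem (ball_mem_nhds z' hδ)] with x hx hxb hxW
  rw [mem_openCone_rot, LinearIsometryEquiv.symm_symm] at hxW
  rw [← hx, hΨ _ hxW hxb, LinearIsometryEquiv.symm_symm, radial_comp]
  rfl

lemma IsCircumcircle.onCircle {W : Finset E3} (hW : IsConvexPolygon W) {c : E3} {h : ℝ}
    (hc : IsCircumcircle W c h) : OnCircle (h⁻¹ • c) W := fun w hw =>
  ⟨hW.norm_eq_one w hw, by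
    rw [real_inner_smul_left, hc.2.2 w hw, inv_mul_cancel₀ hc.2.1.ne']⟩

lemma OnCircle.unique {W : Finset E3} (hW : IsConvexPolygon W) {ℓ ℓ' : E3} (h : OnCircle ℓ W)
    (h' : OnCircle ℓ' W) : ℓ = ℓ' :=
  hW.eq_of_inner_eq fun w hw => by rw [(h w hw).2, (h' w hw).2]

/-- `t` is the value at `y` of the linear form which is `1` at the vertices of a cell at `y`. -/
def IsValue (V : Finset S) (𝓔 : Set (Set S)) (ψ : E3 → S) (y : E3) (t : ℝ) : Prop :=
  ∃ W φ ℓ, IsLocalCell V 𝓔 ψ y W φ ∧ OnCircle ℓ W ∧ t = ⟪ℓ, y⟫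

lemma exists_inner_ne_zero {m : E3} (hm : m ≠ 0) {O : Set E3} (hO : IsOpen O) (hne : O.Nonempty) :
    ∃ z ∈ O, ⟪m, z⟫ ≠ 0 := by
  by_contra! hall
  obtain ⟨z, hz⟩ := hne
  refine hm (inner_eq_of_eventually (x := z) ?_)
  filter_upwards [hO.mem_nhds hz] with y hy
  rw [hall y hy, inner_zero_left]

section Two

variable {W₁ W₂ : Finset E3} {φ₁ φ₂ ψ : E3 → S} {ℓ₁ ℓ₂ m : E3} {B : Set E3}

/-- A local cell at `z` has interior points in `B` off the plane of `m`. There its germ is that of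
one of the two given cells, with which it coincides by `IsCell.eq_of_eventually_eq`. -/
lemma IsValue.eq_or_eq (hd : IsSphericalConeMetric V) (h₁ : IsCell V 𝓔 W₁ φ₁)
    (h₂ : IsCell V 𝓔 W₂ φ₂) (hℓ₁ : OnCircle ℓ₁ W₁) (hℓ₂ : OnCircle ℓ₂ W₂) (hm : m ≠ 0)
    (hB : IsOpen B) (hψ₁ : ∀ z ∈ B, z ∈ openCone W₁ → ψ z = radial φ₁ z)
    (hψ₂ : ∀ z ∈ B, z ∈ openCone W₂ → ψ z = radial φ₂ z)
    (hpos : ∀ z ∈ B, 0 < ⟪m, z⟫ → z ∈ openCone W₁) (hneg : ∀ z ∈ B, ⟪m, z⟫ < 0 → z ∈ openCone W₂)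
    {z : E3} (hz : z ∈ B) {t : ℝ} (ht : IsValue V 𝓔 ψ z t) :
    (z ∈ cone W₁ ∧ t = ⟪ℓ₁, z⟫) ∨ (z ∈ cone W₂ ∧ t = ⟪ℓ₂, z⟫) := by
  obtain ⟨W, φ, ℓ, h, hℓ, rfl⟩ := ht
  have hW := h.isCell.convex
  obtain ⟨O, hO, hOo, hzO⟩ := _root_.eventually_nhds_iff.1 h.eventually_eq
  have hNo : IsOpen ((B ∩ O) ∩ openCone W) := (hB.inter hOo).inter hW.isOpen_openCone
  obtain ⟨y, ⟨⟨hyB, hyO⟩, hyW⟩, hmy⟩ := exists_inner_ne_zero hm hNo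
    (_root_.mem_closure_iff.1 (cone_subset_closure_openCone W h.mem_cone) (B ∩ O) (hB.inter hOo)
      ⟨hz, hzO⟩)
  have key : ∀ {W' : Finset E3} {φ' : E3 → S} {ℓ' : E3}, IsCell V 𝓔 W' φ' → OnCircle ℓ' W' →
      (∀ z ∈ B, z ∈ openCone W' → ψ z = radial φ' z) → y ∈ openCone W' →
      z ∈ cone W' ∧ ⟪ℓ, z⟫ = ⟪ℓ', z⟫ := by
    intro W' φ' ℓ' h' hℓ' hψ' hy'
    obtain ⟨hWW, -⟩ := h.isCell.eq_of_eventually_eq hd h' hyW hy' (by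
      filter_upwards [hNo.mem_nhds ⟨⟨hyB, hyO⟩, hyW⟩, h'.convex.isOpen_openCone.mem_nhds hy']
        with x hx hx'
      rw [← hO x hx.1.2 hx.2, hψ' x hx.1.1 hx'])
    subst hWW
    exact ⟨h.mem_cone, by rw [hℓ.unique hW hℓ']⟩
  rcases hmy.lt_or_gt with h0 | h0
  · exact Or.inr (key h₂ hℓ₂ hψ₂ (hneg y hyB h0))
  · exact Or.inl (key h₁ hℓ₁ hψ₁ (hpos y hyB h0))

end Two

lemma inner_sub_eq_mul {W : Finset E3} (hW : IsConvexPolygon W) {p q m : E3} (hs : IsSide W p q m)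
    {n : E3} (hp : ⟪n, p⟫ = 0) (hq : ⟪n, q⟫ = 0) : ∃ k : ℝ, ∀ z, ⟪n, z⟫ = k * ⟪m, z⟫ := by
  obtain ⟨r, hr, hrp, hrq⟩ := hW.exists_third p q
  obtain ⟨f, g, k, -, -, -, hsum, -⟩ :=
    hW.exists_coords hs.1 hs.2.1 hr hs.2.2.1 hrp.symm hrq.symm
  have hmr := hs.2.2.2.2.2 r hr hrp hrq
  refine ⟨⟪n, r⟫ / ⟪m, r⟫, fun z => ?_⟩
  rw [hsum z]
  simp only [inner_add_right, real_inner_smul_right, hp, hq, hs.2.2.2.1, hs.2.2.2.2.1]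
  field_simp
  ring

/-- Across an edge of a Delaunay decomposition the linear form grows. -/
lemma IsDelaunayDecomposition.exists_neg (hD : IsDelaunayDecomposition V 𝓔) {W₁ W₂ : Finset E3}
    {φ₁ φ₂ : E3 → S} (h₁ : IsCell V 𝓔 W₁ φ₁) (h₂ : IsCell V 𝓔 W₂ φ₂) {p q m ℓ₁ ℓ₂ : E3}
    (hadj : IsAdjacent V W₁ φ₁ W₂ φ₂ p q m) (hℓ₁ : OnCircle ℓ₁ W₁) (hℓ₂ : OnCircle ℓ₂ W₂) :
    ∃ k : ℝ, k < 0 ∧ ∀ z, ⟪ℓ₂, z⟫ = ⟪ℓ₁, z⟫ + k * ⟪m, z⟫ := by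
  obtain ⟨k, hk⟩ := inner_sub_eq_mul h₁.convex hadj.left (n := ℓ₂ - ℓ₁)
    (by rw [inner_sub_left, (hℓ₂ p hadj.right.1).2, (hℓ₁ p hadj.left.1).2, sub_self])
    (by rw [inner_sub_left, (hℓ₂ q hadj.right.2.1).2, (hℓ₁ q hadj.left.2.1).2, sub_self])
  refine ⟨k, ?_, fun z => by rw [← hk, inner_sub_left]; ring⟩
  obtain ⟨w, hw, hwp, hwq⟩ := h₂.convex.exists_third p q
  obtain ⟨c, r, hc⟩ := hD.circumscribed W₁ φ₁ h₁
  -- A third vertex `w` of the second cell lies strictly outside the first disk, so `⟪ℓ₁, w⟫ < 1 =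
  -- ⟪ℓ₂, w⟫`; as `⟪m, w⟫ < 0`, the factor `k` is negative.
  have hne := hD.empty_disk W₁ φ₁ W₂ φ₂ p q h₁ h₂ hadj.isDeveloped c r hc w hw
  have hlt : ⟪c, w⟫ < r := by
    by_contra! hle
    rcases hne hle with h | h
    exacts [hwp h, hwq h]
  have h1 : ⟪ℓ₁, w⟫ < 1 := by
    rw [hc.inv_smul_eq h₁.convex hℓ₁, real_inner_smul_left, ← div_eq_inv_mul, div_lt_one hc.2.1]
    exact hlt
  have h2 := hk w
  rw [inner_sub_left, (hℓ₂ w hw).2] at h2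
  have h3 := hadj.right.2.2.2.2.2 w hw hwp hwq
  rw [inner_neg_left] at h3
  by_contra! hk0
  nlinarith

lemma IsGlued.eventually_eq (hd : IsSphericalConeMetric V) {W₁ W₂ : Finset E3} {φ₁ φ₂ ψ Ψ : E3 → S}
    {p q m y : E3} {δ : ℝ} (h₁ : IsCell V 𝓔 W₁ φ₁) (hs : IsSide W₁ p q m) (hy : y ∈ arcCone p q)
    (hg : IsGlued V W₁ φ₁ W₂ φ₂ m y δ Ψ) {U : Set E3} (hU : IsOpen U) (hyU : y ∈ U)
    (hψ : LocIso ψ U) (hev : ∀ᶠ z in 𝓝 y, z ∈ openCone W₁ → ψ z = radial φ₁ z) :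
    ∀ᶠ z in 𝓝 y, Ψ z = ψ z := by
  have hyc : y ∈ cone W₁ := arcCone_subset_cone hs.1 hs.2.1 hy
  have h2 : ∀ᶠ z in 𝓝 y, z ∈ U ∧ (z ∈ openCone W₁ → ψ z = radial φ₁ z) :=
    Filter.Eventually.and (hU.mem_nhds hyU) hev
  obtain ⟨ε, hε, hball⟩ := Metric.eventually_nhds_iff_ball.1 h2
  have hρ : 0 < min ε δ := lt_min hε hg.pos
  obtain ⟨x, hxb, hxW⟩ := _root_.mem_closure_iff.1 (cone_subset_closure_openCone _ hyc)
    (ball y (min ε δ)) isOpen_ball (mem_ball_self hρ)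
  have hall := LocIso.eq_of_eventually_eq hd isOpen_ball
    (convex_ball y (min ε δ)).isPreconnected
    (hg.locIso.mono (ball_subset_ball (min_le_right _ _)))
    (hψ.mono fun z hz => (hball z (ball_subset_ball (min_le_left _ _) hz)).1)
    (fun z hz => hg.notMem z (ball_subset_ball (min_le_right _ _) hz)) hxb (by
      filter_upwards [isOpen_ball.mem_nhds hxb, h₁.convex.isOpen_openCone.mem_nhds hxW] with z hz hzW
      rw [(hball z (ball_subset_ball (min_le_left _ _) hz)).2 hzW]
      exact (hg.left z (ball_subset_ball (min_le_right _ _) hz)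
        (h₁.convex.inner_pos_of_side hs hzW).le).2)
  exact Filter.eventually_of_mem (ball_mem_nhds y hρ) hall

/-- Inside a cell a single form is used twice; at a side the two adjacent forms appear, and
`exists_neg` says that the form valid on each side of the plane is the larger one. Vertices do not
occur because `ψ y ∉ V`. -/
lemma IsDelaunayDecomposition.eventually_isValue_iff (hd : IsSphericalConeMetric V)
    (hD : IsDelaunayDecomposition V 𝓔) {U : Set E3} (hU : IsOpen U) {ψ : E3 → S}
    (hψ : LocIso ψ U) {y : E3} (hy : y ∈ U) (hV : ψ y ∉ V) :
    ∃ ℓ₁ ℓ₂, ∀ᶠ z in 𝓝 y, ∀ t, IsValue V 𝓔 ψ z t ↔ t = max ⟪ℓ₁, z⟫ ⟪ℓ₂, z⟫ := by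
  have hdec := hD.toIsConvexDecomposition
  obtain ⟨W₁, φ₁, hloc⟩ := exists_isLocalCell hd hdec hU hψ hy hV
  have h₁ := hloc.isCell
  obtain ⟨c₁, r₁, hc₁⟩ := hD.circumscribed W₁ φ₁ h₁
  have hℓ₁ := hc₁.onCircle h₁.convex
  have hy0 := hψ.ne_zero hy
  by_cases hyo : y ∈ openCone W₁
  · refine ⟨r₁⁻¹ • c₁, r₁⁻¹ • c₁, ?_⟩
    obtain ⟨B, hB, hBo, hyB⟩ := _root_.eventually_nhds_iff.1
      (hloc.eventually_eq.and (h₁.convex.isOpen_openCone.mem_nhds hyo))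
    filter_upwards [hBo.mem_nhds hyB] with z hz t
    rw [max_self]
    constructor
    · intro ht
      rcases ht.eq_or_eq hd h₁ h₁ hℓ₁ hℓ₁ hy0 hBo (fun x hx => (hB x hx).1)
        (fun x hx => (hB x hx).1) (fun x hx _ => (hB x hx).2) (fun x hx _ => (hB x hx).2) hz
        with h | h
      exacts [h.2, h.2]
    · rintro rfl
      refine ⟨W₁, φ₁, _, ⟨h₁, openCone_subset_cone _ (hB z hz).2, ?_⟩, hℓ₁, rfl⟩
      filter_upwards [hBo.mem_nhds hz] with x hx using (hB x hx).1
  obtain ⟨p, q, m, hs, hpq⟩ : ∃ p q m, IsSide W₁ p q m ∧ y ∈ arcCone p q := by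
    refine (h₁.convex.side_or_vertex hloc.mem_cone hyo hy0).resolve_left ?_
    rintro ⟨w, hw, r, hr, hyw⟩
    refine hV ?_
    rw [hloc.apply_eq hU hψ hy, hyw, radial_smul _ _ hr,
      radial_of_norm_eq_one _ (h₁.convex.norm_eq_one w hw)]
    exact h₁.vertex w hw
  obtain ⟨W₂, φ₂, h₂, hadj⟩ := h₁.exists_isAdjacent hd hdec hs
  obtain ⟨c₂, r₂, hc₂⟩ := hD.circumscribed W₂ φ₂ h₂
  have hℓ₂ := hc₂.onCircle h₂.convex
  obtain ⟨k, hk, hkℓ⟩ := hD.exists_neg h₁ h₂ hadj hℓ₁ hℓ₂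
  obtain ⟨δ, Ψ, hg⟩ := hadj.glued y hpq
  have hΨ := hg.eventually_eq hd h₁ hs hpq hU hy hψ hloc.eventually_eq
  have hpq₂ := h₂.convex.eventually_mem_of_side hadj.right hpq
  obtain ⟨B, hB, hBo, hyB⟩ := _root_.eventually_nhds_iff.1 (((h₁.convex.eventually_mem_of_side hs hpq).and
    hpq₂).and (hΨ.and (ball_mem_nhds y hg.pos)))
  simp only [inner_neg_left, neg_nonneg, neg_pos] at hB
  have hψ₁ : ∀ z ∈ B, z ∈ openCone W₁ → ψ z = radial φ₁ z := fun z hz hzW => by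
    rw [← (hB z hz).2.1]
    exact (hg.left z (hB z hz).2.2 (h₁.convex.inner_pos_of_side hs hzW).le).2
  have hψ₂ : ∀ z ∈ B, z ∈ openCone W₂ → ψ z = radial φ₂ z := fun z hz hzW => by
    rw [← (hB z hz).2.1]
    have := h₂.convex.inner_pos_of_side hadj.right hzW
    rw [inner_neg_left, neg_pos] at this
    exact (hg.right z (hB z hz).2.2 this.le).2
  refine ⟨r₁⁻¹ • c₁, r₂⁻¹ • c₂, ?_⟩
  filter_upwards [hBo.mem_nhds hyB] with z hz t
  have hmax₁ : 0 ≤ ⟪m, z⟫ → max ⟪r₁⁻¹ • c₁, z⟫ ⟪r₂⁻¹ • c₂, z⟫ = ⟪r₁⁻¹ • c₁, z⟫ := fun h =>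
    max_eq_left (by rw [hkℓ]; nlinarith)
  have hmax₂ : ⟪m, z⟫ ≤ 0 → max ⟪r₁⁻¹ • c₁, z⟫ ⟪r₂⁻¹ • c₂, z⟫ = ⟪r₂⁻¹ • c₂, z⟫ := fun h =>
    max_eq_right (by rw [hkℓ]; nlinarith)
  constructor
  · intro ht
    rcases ht.eq_or_eq hd h₁ h₂ hℓ₁ hℓ₂ (hs.ne_zero h₁.convex) hBo hψ₁ hψ₂
      (fun x hx => (hB x hx).1.1.2) (fun x hx => (hB x hx).1.2.2) hz with ⟨h3, h4⟩ | ⟨h3, h4⟩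
    · rw [hmax₁ (IsConvexPolygon.inner_nonneg_of_side hs h3), h4]
    · have := IsConvexPolygon.inner_nonneg_of_side hadj.right h3
      rw [inner_neg_left, neg_nonneg] at this
      rw [hmax₂ this, h4]
  · rintro rfl
    rcases le_total 0 ⟪m, z⟫ with h | h
    · refine ⟨W₁, φ₁, _, ⟨h₁, (hB z hz).1.1.1 h, ?_⟩, hℓ₁, hmax₁ h⟩
      filter_upwards [hBo.mem_nhds hz] with x hx using hψ₁ x hx
    · refine ⟨W₂, φ₂, _, ⟨h₂, (hB z hz).1.2.1 h, ?_⟩, hℓ₂, hmax₂ h⟩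
      filter_upwards [hBo.mem_nhds hz] with x hx using hψ₂ x hx

/-! ### Convexity -/

/-- A function which is locally the maximum of two linear forms is convex. -/
lemma convexOn_of_eventually_eq_max {K : Set E3} (hK : Convex ℝ K) {f : E3 → ℝ}
    (hf : ∀ y ∈ K, ∃ ℓ₁ ℓ₂ : E3, ∀ᶠ z in 𝓝 y, f z = max ⟪ℓ₁, z⟫ ⟪ℓ₂, z⟫) : ConvexOn ℝ K f := by
  have hcont : ∀ y ∈ K, ContinuousAt f y := by
    intro y hy
    obtain ⟨ℓ₁, ℓ₂, h⟩ := hf y hy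
    have : ContinuousAt (fun z => max ⟪ℓ₁, z⟫ ⟪ℓ₂, z⟫) y := by fun_prop
    exact this.congr (h.mono fun z hz => hz.symm)
  have hsupp : ∀ y ∈ K, ∃ ℓ : E3, f y = ⟪ℓ, y⟫ ∧ ∀ᶠ z in 𝓝 y, ⟪ℓ, z⟫ ≤ f z := by
    intro y hy
    obtain ⟨ℓ₁, ℓ₂, h⟩ := hf y hy
    rcases max_choice ⟪ℓ₁, y⟫ ⟪ℓ₂, y⟫ with h1 | h1
    · exact ⟨ℓ₁, h.self_of_nhds.trans h1, h.mono fun z hz => hz ▸ le_max_left _ _⟩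
    · exact ⟨ℓ₂, h.self_of_nhds.trans h1, h.mono fun z hz => hz ▸ le_max_right _ _⟩
  refine ⟨hK, fun x hx y hy a b ha hb hab => ?_⟩
  set c : ℝ → E3 := fun t => x + t • (y - x) with hc
  have hcK : ∀ t ∈ Icc (0 : ℝ) 1, c t ∈ K := fun t ht => hK.add_smul_sub_mem hx hy ht
  set g : ℝ → ℝ := fun t => f (c t) - (f x + t * (f y - f x)) with hg
  have hgc : ContinuousOn g (Icc 0 1) := fun t ht => by
    have h1 : ContinuousAt (fun t => f (c t)) t :=
      ContinuousAt.comp (f := c) (hcont _ (hcK t ht)) (by fun_prop)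
    exact (h1.sub (by fun_prop)).continuousWithinAt
  have hle : ∀ t ∈ Icc (0 : ℝ) 1, g t ≤ 0 := by
    by_contra! hcon
    obtain ⟨t₀, ht₀, hpos⟩ := hcon
    obtain ⟨t₁, ht₁, hmax⟩ := isCompact_Icc.exists_isMaxOn ⟨t₀, ht₀⟩ hgc
    have hM : 0 < g t₁ := hpos.trans_le (hmax ht₀)
    have hKc : IsCompact (Icc (0 : ℝ) 1 ∩ g ⁻¹' {g t₁}) :=
      isCompact_Icc.of_isClosed_subset
        (hgc.preimage_isClosed_of_isClosed isClosed_Icc isClosed_singleton) inter_subset_left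
    -- At the leftmost maximum `s` of the excess over the chord, a supporting form bounds `g` below
    -- by an affine function. Its slope is zero since `s` is an interior maximum, so `g` is also
    -- maximal slightly to the left of `s`.
    obtain ⟨s, ⟨hs, hgs⟩, hleast⟩ := hKc.exists_isLeast ⟨t₁, ht₁, rfl⟩
    have hgs : g s = g t₁ := hgs
    have hg0 : g 0 = 0 := by simp [hg, hc]
    have hg1 : g 1 = 0 := by simp [hg, hc]
    have hs0 : 0 < s := hs.1.lt_of_ne (by rintro rfl; linarith)
    have hs1 : s < 1 := hs.2.lt_of_ne (by rintro rfl; linarith)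
    obtain ⟨ℓ, hℓ, hev⟩ := hsupp _ (hcK s hs)
    have hcs : Tendsto c (𝓝 s) (𝓝 (c s)) := Continuous.tendsto (by fun_prop) s
    obtain ⟨ε, hε, hball⟩ := Metric.eventually_nhds_iff.1 ((hcs.eventually hev).and
      (Icc_mem_nhds hs0 hs1))
    set d := ⟪ℓ, y - x⟫ - (f y - f x) with hd
    have hlow : ∀ t, dist t s < ε → g s + (t - s) * d ≤ g t ∧ g t ≤ g s := by
      intro t ht
      obtain ⟨h1, h2⟩ := hball ht
      refine ⟨?_, hgs.symm ▸ hmax h2⟩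
      have h3 : ⟪ℓ, c t⟫ = ⟪ℓ, c s⟫ + (t - s) * ⟪ℓ, y - x⟫ := by
        simp only [hc, inner_add_right, real_inner_smul_right]; ring
      simp only [hg, hd]
      rw [hℓ]
      nlinarith
    have e1 := hlow (s - ε / 2) (by rw [Real.dist_eq, sub_sub_cancel_left, abs_neg, abs_of_pos] <;> linarith)
    have e2 := hlow (s + ε / 2) (by rw [Real.dist_eq, add_sub_cancel_left, abs_of_pos] <;> linarith)
    have hd0 : d = 0 := by
      have e3 : (s - ε / 2 - s) * d ≤ 0 := by linarith [e1.1, e1.2]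
      have e4 : (s + ε / 2 - s) * d ≤ 0 := by linarith [e2.1, e2.2]
      nlinarith
    have e5 : g (s - ε / 2) = g t₁ := by
      rw [hd0, mul_zero, add_zero] at e1
      rw [← hgs]; exact le_antisymm e1.2 e1.1
    have e6 := hleast ⟨(hball (show dist (s - ε / 2) s < ε by
      rw [Real.dist_eq, sub_sub_cancel_left, abs_neg, abs_of_pos] <;> linarith)).2, e5⟩
    linarith
  have h1 := hle b ⟨hb, by linarith⟩
  have h2 : c b = a • x + b • y := by
    have : a = 1 - b := by linarith
    simp only [hc, this]; module
  simp only [hg, h2] at h1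
  have h3 : a = 1 - b := by linarith
  rw [smul_eq_mul, smul_eq_mul]
  rw [h3] at h1 ⊢
  linarith

/-! ### Values near contact points -/

lemma OnCircle.rot {W : Finset E3} {ℓ : E3} (h : OnCircle ℓ W) (A : E3 ≃ₗᵢ[ℝ] E3) :
    OnCircle (A ℓ) (rot A W) := fun w hw => by
  have := h _ (mem_rot.1 hw)
  rw [A.symm.norm_map] at this
  refine ⟨this.1, ?_⟩
  rw [← this.2, ← A.inner_map_map ℓ, A.apply_symm_apply]

lemma IsDelaunayDecomposition.exists_onCircle (hD : IsDelaunayDecomposition V 𝓔) {W : Finset E3}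
    {φ : E3 → S} (h : IsCell V 𝓔 W φ) : ∃ ℓ, OnCircle ℓ W := by
  obtain ⟨c, r, hc⟩ := hD.circumscribed W φ h
  exact ⟨_, hc.onCircle h.convex⟩

/-- The part of the closed polygon where the form is at least `1 + ε` is compact and contains no
vertices, because the form is `1` there; its image is therefore closed and misses `V`. Cells with
the same face differ by a rotation, so one set serves all of them. -/
lemma IsDelaunayDecomposition.exists_isClosed_face (hd : IsSphericalConeMetric V)
    (hD : IsDelaunayDecomposition V 𝓔) {F : Set S} (hF : F ∈ faceSet V 𝓔) {ε : ℝ} (hε : 0 < ε) :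
    ∃ K : Set S, IsClosed K ∧ (∀ v ∈ V, v ∉ K) ∧ ∀ W φ ℓ z, IsCell V 𝓔 W φ →
      φ '' openPolygon W = F → OnCircle ℓ W → z ∈ polygon W → 1 + ε ≤ ⟪ℓ, z⟫ → φ z ∈ K := by
  obtain ⟨W₀, φ₀, h₀, rfl⟩ := hF
  obtain ⟨ℓ₀, hℓ₀⟩ := hD.exists_onCircle h₀
  refine ⟨φ₀ '' (polygon W₀ ∩ {z | 1 + ε ≤ ⟪ℓ₀, z⟫}), ?_, ?_, ?_⟩
  · have hK : IsCompact (polygon W₀ ∩ {z | 1 + ε ≤ ⟪ℓ₀, z⟫}) :=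
      (isCompact_polygon h₀.convex.isClosed_cone).inter_right
        (isClosed_le continuous_const (by fun_prop))
    exact (hK.image_of_continuousOn (h₀.continuousOn.mono inter_subset_left)).isClosed
  · rintro _ hv ⟨z, ⟨hz, hεz⟩, rfl⟩
    have hεz : 1 + ε ≤ ⟪ℓ₀, z⟫ := hεz
    have hz0 := ne_zero_of_norm_eq_one hz.1
    have hrad := radial_of_norm_eq_one φ₀ hz.1
    by_cases hzo : z ∈ openCone W₀
    · exact h₀.radial_notMem hzo (hrad ▸ hv)
    rcases h₀.convex.side_or_vertex hz.2 hzo hz0 with ⟨w, hw, r, hr, hzw⟩ | ⟨p, q, m, hs, hpq⟩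
    · have := eq_of_pos_smul_eq hz.1 (hℓ₀ w hw).1 hr hzw
      rw [this, (hℓ₀ w hw).2] at hεz
      linarith
    · exact h₀.radial_side_notMem hD.toIsConvexDecomposition hs hpq (hrad ▸ hv)
  · intro W φ ℓ z h hWF hℓ hz hεz
    obtain ⟨k, hk⟩ := openCone_nonempty W
    obtain ⟨A, hkA, hA⟩ := h₀.exists_rot hd h.convex.isOpen_openCone h.radial_locIso_openCone hk
      (hWF ▸ h.mem_face_of_radial hk)
    obtain ⟨rfl, hφ⟩ := h.eq_of_eventually_eq hd (h₀.rot A) hk hkA hA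
    rw [hφ z hz]
    refine ⟨A.symm z, ⟨mem_polygon_rot.1 hz, ?_⟩, rfl⟩
    have hℓA := hℓ.unique h.convex (hℓ₀.rot A)
    rw [hℓA, ← A.symm.inner_map_map, A.symm_apply_apply] at hεz
    exact hεz

lemma IsDelaunayDecomposition.exists_isClosed (hd : IsSphericalConeMetric V)
    (hD : IsDelaunayDecomposition V 𝓔) {ε : ℝ} (hε : 0 < ε) :
    ∃ K : Set S, IsClosed K ∧ (∀ v ∈ V, v ∉ K) ∧ ∀ W φ ℓ z, IsCell V 𝓔 W φ →
      OnCircle ℓ W → z ∈ polygon W → 1 + ε ≤ ⟪ℓ, z⟫ → φ z ∈ K := by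
  choose! K hK hKV hKε using fun F (hF : F ∈ faceSet V 𝓔) => hD.exists_isClosed_face hd hF hε
  refine ⟨⋃ F ∈ faceSet V 𝓔, K F,
    (hD.toIsConvexDecomposition.finite_faceSet hd).isClosed_biUnion hK, ?_, ?_⟩
  · intro v hv hmem
    obtain ⟨F, hF, hvF⟩ := mem_iUnion₂.1 hmem
    exact hKV F hF v hv hvF
  · intro W φ ℓ z h hℓ hz hεz
    have hF : φ '' openPolygon W ∈ faceSet V 𝓔 := ⟨W, φ, h, rfl⟩
    exact mem_iUnion₂.2 ⟨_, hF, hKε _ hF W φ ℓ z h rfl hℓ hz hεz⟩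

lemma IsDelaunayDecomposition.eventually_isValue_lt (hd : IsSphericalConeMetric V)
    (hD : IsDelaunayDecomposition V 𝓔) {ℓ : E3} {ψ : E3 → S} (h : EmptyDisc V ℓ ψ) {p : E3}
    (hp : p ∈ contact V ℓ ψ) {ε : ℝ} (hε : 0 < ε) :
    ∀ᶠ y in 𝓝[D ℓ] p, ∀ t, IsValue V 𝓔 ψ y t → t < 1 + ε := by
  obtain ⟨hp1, -, v, hv, hlim⟩ := hp
  obtain ⟨K, hK, hKV, hKε⟩ := hD.exists_isClosed hd (half_pos hε)
  have h1 : ∀ᶠ y in 𝓝[D ℓ] p, ψ y ∈ Kᶜ :=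
    (hlim.tendsto (ne_zero_of_norm_eq_one hp1)).eventually_mem
      (hK.isOpen_compl.mem_nhds (hKV v hv))
  have h2 : ∀ᶠ y in 𝓝[D ℓ] p, ‖y‖ * (1 + ε / 2) < 1 + ε := by
    refine eventually_nhdsWithin_of_eventually_nhds ?_
    refine ContinuousAt.eventually_lt (by fun_prop) (by fun_prop) ?_
    rw [hp1]
    linarith
  filter_upwards [h1, h2, self_mem_nhdsWithin] with y hy1 hy2 hyD t ht
  obtain ⟨W, φ, ℓ', hloc, hℓ', rfl⟩ := ht
  have hy0 := ne_zero_of_mem_D hyD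
  have hn := norm_pos_iff.2 hy0
  have hlt : ⟪ℓ', ‖y‖⁻¹ • y⟫ < 1 + ε / 2 := by
    by_contra! hle
    refine hy1 ?_
    rw [hloc.apply_eq (isOpen_D ℓ) h.locIso hyD]
    exact hKε W φ ℓ' _ hloc.isCell hℓ' (normalize_mem_polygon hloc.mem_cone hy0) hle
  rw [real_inner_smul_right, inv_mul_lt_iff₀ hn] at hlt
  exact hlt.trans hy2

/-- The values of the cells form a convex function on the disc. It is at most `1 + ε` near the
contact points, and `y` is a convex combination of these, so Jensen's inequality bounds it at `y`.
-/
lemma IsDelaunayDecomposition.isValue_le (hd : IsSphericalConeMetric V)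
    (hD : IsDelaunayDecomposition V 𝓔) {ℓ y : E3} {ψ : E3 → S} (h : EmptyDisc V ℓ ψ)
    (hy : y ∈ D ℓ) (hyc : y ∈ cone (vertices V ℓ ψ)) (hy1 : ⟪ℓ, y⟫ = 1) {t : ℝ}
    (ht : IsValue V 𝓔 ψ y t) : t ≤ 1 := by
  choose! ℓ₁ ℓ₂ hℓ using fun y (hy : y ∈ D ℓ) =>
    hD.eventually_isValue_iff hd (isOpen_D ℓ) h.locIso hy (h.notMem y hy)
  set f : E3 → ℝ := fun y => max ⟪ℓ₁ y, y⟫ ⟪ℓ₂ y, y⟫ with hf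
  have hval : ∀ z ∈ D ℓ, ∀ t, IsValue V 𝓔 ψ z t ↔ t = f z := fun z hz => (hℓ z hz).self_of_nhds
  have hconv : ConvexOn ℝ (D ℓ) f := convexOn_of_eventually_eq_max (convex_D ℓ) fun z hz => by
    refine ⟨ℓ₁ z, ℓ₂ z, ?_⟩
    filter_upwards [hℓ z hz, (isOpen_D ℓ).mem_nhds hz] with x hx hxD
    rw [← hx, hval x hxD]
  rw [hval y hy] at ht
  subst ht
  refine le_of_forall_pos_le_add fun ε hε => ?_
  have hc := h.onCircle hd hy
  have hmem : ∀ w ∈ vertices V ℓ ψ, ∀ τ : ℝ, 0 < τ → τ < 1 → w + τ • (y - w) ∈ D ℓ :=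
    fun w hw τ h0 h1 => add_smul_mem_of_mem_closure (isOpen_D ℓ) (convex_D ℓ) hy
      (mem_closure_D hy (by rw [(hc w hw).1, (hc w hw).2])) h0 h1
  have hI : ∀ᶠ τ : ℝ in 𝓝[>] 0, τ ∈ Ioo (0 : ℝ) 1 := Ioo_mem_nhdsGT one_pos
  have hev : ∀ᶠ τ : ℝ in 𝓝[>] 0, ∀ w ∈ vertices V ℓ ψ, f (w + τ • (y - w)) < 1 + ε := by
    refine (Filter.eventually_all_finset _).2 fun w hw => ?_
    have ht : Tendsto (fun τ : ℝ => w + τ • (y - w)) (𝓝[>] 0) (𝓝[D ℓ] w) :=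
      tendsto_nhdsWithin_iff.2 ⟨tendsto_add_smul w (y - w),
        hI.mono fun τ hτ => hmem w hw τ hτ.1 hτ.2⟩
    filter_upwards [ht.eventually (hD.eventually_isValue_lt hd h ((h.mem_vertices hd hy).1 hw) hε),
      hI] with τ hτ hτI
    exact hτ _ ((hval _ (hmem w hw τ hτI.1 hτI.2) _).2 rfl)
  obtain ⟨τ, hτ, hτI⟩ := (hev.and hI).exists
  obtain ⟨a, ha, hya⟩ := hyc
  have hsum : ∑ w ∈ vertices V ℓ ψ, a w = 1 := by rw [← hc.inner_sum, ← hya, hy1]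
  -- Contact points are on the boundary of the domain, so they are moved towards `y` by the fraction
  -- `τ`. The same weights still combine the moved points to `y`.
  have hcomb : ∑ w ∈ vertices V ℓ ψ, a w • (w + τ • (y - w)) = y := by
    have : ∀ w, a w • (w + τ • (y - w)) = (1 - τ) • (a w • w) + a w • (τ • y) := fun w => by module
    simp_rw [this]
    rw [Finset.sum_add_distrib, ← Finset.smul_sum, ← Finset.sum_smul, hsum, ← hya]
    module
  calc f y = f (∑ w ∈ vertices V ℓ ψ, a w • (w + τ • (y - w))) := by rw [hcomb]
    _ ≤ ∑ w ∈ vertices V ℓ ψ, a w • f (w + τ • (y - w)) :=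
      hconv.map_sum_le ha hsum fun w hw => hmem w hw τ hτI.1 hτI.2
    _ ≤ ∑ w ∈ vertices V ℓ ψ, a w • (1 + ε) :=
      Finset.sum_le_sum fun w hw => smul_le_smul_of_nonneg_left (hτ w hw).le (ha w hw)
    _ = 1 + ε := by rw [← Finset.sum_smul, hsum, one_smul]

/-! ### Cells and full discs -/

lemma IsCell.exists_emptyDisc (hd : IsSphericalConeMetric V) {W : Finset E3} {φ : E3 → S}
    (h : IsCell V 𝓔 W φ) {x : E3} (hx : x ∈ openCone W) (hx1 : ‖x‖ = 1) :
    ∃ ℓ ψ, EmptyDisc V ℓ ψ ∧ x ∈ D ℓ ∧ ∀ᶠ y in 𝓝 x, ψ y = radial φ y := by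
  have hV := h.radial_notMem hx
  obtain ⟨ℓ, g, δ, hg⟩ := exists_chart (hd.regular _ hV) hV hx1
  obtain ⟨A, hA, heq⟩ := h.radial_locIso_openCone.exists_frame hd h.convex.isOpen_openCone
    (isOpen_D ℓ) hg.emptyDisc.locIso hx hg.mem rfl hg.map_center.symm hV
  exact ⟨A.symm ℓ, g ∘ A, hg.emptyDisc.comp A, mem_D_comp.2 (hA.symm ▸ hg.mem), heq⟩

/-- On the ray of an interior point of the cell, let `z` satisfy `⟪ℓ, z⟫ = 1` for the full disc.
Then `isValue_le` gives `⟪ℓ', z⟫ ≤ 1` for the form of the cell, while `⟪ℓ, w⟫ ≤ 1` at its vertices.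
With positive coefficients of `z` this forces `⟪ℓ, w⟫ = 1` for every vertex. -/
lemma IsDelaunayDecomposition.exists_isFull_onCircle [CompactSpace S]
    (hd : IsSphericalConeMetric V) (hD : IsDelaunayDecomposition V 𝓔) {W : Finset E3}
    {φ : E3 → S} (h : IsCell V 𝓔 W φ) :
    ∃ ℓ ψ, IsFull V ℓ ψ ∧ OnCircle ℓ W ∧ W ⊆ vertices V ℓ ψ ∧
      ∀ y ∈ openCone W, ψ y = radial φ y := by
  have hdec := hD.toIsConvexDecomposition
  have hW := h.convex
  obtain ⟨ℓ', hℓ'⟩ := hD.exists_onCircle h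
  obtain ⟨x, hx, hx1⟩ : ∃ x ∈ openCone W, ‖x‖ = 1 := by
    obtain ⟨k, hk⟩ := openCone_nonempty W
    have hk0 : k ≠ 0 := fun h0 => hW.zero_notMem_openCone (h0 ▸ hk)
    exact ⟨_, smul_mem_openCone hk (inv_pos.2 (norm_pos_iff.2 hk0)), norm_inv_smul hk0⟩
  obtain ⟨ℓ₀, ψ₀, h₀, hxD₀, heq₀⟩ := h.exists_emptyDisc hd hx hx1
  obtain ⟨ℓ, ψ, hfull, hxD, hxc, hag⟩ := exists_isFull hd hdec h₀ hxD₀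
  have heq : ∀ᶠ y in 𝓝 x, ψ y = radial φ y := by
    filter_upwards [heq₀, (isOpen_D ℓ₀).mem_nhds hxD₀, (isOpen_D ℓ).mem_nhds hxD] with y h1 h2 h3
    rw [hag y ⟨h2, h3⟩, h1]
  have hagree : ∀ y ∈ D ℓ ∩ openCone W, ψ y = radial φ y :=
    LocIso.eq_of_eventually_eq hd ((isOpen_D ℓ).inter hW.isOpen_openCone)
      ((convex_D ℓ).inter (convex_openCone W)).isPreconnected
      (hfull.emptyDisc.locIso.mono inter_subset_left)
      (h.radial_locIso_openCone.mono inter_subset_right)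
      (fun y hy => hfull.emptyDisc.notMem y hy.1) ⟨hxD, hx⟩ heq
  have hpos : 0 < ⟪ℓ, x⟫ := (norm_nonneg x).trans_lt hxD
  set z := ⟪ℓ, x⟫⁻¹ • x with hz
  have hzW : z ∈ openCone W := smul_mem_openCone hx (inv_pos.2 hpos)
  have hzD : z ∈ D ℓ := smul_mem_D hxD (inv_pos.2 hpos)
  have hz1 : ⟪ℓ, z⟫ = 1 := by rw [hz, real_inner_smul_right, inv_mul_cancel₀ hpos.ne']
  have hev : ∀ᶠ y in 𝓝 z, y ∈ openCone W → ψ y = radial φ y := by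
    filter_upwards [(isOpen_D ℓ).mem_nhds hzD] with y hy hyW using hagree y ⟨hy, hyW⟩
  have hle : ⟪ℓ', z⟫ ≤ 1 := hD.isValue_le hd hfull.emptyDisc hzD
    (smul_mem_cone hxc (inv_pos.2 hpos).le) hz1
    ⟨W, φ, ℓ', ⟨h, openCone_subset_cone W hzW, hev⟩, hℓ', rfl⟩
  have hvert := h.inner_vertex_le_one hd hfull.emptyDisc hx hxD (heq.mono fun _ => Eq.symm)
  have hcirc : OnCircle ℓ W := by
    obtain ⟨a, ha, hza⟩ := hzW
    have hs : ∑ w ∈ W, a w * (1 - ⟪ℓ, w⟫) = 0 := by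
      refine le_antisymm ?_ (Finset.sum_nonneg fun w hw =>
        mul_nonneg (ha w hw).le (sub_nonneg.2 (hvert w hw)))
      rw [hza, hℓ'.inner_sum] at hle
      rw [hza, inner_sum] at hz1
      simp_rw [real_inner_smul_right] at hz1
      simp_rw [mul_sub, mul_one]
      rw [Finset.sum_sub_distrib, hz1]
      linarith
    intro w hw
    have := (Finset.sum_eq_zero_iff_of_nonneg fun w hw =>
      mul_nonneg (ha w hw).le (sub_nonneg.2 (hvert w hw))).1 hs w hw
    refine ⟨hW.norm_eq_one w hw, ?_⟩
    rcases mul_eq_zero.1 this with h0 | h0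
    · exact absurd h0 (ha w hw).ne'
    · linarith
  have hsub := hcirc.openCone_subset hW.three_le_card
  refine ⟨ℓ, ψ, hfull, hcirc, fun w hw => ?_, fun y hy => hagree y ⟨hsub hy, hy⟩⟩
  rw [hfull.emptyDisc.mem_vertices hd hxD]
  refine ⟨(hcirc w hw).1, (hcirc w hw).2, φ w, h.vertex w hw, ?_⟩
  exact IsLimitAt.of_agree hd hW.isOpen_openCone (convex_openCone W) (isOpen_D ℓ) (convex_D ℓ)
    h.radial_locIso_openCone hfull.emptyDisc.locIso (fun y hy => h.radial_notMem hy) hx hxD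
    (heq.mono fun _ => Eq.symm) (cone_subset_closure_openCone W (mem_cone_of_mem hw))
    (mem_closure_D hxD (by rw [(hcirc w hw).1, (hcirc w hw).2]))
    (ne_zero_of_norm_eq_one (hcirc w hw).1) (h.isLimitAt_vertex hw)

lemma IsGlued.symm {W₁ W₂ : Finset E3} {φ₁ φ₂ ψ : E3 → S} {m c : E3} {δ : ℝ}
    (h : IsGlued V W₁ φ₁ W₂ φ₂ m c δ ψ) : IsGlued V W₂ φ₂ W₁ φ₁ (-m) c δ ψ where
  pos := h.pos
  dist_eq := h.dist_eq
  notMem := h.notMem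
  left y hy hm := h.right y hy (by rwa [inner_neg_left, neg_nonneg] at hm)
  right y hy hm := h.left y hy (by rwa [inner_neg_left, neg_nonpos] at hm)

lemma IsConvexPolygon.notMem_cone {W W' : Finset E3} (hW : IsConvexPolygon W) (h : W' ⊆ W) {p : E3}
    (hp : p ∈ W) (hp' : p ∉ W') : p ∉ cone W' := by
  classical
  rintro ⟨a, ha, hpa⟩
  refine hW.convex_position p hp ⟨fun w => if w ∈ W' then a w else 0, fun w _ => ?_, if_neg hp', ?_⟩
  · dsimp only
    split_ifs with hw
    exacts [ha w hw, le_rfl]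
  · rw [← Finset.sum_subset h fun w _ hw => by simp only [if_neg hw, zero_smul], hpa]
    exact Finset.sum_congr rfl fun w hw => by simp only [if_pos hw]

/-- A contact point `v` that is not a vertex of the cell is separated from it by a side. Across this
side the form grows, so `v` would lie inside the full disc of the neighbouring cell, against weak
duality. -/
lemma IsDelaunayDecomposition.exists_isFull [CompactSpace S] (hd : IsSphericalConeMetric V)
    (hD : IsDelaunayDecomposition V 𝓔) {W : Finset E3} {φ : E3 → S} (h : IsCell V 𝓔 W φ) :
    ∃ ℓ ψ, IsFull V ℓ ψ ∧ W = vertices V ℓ ψ ∧ ∀ y ∈ openCone W, ψ y = radial φ y := by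
  obtain ⟨ℓ, ψ, hfull, hℓ, hsub, hag⟩ := hD.exists_isFull_onCircle hd h
  refine ⟨ℓ, ψ, hfull, subset_antisymm hsub fun v hv => ?_, hag⟩
  by_contra hvW
  obtain ⟨p, q, m, hs, hneg⟩ := h.convex.exists_side_inner_neg
    ((hfull.isConvexPolygon hd).notMem_cone hsub hv hvW)
  obtain ⟨W₂, φ₂, h₂, hadj⟩ := h.exists_isAdjacent hd hD.toIsConvexDecomposition hs
  obtain ⟨ℓ₂, ψ₂, hfull₂, hℓ₂, -, hag₂⟩ := hD.exists_isFull_onCircle hd h₂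
  have hy : p + q ∈ arcCone p q := ⟨1, 1, one_pos, one_pos, by rw [one_smul, one_smul]⟩
  have hyD := hℓ.arcCone_subset hs.1 hs.2.1 hs.2.2.1 hy
  have hyD₂ := hℓ₂.arcCone_subset hadj.right.1 hadj.right.2.1 hs.2.2.1 hy
  obtain ⟨δ, Ψ, hg⟩ := hadj.glued _ hy
  have e₁ := hg.eventually_eq hd h hs hy (isOpen_D ℓ) hyD hfull.emptyDisc.locIso
    (Eventually.of_forall hag)
  have e₂ := hg.symm.eventually_eq hd h₂ hadj.right hy (isOpen_D ℓ₂) hyD₂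
    hfull₂.emptyDisc.locIso (Eventually.of_forall hag₂)
  have hle := (hfull.emptyDisc.inner_contact_le hd hfull₂.emptyDisc hyD hyD₂
    (by filter_upwards [e₁, e₂] with z h1 h2 using h1.symm.trans h2)
    ((hfull.mem_vertices hd).1 hv)).1
  obtain ⟨k, hk, hkℓ⟩ := hD.exists_neg h h₂ hadj hℓ hℓ₂
  rw [hkℓ, ((hfull.onCircle hd) v hv).2] at hle
  nlinarith

lemma IsCell.image_openArc_eq (hd : IsSphericalConeMetric V) {ℓ : E3} {ψ φ : E3 → S}
    (hfull : IsFull V ℓ ψ) (h : IsCell V 𝓔 (vertices V ℓ ψ) φ)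
    (heq : ∀ y ∈ openCone (vertices V ℓ ψ), ψ y = radial φ y) {p q m : E3}
    (hs : IsSide (vertices V ℓ ψ) p q m) : φ '' openArc p q = ψ '' openArc p q := by
  refine image_congr fun y hy => ?_
  rw [h.eq_radial_of_mem_cone (isOpen_D ℓ) hfull.emptyDisc.locIso.continuousOn (fun z _ => heq z)
    (hfull.openArc_subset hd hs hy) (arcCone_subset_cone hs.1 hs.2.1 hy.2)
    (ne_zero_of_norm_eq_one hy.1), radial_of_norm_eq_one _ hy.1]

/-- Every edge is a side of a cell, and cells come from full discs. Conversely, a generic point of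
the polygon of a full disc lies in some cell; that cell comes from a full disc which coincides with
the given one by `IsFull.eq_of_mem_openCone`, so its sides are edges. -/
theorem IsDelaunayDecomposition.eq_delaunayEdges [CompactSpace S] (hd : IsSphericalConeMetric V)
    (hD : IsDelaunayDecomposition V 𝓔) : 𝓔 = delaunayEdges V := by
  have hdec := hD.toIsConvexDecomposition
  refine Subset.antisymm ?_ ?_
  · intro e he
    obtain ⟨W, φ, p, q, m, h, hs, rfl⟩ := hdec.exists_side_image_eq hd he
    obtain ⟨ℓ, ψ, hfull, rfl, heq⟩ := hD.exists_isFull hd h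
    exact ⟨ℓ, ψ, p, q, m, hfull, hs, h.image_openArc_eq hd hfull heq hs⟩
  · rintro _ ⟨ℓ, ψ, p, q, m, hfull, hs, rfl⟩
    have hP := hfull.isConvexPolygon hd
    have hsub := (hfull.onCircle hd).openCone_subset hfull.three_le_card
    obtain ⟨x, hx, hskel⟩ := hdec.exists_notMem_skeleton hP.isOpen_openCone (openCone_nonempty _)
      (hfull.emptyDisc.locIso.mono hsub) fun y hy => hfull.emptyDisc.notMem y (hsub hy)
    obtain ⟨W, φ, h, hxW, hψφ⟩ := hdec.exists_cell hd (isOpen_D ℓ) hfull.emptyDisc.locIso (hsub hx)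
      hskel
    obtain ⟨ℓ₂, ψ₂, hfull₂, rfl, heq⟩ := hD.exists_isFull hd h
    have hsub₂ := (hfull₂.onCircle hd).openCone_subset hfull₂.three_le_card
    obtain ⟨hℓ, hvert, hag⟩ := hfull.eq_of_mem_openCone hd hfull₂ (hsub₂ hxW) (by
      filter_upwards [hψφ, h.convex.isOpen_openCone.mem_nhds hxW] with z h1 h2
      rw [h1, heq z h2]) hx (openCone_subset_cone _ hxW)
    have hs₂ : IsSide (vertices V ℓ₂ ψ₂) p q m := hvert ▸ hs
    rw [image_congr fun y hy => hag y (hfull.openArc_subset hd hs hy),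
      ← h.image_openArc_eq hd hfull₂ heq hs₂]
    exact (h.side p q m hs₂).2

end SphCone

end

theorem lemma2p3 {S : Type*} [MetricSpace S] [CompactSpace S] [ConnectedSpace S] (V : Finset S)
    (hd : SphCone.IsSphericalConeMetric V)
    (hT : ∃ 𝓣 : Set (Set S), SphCone.IsConvexTriangulation V 𝓣) :
    ∃! 𝓔 : Set (Set S), SphCone.IsDelaunayDecomposition V 𝓔 := by
  obtain ⟨𝓣, h𝓣⟩ := hT
  exact ⟨SphCone.delaunayEdges V,
    SphCone.isDelaunayDecomposition_delaunayEdges hd h𝓣.toIsConvexDecomposition,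
    fun _ hD => hD.eq_delaunayEdges hd⟩
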